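/- Let $k$ be a field. All modules are homologically graded (differentials have degree $-1$), and $\mathbb N^3$-dg modules are families $M=(M(p,q,r))_{p,q,r\in\mathbb N}$ of dg $k$-modules. An arity is *thin* if it is $(0,q,0)$, *semi-thin* if exactly one of $p,r$ is $0$, and *non-thin* otherwise. The thin desuspension $s_{\rm thin}^{-1}M$ is $s^{-1}M$ in thin arities and $M$ in all other arities. A *dg box operad* $\mathcal B$ is an $\mathbb N^3$-dg module with a unit $1\in\mathcal B(0,1,0)$ and composition chain maps $\mathcal B(p,n,r)\otimes\bigotimes_{i=1}^n\mathcal B(p_{i-1},q_i,p_i)\to\mathcal B(p+p_0,\sum_i q_i,r+p_n)$ ($n\ge 0$), which are associative (up to the Koszul sign of the shuffle) and unital; *dg box cooperads* are defined dually. Iterating gives compositions $\mu_S$ and decompositions $\Delta_S$ for every stacking $S$ of boxes, i.e. every planar tree whose vertices carry arities $(p_v,q_v,r_v)$, $q_v$ being the number of inputs of $v$, with matching horizontal labels; above a vertex without inputs an arbitrary number of horizontal strands may pass. Boxes are ordered in the standard order (bottom before top, left before right). A dg box cooperad $\mathcal C=\overline{\mathcal C}\oplus k$ is *conilpotent* if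 it is coaugmented and its reduced decompositions define a map $\overline{\mathcal C}\to\bigoplus_S\bigotimes_{v\in S}\overline{\mathcal C}(p_v,q_v,r_v)$, i.e. for each element almost all of them vanish. A stacking $S$ with $n$ boxes and total arity $(p,q,r)$ is *thin-quadratic* if it has no semi-thin box, its thin desuspended degree ($0$ if $(p,r)=(0,0)$, and $1+\#\{\text{thin boxes}\}-n$ otherwise) equals $2-n$, and its horizontal composite graph (boxes and horizontal strands, connected along horizontal adjacencies) has exactly two connected components. For $n\ge2$ it is of type I (two thin boxes), type II (non-thin bottom box, thin top box) or type III (thin bottom box, $n-1$ non-thin boxes). Put $$\Delta^{s^{-1}}_{(1)}(s_{\rm thin}^{-1}c)=\sum_{S}\varepsilon_S\,(S;s_{\rm thin}^{-1}c_{(1)}\otimes\cdots\otimes s_{\rm thin}^{-1}c_{(n)}),\qquad \varepsilon_S=\begin{cases}(-1)^{|c_{(1)}|+1}&\text{type I}\\(-1)^{|c_{(1)}|}&\text{type II}\\-1&\text{type III,}\end{cases}$$ the sum being over thin-quadratic $S$ with at least two boxes, $\Delta_S(c)=c_{(1)}\otimes\cdots\otimes c_{(n)}$. **Proposition.** Let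 $\mathcal B$ be a dg box operad and $\mathcal C$ a conilpotent dg box cooperad, and assume that $\mathcal B(0,0,0)=0$ or $\mathcal C(0,0,0)=0$. On $\prod\mathrm{Hom}(s_{\rm thin}^{-1}\mathcal C,\mathcal B):=\prod_{p,q,r}\mathrm{Hom}(s_{\rm thin}^{-1}\mathcal C(p,q,r),\mathcal B(p,q,r))$, with differential $d(f)=d_{\mathcal B}f-(-1)^{|f|}f\,d_{s_{\rm thin}^{-1}\mathcal C}$, let $P_n(f_1\otimes\cdots\otimes f_n)$, for $n\ge 2$, be $(-1)^{\sum_i|f_i|}$ times the composite of the $n$-box part of $\Delta^{s^{-1}}_{(1)}$, of $f_1\otimes\cdots\otimes f_n$ (with the Koszul sign rule), and of the compositions $\mu_S$ of $\mathcal B$; only finitely many $S$ contribute on each element. Let $$L_n(f_1,\dots,f_n)=\sum_{\sigma\in\mathbb S_n}(-1)^{\sigma(f)}P_n(f_{\sigma(1)},\dots,f_{\sigma(n)})$$ with $(-1)^{\sigma(f)}$ the Koszul sign. Then $L_1:=d$ and $(L_n)_{n\ge2}$ form a suspended $L_\infty$-structure: the $L_n$ are multilinear, graded symmetric, of degree $-1$,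 and for all $n\ge1$ and homogeneous $f_1,\dots,f_n$ $$\sum_{l=1}^{n}\ \sum_{\chi}(-1)^{\chi(f)}L_{n-l+1}\bigl(L_l(f_{\chi(1)},\dots,f_{\chi(l)}),f_{\chi(l+1)},\dots,f_{\chi(n)}\bigr)=0,$$ where $\chi$ runs over the permutations that are increasing on $\{1,\dots,l\}$ and on $\{l+1,\dots,n\}$. The same holds when $\Delta_S$ is replaced by the reduced decomposition (followed by the projection $\mathcal C\to\overline{\mathcal C}$ in each tensor factor). -/

import Mathlib

open scoped TensorProduct

noncomputable section

namespace BoxOperads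

/-! ### `ℕ³`-dg modules -/

/-- A colour `(p, q, r)`: a box with `q` vertical inputs, one vertical output, `p` horizontal
inputs and `r` horizontal outputs. -/
abbrev Colour := ℕ × ℕ × ℕ

/-- The thin colours `(0, q, 0)`. -/
def Thin (α : Colour) : Prop := α.1 = 0 ∧ α.2.2 = 0

/-- The semi-thin colours: exactly one of `p`, `r` vanishes. -/
def SemiThin (α : Colour) : Prop := (α.1 = 0 ∧ 0 < α.2.2) ∨ (0 < α.1 ∧ α.2.2 = 0)

instance : DecidablePred Thin := fun _ => inferInstanceAs (Decidable (_ ∧ _))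

/-- The sign `(-1)^m` as a scalar. -/
def sgn (k : Type*) [Ring k] (m : ℤ) : k := ((m.negOnePow : ℤ) : k)

/-- An `ℕ³`-dg module (homologically graded), presented on its total space `V`: the module `V` is
the internal direct sum of the pieces `piece (p, q, r) e` of colour `(p, q, r)` and degree `e`. -/
structure DgModule (k V : Type*) [Field k] [AddCommGroup V] [Module k V] where
  piece : Colour → ℤ → Submodule k V
  internal : DirectSum.IsInternal (fun i : Colour × ℤ => piece i.1 i.2)
  d : V →ₗ[k] V
  d_mem : ∀ {α e x}, x ∈ piece α e → d x ∈ piece α (e - 1)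
  d_d : ∀ x, d (d x) = 0

namespace DgModule

variable {k V W : Type*} [Field k] [AddCommGroup V] [Module k V] [AddCommGroup W] [Module k W]

/-- The linear endomorphism which is multiplication by the scalar `w α e` on `piece α e`. -/
def scale (M : DgModule k V) (w : Colour → ℤ → k) : V →ₗ[k] V :=
  DirectSum.toModule k (Colour × ℤ) V (fun i => w i.1 i.2 • (M.piece i.1 i.2).subtype) ∘ₗ
    ((LinearEquiv.ofBijective (DirectSum.coeLinearMap
      (fun i : Colour × ℤ => M.piece i.1 i.2)) M.internal).symm : V →ₗ[k] _)

theorem scale_apply (M : DgModule k V) (w : Colour → ℤ → k) {α : Colour} {e : ℤ} {x : V}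
    (hx : x ∈ M.piece α e) : M.scale w x = w α e • x := by
  have h : (LinearEquiv.ofBijective (DirectSum.coeLinearMap
      (fun i : Colour × ℤ => M.piece i.1 i.2)) M.internal).symm x =
      DirectSum.lof k (Colour × ℤ) (fun i => M.piece i.1 i.2) (α, e) ⟨x, hx⟩ := by
    rw [LinearEquiv.symm_apply_eq]
    exact (DirectSum.coeLinearMap_lof (fun i : Colour × ℤ => M.piece i.1 i.2) (α, e) ⟨x, hx⟩).symm
  simp only [scale, LinearMap.comp_apply, LinearEquiv.coe_coe, h, DirectSum.toModule_lof]
  simp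

/-- The operator `x ↦ (-1)^(m * |x|) x`. -/
def koszul (M : DgModule k V) (m : ℤ) : V →ₗ[k] V := M.scale fun _ e => sgn k (m * e)

/-- The projection onto the component of colour `α`. -/
def proj (M : DgModule k V) (α : Colour) : V →ₗ[k] V := M.scale fun β _ => if β = α then 1 else 0

/-- The thin desuspension `s_thin⁻¹ M`. The underlying space is that of `M`, the map `s_thin⁻¹`
being the identity of `V`; thin elements are lowered by one in degree and the differential changes
its sign on them. -/
def thinDesuspension (M : DgModule k V) : DgModule k V where
  piece α e := M.piece α (if Thin α then e + 1 else e)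
  internal := by
    have h := M.internal
    rw [DirectSum.isInternal_submodule_iff_iSupIndep_and_iSup_eq_top] at h ⊢
    let E : Colour × ℤ ≃ Colour × ℤ :=
      { toFun := fun i => (i.1, if Thin i.1 then i.2 + 1 else i.2)
        invFun := fun i => (i.1, if Thin i.1 then i.2 - 1 else i.2)
        left_inv := by rintro ⟨a, b⟩; by_cases h : Thin a <;> simp [h]
        right_inv := by rintro ⟨a, b⟩; by_cases h : Thin a <;> simp [h] }
    exact ⟨h.1.comp E.injective,
      (E.iSup_comp (g := fun i : Colour × ℤ => M.piece i.1 i.2)).trans h.2⟩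
  d := (M.scale fun α _ => if Thin α then -1 else 1) ∘ₗ M.d
  d_mem := by
    intro α e x hx
    have hd := M.d_mem hx
    rw [LinearMap.comp_apply, scale_apply M _ hd]
    refine Submodule.smul_mem _ _ ?_
    by_cases h : Thin α
    · simpa [h] using hd
    · simpa [h] using hd
  d_d := by
    have key : ∀ (α : Colour) (e : ℤ) (x : V), x ∈ M.piece α e →
        ((M.scale fun α _ => if Thin α then -1 else 1) ∘ₗ M.d)
          (((M.scale fun α _ => if Thin α then -1 else 1) ∘ₗ M.d) x) = 0 := by
      intro α e x hx
      simp only [LinearMap.comp_apply]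
      rw [scale_apply M _ (M.d_mem hx), map_smul, M.d_d, smul_zero, map_zero]
    intro x
    have hx : x ∈ ⨆ i : Colour × ℤ, M.piece i.1 i.2 := by
      rw [M.internal.submodule_iSup_eq_top]; trivial
    induction hx using Submodule.iSup_induction' with
    | mem i x hx => exact key _ _ _ hx
    | zero => simp
    | add x y _ _ hx hy => rw [map_add, map_add, hx, hy, add_zero]

/-- The degree `m` part of the totalisation `∏ Hom(M(p,q,r), N(p,q,r))`: as `V` is the direct sum
of its pieces, a family of homogeneous maps is one linear map on the total spaces. -/
def Hom (M : DgModule k V) (N : DgModule k W) (m : ℤ) : Submodule k (V →ₗ[k] W) where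
  carrier := {f | ∀ α e, ∀ x ∈ M.piece α e, f x ∈ N.piece α (e + m)}
  add_mem' hf hg α e x hx := add_mem (hf α e x hx) (hg α e x hx)
  zero_mem' _ _ _ _ := zero_mem _
  smul_mem' c _ hf α e x hx := Submodule.smul_mem _ c (hf α e x hx)

/-- The differential `d f = d_N f - (-1)^|f| f d_M` on maps of degree `m`. -/
def homD (M : DgModule k V) (N : DgModule k W) (m : ℤ) (f : V →ₗ[k] W) : V →ₗ[k] W :=
  N.d ∘ₗ f - sgn k m • (f ∘ₗ M.d)

end DgModule

/-! ### dg box operads -/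

/-- A dg box operad on the total space `V`. The map `comp n ps`, whose argument `0` is the bottom
box and whose arguments `1, …, n` are the top boxes, collects the composition maps
`B(p,n,r) ⊗ ⨂ᵢ B(psᵢ₋₁,qᵢ,psᵢ) ⟶ B(p + ps₀, ∑ qᵢ, r + psₙ)`, and vanishes on all other colours.
For `n = 0` it is a map `B(p,0,r) ⟶ B(p + ps₀, 0, r + ps₀)`. -/
structure DgBoxOperad (k V : Type*) [Field k] [AddCommGroup V] [Module k V]
    extends DgModule k V where
  comp : ∀ (n : ℕ) (_ : Fin (n + 1) → ℕ), MultilinearMap k (fun _ : Fin (n + 1) => V) V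
  one : V
  comp_mem : ∀ (n : ℕ) (ps : Fin (n + 1) → ℕ) (p r : ℕ) (q : Fin n → ℕ) (e : Fin (n + 1) → ℤ)
    (x : Fin (n + 1) → V), x 0 ∈ piece (p, n, r) (e 0) →
    (∀ i : Fin n, x i.succ ∈ piece (ps i.castSucc, q i, ps i.succ) (e i.succ)) →
    comp n ps x ∈ piece (p + ps 0, ∑ i, q i, r + ps (Fin.last n)) (∑ i, e i)
  comp_bottom_zero : ∀ (n : ℕ) (ps : Fin (n + 1) → ℕ) (x : Fin (n + 1) → V) (p q r : ℕ) (e : ℤ),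
    x 0 ∈ piece (p, q, r) e → q ≠ n → comp n ps x = 0
  comp_top_zero : ∀ (n : ℕ) (ps : Fin (n + 1) → ℕ) (x : Fin (n + 1) → V) (i : Fin n)
    (p q r : ℕ) (e : ℤ), x i.succ ∈ piece (p, q, r) e →
    (p ≠ ps i.castSucc ∨ r ≠ ps i.succ) → comp n ps x = 0
  one_mem : one ∈ piece (0, 1, 0) 0
  d_one : d one = 0
  /-- The composition maps are chain maps. -/
  d_comp : ∀ (n : ℕ) (ps : Fin (n + 1) → ℕ) (x : Fin (n + 1) → V),
    d (comp n ps x) = ∑ i, comp n ps (fun j =>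
      if j < i then toDgModule.koszul 1 (x j) else if j = i then d (x j) else x j)
  /-- Associativity. The boxes `x i` (`i < n`) lie on top of `x₀`; the boxes `y j` with
  `off i ≤ j < off (i + 1)` lie on top of `x i`, where `off i = m 0 + ⋯ + m (i - 1)`. The numbers
  `ps i` and `R j` are the horizontal labels between adjacent boxes of the two upper rows. -/
  assoc : ∀ (n : ℕ) (m ps R : ℕ → ℕ) (off : ℕ → ℕ) (p r : ℕ) (q : ℕ → ℕ) (e₀ : ℤ) (δ e : ℕ → ℤ)
    (x₀ : V) (x y : ℕ → V), (∀ i, off i = ∑ t ∈ Finset.range i, m t) →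
    x₀ ∈ piece (p, n, r) e₀ →
    (∀ i < n, x i ∈ piece (ps i, m i, ps (i + 1)) (δ i)) →
    (∀ j < off n, y j ∈ piece (R j, q j, R (j + 1)) (e j)) →
    comp n (fun i => ps i + R (off i)) (Fin.cons x₀ fun i : Fin n =>
        comp (m i) (fun j => R (off i + j)) (Fin.cons (x i) fun j : Fin (m i) => y (off i + j))) =
      sgn k (∑ i ∈ Finset.range n, δ i * ∑ j ∈ Finset.range (off i), e j) •
        comp (off n) (fun j => R j)
          (Fin.cons (comp n (fun i => ps i) (Fin.cons x₀ fun i : Fin n => x i))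
            fun j : Fin (off n) => y j)
  comp_one : ∀ (p n r : ℕ) (e : ℤ) (x : V), x ∈ piece (p, n, r) e →
    comp n (fun _ => 0) (Fin.cons x fun _ => one) = x
  one_comp : ∀ (p q r : ℕ) (e : ℤ) (x : V), x ∈ piece (p, q, r) e →
    comp 1 ![p, r] ![one, x] = x

/-! ### dg box cooperads -/

/-- For `δ : V ⟶ V^{⊗(n+1)}` and functionals `φ₀, φ₁, …, φₙ` on `V`, the functional
`(φ₀ ⊗ φ₁ ⊗ ⋯ ⊗ φₙ) ∘ δ`. -/
def dualComp {k V : Type*} [Field k] [AddCommGroup V] [Module k V] {n : ℕ}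
    (δ : V →ₗ[k] ⨂[k] _ : Fin (n + 1), V) (φ₀ : V →ₗ[k] k) (φ : Fin n → V →ₗ[k] k) : V →ₗ[k] k :=
  PiTensorProduct.lift ((MultilinearMap.mkPiAlgebra k (Fin (n + 1)) k).compLinearMap
    (Fin.cons (α := fun _ => V →ₗ[k] k) φ₀ φ)) ∘ₗ δ

/-- A dg box cooperad on the total space `V`, obtained from the notion of a dg box operad by
reversing all arrows. The map `decomp n ps` collects the decomposition maps
`C(p + ps₀, ∑ qᵢ, r + psₙ) ⟶ C(p,n,r) ⊗ ⨂ᵢ C(psᵢ₋₁,qᵢ,psᵢ)` for all `p`, `r` and `q`; tensor factor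
`0` is the bottom box.

Coassociativity and counitality are identities between elements of tensor powers of `V`; they are
stated by evaluating both sides on all tensor products of (homogeneous) functionals, which is
equivalent as these separate the points of a tensor power of a vector space. -/
structure DgBoxCooperad (k V : Type*) [Field k] [AddCommGroup V] [Module k V]
    extends DgModule k V where
  decomp : ∀ (n : ℕ) (_ : Fin (n + 1) → ℕ), V →ₗ[k] ⨂[k] _ : Fin (n + 1), V
  counit : V →ₗ[k] k
  decomp_mem : ∀ (n : ℕ) (ps : Fin (n + 1) → ℕ) (P Q R : ℕ) (e : ℤ) (c : V), c ∈ piece (P, Q, R) e →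
    decomp n ps c ∈ Submodule.span k {t | ∃ (p r : ℕ) (q : Fin n → ℕ) (ε : Fin (n + 1) → ℤ)
      (x : Fin (n + 1) → V), p + ps 0 = P ∧ ∑ i, q i = Q ∧ r + ps (Fin.last n) = R ∧
      ∑ i, ε i = e ∧ x 0 ∈ piece (p, n, r) (ε 0) ∧
      (∀ i : Fin n, x i.succ ∈ piece (ps i.castSucc, q i, ps i.succ) (ε i.succ)) ∧
      t = PiTensorProduct.tprod k x}
  counit_zero : ∀ (α : Colour) (e : ℤ) (c : V), c ∈ piece α e → (α ≠ (0, 1, 0) ∨ e ≠ 0) →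
    counit c = 0
  counit_d : ∀ c, counit (d c) = 0
  /-- The decomposition maps are chain maps. -/
  decomp_d : ∀ (n : ℕ) (ps : Fin (n + 1) → ℕ) (c : V),
    decomp n ps (d c) = ∑ i, PiTensorProduct.map (fun j =>
      if j < i then toDgModule.koszul 1 else if j = i then d else LinearMap.id) (decomp n ps c)
  /-- Coassociativity; the indices are as in the associativity of a box operad. -/
  coassoc : ∀ (n : ℕ) (m ps R : ℕ → ℕ) (off : ℕ → ℕ) (δ e : ℕ → ℤ)
    (φ₀ : V →ₗ[k] k) (φ ψ : ℕ → V →ₗ[k] k), (∀ i, off i = ∑ t ∈ Finset.range i, m t) →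
    (∀ i < n, ∀ (p q r : ℕ) (e' : ℤ), ∀ x ∈ piece (p, q, r) e', (q ≠ m i ∨ e' ≠ δ i) → φ i x = 0) →
    (∀ j < off n, ∀ (α : Colour) (e' : ℤ), ∀ x ∈ piece α e', e' ≠ e j → ψ j x = 0) →
    dualComp (decomp n fun i => ps i + R (off i)) φ₀ (fun i : Fin n =>
        dualComp (decomp (m i) fun j => R (off i + j)) (φ i) fun j : Fin (m i) => ψ (off i + j)) =
      sgn k (∑ i ∈ Finset.range n, δ i * ∑ j ∈ Finset.range (off i), e j) •
        dualComp (decomp (off n) fun j => R j)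
          (dualComp (decomp n fun i => ps i) φ₀ fun i : Fin n => φ i)
          fun j : Fin (off n) => ψ j
  counit_right : ∀ (p n r : ℕ) (e : ℤ) (c : V), c ∈ piece (p, n, r) e → ∀ φ : V →ₗ[k] k,
    dualComp (decomp n fun _ => 0) φ (fun _ => counit) c = φ c
  counit_left : ∀ (p q r : ℕ) (e : ℤ) (c : V), c ∈ piece (p, q, r) e → ∀ φ : V →ₗ[k] k,
    dualComp (decomp 1 ![p, r]) counit (fun _ => φ) c = φ c

/-! ### Stackings of boxes -/

/-- Stackings in standard order, as planar trees: `leaf` is the unit stacking `η`, and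
`box p r n a c` is the box `(p, n, r)` carrying the stackings `c 0, …, c (n - 1)` on its vertical
inputs. On a box without vertical inputs (`n = 0`) there is an open (degenerate) space, through
which `a` horizontal strands pass; for `n > 0` the number `a` has no meaning. -/
inductive Stack : Type
  | leaf : Stack
  | box (p r n a : ℕ) (c : Fin n → Stack) : Stack

namespace Stack

/-- The number of boxes. -/
def size : Stack → ℕ
  | leaf => 0
  | box _ _ _ _ c => 1 + ∑ i, size (c i)

/-- The number of thin boxes. -/
def thinCount : Stack → ℕ
  | leaf => 0
  | box p r n _ c => (if Thin (p, n, r) then 1 else 0) + ∑ i, thinCount (c i)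

/-- The number of horizontal inputs of the whole stacking. -/
def left : Stack → ℕ
  | leaf => 0
  | box p _ 0 a _ => p + a
  | box p _ (_ + 1) _ c => p + left (c 0)

/-- The number of horizontal outputs of the whole stacking. -/
def right : Stack → ℕ
  | leaf => 0
  | box _ r 0 a _ => r + a
  | box _ r (n + 1) _ c => r + right (c (Fin.last n))

/-- The horizontal labels between adjacent stackings in the row `c` on top of a box. -/
def profile : ∀ (n : ℕ) (_ : ℕ) (_ : Fin n → Stack), Fin (n + 1) → ℕ
  | 0, a, _ => fun _ => a
  | _ + 1, _, c => Fin.cons (left (c 0)) fun i => right (c i)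

/-- Horizontal outputs and inputs of neighbours match (and the meaningless labels are `0`). -/
def Valid : Stack → Prop
  | leaf => True
  | box _ _ n a c => (∀ i, Valid (c i)) ∧ (0 < n → a = 0) ∧
      ∀ i j : Fin n, i.val + 1 = j.val → right (c i) = left (c j)

/-- No box of the stacking is semi-thin. -/
def NoSemiThin : Stack → Prop
  | leaf => True
  | box p r n _ c => ¬ SemiThin (p, n, r) ∧ ∀ i, NoSemiThin (c i)

/-- The bottom box is thin. -/
def BottomThin : Stack → Prop
  | leaf => False
  | box p r n _ _ => Thin (p, n, r)

/-- The boxes of a stacking, and the horizontal strands in its degenerate spaces. -/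
inductive Node : Stack → Type
  | root {p r n a : ℕ} {c : Fin n → Stack} : Node (box p r n a c)
  | strand {p r a : ℕ} {c : Fin 0 → Stack} (t : Fin a) : Node (box p r 0 a c)
  | up {p r n a : ℕ} {c : Fin n → Stack} (i : Fin n) (v : Node (c i)) : Node (box p r n a c)

/-- The horizontal inputs of a stacking from bottom to top: to which box or strand they belong. -/
def leftWires : ∀ S : Stack, List (Node S)
  | leaf => []
  | box p _ 0 a _ => List.replicate p Node.root ++ (List.finRange a).map Node.strand
  | box p _ (_ + 1) _ c => List.replicate p Node.root ++ (leftWires (c 0)).map (Node.up 0)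

/-- The horizontal outputs of a stacking from bottom to top. -/
def rightWires : ∀ S : Stack, List (Node S)
  | leaf => []
  | box _ r 0 a _ => List.replicate r Node.root ++ (List.finRange a).map Node.strand
  | box _ r (n + 1) _ c =>
      List.replicate r Node.root ++ (rightWires (c (Fin.last n))).map (Node.up (Fin.last n))

/-- Two boxes or strands are horizontally adjacent: a horizontal output of the first is a horizontal
input of the second. -/
inductive Adj : ∀ S : Stack, Node S → Node S → Prop
  | row {p r n a : ℕ} {c : Fin n → Stack} (i j : Fin n) (h : i.val + 1 = j.val)
      (v : Node (c i)) (w : Node (c j)) (hvw : (v, w) ∈ (rightWires (c i)).zip (leftWires (c j))) :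
      Adj (box p r n a c) (Node.up i v) (Node.up j w)
  | up {p r n a : ℕ} {c : Fin n → Stack} (i : Fin n) (v w : Node (c i)) (h : Adj (c i) v w) :
      Adj (box p r n a c) (Node.up i v) (Node.up i w)

/-- The number of connected components of the horizontal composite graph. -/
def horizontalComponents (S : Stack) : ℕ := Nat.card (Quot (Adj S))

/-- The thin desuspended degree. -/
def thinDegree (S : Stack) : ℤ :=
  if S.left = 0 ∧ S.right = 0 then 0 else (1 + S.thinCount) - S.size

/-- Thin-quadratic stackings (stackings here are always in standard order). -/
def ThinQuadratic (S : Stack) : Prop :=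
  S.Valid ∧ S.NoSemiThin ∧ S.thinDegree = 2 - S.size ∧ S.horizontalComponents = 2

end Stack

/-! ### Conilpotency -/

section Conilpotent

variable {k V : Type*} [Field k] [AddCommGroup V] [Module k V]

/-- For an endomorphism `π` of `V`, the map `π^{⊗ n} ∘ Δ_S` where `Δ_S` is the decomposition along
the stacking `S` with `n` boxes; it takes values in words of length `n` in `V` (the boxes being in
standard order). -/
def DgBoxCooperad.iter (C : DgBoxCooperad k V) (π : V →ₗ[k] V) :
    Stack → (V →ₗ[k] TensorAlgebra k V)
  | .leaf => Algebra.linearMap k (TensorAlgebra k V) ∘ₗ C.counit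
  | .box p r n a c =>
      PiTensorProduct.lift ((MultilinearMap.mkPiAlgebraFin k (n + 1) (TensorAlgebra k V)).compLinearMap
        (Fin.cons (α := fun _ => V →ₗ[k] TensorAlgebra k V)
          (TensorAlgebra.ι k ∘ₗ π ∘ₗ C.proj (p, n, r)) fun i => C.iter π (c i))) ∘ₗ
      C.decomp n (Stack.profile n a c)

/-- The projection `c ↦ c - ε(c) 1` onto the coaugmentation coideal. -/
def DgBoxCooperad.reduce (C : DgBoxCooperad k V) (one : V) : V →ₗ[k] V :=
  LinearMap.id - C.counit.smulRight one

end Conilpotent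

/-- A conilpotent dg box cooperad `C = C̄ ⊕ k`: a dg box cooperad with a coaugmentation (a morphism
of dg box cooperads from `k`, given by the element `one`), such that the reduced decompositions
of an element along all stackings form an element of the direct sum over the stackings, i.e.
almost all of them vanish. -/
structure ConilpotentDgBoxCooperad (k V : Type*) [Field k] [AddCommGroup V] [Module k V]
    extends DgBoxCooperad k V where
  one : V
  one_mem : one ∈ piece (0, 1, 0) 0
  d_one : d one = 0
  counit_one : counit one = 1
  decomp_one : decomp 1 (fun _ => 0) one = PiTensorProduct.tprod k fun _ => one
  decomp_one_zero : ∀ (n : ℕ) (ps : Fin (n + 1) → ℕ), (n ≠ 1 ∨ ∃ i, ps i ≠ 0) →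
    decomp n ps one = 0
  conilpotent : ∀ c : V,
    {S : Stack | S.Valid ∧ toDgBoxCooperad.iter (toDgBoxCooperad.reduce one) S c ≠ 0}.Finite

/-! ### Suspended `L∞`-structures -/

/-- The Koszul sign of `x₁ ⊗ ⋯ ⊗ xₙ ↦ x_{σ 1} ⊗ ⋯ ⊗ x_{σ n}`, where `xᵢ` has degree `δ i`. -/
def koszulSign {n : ℕ} (δ : Fin n → ℤ) (σ : Equiv.Perm (Fin n)) : ℤ :=
  ∏ i, ∏ j, if i < j ∧ σ j < σ i then ((δ (σ i) * δ (σ j)).negOnePow : ℤ) else 1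

/-- `σ` is increasing on the first `l` and on the last `n - l` indices. -/
def IsShuffle {n : ℕ} (l : ℕ) (σ : Equiv.Perm (Fin n)) : Prop :=
  ∀ i j : Fin n, i < j → (j.val < l ∨ l ≤ i.val) → σ i < σ j

instance {n : ℕ} (l : ℕ) : DecidablePred (IsShuffle (n := n) l) :=
  fun _ => inferInstanceAs (Decidable (∀ _, _))

/-- The operations `ℓ n`, `n ≥ 1`, form a suspended `L∞`-structure on the graded module with degree
`e` part `L e`: on homogeneous elements (`ℓ n δ x` being the value at `x₁, …, xₙ` of degrees
`δ 1, …, δ n`) they are multilinear, of degree `-1`, graded symmetric, and satisfy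
`∑_{k+l=n+1} ∑_{χ shuffle} ± ℓ_k(ℓ_l(x_{χ 1}, …, x_{χ l}), x_{χ (l+1)}, …, x_{χ n}) = 0`
for all `n ≥ 1`. In particular `ℓ 1` is a differential. -/
structure IsSuspendedLInfty {k E : Type*} [Field k] [AddCommGroup E] [Module k E]
    (L : ℤ → Submodule k E) (ℓ : ∀ n : ℕ, (Fin n → ℤ) → (Fin n → E) → E) : Prop where
  map_add : ∀ n, 1 ≤ n → ∀ (δ : Fin n → ℤ) (x : Fin n → E), (∀ i, x i ∈ L (δ i)) →
    ∀ (i : Fin n), ∀ y ∈ L (δ i), ∀ z ∈ L (δ i),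
    ℓ n δ (Function.update x i (y + z)) =
      ℓ n δ (Function.update x i y) + ℓ n δ (Function.update x i z)
  map_smul : ∀ n, 1 ≤ n → ∀ (δ : Fin n → ℤ) (x : Fin n → E), (∀ i, x i ∈ L (δ i)) →
    ∀ (i : Fin n) (a : k), ∀ y ∈ L (δ i),
    ℓ n δ (Function.update x i (a • y)) = a • ℓ n δ (Function.update x i y)
  mem : ∀ n, 1 ≤ n → ∀ (δ : Fin n → ℤ) (x : Fin n → E), (∀ i, x i ∈ L (δ i)) →
    ℓ n δ x ∈ L (∑ i, δ i - 1)
  symm : ∀ n, 1 ≤ n → ∀ (δ : Fin n → ℤ) (x : Fin n → E), (∀ i, x i ∈ L (δ i)) →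
    ∀ σ : Equiv.Perm (Fin n),
    ℓ n (fun i => δ (σ i)) (fun i => x (σ i)) = koszulSign δ σ • ℓ n δ x
  relation : ∀ n, 1 ≤ n → ∀ (δ : Fin n → ℤ) (x : Fin n → E), (∀ i, x i ∈ L (δ i)) →
    ∑ l : Fin n, ∑ σ : Equiv.Perm (Fin n) with IsShuffle (l.val + 1) σ,
      koszulSign δ σ •
        ℓ (n - (l.val + 1) + 1)
          (Fin.cons (∑ i : Fin (l.val + 1), δ (σ ⟨i.val, by omega⟩) - 1)
            fun j : Fin (n - (l.val + 1)) => δ (σ ⟨l.val + 1 + j.val, by omega⟩))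
          (Fin.cons
            (ℓ (l.val + 1) (fun i => δ (σ ⟨i.val, by omega⟩)) fun i => x (σ ⟨i.val, by omega⟩))
            fun j : Fin (n - (l.val + 1)) => x (σ ⟨l.val + 1 + j.val, by omega⟩)) = 0

/-! ### The operations on the totalisation -/

section Convolution

variable {k U V : Type*} [Field k] [AddCommGroup U] [Module k U] [AddCommGroup V] [Module k V]

/-- The sum of a family of linear maps that is finite at every point (and `0` if it is not). -/
def locallyFiniteSum {I : Type*} (F : I → U →ₗ[k] V) : U →ₗ[k] V := by
  classical
  exact if h : ∀ c, (Function.support fun S => F S c).Finite then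
    { toFun := fun c => ∑ᶠ S, F S c
      map_add' := fun x y => by
        simp only [map_add]
        exact finsum_add_distrib (h x) (h y)
      map_smul' := fun a x => by
        simp only [map_smul, RingHom.id_apply]
        exact (smul_finsum' a (h x)).symm }
  else 0

/-- For linear maps `g s, g (s + 1), …`, one for each box of the stacking `S` (in standard order),
the composite `C ⟶ C ⊗ ⋯ ⊗ C ⟶ B ⊗ ⋯ ⊗ B ⟶ B` of the decomposition `Δ_S`, the maps `g` on the
tensor factors (without any sign) and the composition `μ_S`. -/
def convolve (C : DgBoxCooperad k U) (B : DgBoxOperad k V) (g : ℕ → U →ₗ[k] V) :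
    Stack → ℕ → (U →ₗ[k] V)
  | .leaf, _ => C.counit.smulRight B.one
  | .box p r n a c, s =>
      PiTensorProduct.lift ((B.comp n (Stack.profile n a c)).compLinearMap
        (Fin.cons (α := fun _ => U →ₗ[k] V) (g s ∘ₗ C.proj (p, n, r)) fun i =>
          convolve C B g (c i) (s + 1 + ∑ j with j < i, (c j).size))) ∘ₗ
      C.decomp n (Stack.profile n a c)

open Classical in
/-- The sign of the component along `S` of the thin desuspended infinitesimal decomposition, as an
operator on the first tensor factor `c₁`: `(-1)^|c₁|` if the bottom box is not thin (type II), and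
otherwise `(-1)^(|c₁| + 1)` if all boxes are thin (type I) and `-1` if not (type III). Here `|c₁|`
is the degree in `C`. -/
def infinitesimalSign (C : DgBoxCooperad k U) (S : Stack) : U →ₗ[k] U :=
  if ¬ S.BottomThin then C.koszul 1
  else if S.thinCount = S.size then - C.koszul 1
  else - LinearMap.id

/-- The summand along `S` of `μ ∘ (f₁ ⊗ ⋯ ⊗ fₙ) ∘ Δ`, with `Δ` the thin desuspended infinitesimal
decomposition and `fᵢ : s_thin⁻¹ C ⟶ B` of degree `δ i`. By the Koszul rule, `fᵢ` is applied to
`(-1)^((|fᵢ₊₁| + ⋯ + |fₙ|) |yᵢ|) yᵢ`, where `|yᵢ|` is the degree in `s_thin⁻¹ C`. The map `π` is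
first applied to each tensor factor: for `π = id` this gives the infinitesimal decomposition of `C`,
for `π` the projection onto `C̄` the reduced one. -/
def pSummand (C : DgBoxCooperad k U) (B : DgBoxOperad k V) (π : U →ₗ[k] U) {n : ℕ}
    (δ : Fin n → ℤ) (f : Fin n → U →ₗ[k] V) (S : Stack) : U →ₗ[k] V :=
  convolve C B (fun v => if h : v < n then
    f ⟨v, h⟩ ∘ₗ C.thinDesuspension.koszul (∑ j with (⟨v, h⟩ : Fin n) < j, δ j) ∘ₗ π ∘ₗ
      (if v = 0 then infinitesimalSign C S else LinearMap.id)
    else 0) S 0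

/-- The maps `P_n`. -/
def opP (C : DgBoxCooperad k U) (B : DgBoxOperad k V) (π : U →ₗ[k] U) (n : ℕ)
    (δ : Fin n → ℤ) (f : Fin n → U →ₗ[k] V) : U →ₗ[k] V :=
  sgn k (∑ i, δ i) • locallyFiniteSum
    fun S : {S : Stack // S.ThinQuadratic ∧ S.size = n} => pSummand C B π δ f S

/-- The operations `L_n`: the differential for `n = 1`, and the symmetrization of `P_n` for
`n ≥ 2`. -/
def opL (C : DgBoxCooperad k U) (B : DgBoxOperad k V) (π : U →ₗ[k] U) :
    ∀ n : ℕ, (Fin n → ℤ) → (Fin n → U →ₗ[k] V) → (U →ₗ[k] V)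
  | 0, _, _ => 0
  | 1, δ, f => C.thinDesuspension.homD B.toDgModule (δ 0) (f 0)
  | n + 2, δ, f => ∑ σ : Equiv.Perm (Fin (n + 2)),
      koszulSign δ σ • opP C B π (n + 2) (fun i => δ (σ i)) fun i => f (σ i)

end Convolution

end BoxOperads

namespace BoxOperads

variable {k U V : Type*} [Field k] [AddCommGroup U] [Module k U] [AddCommGroup V] [Module k V]

open Finset (sum_congr mem_univ univ sum_add_distrib smul_sum sum_eq_zero mem_range prod_congr
  mem_filter sum_subset mem_Ico ne_of_mem_erase mem_erase sum_const_zero sum_range sum_erase_add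
  mem_biUnion sum_range_succ prod_mul_distrib mul_sum sum_ite_eq' sum_range_one
  subset_biUnion_of_mem sum_eq_zero_iff mem_of_mem_erase range_eq_Ico range Ico sum_eq_single
  sum_bij prod_comm mem_sigma sum_insertNone prod_const_one notMem_empty
  exists_ne_zero_of_sum_ne_zero insertNone prod_range sum_comm add_sum_erase subset_union_left
  subset_union_right)
open LinearMap (inl inr comp_apply smulRight_apply prod_apply compMultilinearMap_apply smul_comp
  comp_assoc add_comp)
open Function (update update_of_ne update_self Injective Bijective extend)
open Fin (cons cons_zero cons_succ update_cons_zero cons_update prod_univ_succ sum_univ_succ)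
open MultilinearMap (compLinearMap_apply toLinearMap_apply mkPiAlgebra mkPiAlgebra_apply
  map_smul_univ)

instance {k U : Type*} [Field k] [AddCommGroup U] [Module k U] :
    Coe (ConilpotentDgBoxCooperad k U) (DgBoxCooperad k U) := ⟨fun C => C.toDgBoxCooperad⟩

instance {k U : Type*} [Field k] [AddCommGroup U] [Module k U] :
    Coe (DgBoxCooperad k U) (DgModule k U) := ⟨fun C => C.toDgModule⟩

instance {k U : Type*} [Field k] [AddCommGroup U] [Module k U] :
    Coe (DgBoxOperad k U) (DgModule k U) := ⟨fun B => B.toDgModule⟩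

section Sign

lemma sgn_add (a b : ℤ) : sgn k (a + b) = sgn k a * sgn k b := by
  simp [sgn, Int.negOnePow_add]

@[simp] lemma sgn_zero : sgn k 0 = 1 := by simp [sgn]

@[simp] lemma sgn_one : sgn k 1 = -1 := by simp [sgn]

@[simp] lemma sgn_neg (a : ℤ) : sgn k (-a) = sgn k a := by simp [sgn]

lemma sgn_mul_self (a : ℤ) : sgn k a * sgn k a = 1 := by
  rw [← sgn_add]; simp [sgn, Int.negOnePow_even]

lemma sgn_even {a : ℤ} (h : Even a) : sgn k a = 1 := by simp [sgn, Int.negOnePow_even a h]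

lemma sgn_eq_of_even_sub {a b : ℤ} (h : Even (a - b)) : sgn k a = sgn k b := by
  have : a = (a - b) + b := by ring
  rw [this, sgn_add, sgn_even h, one_mul]

lemma sgn_sum {ι : Type*} (s : Finset ι) (f : ι → ℤ) :
    sgn k (∑ i ∈ s, f i) = ∏ i ∈ s, sgn k (f i) := by
  classical
  induction s using Finset.induction_on with
  | empty => simp
  | insert a s ha ih => rw [Finset.sum_insert ha, Finset.prod_insert ha, sgn_add, ih]

end Sign

namespace DgModule

variable {W : Type*} [AddCommGroup W] [Module k W]

/-- The index type of a homogeneous basis. -/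
abbrev HIndex (M : DgModule k V) : Type _ :=
  Σ i : Colour × ℤ, Module.Basis.ofVectorSpaceIndex k (M.piece i.1 i.2)

/-- A basis of homogeneous elements. -/
def hbasis (M : DgModule k V) : Module.Basis M.HIndex k V :=
  M.internal.collectedBasis fun i => Module.Basis.ofVectorSpace k (M.piece i.1 i.2)

lemma hbasis_mem (M : DgModule k V) (a : M.HIndex) : M.hbasis a ∈ M.piece a.1.1 a.1.2 :=
  M.internal.collectedBasis_mem _ a

lemma hbasis_repr_of_ne (M : DgModule k V) (a : M.HIndex) {α : Colour} {e : ℤ} {x : V}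
    (hx : x ∈ M.piece α e) (h : (α, e) ≠ a.1) : M.hbasis.repr x a = 0 :=
  M.internal.collectedBasis_repr_of_mem_ne (fun i => Module.Basis.ofVectorSpace k (M.piece i.1 i.2))
    (i := (α, e)) h hx

/-- Multilinear maps which agree on homogeneous elements are equal. -/
lemma multilinear_ext (M : DgModule k V) {n : ℕ} {f g : MultilinearMap k (fun _ : Fin n => V) W}
    (h : ∀ (α : Fin n → Colour) (e : Fin n → ℤ) (x : Fin n → V),
      (∀ i, x i ∈ M.piece (α i) (e i)) → f x = g x) : f = g :=
  Module.Basis.ext_multilinear (fun _ => M.hbasis) fun v =>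
    h (fun i => (v i).1.1) (fun i => (v i).1.2) _ fun i => M.hbasis_mem (v i)

lemma linear_ext (M : DgModule k V) {f g : V →ₗ[k] W}
    (h : ∀ (α : Colour) (e : ℤ) (x : V), x ∈ M.piece α e → f x = g x) : f = g :=
  M.hbasis.ext fun a => h _ _ _ (M.hbasis_mem a)

lemma koszul_apply (M : DgModule k V) (m : ℤ) {α : Colour} {e : ℤ} {x : V}
    (hx : x ∈ M.piece α e) : M.koszul m x = sgn k (m * e) • x := M.scale_apply _ hx

lemma proj_apply (M : DgModule k V) (β : Colour) {α : Colour} {e : ℤ} {x : V}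
    (hx : x ∈ M.piece α e) : M.proj β x = if α = β then x else 0 := by
  rw [proj, M.scale_apply _ hx]; split <;> simp

lemma koszul_mem (M : DgModule k V) (m : ℤ) {α : Colour} {e : ℤ} {x : V}
    (hx : x ∈ M.piece α e) : M.koszul m x ∈ M.piece α e := by
  rw [M.koszul_apply m hx]; exact Submodule.smul_mem _ _ hx

lemma koszul_koszul (M : DgModule k V) (m n : ℤ) (x : V) :
    M.koszul m (M.koszul n x) = M.koszul (m + n) x := by
  have : M.koszul m ∘ₗ M.koszul n = M.koszul (m + n) := M.linear_ext fun α e x hx => by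
    rw [comp_apply, M.koszul_apply n hx, map_smul, M.koszul_apply m hx,
      M.koszul_apply _ hx, smul_smul, add_mul, sgn_add, mul_comm]
  exact LinearMap.congr_fun this x

@[simp] lemma koszul_zero (M : DgModule k V) : M.koszul 0 = LinearMap.id :=
  M.linear_ext fun α e x hx => by rw [M.koszul_apply 0 hx]; simp

lemma koszul_self (M : DgModule k V) (m : ℤ) (x : V) : M.koszul m (M.koszul m x) = x := by
  rw [koszul_koszul]
  have : M.koszul (m + m) = LinearMap.id := M.linear_ext fun α e x hx => by
    rw [M.koszul_apply _ hx, add_mul, sgn_add, sgn_mul_self]; simp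
  rw [this]; rfl

lemma koszul_d (M : DgModule k V) (m : ℤ) (x : V) :
    M.koszul m (M.d x) = sgn k m • M.d (M.koszul m x) := by
  have : M.koszul m ∘ₗ M.d = sgn k m • (M.d ∘ₗ M.koszul m) := M.linear_ext fun α e x hx => by
    simp only [comp_apply, LinearMap.smul_apply]
    rw [M.koszul_apply m (M.d_mem hx), M.koszul_apply m hx, map_smul, smul_smul, ← sgn_add]
    congr 1
    exact sgn_eq_of_even_sub ⟨-m, by ring⟩
  exact LinearMap.congr_fun this x

end DgModule

namespace DgBoxOperad

variable (B : DgBoxOperad k V)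

/-- Colours for which the composition `comp n ps` does not vanish. -/
def Match (n : ℕ) (ps : Fin (n + 1) → ℕ) (α : Fin (n + 1) → Colour) : Prop :=
  (α 0).2.1 = n ∧ ∀ i : Fin n, (α i.succ).1 = ps i.castSucc ∧ (α i.succ).2.2 = ps i.succ

/-- The colour of a composite. -/
def compColour (n : ℕ) (ps : Fin (n + 1) → ℕ) (α : Fin (n + 1) → Colour) : Colour :=
  ((α 0).1 + ps 0, ∑ i : Fin n, (α i.succ).2.1, (α 0).2.2 + ps (Fin.last n))

lemma comp_eq_zero {n : ℕ} {ps : Fin (n + 1) → ℕ} {α : Fin (n + 1) → Colour}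
    (h : ¬ Match n ps α) {e : Fin (n + 1) → ℤ} {x : Fin (n + 1) → V}
    (hx : ∀ i, x i ∈ B.piece (α i) (e i)) : B.comp n ps x = 0 := by
  by_cases h0 : (α 0).2.1 = n
  · simp only [Match, h0, true_and, not_forall] at h
    obtain ⟨i, hi⟩ := h
    exact B.comp_top_zero n ps x i _ _ _ (e i.succ) (hx i.succ) (by tauto)
  · exact B.comp_bottom_zero n ps x _ _ _ (e 0) (hx 0) h0

lemma comp_mem' {n : ℕ} {ps : Fin (n + 1) → ℕ} {α : Fin (n + 1) → Colour}
    {e : Fin (n + 1) → ℤ} {x : Fin (n + 1) → V}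
    (hx : ∀ i, x i ∈ B.piece (α i) (e i)) :
    B.comp n ps x ∈ B.piece (compColour n ps α) (∑ i, e i) := by
  by_cases h : Match n ps α
  · refine B.comp_mem n ps (α 0).1 (α 0).2.2 (fun i => (α i.succ).2.1) e x ?_ fun i => ?_
    · have h0 : ((α 0).1, n, (α 0).2.2) = α 0 := Prod.ext rfl (Prod.ext h.1.symm rfl)
      rw [h0]; exact hx 0
    · rw [← (h.2 i).1, ← (h.2 i).2]; exact hx i.succ
  · rw [B.comp_eq_zero h hx]; exact zero_mem _

lemma koszul_comp (m : ℤ) (n : ℕ) (ps : Fin (n + 1) → ℕ) (x : Fin (n + 1) → V) :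
    B.koszul m (B.comp n ps x) = B.comp n ps fun i => B.koszul m (x i) := by
  have : (B.koszul m).compMultilinearMap (B.comp n ps) =
      (B.comp n ps).compLinearMap fun _ => B.koszul m := B.multilinear_ext fun α e x hx => by
    simp only [compMultilinearMap_apply, compLinearMap_apply]
    rw [B.koszul_apply m (B.comp_mem' hx)]
    have : (fun i => B.koszul m (x i)) = fun i => sgn k (m * e i) • x i := by
      funext i; exact B.koszul_apply m (hx i)
    rw [this, map_smul_univ, mul_sum, sgn_sum]
  exact congrFun (congrArg (fun f => f.toFun) this) x

lemma koszul_one (m : ℤ) : B.koszul m B.one = B.one := by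
  rw [B.koszul_apply m B.one_mem]; simp

end DgBoxOperad

lemma isInternal_of_proj {k V ι : Type*} [Field k] [AddCommGroup V] [Module k V] [DecidableEq ι]
    (S : ι → Submodule k V) (p : ι → V →ₗ[k] V) (h₁ : ∀ i, ∀ x ∈ S i, p i x = x)
    (h₂ : ∀ i j, j ≠ i → ∀ x ∈ S j, p i x = 0) (h₃ : ⨆ i, S i = ⊤) : DirectSum.IsInternal S := by
  rw [DirectSum.isInternal_submodule_iff_iSupIndep_and_iSup_eq_top]
  refine ⟨fun i => ?_, h₃⟩
  rw [Submodule.disjoint_def]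
  intro x hx hx'
  have hle : (⨆ j, ⨆ (_ : j ≠ i), S j) ≤ LinearMap.ker (p i) :=
    iSup₂_le fun j hj y hy => h₂ i j hj y hy
  rw [← h₁ i x hx]
  exact hle hx'

namespace DgModule

/-- The projection onto the piece of colour and degree `i`. -/
def component (M : DgModule k V) (i : Colour × ℤ) : V →ₗ[k] V :=
  M.scale fun β e => if (β, e) = i then 1 else 0

lemma component_apply (M : DgModule k V) (i : Colour × ℤ) {α : Colour} {e : ℤ} {x : V}
    (hx : x ∈ M.piece α e) : M.component i x = if (α, e) = i then x else 0 := by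
  rw [component, M.scale_apply _ hx]; split <;> simp

/-- `M ⊕ ε M` for a parameter `ε` of degree `-d`. -/
def ext (M : DgModule k V) (d : ℤ) : DgModule k (V × V) where
  piece α e := (M.piece α e).prod (M.piece α (e + d))
  internal := by
    refine isInternal_of_proj _
      (fun i => (M.component i).prodMap (M.component (i.1, i.2 + d))) ?_ ?_ ?_
    · rintro ⟨α, e⟩ ⟨x, y⟩ ⟨hx, hy⟩
      simp only [LinearMap.prodMap_apply]
      rw [M.component_apply _ hx, M.component_apply _ hy]; simp
    · rintro ⟨α, e⟩ ⟨β, e'⟩ hne ⟨x, y⟩ ⟨hx, hy⟩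
      simp only [LinearMap.prodMap_apply]
      rw [M.component_apply _ hx, M.component_apply _ hy, if_neg hne, if_neg]
      · rfl
      · simpa using hne
    · rw [eq_top_iff]
      rintro ⟨x, y⟩ -
      have hx : x ∈ (⨆ i : Colour × ℤ, (M.piece i.1 i.2).prod (M.piece i.1 (i.2 + d))).comap
          (inl k V V) := by
        have : ⊤ ≤ (⨆ i : Colour × ℤ, (M.piece i.1 i.2).prod (M.piece i.1 (i.2 + d))).comap
            (inl k V V) := by
          rw [← M.internal.submodule_iSup_eq_top]
          exact iSup_le fun i z hz => Submodule.mem_comap.2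
            (Submodule.mem_iSup_of_mem i ⟨hz, zero_mem _⟩)
        exact this trivial
      have hy : y ∈ (⨆ i : Colour × ℤ, (M.piece i.1 i.2).prod (M.piece i.1 (i.2 + d))).comap
          (inr k V V) := by
        have : ⊤ ≤ (⨆ i : Colour × ℤ, (M.piece i.1 i.2).prod (M.piece i.1 (i.2 + d))).comap
            (inr k V V) := by
          rw [← M.internal.submodule_iSup_eq_top]
          refine iSup_le fun i z hz => Submodule.mem_comap.2
            (Submodule.mem_iSup_of_mem (i.1, i.2 - d) ⟨zero_mem _, ?_⟩)
          simpa using hz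
        exact this trivial
      have : (x, y) = inl k V V x + inr k V V y := by simp
      rw [this]
      exact add_mem hx hy
  d := M.d.prodMap (sgn k d • M.d)
  d_mem := by
    rintro α e ⟨x, y⟩ ⟨hx, hy⟩
    refine ⟨M.d_mem hx, ?_⟩
    have := M.d_mem hy
    rw [add_sub_right_comm] at this
    exact Submodule.smul_mem _ _ this
  d_d x := by simp [M.d_d]

lemma mem_ext {M : DgModule k V} {d : ℤ} {α : Colour} {e : ℤ} {x : V × V} :
    x ∈ (M.ext d).piece α e ↔ x.1 ∈ M.piece α e ∧ x.2 ∈ M.piece α (e + d) := Iff.rfl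

lemma ext_d_apply (M : DgModule k V) (d : ℤ) (x : V × V) :
    (M.ext d).d x = (M.d x.1, sgn k d • M.d x.2) := rfl

lemma ext_koszul (M : DgModule k V) (d m : ℤ) (x : V × V) :
    (M.ext d).koszul m x = (M.koszul m x.1, sgn k (m * d) • M.koszul m x.2) := by
  have : (M.ext d).koszul m = (M.koszul m).prodMap (sgn k (m * d) • M.koszul m) :=
    (M.ext d).linear_ext fun α e x hx => by
      rw [koszul_apply _ m hx]
      obtain ⟨h1, h2⟩ := mem_ext.1 hx
      refine Prod.ext ?_ ?_
      · simp [M.koszul_apply m h1]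
      · simp only [Prod.smul_snd, LinearMap.prodMap_apply, LinearMap.smul_apply]
        rw [M.koszul_apply m h2, smul_smul, ← sgn_add]
        congr 1
        exact sgn_eq_of_even_sub ⟨-(m * d), by ring⟩
  exact LinearMap.congr_fun this x

end DgModule

namespace DgBoxOperad

variable (B : DgBoxOperad k V)

/-- The projections of `V × V` which extract the coefficient of `ε` sitting at the `i`-th factor of
a tensor product. -/
def slot (d : ℤ) {n : ℕ} (i j : Fin (n + 1)) : V × V →ₗ[k] V :=
  if j < i then B.koszul d ∘ₗ LinearMap.fst k V V else
    if j = i then LinearMap.snd k V V else LinearMap.fst k V V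

/-- The composition of `B ⊕ ε B`. -/
def extComp (d : ℤ) (n : ℕ) (ps : Fin (n + 1) → ℕ) :
    MultilinearMap k (fun _ : Fin (n + 1) => V × V) (V × V) :=
  ((B.comp n ps).compLinearMap fun _ => LinearMap.fst k V V).prod
    (∑ i, (B.comp n ps).compLinearMap (B.slot d i))

lemma extComp_fst (d : ℤ) (n : ℕ) (ps : Fin (n + 1) → ℕ) (x : Fin (n + 1) → V × V) :
    (B.extComp d n ps x).1 = B.comp n ps fun j => (x j).1 := rfl

lemma extComp_snd (d : ℤ) (n : ℕ) (ps : Fin (n + 1) → ℕ) (x : Fin (n + 1) → V × V) :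
    (B.extComp d n ps x).2 = ∑ i, B.comp n ps fun j => B.slot d i j (x j) := by
  simp [extComp]

lemma slot_lt {d : ℤ} {n : ℕ} {i j : Fin (n + 1)} (h : j < i) (x : V × V) :
    B.slot d i j x = B.koszul d x.1 := by simp [slot, h]

lemma slot_self {d : ℤ} {n : ℕ} (i : Fin (n + 1)) (x : V × V) :
    B.slot d i i x = x.2 := by simp [slot]

lemma slot_gt {d : ℤ} {n : ℕ} {i j : Fin (n + 1)} (h : i < j) (x : V × V) :
    B.slot d i j x = x.1 := by simp [slot, h.not_gt, h.ne']

lemma slot_mem {d : ℤ} {n : ℕ} (i j : Fin (n + 1)) {α : Colour} {e : ℤ} {x : V × V}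
    (hx : x ∈ (B.toDgModule.ext d).piece α e) :
    B.slot d i j x ∈ B.piece α (if j = i then e + d else e) := by
  rcases lt_trichotomy j i with h | rfl | h
  · rw [B.slot_lt h, if_neg h.ne]; exact B.koszul_mem _ hx.1
  · rw [B.slot_self, if_pos rfl]; exact hx.2
  · rw [B.slot_gt h, if_neg h.ne']; exact hx.1

lemma slot_koszul {d : ℤ} {n : ℕ} (i j : Fin (n + 1)) (m : ℤ) (x : V × V) :
    B.slot d i j ((B.toDgModule.ext d).koszul m x) =
      if j = i then sgn k (m * d) • B.koszul m (B.slot d i j x) else B.koszul m (B.slot d i j x) := by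
  rw [DgModule.ext_koszul]
  rcases lt_trichotomy j i with h | rfl | h
  · rw [B.slot_lt h, B.slot_lt h, if_neg h.ne, B.koszul_koszul, B.koszul_koszul, add_comm]
  · rw [B.slot_self, B.slot_self, if_pos rfl]
  · rw [B.slot_gt h, B.slot_gt h, if_neg h.ne']

lemma ext_d_comp (d : ℤ) (n : ℕ) (ps : Fin (n + 1) → ℕ) (x : Fin (n + 1) → V × V) :
    (B.toDgModule.ext d).d (B.extComp d n ps x) = ∑ i, B.extComp d n ps (fun j =>
      if j < i then (B.toDgModule.ext d).koszul 1 (x j) else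
        if j = i then (B.toDgModule.ext d).d (x j) else x j) := by
  refine Prod.ext ?_ ?_
  · rw [DgModule.ext_d_apply, Prod.fst_sum]
    simp only [extComp_fst, B.d_comp]
    refine sum_congr rfl fun i _ => congrArg _ (funext fun j => ?_)
    split_ifs <;> simp [DgModule.ext_koszul, DgModule.ext_d_apply]
  · rw [DgModule.ext_d_apply, Prod.snd_sum]
    simp only [extComp_snd, B.d_comp, map_sum, smul_sum]
    rw [sum_comm]
    refine sum_congr rfl fun i _ => sum_congr rfl fun j _ => ?_
    have : (fun l => B.slot d j l (if l < i then (B.toDgModule.ext d).koszul 1 (x l) else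
        if l = i then (B.toDgModule.ext d).d (x l) else x l)) =
        fun l => (if l = min i j then sgn k d else 1) •
          (if l < i then B.koszul 1 (B.slot d j l (x l)) else
            if l = i then B.d (B.slot d j l (x l)) else B.slot d j l (x l)) := by
      funext l
      rcases lt_trichotomy l i with hl | rfl | hl
      · have h : l = min i j ↔ l = j := by
          rcases le_total i j with h | h
          · rw [min_eq_left h]
            exact ⟨fun h' => absurd h' hl.ne, fun h' => absurd (h' ▸ hl) h.not_gt⟩
          · rw [min_eq_right h]
        simp only [if_pos hl, h]
        rw [slot_koszul]
        split_ifs <;> simp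
      · simp only [lt_irrefl, if_false, if_true]
        rcases lt_trichotomy l j with h | rfl | h
        · rw [B.slot_lt h, B.slot_lt h, DgModule.ext_d_apply, DgModule.koszul_d, if_pos (min_eq_left h.le).symm]
        · rw [B.slot_self, B.slot_self, DgModule.ext_d_apply, if_pos (min_self l).symm]
        · rw [B.slot_gt h, B.slot_gt h, DgModule.ext_d_apply, min_eq_right h.le, if_neg h.ne',
            one_smul]
      · simp only [if_neg hl.not_gt, if_neg hl.ne', if_neg (min_le_left i j |>.trans_lt hl).ne', one_smul]
    rw [this, (B.comp n ps).map_smul_univ]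
    simp

end DgBoxOperad

lemma sum_range_blocks {M : Type*} [AddCommMonoid M] (m off : ℕ → ℕ)
    (hoff : ∀ i, off i = ∑ t ∈ range i, m t) (f : ℕ → M) (n : ℕ) :
    ∑ j ∈ range (off n), f j = ∑ i ∈ range n, ∑ t ∈ range (m i), f (off i + t) := by
  induction n with
  | zero => simp [hoff 0]
  | succ n ih =>
    have : off (n + 1) = off n + m n := by rw [hoff, hoff, sum_range_succ]
    rw [this, Finset.sum_range_add, ih, sum_range_succ]

lemma off_mono {m off : ℕ → ℕ} (hoff : ∀ i, off i = ∑ t ∈ range i, m t) : Monotone off := by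
  intro i j h
  rw [hoff, hoff]
  exact Finset.sum_le_sum_of_subset (Finset.range_mono h)

lemma off_succ {m off : ℕ → ℕ} (hoff : ∀ i, off i = ∑ t ∈ range i, m t) (i : ℕ) :
    off (i + 1) = off i + m i := by rw [hoff, hoff, sum_range_succ]

lemma vec_two_eq_cons {W : Type*} (a b : W) : (![a, b] : Fin 2 → W) = cons a fun _ => b := by
  funext i; fin_cases i <;> rfl

namespace DgBoxOperad

variable (B : DgBoxOperad k V)

lemma comp_cons_smul {n : ℕ} (ps : Fin (n + 1) → ℕ) (z : V) (a : Fin n → k) (w : Fin n → V) :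
    B.comp n ps (cons z fun j => a j • w j) = (∏ j, a j) • B.comp n ps (cons z w) := by
  have : (cons z fun j => a j • w j : Fin (n + 1) → V) =
      fun l => (cons 1 a : Fin (n + 1) → k) l • (cons z w : Fin (n + 1) → V) l := by
    funext l
    refine Fin.cases ?_ (fun j => ?_) l <;> simp
  rw [this, map_smul_univ, prod_univ_succ]
  simp

lemma comp_cons_smul_bottom {n : ℕ} (ps : Fin (n + 1) → ℕ) (a : k) (z : V) (w : Fin n → V) :
    B.comp n ps (cons (a • z) w) = a • B.comp n ps (cons z w) := by
  have := (B.comp n ps).map_update_smul (cons z w) 0 a z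
  rwa [update_cons_zero, update_cons_zero] at this

lemma comp_cons_update_sum {ι : Type*} {n : ℕ} (ps : Fin (n + 1) → ℕ) (z : V) (w : Fin n → V)
    (i : Fin n) (s : Finset ι) (f : ι → V) :
    B.comp n ps (cons z (update w i (∑ t ∈ s, f t))) =
      ∑ t ∈ s, B.comp n ps (cons z (update w i (f t))) := by
  simp only [cons_update]
  exact (B.comp n ps).map_update_sum _ _ _ _

/-- `slot` for the factors on top of a bottom factor, indexed by natural numbers. -/
def topSlot (d : ℤ) (i j : ℕ) : V × V →ₗ[k] V :=
  if j < i then B.koszul d ∘ₗ LinearMap.fst k V V else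
    if j = i then LinearMap.snd k V V else LinearMap.fst k V V

lemma topSlot_lt {d : ℤ} {i j : ℕ} (h : j < i) (x : V × V) :
    B.topSlot d i j x = B.koszul d x.1 := by simp [topSlot, h]

lemma topSlot_self {d : ℤ} (i : ℕ) (x : V × V) : B.topSlot d i i x = x.2 := by
  simp [topSlot]

lemma topSlot_gt {d : ℤ} {i j : ℕ} (h : i < j) (x : V × V) :
    B.topSlot d i j x = x.1 := by simp [topSlot, h.not_gt, h.ne']

lemma topSlot_mem {d : ℤ} (i j : ℕ) {α : Colour} {e : ℤ} {x : V × V}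
    (hx : x ∈ (B.toDgModule.ext d).piece α e) :
    B.topSlot d i j x ∈ B.piece α (if j = i then e + d else e) := by
  rcases lt_trichotomy j i with h | rfl | h
  · rw [B.topSlot_lt h, if_neg h.ne]; exact B.koszul_mem _ hx.1
  · rw [B.topSlot_self, if_pos rfl]; exact hx.2
  · rw [B.topSlot_gt h, if_neg h.ne']; exact hx.1

lemma extComp_cons_snd (d : ℤ) (n : ℕ) (ps : Fin (n + 1) → ℕ) (a : V × V) (w : Fin n → V × V) :
    (B.extComp d n ps (cons a w)).2 = B.comp n ps (cons a.2 fun j => (w j).1) + ∑ i ∈ range n,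
        B.comp n ps (cons (B.koszul d a.1) fun j => B.topSlot d i j (w j)) := by
  rw [extComp_snd, sum_univ_succ, sum_range]
  refine congrArg₂ _ (congrArg _ (funext fun j => ?_))
    (sum_congr rfl fun i _ => congrArg _ (funext fun j => ?_))
  · refine Fin.cases ?_ (fun j => ?_) j
    · simp [slot_self]
    · simp [B.slot_gt (Fin.succ_pos j)]
  · refine Fin.cases ?_ (fun j => ?_) j
    · simp [B.slot_lt (Fin.succ_pos i)]
    · simp only [cons_succ, slot, topSlot, Fin.lt_def, Fin.ext_iff, Fin.val_succ,
        add_lt_add_iff_right, add_left_inj]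

lemma extComp_cons_fst (d : ℤ) (n : ℕ) (ps : Fin (n + 1) → ℕ) (a : V × V) (w : Fin n → V × V) :
    (B.extComp d n ps (cons a w)).1 = B.comp n ps (cons a.1 fun j => (w j).1) := by
  rw [extComp_fst]
  refine congrArg _ (funext fun j => ?_)
  refine Fin.cases ?_ (fun j => ?_) j <;> simp

/-- The left hand side of associativity. -/
def assocLeft (n : ℕ) (m ps R off : ℕ → ℕ) (x₀ : V) (x y : ℕ → V) : V :=
  B.comp n (fun i => ps i + R (off i)) (cons x₀ fun i : Fin n =>
    B.comp (m i) (fun j => R (off i + j)) (cons (x i) fun j : Fin (m i) => y (off i + j)))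

/-- The right hand side of associativity. -/
def assocRight (n : ℕ) (ps R off : ℕ → ℕ) (x₀ : V) (x y : ℕ → V) : V :=
  B.comp (off n) (fun j => R j) (cons (B.comp n (fun i => ps i) (cons x₀ fun i : Fin n => x i))
    fun j : Fin (off n) => y j)

lemma ext_assoc (d : ℤ) (n : ℕ) (m ps R : ℕ → ℕ) (off : ℕ → ℕ) (p r : ℕ) (q : ℕ → ℕ) (e₀ : ℤ)
    (δ e : ℕ → ℤ) (x₀ : V × V) (x y : ℕ → V × V) (hoff : ∀ i, off i = ∑ t ∈ range i, m t)
    (h₀ : x₀ ∈ (B.toDgModule.ext d).piece (p, n, r) e₀)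
    (hx : ∀ i < n, x i ∈ (B.toDgModule.ext d).piece (ps i, m i, ps (i + 1)) (δ i))
    (hy : ∀ j < off n, y j ∈ (B.toDgModule.ext d).piece (R j, q j, R (j + 1)) (e j)) :
    B.extComp d n (fun i => ps i + R (off i)) (cons x₀ fun i : Fin n =>
        B.extComp d (m i) (fun j => R (off i + j))
          (cons (x i) fun j : Fin (m i) => y (off i + j))) =
      sgn k (∑ i ∈ range n, δ i * ∑ j ∈ range (off i), e j) • B.extComp d (off n) (fun j => R j)
          (cons (B.extComp d n (fun i => ps i) (cons x₀ fun i : Fin n => x i))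
            fun j : Fin (off n) => y j) := by
  set E := ∑ i ∈ range n, δ i * ∑ j ∈ range (off i), e j with hE
  set ss : ℕ → (ℕ → V × V) → ℕ → V := fun i z j => B.topSlot d i j (z j) with hss
  set sk : ℕ → (ℕ → V × V) → ℕ → V := fun i z j => if j < i then B.koszul d (z j).1 else (z j).1
    with hsk
  have hlow : ∀ i < n, off i ≤ off n := fun i hi => off_mono hoff hi.le
  have assoc0 : ∀ (x₀' : V) (x' y' : ℕ → V) (e₀' : ℤ) (δ' e' : ℕ → ℤ),
      x₀' ∈ B.piece (p, n, r) e₀' → (∀ i < n, x' i ∈ B.piece (ps i, m i, ps (i + 1)) (δ' i)) →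
      (∀ j < off n, y' j ∈ B.piece (R j, q j, R (j + 1)) (e' j)) →
      B.assocLeft n m ps R off x₀' x' y' = sgn k (∑ i ∈ range n, δ' i * ∑ j ∈ range (off i), e' j) •
          B.assocRight n ps R off x₀' x' y' := fun x₀' x' y' e₀' δ' e' h0' hx' hy' =>
    B.assoc n m ps R off p r q e₀' δ' e' x₀' x' y' hoff h0' hx' hy'
  have hfx : ∀ i < n, (x i).1 ∈ B.piece (ps i, m i, ps (i + 1)) (δ i) := fun i hi => (hx i hi).1
  have hfy : ∀ j < off n, (y j).1 ∈ B.piece (R j, q j, R (j + 1)) (e j) := fun j hj => (hy j hj).1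
  have hskm : ∀ (i j : ℕ) {z : ℕ → V × V} {α : Colour} {e : ℤ},
      z j ∈ (B.toDgModule.ext d).piece α e → sk i z j ∈ B.piece α e := by
    intro i j z α e hz
    simp only [hsk]; split_ifs
    · exact B.koszul_mem _ hz.1
    · exact hz.1
  have hL : (B.extComp d n (fun i => ps i + R (off i)) (cons x₀ fun i : Fin n =>
        B.extComp d (m i) (fun j => R (off i + j))
          (cons (x i) fun j : Fin (m i) => y (off i + j)))).2 =
      B.assocLeft n m ps R off x₀.2 (fun i => (x i).1) (fun j => (y j).1) +
      ∑ i ∈ range n, (B.assocLeft n m ps R off (B.koszul d x₀.1) (ss i x) (sk (off i) y) +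
        ∑ t ∈ range (m i),
          B.assocLeft n m ps R off (B.koszul d x₀.1) (sk (i + 1) x) (ss (off i + t) y)) := by
    rw [extComp_cons_snd]
    congr 1
    · unfold assocLeft; simp only [extComp_cons_fst]
    · refine sum_congr rfl fun i hi => ?_
      have hi' := mem_range.1 hi
      let z : Option ℕ → V := fun o => o.elim
        (B.comp (m i) (fun j => R (off i + j)) (cons (x i).2 fun j : Fin (m i) => (y (off i + j)).1))
        fun t => B.comp (m i) (fun j => R (off i + j))
          (cons (B.koszul d (x i).1) fun j : Fin (m i) => B.topSlot d t j (y (off i + j)))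
      have h1 : (fun j : Fin n => B.topSlot d i j (B.extComp d (m j) (fun l => R (off j + l))
            (cons (x j) fun l : Fin (m j) => y (off j + l)))) =
          update (fun j : Fin n => B.topSlot d i j (B.extComp d (m j)
            (fun l => R (off j + l)) (cons (x j) fun l : Fin (m j) => y (off j + l)))) ⟨i, hi'⟩
            (∑ o ∈ insertNone (range (m i)), z o) := by
        rw [eq_comm, Function.update_eq_self_iff, sum_insertNone]
        simp only [topSlot_self, extComp_cons_snd]
        rfl
      rw [h1, comp_cons_update_sum, sum_insertNone]
      congr 1
      · unfold assocLeft
        refine congrArg _ (congrArg _ (funext fun j => ?_))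
        rcases lt_trichotomy (j : ℕ) i with h | h | h
        · rw [update_of_ne (fun h' => h.ne (congrArg Fin.val h'))]
          simp only [hss, B.topSlot_lt h, extComp_cons_fst, koszul_comp]
          refine congrArg _ (funext fun l => ?_)
          refine Fin.cases ?_ (fun l => ?_) l
          · simp
          · have : off j + l < off i := lt_of_lt_of_le
              (by have := l.2; have := off_succ hoff j; omega) (off_mono hoff (Nat.add_one_le_iff.2 h))
            simp [hsk, this]
        · obtain rfl : j = ⟨i, hi'⟩ := Fin.ext h
          rw [update_self]
          simp only [hss, hsk, topSlot_self, z, Option.elim]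
          simp
        · rw [update_of_ne (fun h' => h.ne' (congrArg Fin.val h'))]
          simp only [hss, B.topSlot_gt h, extComp_cons_fst]
          refine congrArg _ (congrArg _ (funext fun l => ?_))
          have : ¬ off j + l < off i := by have := off_mono hoff h.le; omega
          simp [hsk, this]
      · refine sum_congr rfl fun t ht => ?_
        have ht' := mem_range.1 ht
        unfold assocLeft
        refine congrArg _ (congrArg _ (funext fun j => ?_))
        rcases lt_trichotomy (j : ℕ) i with h | h | h
        · rw [update_of_ne (fun h' => h.ne (congrArg Fin.val h'))]
          simp only [hsk, B.topSlot_lt h, extComp_cons_fst, koszul_comp, if_pos (Nat.lt_succ_of_lt h)]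
          refine congrArg _ (funext fun l => ?_)
          refine Fin.cases ?_ (fun l => ?_) l
          · simp
          · have : off j + l < off i + t := lt_of_lt_of_le
              (by have := l.2; have := off_succ hoff j; omega)
              ((off_mono hoff (Nat.add_one_le_iff.2 h)).trans (Nat.le_add_right _ _))
            simp [hss, B.topSlot_lt this]
        · obtain rfl : j = ⟨i, hi'⟩ := Fin.ext h
          rw [update_self]
          simp only [z, Option.elim, hsk, hss, lt_add_one, if_true]
          refine congrArg _ (congrArg _ (funext fun l => ?_))
          simp [topSlot]
        · rw [update_of_ne (fun h' => h.ne' (congrArg Fin.val h'))]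
          have h2 : ¬ (j : ℕ) < i + 1 := by omega
          simp only [hsk, B.topSlot_gt h, extComp_cons_fst, if_neg h2]
          refine congrArg _ (congrArg _ (funext fun l => ?_))
          have : off i + t < off j + l := by
            have := off_mono hoff (Nat.add_one_le_iff.2 h); have := off_succ hoff i; omega
          simp [hss, B.topSlot_gt this]
  have hR : (B.extComp d (off n) (fun j => R j)
          (cons (B.extComp d n (fun i => ps i) (cons x₀ fun i : Fin n => x i))
            fun j : Fin (off n) => y j)).2 =
      B.assocRight n ps R off x₀.2 (fun i => (x i).1) (fun j => (y j).1) +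
      ∑ i ∈ range n, (B.assocRight n ps R off (B.koszul d x₀.1) (ss i x) (fun j => (y j).1) +
        ∑ t ∈ range (m i), B.assocRight n ps R off (B.koszul d x₀.1)
          (fun i => B.koszul d (x i).1) (ss (off i + t) y)) := by
    rw [extComp_cons_snd, extComp_cons_snd, extComp_cons_fst, sum_add_distrib, ← add_assoc,
      ← sum_range_blocks m off hoff (fun j => B.assocRight n ps R off (B.koszul d x₀.1)
          (fun i => B.koszul d (x i).1) (ss j y))]
    congr 1
    · let z : Option ℕ → V := fun o => o.elim
        (B.comp n (fun i => ps i) (cons x₀.2 fun i : Fin n => (x i).1))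
        fun i => B.comp n (fun i => ps i) (cons (B.koszul d x₀.1) fun j : Fin n => ss i x j)
      have h1 := (B.comp (off n) fun j => R j).map_update_sum
        (t := insertNone (range n)) (i := 0) (g := z)
        (m := cons 0 fun j : Fin (off n) => (y j).1)
      simp only [update_cons_zero, sum_insertNone] at h1
      exact h1
    · refine sum_congr rfl fun j hj => ?_
      unfold assocRight
      rw [koszul_comp]
      refine congrArg _ (congrArg (cons · _) (congrArg _ (funext fun l => ?_)))
      refine Fin.cases ?_ (fun l => ?_) l <;> simp
  refine Prod.ext ?_ ?_
  · rw [Prod.smul_fst, extComp_cons_fst, extComp_cons_fst, extComp_cons_fst]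
    simp only [extComp_cons_fst]
    exact assoc0 _ _ _ e₀ δ e h₀.1 hfx hfy
  · rw [Prod.smul_snd, hL, hR, smul_add, smul_sum]
    congr 1
    · exact assoc0 _ _ _ _ δ e h₀.2 hfx hfy
    refine sum_congr rfl fun i hi => ?_
    have hi' := mem_range.1 hi
    rw [smul_add, smul_sum]
    congr 1
    · rw [assoc0 _ _ _ e₀ _ e (B.koszul_mem _ h₀.1) (fun j hj => B.topSlot_mem i j (hx j hj)) fun j hj => hskm (off i) j (hy j hj)]
      have h1 : B.assocRight n ps R off (B.koszul d x₀.1) (ss i x) (sk (off i) y) =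
          sgn k (d * ∑ j ∈ range (off i), e j) •
            B.assocRight n ps R off (B.koszul d x₀.1) (ss i x) fun j => (y j).1 := by
        unfold assocRight
        have : (fun j : Fin (off n) => sk (off i) y j) =
            fun j : Fin (off n) => (if (j : ℕ) < off i then sgn k (d * e j) else 1) • (y j).1 := by
          funext j
          simp only [hsk]; split_ifs
          · rw [B.koszul_apply d (hfy j j.2)]
          · rw [one_smul]
        rw [this, comp_cons_smul, ← prod_range (fun j => if j < off i then sgn k (d * e j) else 1),
          mul_sum, sgn_sum, Finset.prod_ite, prod_const_one, mul_one]
        congr 2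
        ext j
        have := hlow i hi'
        simp; omega
      rw [h1, smul_smul, ← sgn_add]
      congr 1
      have h2 : ∑ l ∈ range n, (if l = i then δ l + d else δ l) * ∑ j ∈ range (off l), e j =
          E + d * ∑ j ∈ range (off i), e j := by
        rw [hE, ← sum_erase_add _ _ hi, ← sum_erase_add (a := i) _ _ hi, if_pos rfl,
          sum_congr rfl (g := fun l => δ l * ∑ j ∈ range (off l), e j)]
        · ring
        · intro l hl; rw [if_neg (ne_of_mem_erase hl)]
      rw [h2]
      exact sgn_eq_of_even_sub ⟨d * ∑ j ∈ range (off i), e j, by ring⟩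
    · refine sum_congr rfl fun t ht => ?_
      have ht' := mem_range.1 ht
      rw [assoc0 _ _ _ e₀ δ _ (B.koszul_mem _ h₀.1) (fun j hj => hskm (i + 1) j (hx j hj))
        fun j hj => B.topSlot_mem (off i + t) j (hy j hj)]
      set D := ∑ l ∈ range n, if i < l then δ l else 0 with hD
      have h1 : B.assocRight n ps R off (B.koszul d x₀.1) (fun i => B.koszul d (x i).1)
          (ss (off i + t) y) = sgn k (d * D) •
            B.assocRight n ps R off (B.koszul d x₀.1) (sk (i + 1) x) (ss (off i + t) y) := by
        unfold assocRight
        have : (fun j : Fin n => B.koszul d (x j).1) =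
            fun j : Fin n => (if i < (j : ℕ) then sgn k (d * δ j) else 1) • sk (i + 1) x j := by
          funext j
          simp only [hsk]; split_ifs with h1 h2 h2
          · omega
          · rw [B.koszul_apply d (hfx j j.2)]
          · rw [one_smul]
          · omega
        rw [this, comp_cons_smul, comp_cons_smul_bottom,
          ← prod_range (fun j => if i < j then sgn k (d * δ j) else 1), hD, mul_sum,
          sgn_sum]
        congr 1
        refine prod_congr rfl fun j _ => ?_
        split_ifs <;> simp
      rw [h1, smul_smul, ← sgn_add]
      congr 2
      rw [hE, hD, mul_sum, ← sum_add_distrib]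
      refine sum_congr rfl fun l hl => ?_
      by_cases hil : i < l
      · have hmem : off i + t ∈ range (off l) := by
          rw [mem_range]
          have := off_mono hoff (Nat.add_one_le_iff.2 hil); have := off_succ hoff i; omega
        rw [if_pos hil, ← sum_erase_add _ _ hmem,
          ← sum_erase_add (a := off i + t) (range (off l)) e hmem, if_pos rfl,
          sum_congr rfl (g := e)]
        · ring
        · intro j hj; rw [if_neg (ne_of_mem_erase hj)]
      · have hmem : ∀ j ∈ range (off l), j ≠ off i + t := by
          intro j hj
          have := off_mono hoff (not_lt.1 hil); have := mem_range.1 hj; omega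
        rw [if_neg hil, mul_zero, add_zero]
        congr 1
        exact sum_congr rfl fun j hj => by rw [if_neg (hmem j hj)]

/-- The dg box operad `B ⊕ ε B` for a square-zero parameter `ε` of degree `-d`. -/
def ext (d : ℤ) : DgBoxOperad k (V × V) where
  toDgModule := B.toDgModule.ext d
  comp := B.extComp d
  one := (B.one, 0)
  comp_mem n ps p r q e x h0 hx := by
    have hslot : ∀ i, B.comp n ps (fun j => B.slot d i j (x j)) ∈
        B.piece (p + ps 0, ∑ i, q i, r + ps (Fin.last n)) (∑ i, e i + d) := by
      intro i
      have := B.comp_mem n ps p r q (fun j => if j = i then e j + d else e j)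
        (fun j => B.slot d i j (x j)) (B.slot_mem i 0 h0) fun j => B.slot_mem i _ (hx j)
      rwa [← sum_erase_add _ _ (mem_univ i), if_pos rfl,
        sum_congr rfl (g := e), ← add_assoc, sum_erase_add _ _ (mem_univ i)] at this
      intro j hj; rw [if_neg (ne_of_mem_erase hj)]
    refine ⟨B.comp_mem n ps p r q e _ h0.1 fun i => (hx i).1, ?_⟩
    rw [extComp_snd]
    exact Submodule.sum_mem _ fun i _ => hslot i
  comp_bottom_zero n ps x p q r e h0 hq := by
    refine Prod.ext ?_ ?_
    · exact B.comp_bottom_zero n ps _ p q r e h0.1 hq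
    · rw [extComp_snd]
      exact sum_eq_zero fun i _ => B.comp_bottom_zero n ps _ p q r _ (B.slot_mem i 0 h0) hq
  comp_top_zero n ps x i p q r e hx hpr := by
    refine Prod.ext ?_ ?_
    · exact B.comp_top_zero n ps _ i p q r e hx.1 hpr
    · rw [extComp_snd]
      exact sum_eq_zero fun j _ => B.comp_top_zero n ps _ i p q r _ (B.slot_mem j _ hx) hpr
  one_mem := ⟨B.one_mem, zero_mem _⟩
  d_one := by simp [DgModule.ext_d_apply, B.d_one]
  d_comp := B.ext_d_comp d
  assoc := B.ext_assoc d
  comp_one p n r e x hx := by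
    refine Prod.ext ?_ ?_
    · rw [extComp_cons_fst]; exact B.comp_one p n r e _ hx.1
    · rw [extComp_cons_snd, B.comp_one p n r _ _ hx.2, sum_eq_zero, add_zero]
      intro i hi
      exact (B.comp n _).map_coord_zero (Fin.succ ⟨i, mem_range.1 hi⟩)
        (B.topSlot_self (d := d) i (B.one, 0))
  one_comp p q r e x hx := by
    rw [vec_two_eq_cons (B.one, 0) x]
    refine Prod.ext ?_ ?_
    · rw [extComp_cons_fst, ← vec_two_eq_cons]; exact B.one_comp p q r e _ hx.1
    · rw [extComp_cons_snd, sum_range_one,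
        (B.comp 1 _).map_coord_zero (m := cons (0 : V) _) 0 rfl, zero_add, koszul_one]
      have : (fun j : Fin 1 => B.topSlot d 0 j x) = fun _ => x.2 := by
        funext j; obtain rfl := Fin.fin_one_eq_zero j; exact B.topSlot_self 0 x
      rw [this, ← vec_two_eq_cons]; exact B.one_comp p q r _ _ hx.2

lemma ext_comp_cons_fst (d : ℤ) (n : ℕ) (ps : Fin (n + 1) → ℕ) (a : V × V) (w : Fin n → V × V) :
    ((B.ext d).comp n ps (cons a w)).1 = B.comp n ps (cons a.1 fun j => (w j).1) :=
  B.extComp_cons_fst d n ps a w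

lemma ext_comp_cons_snd (d : ℤ) (n : ℕ) (ps : Fin (n + 1) → ℕ) (a : V × V) (w : Fin n → V × V) :
    ((B.ext d).comp n ps (cons a w)).2 = B.comp n ps (cons a.2 fun j => (w j).1) + ∑ i ∈ range n,
        B.comp n ps (cons (B.koszul d a.1) fun j => B.topSlot d i j (w j)) :=
  B.extComp_cons_snd d n ps a w

end DgBoxOperad

lemma exists_block {m off : ℕ → ℕ} (hoff : ∀ i, off i = ∑ t ∈ range i, m t) {n j : ℕ}
    (hj : j < off n) : ∃ i < n, ∃ t < m i, j = off i + t := by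
  induction n with
  | zero => simp [hoff 0] at hj
  | succ n ih =>
    by_cases h : j < off n
    · obtain ⟨i, hi, h⟩ := ih h
      exact ⟨i, hi.trans (Nat.lt_succ_self n), h⟩
    · rw [off_succ hoff] at hj
      exact ⟨n, Nat.lt_succ_self n, j - off n, by omega, by omega⟩

lemma block_unique {m off : ℕ → ℕ} (hoff : ∀ i, off i = ∑ t ∈ range i, m t)
    {i i' t t' : ℕ} (ht : t < m i) (ht' : t' < m i') (h : off i + t = off i' + t') : i = i' := by
  rcases lt_trichotomy i i' with hl | rfl | hl
  · have := off_mono hoff (Nat.add_one_le_iff.2 hl); have := off_succ hoff i; omega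
  · rfl
  · have := off_mono hoff (Nat.add_one_le_iff.2 hl); have := off_succ hoff i'; omega

namespace DgBoxOperad

variable (B : DgBoxOperad k V)

/-- Composition as a linear map in the bottom argument. -/
def compBottom (n : ℕ) (ps : Fin (n + 1) → ℕ) (w : Fin n → V) : V →ₗ[k] V :=
  (B.comp n ps).toLinearMap (cons 0 w) 0

lemma compBottom_apply (n : ℕ) (ps : Fin (n + 1) → ℕ) (w : Fin n → V) (z : V) :
    B.compBottom n ps w z = B.comp n ps (cons z w) := by
  simp [compBottom, update_cons_zero]

lemma comp_cons_zero (n : ℕ) (ps : Fin (n + 1) → ℕ) (w : Fin n → V) :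
    B.comp n ps (cons 0 w) = 0 := (B.comp n ps).map_coord_zero 0 rfl

lemma assoc_homogeneous (n : ℕ) (m ps R off : ℕ → ℕ) (x₀ : V) (x y : ℕ → V)
    (α β : ℕ → Colour) (δ e : ℕ → ℤ) (hoff : ∀ i, off i = ∑ t ∈ range i, m t)
    (hx : ∀ i < n, x i ∈ B.piece (α i) (δ i)) (hα : ∀ i < n, (α i).2.1 = m i)
    (hy : ∀ j < off n, y j ∈ B.piece (β j) (e j)) :
    B.assocLeft n m ps R off x₀ x y = sgn k (∑ i ∈ range n, δ i * ∑ j ∈ range (off i), e j) •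
        B.assocRight n ps R off x₀ x y := by
  let A : V →ₗ[k] V := B.compBottom n (fun i => ps i + R (off i)) fun i : Fin n =>
    B.comp (m i) (fun j => R (off i + j)) (cons (x i) fun j : Fin (m i) => y (off i + j))
  let A' : V →ₗ[k] V := sgn k (∑ i ∈ range n, δ i * ∑ j ∈ range (off i), e j) •
    (B.compBottom (off n) (fun j => R j) (fun j : Fin (off n) => y j) ∘ₗ
      B.compBottom n (fun i => ps i) fun i : Fin n => x i)
  have hA : ∀ z, A z = B.assocLeft n m ps R off z x y := fun z => by
    simp only [A, compBottom_apply]; rfl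
  have hA' : ∀ z, A' z = sgn k (∑ i ∈ range n, δ i * ∑ j ∈ range (off i), e j) •
      B.assocRight n ps R off z x y := fun z => by
    simp only [A', LinearMap.smul_apply, comp_apply, compBottom_apply]; rfl
  suffices h : A = A' by rw [← hA, ← hA', h]
  refine B.linear_ext fun γ e₀ z hz => ?_
  rw [hA, hA']
  by_cases hq : γ.2.1 = n
  swap
  · have h1 : B.assocLeft n m ps R off z x y = 0 := B.comp_bottom_zero n _ _ _ _ _ e₀ hz hq
    have h2 : B.assocRight n ps R off z x y = 0 := by
      unfold assocRight
      rw [B.comp_bottom_zero n _ (cons z fun i : Fin n => x i) _ _ _ e₀ hz hq, comp_cons_zero]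
    rw [h1, h2, smul_zero]
  by_cases hm : ∀ j < off n, (β j).1 = R j ∧ (β j).2.2 = R (j + 1)
  swap
  · push Not at hm
    obtain ⟨j, hj, hm⟩ := hm
    have hm' : (β j).1 ≠ R j ∨ (β j).2.2 ≠ R (j + 1) := by tauto
    have h2 : B.assocRight n ps R off z x y = 0 :=
      B.comp_top_zero (off n) _ _ ⟨j, hj⟩ _ _ _ (e j) (hy j hj) hm'
    obtain ⟨i, hi, t, ht, rfl⟩ := exists_block hoff hj
    have h1 : B.assocLeft n m ps R off z x y = 0 :=
      (B.comp n _).map_coord_zero (Fin.succ ⟨i, hi⟩)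
        (B.comp_top_zero (m i) _ _ ⟨t, ht⟩ _ _ _ (e _) (hy _ hj) hm')
    rw [h1, h2, smul_zero]
  have hy' : ∀ j < off n, y j ∈ B.piece (R j, (β j).2.1, R (j + 1)) (e j) := fun j hj => by
    have := hy j hj; rwa [show β j = (R j, (β j).2.1, R (j + 1)) from
      Prod.ext (hm j hj).1 (Prod.ext rfl (hm j hj).2)] at this
  have hx' : ∀ i < n, x i ∈ B.piece ((α i).1, m i, (α i).2.2) (δ i) := fun i hi => by
    have := hx i hi; rwa [show α i = ((α i).1, m i, (α i).2.2) from
      Prod.ext rfl (Prod.ext (hα i hi) rfl)] at this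
  by_cases hp : ∀ i < n, (α i).1 = ps i ∧ (α i).2.2 = ps (i + 1)
  · refine B.assoc n m ps R off γ.1 γ.2.2 (fun j => (β j).2.1) e₀ δ e z x y hoff ?_ ?_ hy'
    · have : γ = (γ.1, n, γ.2.2) := Prod.ext rfl (Prod.ext hq rfl)
      rwa [← this]
    · intro i hi
      have := hx' i hi
      rwa [(hp i hi).1, (hp i hi).2] at this
  · push Not at hp
    obtain ⟨i, hi, hp⟩ := hp
    have hp' : (α i).1 ≠ ps i ∨ (α i).2.2 ≠ ps (i + 1) := by tauto
    have h2 : B.assocRight n ps R off z x y = 0 := by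
      unfold assocRight
      rw [B.comp_top_zero n _ _ ⟨i, hi⟩ _ _ _ (δ i) (hx' i hi) hp', comp_cons_zero]
    have h1 : B.assocLeft n m ps R off z x y = 0 := by
      have hin := B.comp_mem (m i) (fun j => R (off i + j)) (α i).1 (α i).2.2
        (fun j => (β (off i + j)).2.1) (cons (δ i) fun j => e (off i + j))
        (cons (x i) fun j : Fin (m i) => y (off i + j)) (hx' i hi) fun j => by
          have hj : off i + (j : ℕ) < off n := lt_of_lt_of_le
            (by have := j.2; have := off_succ hoff i; omega) (off_mono hoff (Nat.add_one_le_iff.2 hi))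
          exact hy' _ hj
      refine B.comp_top_zero n _ _ ⟨i, hi⟩ _ _ _ _ hin ?_
      simp only [Fin.val_zero, Fin.val_last, Fin.castSucc_mk, Fin.succ_mk, off_succ hoff, add_zero]
      omega
    rw [h1, h2, smul_zero]

end DgBoxOperad

section Conv

variable (C : DgBoxCooperad k U) (B : DgBoxOperad k V)

/-- The composite of a decomposition of `C`, linear maps on the factors and a composition of `B`. -/
def conv (n : ℕ) (ps : Fin (n + 1) → ℕ) :
    MultilinearMap k (fun _ : Fin (n + 1) => U →ₗ[k] V) (U →ₗ[k] V) :=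
  ((LinearMap.lcomp k V (C.decomp n ps)) ∘ₗ
    (PiTensorProduct.lift (R := k) (s := fun _ : Fin (n + 1) => U) (E := V)).toLinearMap).compMultilinearMap
      (MultilinearMap.piLinearMap (B.comp n ps))

lemma conv_apply (n : ℕ) (ps : Fin (n + 1) → ℕ) (f : Fin (n + 1) → U →ₗ[k] V) : conv C B n ps f =
      PiTensorProduct.lift ((B.comp n ps).compLinearMap f) ∘ₗ C.decomp n ps := rfl

/-- Operators on linear maps whose values at a point depend on finitely many values only. -/
def Local {V' : Type*} [AddCommGroup V'] [Module k V'] (O : (U →ₗ[k] V) →ₗ[k] (U →ₗ[k] V')) : Prop :=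
  ∀ c, ∃ s : Finset U, ∀ f : U →ₗ[k] V, (∀ u ∈ s, f u = 0) → O f c = 0

lemma Local.comp {V' V'' : Type*} [AddCommGroup V'] [Module k V'] [AddCommGroup V''] [Module k V'']
    {O : (U →ₗ[k] V') →ₗ[k] (U →ₗ[k] V'')}
    {O' : (U →ₗ[k] V) →ₗ[k] (U →ₗ[k] V')} (h : Local O) (h' : Local O') : Local (O ∘ₗ O') := by
  classical
  intro c
  obtain ⟨s, hs⟩ := h c
  choose t ht using h'
  refine ⟨s.biUnion t, fun f hf => hs _ fun u hu => ht u f fun v hv => hf v ?_⟩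
  exact mem_biUnion.2 ⟨u, hu, hv⟩

lemma tensor_local {n : ℕ} (t : ⨂[k] _ : Fin n, U) :
    ∃ s : Finset U, ∀ (μ : MultilinearMap k (fun _ : Fin n => V) V) (f g : Fin n → U →ₗ[k] V),
      (∀ i, ∀ u ∈ s, f i u = g i u) →
      PiTensorProduct.lift (μ.compLinearMap f) t = PiTensorProduct.lift (μ.compLinearMap g) t := by
  classical
  induction t using PiTensorProduct.induction_on with
  | smul_tprod r x =>
    refine ⟨univ.image x, fun μ f g h => ?_⟩
    simp only [map_smul, PiTensorProduct.lift.tprod, compLinearMap_apply]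
    congr 2
    funext i
    exact h i _ (Finset.mem_image_of_mem _ (mem_univ i))
  | add x y hx hy =>
    obtain ⟨s, hs⟩ := hx
    obtain ⟨t, ht⟩ := hy
    refine ⟨s ∪ t, fun μ f g h => ?_⟩
    rw [map_add, map_add, hs μ f g fun i u hu => h i u (Finset.mem_union_left _ hu),
      ht μ f g fun i u hu => h i u (Finset.mem_union_right _ hu)]

lemma conv_local (n : ℕ) (ps : Fin (n + 1) → ℕ) (c : U) :
    ∃ s : Finset U, ∀ f g : Fin (n + 1) → U →ₗ[k] V, (∀ i, ∀ u ∈ s, f i u = g i u) →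
      conv C B n ps f c = conv C B n ps g c := by
  obtain ⟨s, hs⟩ := tensor_local (V := V) (C.decomp n ps c)
  exact ⟨s, fun f g h => hs _ f g h⟩

lemma local_conv (n : ℕ) (ps : Fin (n + 1) → ℕ) (f : Fin (n + 1) → U →ₗ[k] V) (i : Fin (n + 1)) :
    Local ((conv C B n ps).toLinearMap f i) := by
  intro c
  obtain ⟨s, hs⟩ := conv_local C B n ps c
  refine ⟨s, fun g hg => ?_⟩
  have := hs (update f i g) (update f i 0) fun j u hu => by
    rcases eq_or_ne j i with rfl | h
    · simp [hg u hu]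
    · simp [h]
  rw [toLinearMap_apply, this, (conv C B n ps).map_coord_zero i (by simp)]
  rfl

/-- Two local operators agree at `w` if they agree on maps of rank one made from `w`. -/
lemma Local.ext_rankOne {V' : Type*} [AddCommGroup V'] [Module k V']
    {O O' : (U →ₗ[k] V) →ₗ[k] (U →ₗ[k] V')} (h : Local O) (h' : Local O')
    (M : DgModule k U) (w : U →ₗ[k] V) (hw : ∀ a : M.HIndex, w (M.hbasis a) ≠ 0 →
      O ((M.hbasis.coord a).smulRight (w (M.hbasis a))) =
        O' ((M.hbasis.coord a).smulRight (w (M.hbasis a)))) : O w = O' w := by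
  classical
  ext c
  obtain ⟨s, hs⟩ := h c
  obtain ⟨t, ht⟩ := h' c
  let K : Finset M.HIndex := (s ∪ t).biUnion fun u => (M.hbasis.repr u).support
  let g : U →ₗ[k] V := ∑ a ∈ K, (M.hbasis.coord a).smulRight (w (M.hbasis a))
  have hg : ∀ u ∈ s ∪ t, g u = w u := by
    intro u hu
    have h1 : (M.hbasis.repr u).support ⊆ K := subset_biUnion_of_mem
      (fun u => (M.hbasis.repr u).support) hu
    conv_rhs => rw [← M.hbasis.linearCombination_repr u, Finsupp.linearCombination_apply,
      Finsupp.sum_of_support_subset _ h1 _ (by simp), map_sum]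
    simp [g, LinearMap.sum_apply]
  have e1 : O w c = O g c := by
    have := hs (w - g) fun u hu => by simp [hg u (Finset.mem_union_left _ hu)]
    rwa [map_sub, LinearMap.sub_apply, sub_eq_zero] at this
  have e2 : O' w c = O' g c := by
    have := ht (w - g) fun u hu => by simp [hg u (Finset.mem_union_right _ hu)]
    rwa [map_sub, LinearMap.sub_apply, sub_eq_zero] at this
  rw [e1, e2]
  simp only [g, map_sum]
  refine LinearMap.congr_fun (sum_congr rfl fun a _ => ?_) c
  by_cases h0 : w (M.hbasis a) = 0
  · rw [h0]; simp
  · exact hw a h0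

lemma conv_rankOne (n : ℕ) (ps : Fin (n + 1) → ℕ) (φ₀ : U →ₗ[k] k) (φ : Fin n → U →ₗ[k] k)
    (v₀ : V) (v : Fin n → V) :
    conv C B n ps (cons (φ₀.smulRight v₀) fun i => (φ i).smulRight (v i)) =
      (dualComp (C.decomp n ps) φ₀ φ).smulRight (B.comp n ps (cons v₀ v)) := by
  have hl : PiTensorProduct.lift ((B.comp n ps).compLinearMap
      (cons (φ₀.smulRight v₀) fun i => (φ i).smulRight (v i) : Fin (n + 1) → U →ₗ[k] V)) =
      (PiTensorProduct.lift ((mkPiAlgebra k (Fin (n + 1)) k).compLinearMap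
        (cons (α := fun _ => U →ₗ[k] k) φ₀ φ))).smulRight (B.comp n ps (cons v₀ v)) := by
    refine PiTensorProduct.ext (MultilinearMap.ext fun x => ?_)
    simp only [compMultilinearMap_apply, PiTensorProduct.lift.tprod,
      compLinearMap_apply, smulRight_apply, mkPiAlgebra_apply]
    rw [← map_smul_univ]
    refine congrArg _ (funext fun i => ?_)
    refine Fin.cases ?_ (fun i => ?_) i <;> simp
  rw [conv_apply, hl]
  rfl

/-- Even maps: they preserve colours and degrees. -/
def IsEven (w : U →ₗ[k] V) : Prop := ∀ α e, ∀ x ∈ C.piece α e, w x ∈ B.piece α e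

variable {C B}

lemma IsEven.rankOne {w : U →ₗ[k] V} (h : IsEven C B w) (a : C.HIndex) :
    IsEven C B ((C.hbasis.coord a).smulRight (w (C.hbasis a))) := fun α e u hu => by
  rw [smulRight_apply]
  by_cases hae : (α, e) = a.1
  · have := h _ _ _ (C.hbasis_mem a)
    rw [← hae] at this
    exact Submodule.smul_mem _ _ this
  · rw [show C.hbasis.coord a u = 0 from C.hbasis_repr_of_ne a hu hae, zero_smul]
    exact zero_mem _

lemma conv_assoc (n : ℕ) (m ps R off : ℕ → ℕ) (X : U →ₗ[k] V) (x y : ℕ → U →ₗ[k] V)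
    (hoff : ∀ i, off i = ∑ t ∈ range i, m t)
    (hx : ∀ i < n, IsEven C B (x i))
    (hq : ∀ i < n, ∀ α e, ∀ u ∈ C.piece α e, α.2.1 ≠ m i → x i u = 0)
    (hy : ∀ j < off n, IsEven C B (y j)) :
    conv C B n (fun i => ps i + R (off i)) (cons X fun i : Fin n =>
        conv C B (m i) (fun j => R (off i + j)) (cons (x i) fun j : Fin (m i) => y (off i + j))) =
      conv C B (off n) (fun j => R j)
        (cons (conv C B n (fun i => ps i) (cons X fun i : Fin n => x i))
          fun j : Fin (off n) => y j) := by
  classical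
  let b := C.hbasis
  let Rk : (U →ₗ[k] V) → C.HIndex → Prop := fun w a => ∃ v ∈ B.piece a.1.1 a.1.2,
    w = (b.coord a).smulRight v
  let row : (ℕ → U →ₗ[k] V) → (ℕ → U →ₗ[k] V) → Fin n → U →ₗ[k] V := fun x y i =>
    conv C B (m i) (fun j => R (off i + j)) (cons (x i) fun j : Fin (m i) => y (off i + j))
  let A : (U →ₗ[k] V) → (ℕ → U →ₗ[k] V) → (ℕ → U →ₗ[k] V) → Prop := fun X x y =>
    conv C B n (fun i => ps i + R (off i)) (cons X (row x y)) = conv C B (off n) (fun j => R j)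
        (cons (conv C B n (fun i => ps i) (cons X fun i : Fin n => x i)) fun j : Fin (off n) => y j)
  have base : ∀ (φ₀ : U →ₗ[k] k) (v₀ : V) (x y : ℕ → U →ₗ[k] V),
      (∀ i < n, ∃ a : C.HIndex, a.1.1.2.1 = m i ∧ Rk (x i) a) → (∀ j < off n, ∃ a, Rk (y j) a) →
      A (φ₀.smulRight v₀) x y := by
    intro φ₀ v₀ x y hx hy
    rcases isEmpty_or_nonempty C.HIndex with hemp | ⟨⟨a₀⟩⟩
    · have : Subsingleton U := b.repr.toEquiv.subsingleton
      exact LinearMap.ext fun c => by rw [Subsingleton.elim c 0, map_zero, map_zero]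
    have : Inhabited C.HIndex := ⟨a₀⟩
    choose! a ha v hv hxv using hx
    choose! a' v' hv' hyv using hy
    have hcol : ∀ (a : C.HIndex) (α : Colour) (e : ℤ), ∀ u ∈ C.piece α e, (α, e) ≠ a.1 →
        b.coord a u = 0 := fun a α e u hu h => C.hbasis_repr_of_ne a hu h
    have hin : row x y = fun i : Fin n =>
        (dualComp (C.decomp (m i) fun j => R (off i + j)) (b.coord (a i))
          fun j : Fin (m i) => b.coord (a' (off i + j))).smulRight
          (B.comp (m i) (fun j => R (off i + j))
            (cons (v i) fun j : Fin (m i) => v' (off i + j))) := by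
      funext i
      rw [← conv_rankOne]
      change conv C B _ _ _ = _
      rw [hxv i i.2]
      congr 2
      funext j
      refine hyv _ (lt_of_lt_of_le ?_ (off_mono hoff (Nat.add_one_le_iff.2 i.2)))
      have := j.2; have := off_succ hoff i; omega
    have hbot : conv C B n (fun i => ps i) (cons (φ₀.smulRight v₀) fun i : Fin n => x i) =
        (dualComp (C.decomp n fun i => ps i) φ₀ fun i : Fin n => b.coord (a i)).smulRight
          (B.comp n (fun i => ps i) (cons v₀ fun i : Fin n => v i)) := by
      rw [← conv_rankOne]
      congr 2
      funext i; exact hxv i i.2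
    have htop : (fun j : Fin (off n) => y j) = fun j : Fin (off n) =>
        (b.coord (a' j)).smulRight (v' j) := funext fun j => hyv j j.2
    change _ = _
    rw [hin, hbot, htop, conv_rankOne, conv_rankOne]
    have hco := C.coassoc n m ps R off (fun i => (a i).1.2) (fun j => (a' j).1.2) φ₀
      (fun i => b.coord (a i)) (fun j => b.coord (a' j)) hoff
      (fun i hi p q r e' u hu h => hcol _ _ _ u hu fun h' => by
        have h1 := congrArg (fun z => z.1.2.1) h'; have h2 := congrArg Prod.snd h'
        simp only [ha i hi] at h1 h2
        tauto)
      (fun j hj α e' u hu h => hcol _ _ _ u hu fun h' => h (congrArg Prod.snd h'))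
    have has := B.assoc_homogeneous n m ps R off v₀ v v' (fun i => (a i).1.1) (fun j => (a' j).1.1)
      (fun i => (a i).1.2) (fun j => (a' j).1.2) hoff hv ha hv'
    unfold DgBoxOperad.assocLeft DgBoxOperad.assocRight at has
    rw [hco, has]
    ext c
    simp only [smulRight_apply, LinearMap.smul_apply, smul_smul, smul_eq_mul]
    rw [mul_right_comm, sgn_mul_self, one_mul]
  have baseX : ∀ (x y : ℕ → U →ₗ[k] V), (∀ i < n, ∃ a : C.HIndex, a.1.1.2.1 = m i ∧ Rk (x i) a) →
      (∀ j < off n, ∃ a, Rk (y j) a) → A X x y := by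
    intro x y hx hy
    have h := Local.ext_rankOne (M := C) (w := X)
      (local_conv C B n (fun i => ps i + R (off i)) (cons 0 (row x y)) 0)
      ((local_conv C B (off n) (fun j => R j) (cons 0 fun j : Fin (off n) => y j) 0).comp
        (local_conv C B n (fun i => ps i) (cons 0 fun i : Fin n => x i) 0))
    simp only [comp_apply, toLinearMap_apply, update_cons_zero] at h
    exact h fun a _ => base _ _ x y hx hy
  have stepx : ∀ l ≤ n, ∀ (x y : ℕ → U →ₗ[k] V), (∀ i < n, IsEven C B (x i)) →
      (∀ i < n, ∀ α e, ∀ u ∈ C.piece α e, α.2.1 ≠ m i → x i u = 0) →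
      (∀ i < n, l ≤ i → ∃ a : C.HIndex, a.1.1.2.1 = m i ∧ Rk (x i) a) →
      (∀ j < off n, ∃ a, Rk (y j) a) → A X x y := by
    intro l
    induction l with
    | zero => intro _ x y _ _ h hy; exact baseX x y (fun i hi => h i hi (Nat.zero_le i)) hy
    | succ l ih =>
      intro hl x y he hq hr hy
      have hl' : l < n := hl
      have key : ∀ f : U →ₗ[k] V, row (update x l f) y =
          update (row x y) ⟨l, hl'⟩ (conv C B (m l) (fun j => R (off l + j))
              (cons f fun j : Fin (m l) => y (off l + j))) := by
        intro f; funext i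
        rcases eq_or_ne i ⟨l, hl'⟩ with rfl | h
        · simp [row]
        · rw [update_of_ne h]
          simp only [row, update_of_ne (fun h' => h (Fin.ext h'))]
      have key' : ∀ f : U →ₗ[k] V, (fun i : Fin n => update x l f i) =
          update (fun i : Fin n => x i) ⟨l, hl'⟩ f :=
        Function.update_comp_eq_of_injective x Fin.val_injective ⟨l, hl'⟩
      have h := Local.ext_rankOne (M := C) (w := x l)
        ((local_conv C B n (fun i => ps i + R (off i)) (cons X (row x y)) (Fin.succ ⟨l, hl'⟩)).comp
          (local_conv C B (m l) (fun j => R (off l + j))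
            (cons 0 fun j : Fin (m l) => y (off l + j)) 0))
        ((local_conv C B (off n) (fun j => R j) (cons 0 fun j : Fin (off n) => y j) 0).comp
          (local_conv C B n (fun i => ps i) (cons X fun i : Fin n => x i) (Fin.succ ⟨l, hl'⟩)))
      simp only [comp_apply, toLinearMap_apply, update_cons_zero,
        ← cons_update, ← key, ← key', Function.update_eq_self] at h
      refine h fun a ha => ?_
      have hal : a.1.1.2.1 = m l := by
        by_contra hne; exact ha (hq l hl' _ _ _ (C.hbasis_mem a) hne)
      refine ih hl'.le (update x l _) y ?_ ?_ ?_ hy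
      · intro i hi
        rcases eq_or_ne i l with rfl | h
        · rw [update_self]; exact (he i hi).rankOne a
        · rw [update_of_ne h]; exact he i hi
      · intro i hi α e u hu hne
        rcases eq_or_ne i l with rfl | h
        · rw [update_self, smulRight_apply]
          have : C.hbasis.coord a u = 0 := C.hbasis_repr_of_ne a hu
            fun h => hne (by rw [← hal, ← h])
          rw [this, zero_smul]
        · rw [update_of_ne h]; exact hq i hi α e u hu hne
      · intro i hi hli
        rcases eq_or_ne i l with rfl | h
        · rw [update_self]; exact ⟨a, hal, _, he i hi _ _ _ (C.hbasis_mem a), rfl⟩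
        · rw [update_of_ne h]; exact hr i hi (by omega)
  have stepy : ∀ l ≤ off n, ∀ y : ℕ → U →ₗ[k] V, (∀ j < off n, IsEven C B (y j)) →
      (∀ j < off n, l ≤ j → ∃ a, Rk (y j) a) → A X x y := by
    intro l
    induction l with
    | zero =>
      intro _ y _ h
      exact stepx n le_rfl x y hx hq (fun i hi hi' => absurd hi hi'.not_gt)
        fun j hj => h j hj (Nat.zero_le j)
    | succ l ih =>
      intro hl y he hr
      have hl' : l < off n := hl
      obtain ⟨i₀, hi₀, t, ht, hlt⟩ := exists_block hoff hl'
      have key : ∀ f : U →ₗ[k] V, row x (update y l f) =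
          update (row x y) ⟨i₀, hi₀⟩ (conv C B (m i₀) (fun j => R (off i₀ + j))
              (cons (x i₀) (update (fun j : Fin (m i₀) => y (off i₀ + j)) ⟨t, ht⟩ f))) := by
        intro f; funext i
        rcases eq_or_ne i ⟨i₀, hi₀⟩ with rfl | h
        · rw [update_self, hlt]
          exact congrArg (fun z => conv C B _ _ (cons (x i₀) z))
            (Function.update_comp_eq_of_injective y (f := fun j : Fin (m i₀) => off i₀ + j.val)
              (fun _ _ h => Fin.ext (Nat.add_left_cancel h)) ⟨t, ht⟩ f)
        · rw [update_of_ne h]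
          refine congrArg (fun z => conv C B _ _ (cons (x i) z)) (funext fun j => ?_)
          rw [update_of_ne]
          intro h'
          exact h (Fin.ext (block_unique hoff j.2 ht (h'.trans hlt)))
      have key' : ∀ f : U →ₗ[k] V, (fun j : Fin (off n) => update y l f j) =
          update (fun j : Fin (off n) => y j) ⟨l, hl'⟩ f :=
        Function.update_comp_eq_of_injective y Fin.val_injective ⟨l, hl'⟩
      have h := Local.ext_rankOne (M := C) (w := y l)
        ((local_conv C B n (fun i => ps i + R (off i)) (cons X (row x y)) (Fin.succ ⟨i₀, hi₀⟩)).comp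
          (local_conv C B (m i₀) (fun j => R (off i₀ + j))
            (cons (x i₀) fun j : Fin (m i₀) => y (off i₀ + j)) (Fin.succ ⟨t, ht⟩)))
        (local_conv C B (off n) (fun j => R j)
          (cons (conv C B n (fun i => ps i) (cons X fun i : Fin n => x i))
            fun j : Fin (off n) => y j) (Fin.succ ⟨l, hl'⟩))
      simp only [comp_apply, toLinearMap_apply,
        ← cons_update, ← key, ← key', Function.update_eq_self] at h
      refine h fun a ha => ih hl'.le (update y l _) ?_ ?_
      · intro i hi
        rcases eq_or_ne i l with rfl | h
        · rw [update_self]; exact (he i hi).rankOne a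
        · rw [update_of_ne h]; exact he i hi
      · intro i hi hli
        rcases eq_or_ne i l with rfl | h
        · rw [update_self]; exact ⟨a, _, he i hi _ _ _ (C.hbasis_mem a), rfl⟩
        · rw [update_of_ne h]; exact hr i hi (by omega)
  exact stepy (off n) le_rfl y hy fun j hj hj' => absurd hj hj'.not_gt

end Conv

section LocallyFinite

variable {V' V'' : Type*} [AddCommGroup V'] [Module k V'] [AddCommGroup V''] [Module k V''] {I J : Type*}

/-- The family `F` is finite at every point and its sum is `f`. -/
def HasLSum (F : I → U →ₗ[k] V) (f : U →ₗ[k] V) : Prop :=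
  ∀ c, ∃ s : Finset I, (∀ i ∉ s, F i c = 0) ∧ ∑ i ∈ s, F i c = f c

lemma hasLSum_iff (F : I → U →ₗ[k] V) (f : U →ₗ[k] V) : letI : TopologicalSpace V := ⊥
    HasLSum F f ↔ ∀ c, HasSum (fun i => F i c) (f c) := by
  let _ : TopologicalSpace V := ⊥
  have : DiscreteTopology V := ⟨rfl⟩
  refine forall_congr' fun c => ⟨?_, fun h => ?_⟩
  · rintro ⟨s, hs, hs'⟩
    rw [← hs']
    exact hasSum_sum_of_ne_finset_zero hs
  · have h1 : ∀ᶠ s : Finset I in Filter.atTop, ∑ i ∈ s, F i c = f c := by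
      have := h.eventually (show ∀ᶠ z in nhds (f c), z = f c by rw [nhds_discrete]; rfl)
      simpa using this
    obtain ⟨s, hs⟩ := Filter.eventually_atTop.1 h1
    refine ⟨s, fun i hi => ?_, hs s le_rfl⟩
    classical
    have h2 := hs (insert i s) (Finset.subset_insert i s)
    rw [Finset.sum_insert hi, hs s le_rfl] at h2
    simpa using h2

namespace HasLSum

variable {F G : I → U →ₗ[k] V} {f g : U →ₗ[k] V}

lemma unique (h : HasLSum F f) (h' : HasLSum F g) : f = g := by
  let _ : TopologicalSpace V := ⊥
  have : DiscreteTopology V := ⟨rfl⟩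
  exact LinearMap.ext fun c => ((hasLSum_iff F f).1 h c).unique ((hasLSum_iff F g).1 h' c)

lemma add (h : HasLSum F f) (h' : HasLSum G g) : HasLSum (fun i => F i + G i) (f + g) := by
  let _ : TopologicalSpace V := ⊥
  have : DiscreteTopology V := ⟨rfl⟩
  exact (hasLSum_iff _ _).2 fun c => ((hasLSum_iff F f).1 h c).add ((hasLSum_iff G g).1 h' c)

lemma zero : HasLSum (fun _ : I => (0 : U →ₗ[k] V)) 0 := fun _ => ⟨∅, by simp⟩

lemma congr (h : HasLSum F f) (hFG : ∀ i, F i = G i) : HasLSum G f := by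
  rwa [← funext hFG]

lemma map_left (h : HasLSum F f) (l : V →ₗ[k] V') : HasLSum (fun i => l ∘ₗ F i) (l ∘ₗ f) :=
  fun c => by
    obtain ⟨s, hs, hs'⟩ := h c
    refine ⟨s, fun i hi => by simp [hs i hi], ?_⟩
    rw [comp_apply, ← hs', map_sum]; rfl

lemma neg (h : HasLSum F f) : HasLSum (fun i => - F i) (-f) := by
  simpa using h.map_left (-LinearMap.id)

lemma smul (h : HasLSum F f) (a : k) : HasLSum (fun i => a • F i) (a • f) :=
  h.map_left (a • LinearMap.id)

lemma map_right {U' : Type*} [AddCommGroup U'] [Module k U'] (h : HasLSum F f) (l : U' →ₗ[k] U) :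
    HasLSum (fun i => F i ∘ₗ l) (f ∘ₗ l) := fun c => h (l c)

lemma ofFinset (s : Finset I) (hs : ∀ i ∉ s, F i = 0) : HasLSum F (∑ i ∈ s, F i) :=
  fun c => ⟨s, fun i hi => by rw [hs i hi]; rfl, by simp⟩

lemma single (i : I) (hi : ∀ j, j ≠ i → F j = 0) : HasLSum F (F i) := by
  have := ofFinset (F := F) {i} fun j hj => hi j (by simpa using hj)
  simpa using this

lemma fintype [Fintype I] : HasLSum F (∑ i, F i) := ofFinset _ (by simp)

lemma comp_injective {e : J → I} (he : Injective e) (hF : ∀ i ∉ Set.range e, F i = 0) :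
    HasLSum (fun j => F (e j)) f ↔ HasLSum F f := by
  let _ : TopologicalSpace V := ⊥
  have : DiscreteTopology V := ⟨rfl⟩
  rw [hasLSum_iff, hasLSum_iff]
  exact forall_congr' fun c => Injective.hasSum_iff (f := fun i => F i c) he
    fun i hi => by simp only [hF i hi, LinearMap.zero_apply]

lemma comp_equiv (e : J ≃ I) : HasLSum (fun j => F (e j)) f ↔ HasLSum F f :=
  comp_injective e.injective fun i hi => absurd ⟨e.symm i, by simp⟩ hi

lemma sigma {β : J → Type*} {F : (Σ j, β j) → U →ₗ[k] V} {G : J → U →ₗ[k] V}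
    (h : HasLSum F f) (hG : ∀ j, HasLSum (fun b => F ⟨j, b⟩) (G j)) : HasLSum G f := by
  let _ : TopologicalSpace V := ⊥
  have : DiscreteTopology V := ⟨rfl⟩
  rw [hasLSum_iff] at h ⊢
  exact fun c => (h c).sigma fun j => (hasLSum_iff _ _).1 (hG j) c

lemma prod_fiber {F : J × I → U →ₗ[k] V} {G : J → U →ₗ[k] V}
    (h : HasLSum F f) (hG : ∀ j, HasLSum (fun b => F ⟨j, b⟩) (G j)) : HasLSum G f := by
  let _ : TopologicalSpace V := ⊥
  have : DiscreteTopology V := ⟨rfl⟩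
  rw [hasLSum_iff] at h ⊢
  exact fun c => (h c).prod_fiberwise fun j => (hasLSum_iff _ _).1 (hG j) c

/-- Extension by zero from a subtype. -/
lemma subtype {p : I → Prop} :
    HasLSum (fun i : {i // p i} => F i) f → (∀ i, ¬ p i → F i = 0) → HasLSum F f := fun h h' =>
  (comp_injective (e := fun i : {i // p i} => (i : I)) Subtype.val_injective fun i hi =>
    h' i fun hp => hi ⟨⟨i, hp⟩, rfl⟩).1 h

lemma local_map {O : (U →ₗ[k] V) →ₗ[k] (U →ₗ[k] V')} (hO : Local O) (h : HasLSum F f) :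
    HasLSum (fun i => O (F i)) (O f) := by
  classical
  intro c
  obtain ⟨s, hs⟩ := hO c
  choose t ht ht' using h
  let T := s.biUnion t
  have hz : ∀ i ∉ T, ∀ u ∈ s, F i u = 0 := fun i hi u hu =>
    ht u i fun h => hi (mem_biUnion.2 ⟨u, hu, h⟩)
  refine ⟨T, fun i hi => hs _ (hz i hi), ?_⟩
  have h1 : O (f - ∑ i ∈ T, F i) c = 0 := hs _ fun u hu => by
    rw [LinearMap.sub_apply, ← ht' u, LinearMap.sum_apply, sub_eq_zero]
    exact sum_subset (subset_biUnion_of_mem t hu) fun i _ hi => ht u i hi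
  rw [map_sub, map_sum, LinearMap.sub_apply, LinearMap.sum_apply, sub_eq_zero] at h1
  exact h1.symm

lemma locallyFiniteSum_eq (h : HasLSum F f) : locallyFiniteSum F = f := by
  have hfin : ∀ c, (Function.support fun S => F S c).Finite := fun c => by
    obtain ⟨s, hs, -⟩ := h c
    exact s.finite_toSet.subset fun i hi => by
      by_contra h'; exact hi (hs i h')
  unfold locallyFiniteSum
  rw [dif_pos hfin]
  ext c
  obtain ⟨s, hs, hs'⟩ := h c
  rw [← hs']
  exact finsum_eq_sum_of_support_subset _ fun i hi => by
    by_contra h'; exact hi (hs i h')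

end HasLSum

lemma hasLSum_locallyFiniteSum {F : I → U →ₗ[k] V}
    (h : ∀ c, ∃ s : Finset I, ∀ i ∉ s, F i c = 0) : HasLSum F (locallyFiniteSum F) := by
  have hfin : ∀ c, (Function.support fun S => F S c).Finite := fun c => by
    obtain ⟨s, hs⟩ := h c
    exact s.finite_toSet.subset fun i hi => by
      by_contra h'; exact hi (hs i h')
  intro c
  obtain ⟨s, hs⟩ := h c
  refine ⟨s, hs, ?_⟩
  unfold locallyFiniteSum
  rw [dif_pos hfin]
  refine (finsum_eq_sum_of_support_subset _ fun i hi => ?_).symm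
  by_contra h'; exact hi (hs i h')

/-- Families of local operators which are, at every point, eventually zero. -/
structure LFO (E : I → (U →ₗ[k] V) →ₗ[k] (U →ₗ[k] V')) : Prop where
  loc : ∀ i, Local (E i)
  fin : ∀ c, ∃ s : Finset I, ∀ i ∉ s, ∀ X, E i X c = 0

open Classical in
/-- The sum of a locally finite family of operators. -/
def opSum (E : I → (U →ₗ[k] V) →ₗ[k] (U →ₗ[k] V')) : (U →ₗ[k] V) →ₗ[k] (U →ₗ[k] V') :=
  if h : LFO E then
    { toFun := fun X => locallyFiniteSum fun i => E i X
      map_add' := fun X Y => by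
        have hX : ∀ X, HasLSum (fun i => E i X) (locallyFiniteSum fun i => E i X) := fun X =>
          hasLSum_locallyFiniteSum fun c => (h.fin c).imp fun s hs i hi => hs i hi X
        have h1 := (hX X).add (hX Y)
        simp only [← map_add] at h1
        exact h1.locallyFiniteSum_eq
      map_smul' := fun a X => by
        have hX : ∀ X, HasLSum (fun i => E i X) (locallyFiniteSum fun i => E i X) := fun X =>
          hasLSum_locallyFiniteSum fun c => (h.fin c).imp fun s hs i hi => hs i hi X
        have h1 := (hX X).smul a
        simp only [← map_smul] at h1
        exact h1.locallyFiniteSum_eq }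
  else 0

namespace LFO

variable {E : I → (U →ₗ[k] V) →ₗ[k] (U →ₗ[k] V')}

lemma hasLSum (h : LFO E) (X : U →ₗ[k] V) : HasLSum (fun i => E i X) (opSum E X) := by
  unfold opSum
  rw [dif_pos h]
  exact hasLSum_locallyFiniteSum fun c => (h.fin c).imp fun s hs i hi => hs i hi X

lemma local_opSum (h : LFO E) : Local (opSum E) := by
  classical
  intro c
  obtain ⟨s, hs⟩ := h.fin c
  choose t ht using fun i => h.loc i c
  refine ⟨s.biUnion t, fun f hf => ?_⟩
  obtain ⟨r, hr, hr'⟩ := h.hasLSum f c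
  rw [← hr']
  refine sum_eq_zero fun i _ => ?_
  by_cases hi : i ∈ s
  · exact ht i f fun u hu => hf u (mem_biUnion.2 ⟨i, hi, hu⟩)
  · exact hs i hi f

/-- The sum over all pairs of an operator of the family and a member of a family of maps. -/
lemma hasLSum_prod (h : LFO E) {F : J → U →ₗ[k] V} {f : U →ₗ[k] V} (hF : HasLSum F f) :
    HasLSum (fun a : I × J => E a.1 (F a.2)) (opSum E f) := by
  classical
  intro c
  obtain ⟨s, hs⟩ := h.fin c
  choose t ht using fun i => h.loc i c
  have hF' := hF
  choose r hr hr' using hF'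
  let T := (s.biUnion t).biUnion r
  have hz : ∀ i, ∀ j ∉ T, E i (F j) c = 0 := fun i j hj => by
    by_cases hi : i ∈ s
    · exact ht i _ fun u hu => hr u j fun h => hj (mem_biUnion.2
        ⟨u, mem_biUnion.2 ⟨i, hi, hu⟩, h⟩)
    · exact hs i hi _
  refine ⟨s ×ˢ T, ?_, ?_⟩
  · rintro ⟨i, j⟩ hij
    rw [Finset.mem_product, not_and_or] at hij
    exact hij.elim (fun hi => hs i hi _) (fun hj => hz i j hj)
  · rw [Finset.sum_product]
    obtain ⟨s', hs', hs''⟩ := h.hasLSum f c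
    have h1 : ∀ i, ∑ j ∈ T, E i (F j) c = E i f c := fun i => by
      obtain ⟨q, hq, hq'⟩ := HasLSum.local_map (h.loc i) hF c
      rw [← hq']
      have e1 : ∑ j ∈ T, E i (F j) c = ∑ j ∈ T ∪ q, E i (F j) c :=
        sum_subset subset_union_left fun j _ hj => hz i j hj
      have e2 : ∑ j ∈ q, E i (F j) c = ∑ j ∈ T ∪ q, E i (F j) c :=
        sum_subset subset_union_right fun j _ hj => hq j hj
      rw [e1, e2]
    simp only [h1]
    rw [← hs'']
    have e1 : ∑ i ∈ s, E i f c = ∑ i ∈ s ∪ s', E i f c :=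
      sum_subset subset_union_left fun i _ hi => hs i hi f
    have e2 : ∑ i ∈ s', E i f c = ∑ i ∈ s ∪ s', E i f c :=
      sum_subset subset_union_right fun i _ hi => hs' i hi
    rw [e1, e2]

lemma subfamily (h : LFO E) {e : J → I} (he : Injective e) : LFO fun j => E (e j) where
  loc j := h.loc (e j)
  fin c := by
    obtain ⟨s, hs⟩ := h.fin c
    exact ⟨s.preimage e he.injOn, fun j hj X => hs _ (fun h => hj (Finset.mem_preimage.2 h)) X⟩

end LFO

end LocallyFinite

section Colours

/-- Maps of degree `d` which preserve colours. -/
def HasDeg (M : DgModule k U) (N : DgModule k V) (d : ℤ) (w : U →ₗ[k] V) : Prop :=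
  ∀ α e, ∀ x ∈ M.piece α e, w x ∈ N.piece α (e + d)

/-- The projection onto the colours satisfying `P`. -/
def DgModule.filter (M : DgModule k U) (P : Colour → Prop) [DecidablePred P] : U →ₗ[k] U :=
  M.scale fun α _ => if P α then 1 else 0

lemma DgModule.filter_apply (M : DgModule k U) (P : Colour → Prop) [DecidablePred P]
    {α : Colour} {e : ℤ} {x : U} (hx : x ∈ M.piece α e) :
    M.filter P x = if P α then x else 0 := by
  rw [filter, M.scale_apply _ hx]; split <;> simp

lemma DgModule.filter_mem (M : DgModule k U) (P : Colour → Prop) [DecidablePred P]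
    {α : Colour} {e : ℤ} {x : U} (hx : x ∈ M.piece α e) : M.filter P x ∈ M.piece α e := by
  rw [M.filter_apply P hx]; split
  · exact hx
  · exact zero_mem _

lemma DgModule.proj_mem (M : DgModule k U) (β : Colour)
    {α : Colour} {e : ℤ} {x : U} (hx : x ∈ M.piece α e) : M.proj β x ∈ M.piece α e := by
  rw [M.proj_apply β hx]; split
  · exact hx
  · exact zero_mem _

/-- Maps which vanish on the colours not satisfying `P`. -/
def SuppOn (M : DgModule k U) (P : Colour → Prop) (w : U →ₗ[k] V) : Prop :=
  ∀ α e, ∀ x ∈ M.piece α e, ¬ P α → w x = 0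

namespace HasDeg

variable {M : DgModule k U} {N : DgModule k V} {d : ℤ} {w w' : U →ₗ[k] V}

lemma sub (h : HasDeg M N d w) (h' : HasDeg M N d w') : HasDeg M N d (w - w') :=
  fun α e x hx => sub_mem (h α e x hx) (h' α e x hx)

lemma smul (h : HasDeg M N d w) (a : k) : HasDeg M N d (a • w) :=
  fun α e x hx => Submodule.smul_mem _ a (h α e x hx)

lemma zero : HasDeg M N d (0 : U →ₗ[k] V) := fun _ _ _ _ => zero_mem _

lemma proj (h : HasDeg M N d w) (β : Colour) :
    HasDeg M N d (w ∘ₗ M.proj β) := fun α e _ hx => h α e _ (M.proj_mem β hx)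

lemma hasLSum {I : Type*} {F : I → U →ₗ[k] V} (h : HasLSum F w) (hF : ∀ i, HasDeg M N d (F i)) :
    HasDeg M N d w := fun α e x hx => by
  obtain ⟨s, -, hs⟩ := h x
  rw [← hs]
  exact sum_mem fun i _ => hF i α e x hx

end HasDeg

lemma isEven_iff {C : DgBoxCooperad k U} {B : DgBoxOperad k V} {w : U →ₗ[k] V} :
    IsEven C B w ↔ HasDeg C B 0 w := by
  simp [IsEven, HasDeg]

namespace SuppOn

variable {M : DgModule k U} {P P' : Colour → Prop} {w w' : U →ₗ[k] V}

lemma sub (h : SuppOn M P w) (h' : SuppOn M P w') : SuppOn M P (w - w') :=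
  fun α e x hx hP => by rw [LinearMap.sub_apply, h α e x hx hP, h' α e x hx hP, sub_zero]

lemma mono (h : SuppOn M P w) (hP : ∀ α, P α → P' α) : SuppOn M P' w :=
  fun α e x hx h' => h α e x hx fun h'' => h' (hP α h'')

lemma hasLSum {I : Type*} {F : I → U →ₗ[k] V} (h : HasLSum F w) (hF : ∀ i, SuppOn M P (F i)) :
    SuppOn M P w := fun α e x hx hP => by
  obtain ⟨s, -, hs⟩ := h x
  rw [← hs]
  exact sum_eq_zero fun i _ => hF i α e x hx hP

lemma comp_filter [DecidablePred P] (h : SuppOn M P w) : w ∘ₗ M.filter P = w :=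
  M.linear_ext fun α e x hx => by
    rw [comp_apply, M.filter_apply P hx]
    split_ifs with hP
    · rfl
    · rw [map_zero, h α e x hx hP]

lemma filter [DecidablePred P] (w : U →ₗ[k] V) : SuppOn M P (w ∘ₗ M.filter P) :=
  fun α e x hx hP => by rw [comp_apply, M.filter_apply P hx, if_neg hP, map_zero]

lemma proj (w : U →ₗ[k] V) (β : Colour) : SuppOn M (· = β) (w ∘ₗ M.proj β) :=
  fun α e x hx hP => by rw [comp_apply, M.proj_apply β hx, if_neg hP, map_zero]

lemma comp_filter_of {Q : Colour → Prop} [DecidablePred Q] (h : SuppOn M P w) :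
    SuppOn M P (w ∘ₗ M.filter Q) := fun α e x hx hP => by
  rw [comp_apply]
  exact h α e _ (M.filter_mem Q hx) hP

end SuppOn

end Colours

section ConvColours

variable {C : DgBoxCooperad k U} {B : DgBoxOperad k V}

/-- To compute `conv` at a homogeneous element, only tensors with matching colours are needed. -/
lemma conv_induction (n : ℕ) (ps : Fin (n + 1) → ℕ) {P Q R : ℕ} {e : ℤ} {c : U}
    (hc : c ∈ C.piece (P, Q, R) e) {W : Type*} [AddCommGroup W] [Module k W]
    (S : Submodule k W) (L : (⨂[k] _ : Fin (n + 1), U) →ₗ[k] W)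
    (h : ∀ (p r : ℕ) (q : Fin n → ℕ) (ε : Fin (n + 1) → ℤ) (x : Fin (n + 1) → U),
      p + ps 0 = P → ∑ i, q i = Q → r + ps (Fin.last n) = R → ∑ i, ε i = e →
      x 0 ∈ C.piece (p, n, r) (ε 0) →
      (∀ i : Fin n, x i.succ ∈ C.piece (ps i.castSucc, q i, ps i.succ) (ε i.succ)) →
      L (PiTensorProduct.tprod k x) ∈ S) : L (C.decomp n ps c) ∈ S := by
  have := C.decomp_mem n ps P Q R e c hc
  have hle : Submodule.span k {t | ∃ (p r : ℕ) (q : Fin n → ℕ) (ε : Fin (n + 1) → ℤ)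
      (x : Fin (n + 1) → U), p + ps 0 = P ∧ ∑ i, q i = Q ∧ r + ps (Fin.last n) = R ∧
      ∑ i, ε i = e ∧ x 0 ∈ C.piece (p, n, r) (ε 0) ∧
      (∀ i : Fin n, x i.succ ∈ C.piece (ps i.castSucc, q i, ps i.succ) (ε i.succ)) ∧
      t = PiTensorProduct.tprod k x} ≤ S.comap L := by
    rw [Submodule.span_le]
    rintro t ⟨p, r, q, ε, x, h1, h2, h3, h4, h5, h6, rfl⟩
    exact h p r q ε x h1 h2 h3 h4 h5 h6
  exact hle this

lemma conv_congr (n : ℕ) (ps : Fin (n + 1) → ℕ) {P Q R : ℕ} {e : ℤ} {c : U}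
    (hc : c ∈ C.piece (P, Q, R) e) (f g : Fin (n + 1) → U →ₗ[k] V)
    (h0 : ∀ p r e, p + ps 0 = P → r + ps (Fin.last n) = R → ∀ x ∈ C.piece (p, n, r) e,
      f 0 x = g 0 x)
    (hi : ∀ (i : Fin n) q e, q ≤ Q → ∀ x ∈ C.piece (ps i.castSucc, q, ps i.succ) e,
      f i.succ x = g i.succ x) : conv C B n ps f c = conv C B n ps g c := by
  have := conv_induction n ps hc (⊥ : Submodule k V)
    (PiTensorProduct.lift ((B.comp n ps).compLinearMap f) -
      PiTensorProduct.lift ((B.comp n ps).compLinearMap g))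
    fun p r q ε x h1 h2 h3 h4 h5 h6 => by
      rw [Submodule.mem_bot, LinearMap.sub_apply, PiTensorProduct.lift.tprod,
        PiTensorProduct.lift.tprod, sub_eq_zero, compLinearMap_apply,
        compLinearMap_apply]
      refine congrArg _ (funext fun i => ?_)
      refine Fin.cases (h0 p r _ h1 h3 _ h5) (fun i => ?_) i
      exact hi i (q i) _ (h2 ▸ Finset.single_le_sum (f := q) (fun _ _ => Nat.zero_le _)
        (mem_univ i)) _ (h6 i)
  rw [Submodule.mem_bot, LinearMap.sub_apply, sub_eq_zero] at this
  exact this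

lemma conv_congr' (n : ℕ) (ps : Fin (n + 1) → ℕ) (f g : Fin (n + 1) → U →ₗ[k] V)
    (h0 : ∀ p r e, ∀ x ∈ C.piece (p, n, r) e, f 0 x = g 0 x)
    (hi : ∀ (i : Fin n) q e, ∀ x ∈ C.piece (ps i.castSucc, q, ps i.succ) e,
      f i.succ x = g i.succ x) : conv C B n ps f = conv C B n ps g :=
  C.linear_ext fun _ _ _ hc => conv_congr n ps hc f g (fun p r e _ _ => h0 p r e)
    (fun i q e _ => hi i q e)

lemma conv_eq_zero_of_bottom (n : ℕ) (ps : Fin (n + 1) → ℕ) (f : Fin (n + 1) → U →ₗ[k] V)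
    (h0 : ∀ p r e, ∀ x ∈ C.piece (p, n, r) e, f 0 x = 0) : conv C B n ps f = 0 := by
  rw [conv_congr' n ps f (update f 0 0) (fun p r e x hx => by simp [h0 p r e x hx])
    (fun i q e x _ => by rw [update_of_ne (Fin.succ_ne_zero i)])]
  exact (conv C B n ps).map_coord_zero 0 (by simp)

lemma conv_eq_zero_of_top (n : ℕ) (ps : Fin (n + 1) → ℕ) (f : Fin (n + 1) → U →ₗ[k] V)
    (i : Fin n) (h0 : ∀ q e, ∀ x ∈ C.piece (ps i.castSucc, q, ps i.succ) e, f i.succ x = 0) :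
    conv C B n ps f = 0 := by
  rw [conv_congr' n ps f (update f i.succ 0)
    (fun p r e x _ => by rw [update_of_ne (Fin.succ_ne_zero i).symm])
    (fun j q e x hx => by
      rcases eq_or_ne j i with rfl | h
      · simp [h0 q e x hx]
      · rw [update_of_ne (fun h' => h (Fin.succ_injective _ h'))])]
  exact (conv C B n ps).map_coord_zero i.succ (by simp)

lemma conv_hasDeg (n : ℕ) (ps : Fin (n + 1) → ℕ) (f : Fin (n + 1) → U →ₗ[k] V)
    (d : Fin (n + 1) → ℤ) (h : ∀ i, HasDeg C B (d i) (f i)) :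
    HasDeg C B (∑ i, d i) (conv C B n ps f) := by
  rintro ⟨P, Q, R⟩ e c hc
  refine conv_induction n ps hc (B.piece (P, Q, R) (e + ∑ i, d i))
    (PiTensorProduct.lift ((B.comp n ps).compLinearMap f)) fun p r q ε x h1 h2 h3 h4 h5 h6 => ?_
  rw [PiTensorProduct.lift.tprod, compLinearMap_apply]
  have := B.comp_mem n ps p r q (fun i => ε i + d i) (fun i => f i (x i)) (h 0 _ _ _ h5)
    fun i => h i.succ _ _ _ (h6 i)
  rwa [h1, h2, h3, sum_add_distrib, h4] at this

lemma conv_isEven (n : ℕ) (ps : Fin (n + 1) → ℕ) (f : Fin (n + 1) → U →ₗ[k] V)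
    (h : ∀ i, IsEven C B (f i)) : IsEven C B (conv C B n ps f) := by
  rw [isEven_iff]
  simpa using conv_hasDeg n ps f (fun _ => 0) fun i => isEven_iff.1 (h i)

/-- The colours in which a composite lives. -/
lemma conv_suppOn (n : ℕ) (ps : Fin (n + 1) → ℕ) (f : Fin (n + 1) → U →ₗ[k] V)
    (D : Colour → Prop) (E : Fin n → Colour → Prop) (h0 : SuppOn C D (f 0))
    (hi : ∀ i, SuppOn C (E i) (f i.succ)) :
    SuppOn C (fun α => ∃ p r, ∃ q : Fin n → ℕ, D (p, n, r) ∧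
      (∀ i, E i (ps i.castSucc, q i, ps i.succ)) ∧
      α = (p + ps 0, ∑ i, q i, r + ps (Fin.last n))) (conv C B n ps f) := by
  classical
  rintro ⟨P, Q, R⟩ e c hc hne
  refine (Submodule.mem_bot k).1 (conv_induction n ps hc ⊥
    (PiTensorProduct.lift ((B.comp n ps).compLinearMap f)) fun p r q ε x h1 h2 h3 h4 h5 h6 => ?_)
  rw [PiTensorProduct.lift.tprod, compLinearMap_apply, Submodule.mem_bot]
  by_cases hD : D (p, n, r)
  · by_cases hE : ∀ i, E i (ps i.castSucc, q i, ps i.succ)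
    · exact absurd ⟨p, r, q, hD, hE, by rw [h1, h2, h3]⟩ hne
    · push Not at hE
      obtain ⟨i, hE⟩ := hE
      exact (B.comp n ps).map_coord_zero i.succ (hi i _ _ _ (h6 i) hE)
  · exact (B.comp n ps).map_coord_zero 0 (h0 _ _ _ h5 hD)

variable (C B) in
/-- The unit of the convolution product. -/
def unitH : U →ₗ[k] V := C.counit.smulRight B.one

lemma unitH_suppOn : SuppOn C (· = (0, 1, 0)) (unitH C B) := fun α e x hx h => by
  rw [unitH, smulRight_apply, C.counit_zero α e x hx (Or.inl h), zero_smul]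

lemma unitH_isEven : IsEven C B (unitH C B) := fun α e x hx => by
  rw [unitH, smulRight_apply]
  by_cases h : α ≠ (0, 1, 0) ∨ e ≠ 0
  · rw [C.counit_zero α e x hx h, zero_smul]; exact zero_mem _
  · push Not at h
    rw [h.1, h.2]
    exact Submodule.smul_mem _ _ B.one_mem

lemma local_lcomp {U : Type*} [AddCommGroup U] [Module k U] (l : U →ₗ[k] U) :
    Local (LinearMap.lcomp k V l) := fun a => ⟨{l a}, fun f hf => by
  simpa using hf _ (Finset.mem_singleton_self _)⟩

lemma conv_unit_bottom (p r : ℕ) (w : U →ₗ[k] V) {d : ℤ} (hw : HasDeg C B d w) :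
    conv C B 1 ![p, r] (cons (unitH C B) fun _ => w) =
      w ∘ₗ C.filter fun α => α.1 = p ∧ α.2.2 = r := by
  have hs : SuppOn C (fun α => α.1 = p ∧ α.2.2 = r)
      (conv C B 1 ![p, r] (cons (unitH C B) fun _ => w)) := by
    refine (conv_suppOn (B := B) 1 ![p, r] (cons (unitH C B) fun _ => w) (· = (0, 1, 0))
      (fun _ _ => True) unitH_suppOn (fun _ _ _ _ _ h => absurd trivial h)).mono ?_
    rintro ⟨P, Q, R⟩ ⟨p', r', q, h1, -, h2⟩
    simp only [Prod.mk.injEq] at h1 h2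
    refine ⟨?_, ?_⟩
    · rw [h2.1, h1.1]; simp
    · rw [h2.2.2, h1.2.2]; simp
  rw [← hs.comp_filter]
  have hup : ∀ z : U →ₗ[k] V, (update (cons (unitH C B) fun _ => w :
      Fin 2 → U →ₗ[k] V) 1 z) = cons (unitH C B) fun _ => z := by
    intro z; funext i; refine Fin.cases ?_ (fun i => ?_) i
    · rfl
    · obtain rfl := Subsingleton.elim i 0
      rfl
  have := Local.ext_rankOne ((local_lcomp (C.filter fun α => α.1 = p ∧ α.2.2 = r)).comp
      (local_conv C B 1 ![p, r] (cons (unitH C B) fun _ => w) 1))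
      (local_lcomp (C.filter fun α => α.1 = p ∧ α.2.2 = r)) C w fun a ha => by
    simp only [comp_apply, toLinearMap_apply, hup, LinearMap.lcomp_apply']
    have hm := hw _ _ _ (C.hbasis_mem a)
    rw [unitH, conv_rankOne]
    refine C.linear_ext fun α e c hc => ?_
    simp only [comp_apply, smulRight_apply]
    rw [C.filter_apply _ hc]
    split_ifs with h
    · obtain ⟨P, Q, R⟩ := α
      obtain ⟨rfl, rfl⟩ := h
      rw [C.counit_left P Q R e c hc]
      by_cases hcol : (a.1.1.1 = P ∧ a.1.1.2.2 = R)
      · congr 1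
        have := B.one_comp a.1.1.1 a.1.1.2.1 a.1.1.2.2 _ _ hm
        rw [hcol.1, hcol.2] at this
        convert this using 2
        funext i; refine Fin.cases rfl (fun i => ?_) i
        obtain rfl := Subsingleton.elim i 0
        rfl
      · have : C.hbasis.coord a c = 0 := C.hbasis_repr_of_ne a hc fun h => hcol (by rw [← h]; simp)
        rw [this, zero_smul, zero_smul]
    · simp
  simpa only [comp_apply, toLinearMap_apply, hup, LinearMap.lcomp_apply'] using this

lemma conv_unit_top (n : ℕ) (X : U →ₗ[k] V) {d : ℤ} (hX : HasDeg C B d X) :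
    conv C B n (fun _ => 0) (cons X fun _ => unitH C B) = X ∘ₗ C.filter fun α => α.2.1 = n := by
  have hs : SuppOn C (fun α => α.2.1 = n)
      (conv C B n (fun _ => 0) (cons X fun _ => unitH C B)) := by
    refine (conv_suppOn (B := B) n (fun _ => 0) (cons X fun _ => unitH C B) (fun _ => True)
      (fun _ α => α = (0, 1, 0)) (fun _ _ _ _ h => absurd trivial h)
        (fun _ => unitH_suppOn)).mono ?_
    rintro ⟨P, Q, R⟩ ⟨p', r', q, -, h1, h2⟩
    simp only [Prod.mk.injEq, true_and, and_true] at h1 h2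
    rw [h2.2.1]
    simp [h1]
  rw [← hs.comp_filter]
  have := Local.ext_rankOne ((local_lcomp (C.filter fun α => α.2.1 = n)).comp
      (local_conv C B n (fun _ => 0) (cons X fun _ => unitH C B) 0))
      (local_lcomp (C.filter fun α => α.2.1 = n)) C X fun a ha => by
    simp only [comp_apply, toLinearMap_apply, update_cons_zero, LinearMap.lcomp_apply']
    have hm := hX _ _ _ (C.hbasis_mem a)
    unfold unitH
    rw [conv_rankOne]
    refine C.linear_ext fun α e c hc => ?_
    simp only [comp_apply, smulRight_apply]
    rw [C.filter_apply _ hc]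
    split_ifs with h
    · obtain ⟨P, Q, R⟩ := α
      obtain rfl : Q = n := h
      rw [C.counit_right P Q R e c hc]
      by_cases hcol : a.1.1.2.1 = Q
      · congr 1
        exact B.comp_one a.1.1.1 Q a.1.1.2.2 (a.1.2 + d) _ (by rw [← hcol]; exact hm)
      · have : C.hbasis.coord a c = 0 := C.hbasis_repr_of_ne a hc fun h => hcol (by rw [← h])
        rw [this, zero_smul, zero_smul]
    · simp
  simpa only [comp_apply, toLinearMap_apply, update_cons_zero, LinearMap.lcomp_apply'] using this

end ConvColours

section Rows

/-- A map is the sum of its restrictions to the parts of a partition of the colours. -/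
lemma hasLSum_filter {ι : Type*} [DecidableEq ι] (M : DgModule k U) (t : Colour → ι)
    (X : U →ₗ[k] V) : HasLSum (fun m => X ∘ₗ M.filter fun α => t α = m) X := by
  have key : ∀ c : U, ∃ s : Finset ι, (∀ m ∉ s, M.filter (fun α => t α = m) c = 0) ∧
      ∑ m ∈ s, M.filter (fun α => t α = m) c = c := by
    intro c
    have hc : c ∈ ⨆ i : Colour × ℤ, M.piece i.1 i.2 := by
      rw [M.internal.submodule_iSup_eq_top]; trivial
    induction hc using Submodule.iSup_induction' with
    | mem i x hx =>
      refine ⟨{t i.1}, fun m hm => ?_, ?_⟩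
      · rw [M.filter_apply _ hx, if_neg]
        exact fun h => hm (by simp [h])
      · rw [Finset.sum_singleton, M.filter_apply _ hx, if_pos rfl]
    | zero => exact ⟨∅, by simp, by simp⟩
    | add x y _ _ hx hy =>
      obtain ⟨s, hs, hs'⟩ := hx
      obtain ⟨r, hr, hr'⟩ := hy
      refine ⟨s ∪ r, fun m hm => ?_, ?_⟩
      · rw [Finset.mem_union, not_or] at hm
        rw [map_add, hs m hm.1, hr m hm.2, add_zero]
      · simp only [map_add, sum_add_distrib]
        rw [← sum_subset subset_union_left fun j _ hj => hs j hj,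
          ← sum_subset subset_union_right fun j _ hj => hr j hj, hs', hr']
  intro c
  obtain ⟨s, hs, hs'⟩ := key c
  refine ⟨s, fun m hm => by rw [comp_apply, hs m hm, map_zero], ?_⟩
  simp only [comp_apply]
  rw [← map_sum, hs']

variable (C : DgBoxCooperad k U) (B : DgBoxOperad k V)

/-- Convolution as an operator on the bottom factor. -/
def convB (n : ℕ) (P : Fin (n + 1) → ℕ) (w : Fin n → U →ₗ[k] V) :
    (U →ₗ[k] V) →ₗ[k] (U →ₗ[k] V) := (conv C B n P).toLinearMap (cons 0 w) 0

variable {C B}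

lemma convB_apply (n : ℕ) (P : Fin (n + 1) → ℕ) (w : Fin n → U →ₗ[k] V) (X : U →ₗ[k] V) :
    convB C B n P w X = conv C B n P (cons X w) := by
  simp [convB, update_cons_zero]

lemma local_convB (n : ℕ) (P : Fin (n + 1) → ℕ) (w : Fin n → U →ₗ[k] V) :
    Local (convB C B n P w) := local_conv C B n P _ 0

lemma conv_hasLSum (n : ℕ) (P : Fin (n + 1) → ℕ) (X : U →ₗ[k] V) {I : Fin n → Type*}
    {F : ∀ i, I i → U →ₗ[k] V} {f : Fin n → U →ₗ[k] V} (h : ∀ i, HasLSum (F i) (f i)) :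
    HasLSum (fun κ : ∀ i, I i => conv C B n P (cons X fun i => F i (κ i)))
      (conv C B n P (cons X f)) := by
  classical
  intro c
  obtain ⟨s, hs⟩ := conv_local C B n P c
  choose r hr hr' using h
  let J : ∀ i, Finset (I i) := fun i => s.biUnion (r i)
  have hz : ∀ i, ∀ j ∉ J i, ∀ u ∈ s, F i j u = 0 := fun i j hj u hu =>
    hr i u j fun h => hj (mem_biUnion.2 ⟨u, hu, h⟩)
  refine ⟨Fintype.piFinset J, fun κ hκ => ?_, ?_⟩
  · rw [Fintype.mem_piFinset, not_forall] at hκ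
    obtain ⟨i, hi⟩ := hκ
    rw [hs _ (cons X (update (fun i => F i (κ i)) i 0)) ?_,
      (conv C B n P).map_coord_zero i.succ (by simp)]
    · rfl
    · intro j u hu
      refine Fin.cases rfl (fun j => ?_) j
      rcases eq_or_ne j i with rfl | hne
      · simp [hz j _ hi u hu]
      · simp [update_of_ne hne]
  · have h1 := MultilinearMap.map_sum_finset ((conv C B n P).curryLeft X) F J
    have h2 := LinearMap.congr_fun h1 c
    rw [LinearMap.sum_apply] at h2
    refine h2.symm.trans (hs _ _ fun j u hu => ?_)
    refine Fin.cases rfl (fun j => ?_) j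
    simp only [cons_succ, LinearMap.sum_apply]
    rw [← hr' j u]
    exact (sum_subset (subset_biUnion_of_mem (r j) hu) fun i _ hi => hr j u i hi).symm

/-- The possible horizontal labels of a row of boxes. -/
abbrev Labels : Type := Σ n : ℕ, Fin (n + 1) → ℕ

variable (C B) in
/-- The sum of all rows of `y` on top of a map. -/
def rows (y : U →ₗ[k] V) : (U →ₗ[k] V) →ₗ[k] (U →ₗ[k] V) :=
  opSum fun ν : Labels => convB C B ν.1 ν.2 fun _ => y

variable (C B) in
/-- The rows of `y` form a locally finite family. -/
def RowFinite (y : U →ₗ[k] V) : Prop := LFO fun ν : Labels => convB C B ν.1 ν.2 fun _ => y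

lemma RowFinite.hasLSum {y : U →ₗ[k] V} (hy : RowFinite C B y) (X : U →ₗ[k] V) :
    HasLSum (fun ν : Labels => conv C B ν.1 ν.2 (cons X fun _ => y)) (rows C B y X) :=
  (LFO.hasLSum hy X).congr fun _ => convB_apply _ _ _ _

/-- The stream which continues `m` by zeros. -/
def stream {n : ℕ} (m : Fin n → ℕ) (i : ℕ) : ℕ := if h : i < n then m ⟨i, h⟩ else 0

lemma stream_coe {n : ℕ} (m : Fin n → ℕ) (i : Fin n) : stream m i = m i := by simp [stream]

lemma stream_lt {n : ℕ} (m : Fin n → ℕ) {i : ℕ} (h : i < n) : stream m i = m ⟨i, h⟩ := by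
  simp [stream, h]

/-- The partial sums of `m`. -/
def offset {n : ℕ} (m : Fin n → ℕ) (i : ℕ) : ℕ := ∑ t ∈ range i, stream m t

lemma offset_self {n : ℕ} (m : Fin n → ℕ) : offset m n = ∑ i, m i := by
  rw [offset, sum_range]; simp [stream_coe]

lemma offset_castSucc_add {n : ℕ} (m : Fin n → ℕ) (i : Fin n) :
    offset m ((i : ℕ) + 1) = offset m i + m i := by
  rw [offset, sum_range_succ, stream_coe]; rfl

lemma offset_le {n : ℕ} (m : Fin n → ℕ) {i j : ℕ} (h : i ≤ j) : offset m i ≤ offset m j :=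
  off_mono (m := stream m) (fun _ => rfl) h

/-- Labels of blocks which agree at the common ends come from one sequence of labels. -/
lemma exists_glue {n : ℕ} (H : Fin (n + 1) → ℕ) (m : Fin n → ℕ) (R : ∀ i, Fin (m i + 1) → ℕ)
    (h0 : ∀ i, H i.castSucc = R i 0) (h1 : ∀ i, H i.succ = R i (Fin.last _)) :
    ∃ S : ℕ → ℕ, (∀ i : Fin (n + 1), S (offset m i) = H i) ∧
      ∀ i, ∀ t : Fin (m i + 1), S (offset m i + t) = R i t := by
  suffices h : ∀ l ≤ n, ∃ S : ℕ → ℕ, (∀ i : Fin (n + 1), i.val ≤ l → S (offset m i) = H i) ∧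
      ∀ i : Fin n, i.val < l → ∀ t : Fin (m i + 1), S (offset m i + t) = R i t by
    obtain ⟨S, h, h'⟩ := h n le_rfl
    exact ⟨S, fun i => h i i.is_le, fun i => h' i i.2⟩
  intro l
  induction l with
  | zero =>
    refine fun _ => ⟨fun _ => H 0, fun i hi => ?_, fun i hi => absurd hi (Nat.not_lt_zero _)⟩
    obtain rfl : i = 0 := Fin.ext (Nat.le_zero.1 hi)
    rfl
  | succ l ih =>
    intro hl
    obtain ⟨S, hS, hS'⟩ := ih (by omega)
    let a : Fin n := ⟨l, hl⟩
    let S' : ℕ → ℕ := fun j =>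
      if h : offset m l < j ∧ j - offset m l < m a + 1 then R a ⟨_, h.2⟩ else S j
    have low : ∀ j ≤ offset m l, S' j = S j := fun j hj => dif_neg fun h => absurd h.1 hj.not_gt
    have high : ∀ t : Fin (m a + 1), S' (offset m l + t) = R a t := fun t => by
      rcases Nat.eq_zero_or_pos t.val with ht | ht
      · rw [ht, add_zero, low _ le_rfl]
        exact (hS a.castSucc le_rfl).trans ((h0 a).trans (congrArg (R a) (Fin.ext ht.symm)))
      · exact (dif_pos ⟨by omega, by have := t.2; omega⟩).trans
          (congrArg (R a) (Fin.ext (Nat.add_sub_cancel_left ..)))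
    refine ⟨S', fun i hi => ?_, fun i hi t => ?_⟩
    · rcases Nat.lt_or_ge l i with h | h
      · obtain rfl : i = a.succ := Fin.ext (by simp only [a, Fin.val_succ]; omega)
        exact (congrArg S' (offset_castSucc_add m a)).trans ((high (Fin.last _)).trans (h1 a).symm)
      · rw [low _ (offset_le m h)]; exact hS i h
    · rcases Nat.lt_or_ge i.val l with h | h
      · rw [low]
        · exact hS' i h t
        · have := offset_castSucc_add m i
          have := offset_le m (Nat.add_one_le_iff.2 h)
          have := t.2
          omega
      · obtain rfl : i = a := Fin.ext (by simp only [a]; omega)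
        exact high t

end Rows

section Rows

variable {C : DgBoxCooperad k U} {B : DgBoxOperad k V}

/-- The colours with prescribed horizontal labels. -/
abbrev HasEnds (l r : ℕ) (α : Colour) : Prop := α.1 = l ∧ α.2.2 = r

/-- The restriction of a map to the colours with prescribed horizontal labels. -/
def restr (C : DgBoxCooperad k U) (l r : ℕ) (w : U →ₗ[k] V) : U →ₗ[k] V :=
  w ∘ₗ C.filter (HasEnds l r)

lemma conv_restr (n : ℕ) (P : Fin (n + 1) → ℕ) (X : U →ₗ[k] V) (w : Fin n → U →ₗ[k] V) :
    conv C B n P (cons X fun i => restr C (P i.castSucc) (P i.succ) (w i)) =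
      conv C B n P (cons X w) := by
  refine conv_congr' n P _ _ (fun _ _ _ _ _ => rfl) fun i q e x hx => ?_
  simp only [cons_succ, restr, comp_apply]
  rw [C.filter_apply _ hx, if_pos ⟨rfl, rfl⟩]

lemma IsEven.filter {w : U →ₗ[k] V} (h : IsEven C B w) (Q : Colour → Prop) [DecidablePred Q] :
    IsEven C B (w ∘ₗ C.filter Q) := fun α e _ hx => h α e _ (C.filter_mem Q hx)

lemma conv_assoc_fin {y : U →ₗ[k] V} (hy : IsEven C B y) {n : ℕ} (P : Fin (n + 1) → ℕ)
    (X : U →ₗ[k] V) (m : Fin n → ℕ) (R : Fin (offset m n + 1) → ℕ) (w : Fin n → U →ₗ[k] V)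
    (hw : ∀ i, IsEven C B (w i))
    (hq : ∀ i, ∀ α e, ∀ u ∈ C.piece α e, α.2.1 ≠ m i → w i u = 0) :
    conv C B n (fun i => P i + stream R (offset m i)) (cons X fun i =>
        conv C B (m i) (fun t => stream R (offset m i + t)) (cons (w i) fun _ => y)) =
      conv C B (offset m n) R (cons (conv C B n P (cons X w)) fun _ => y) := by
  let Ws : ℕ → U →ₗ[k] V := fun i => if h : i < n then w ⟨i, h⟩ else 0
  have hWs : ∀ i : Fin n, Ws i = w i := fun i => by simp [Ws]
  have := conv_assoc (C := C) (B := B) n (stream m) (stream P) (stream R) (offset m) X Ws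
    (fun _ => y) (fun _ => rfl) (fun i hi => by simp only [Ws, dif_pos hi]; exact hw _)
    (fun i hi => by simp only [Ws, dif_pos hi, stream_lt m hi]; exact hq _) (fun _ _ => hy)
  have hc : ∀ (a b : ℕ), a = b → ∀ (S : ℕ → ℕ) (z : U →ₗ[k] V),
      conv C B a (fun j => S j) (cons z fun _ => y) =
        conv C B b (fun j => S j) (cons z fun _ => y) := by rintro a _ rfl S z; rfl
  have h1 : (fun i : Fin n => conv C B (stream m i) (fun j => stream R (offset m i + j))
      (cons (Ws i) fun _ => y)) = fun i : Fin n => conv C B (m i)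
        (fun j => stream R (offset m i + j)) (cons (w i) fun _ => y) :=
    funext fun i => by
      rw [hWs]; exact hc _ _ (stream_coe m i) (fun j => stream R (offset m i + j)) _
  have h2 : (fun i : Fin n => Ws i) = w := funext hWs
  have hP : (fun i : Fin (n + 1) => stream P i) = P := funext fun i => stream_coe P i
  have hP' : (fun i : Fin (n + 1) => stream P i + stream R (offset m i)) =
    fun i => P i + stream R (offset m i) := funext fun i => by rw [stream_coe P i]
  have hRR : (fun j : Fin (offset m n + 1) => stream R j) = R := funext fun j => stream_coe R j
  rw [h1, h2, hP, hP', hRR] at this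
  exact this

/-- Labels of a row which is divided into `n` blocks. -/
abbrev BlockLabels (n : ℕ) : Type := Σ m : Fin n → ℕ, Fin (offset m n + 1) → ℕ

/-- The labels of the whole row and the lengths of the blocks. -/
def BlockLabels.toRow {n : ℕ} (a : BlockLabels n) : Labels × (Fin n → ℕ) :=
  (⟨offset a.1 n, a.2⟩, a.1)

/-- The labels between the blocks, and the labels of the blocks. -/
def BlockLabels.toBlocks {n : ℕ} (a : BlockLabels n) : (Fin (n + 1) → ℕ) × (Fin n → Labels) :=
  (fun i => stream a.2 (offset a.1 i), fun i => ⟨a.1 i, fun t => stream a.2 (offset a.1 i + t)⟩)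

namespace BlockLabels

variable {n : ℕ}

lemma toRow_injective : Injective (toRow (n := n)) := by
  rintro ⟨m, R⟩ ⟨m', R'⟩ h
  simp only [toRow, Prod.mk.injEq] at h
  obtain ⟨h1, rfl⟩ := h
  rw [Sigma.mk.inj_iff] at h1
  rw [eq_of_heq h1.2]

lemma mem_range_toRow {N : ℕ} {R : Fin (N + 1) → ℕ} {m : Fin n → ℕ} (h : N = ∑ i, m i) :
    ((⟨N, R⟩, m) : Labels × (Fin n → ℕ)) ∈ Set.range (toRow (n := n)) := by
  rw [← offset_self] at h
  subst h
  exact ⟨⟨m, R⟩, rfl⟩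

lemma toBlocks_injective : Injective (toBlocks (n := n)) := by
  rintro ⟨m, R⟩ ⟨m', R'⟩ h
  simp only [toBlocks, Prod.mk.injEq] at h
  obtain ⟨h0, h1⟩ := h
  have hm : m = m' := funext fun i => congrArg Sigma.fst (congrFun h1 i)
  subst hm
  congr 1
  funext j
  by_cases hj : (j : ℕ) = offset m n
  · have := congrFun h0 (Fin.last n)
    simp only [Fin.val_last] at this
    rw [← stream_coe R j, ← stream_coe R' j, hj]
    exact this
  · obtain ⟨i, hi, t, ht, hjt⟩ := exists_block (m := stream m) (off := offset m)
      (fun _ => rfl) (show (j : ℕ) < offset m n by have := j.2; omega)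
    rw [stream_lt m hi] at ht
    have h2 := eq_of_heq (Sigma.mk.inj (congrFun h1 ⟨i, hi⟩)).2
    have := congrFun h2 ⟨t, by omega⟩
    simp only [← hjt] at this
    rwa [stream_coe, stream_coe] at this

lemma mem_range_toBlocks {H : Fin (n + 1) → ℕ} {m : Fin n → ℕ} {R : ∀ i, Fin (m i + 1) → ℕ}
    (h0 : ∀ i, H i.castSucc = R i 0) (h1 : ∀ i, H i.succ = R i (Fin.last _)) :
    ((H, fun i => ⟨m i, R i⟩) : (Fin (n + 1) → ℕ) × (Fin n → Labels)) ∈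
      Set.range (toBlocks (n := n)) := by
  obtain ⟨S, hS, hS'⟩ := exists_glue H m R h0 h1
  have hst : ∀ j ≤ offset m n, stream (fun j : Fin (offset m n + 1) => S j) j = S j :=
    fun j hj => by rw [stream_lt _ (Nat.lt_succ_of_le hj)]
  refine ⟨⟨m, fun j => S j⟩, ?_⟩
  refine Prod.ext (funext fun i => ?_) (funext fun i => Sigma.ext rfl (heq_of_eq
    (funext fun t => ?_)))
  · exact (hst _ (offset_le m (by omega))).trans (hS i)
  · refine (hst _ ?_).trans (hS' i t)
    have h2 := offset_castSucc_add m i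
    have h3 := offset_le m (show (i : ℕ) + 1 ≤ n by omega)
    have h4 : (t : ℕ) < m i + 1 := t.2
    show offset m i + (t : ℕ) ≤ offset m n
    omega

end BlockLabels

/-- Rows on top of a row. -/
lemma rows_conv {y : U →ₗ[k] V} (hy : IsEven C B y) (hT : RowFinite C B y) (n : ℕ)
    (P : Fin (n + 1) → ℕ) (X : U →ₗ[k] V) (w : Fin n → U →ₗ[k] V) (hw : ∀ i, IsEven C B (w i)) :
    HasLSum (fun H : Fin (n + 1) → ℕ => conv C B n (fun i => P i + H i)
        (cons X fun i => rows C B y (restr C (P i.castSucc) (P i.succ) (w i))))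
      (rows C B y (conv C B n P (cons X w))) := by
  classical
  obtain ⟨W, hWdef⟩ : ∃ W : Fin n → ℕ → U →ₗ[k] V, W = fun i m =>
    restr C (P i.castSucc) (P i.succ) (w i) ∘ₗ C.filter fun α => α.2.1 = m := ⟨_, rfl⟩
  have hWe : ∀ i m, IsEven C B (W i m) := fun i m => by
    rw [hWdef]; exact ((hw i).filter _).filter _
  have hWq : ∀ i m, SuppOn C.toDgModule (fun α => α.2.1 = m) (W i m) := fun i m => by
    rw [hWdef]; exact SuppOn.filter _
  have hWl : ∀ i m, SuppOn C (HasEnds (P i.castSucc) (P i.succ)) (W i m) :=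
    fun i m => by rw [hWdef]; exact (SuppOn.filter (w i)).comp_filter_of
  have hWsum : ∀ i, HasLSum (W i) (restr C (P i.castSucc) (P i.succ) (w i)) := fun i => by
    rw [hWdef]; exact hasLSum_filter C.toDgModule (fun α => α.2.1) _
  have hWr : ∀ i, ∀ ν : Labels, conv C B ν.1 ν.2 (cons (W i ν.1) fun _ => y) =
      conv C B ν.1 ν.2 (cons (restr C (P i.castSucc) (P i.succ) (w i)) fun _ => y) := by
    intro i ν
    refine conv_congr' _ _ _ _ (fun p r e x hx => ?_) fun _ _ _ _ _ => rfl
    simp only [cons_zero, hWdef, comp_apply]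
    rw [C.filter_apply _ hx, if_pos rfl]
  clear hWdef
  have hR : HasLSum (fun a : Labels × (Fin n → ℕ) => conv C B a.1.1 a.1.2
      (cons (conv C B n P (cons X fun i => W i (a.2 i))) fun _ => y))
      (rows C B y (conv C B n P (cons X w))) := by
    have h1 := conv_hasLSum (C := C) (B := B) n P X hWsum
    rw [conv_restr] at h1
    exact (LFO.hasLSum_prod hT h1).congr fun a => convB_apply _ _ _ _
  rw [← HasLSum.comp_injective BlockLabels.toRow_injective] at hR
  swap
  · rintro ⟨⟨N, R⟩, m⟩ hm
    refine conv_eq_zero_of_bottom _ _ _ fun p r e x hx => ?_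
    have hs := conv_suppOn (C := C) (B := B) n P (cons X fun i => W i (m i)) (fun _ => True)
      (fun i α => α.2.1 = m i) (fun _ _ _ _ h => absurd trivial h) (fun i => hWq i (m i))
    refine hs _ _ x hx ?_
    rintro ⟨p', r', q, -, hq, h⟩
    simp only [Prod.mk.injEq] at h hq
    exact hm (BlockLabels.mem_range_toRow (by rw [h.2.1]; simp [hq]))
  let G : (Fin (n + 1) → ℕ) × (Fin n → Labels) → U →ₗ[k] V := fun b =>
    conv C B n (fun i => P i + b.1 i) (cons X fun i => conv C B (b.2 i).1 (b.2 i).2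
      (cons (W i (b.2 i).1) fun _ => y))
  have hG : ∀ a : BlockLabels n, G a.toBlocks = conv C B (offset a.1 n) a.2
      (cons (conv C B n P (cons X fun i => W i (a.1 i))) fun _ => y) := by
    rintro ⟨m, R⟩
    exact conv_assoc_fin hy P X m R _ (fun i => hWe i _) fun i α e u hu => hWq i _ α e u hu
  have hG0 : ∀ b ∉ Set.range (BlockLabels.toBlocks (n := n)), G b = 0 := by
    rintro ⟨H, κ⟩ hb
    by_contra hne
    have hsupp : ∀ i, SuppOn C.toDgModule
        (fun α => α.1 = P i.castSucc + (κ i).2 0 ∧ α.2.2 = P i.succ + (κ i).2 (Fin.last _))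
        (conv C B (κ i).1 (κ i).2 (cons (W i (κ i).1) fun _ => y)) := fun i => by
      refine (conv_suppOn (C := C) (B := B) (κ i).1 (κ i).2 (cons (W i (κ i).1) fun _ => y)
        (HasEnds (P i.castSucc) (P i.succ)) (fun _ _ => True) (hWl i _)
        (fun _ _ _ _ _ h => absurd trivial h)).mono ?_
      rintro α ⟨p, r, q, ⟨h1, h2⟩, -, rfl⟩
      simp only at h1 h2 ⊢
      omega
    have hm : ∀ i, P i.castSucc + H i.castSucc = P i.castSucc + (κ i).2 0 ∧
        P i.succ + H i.succ = P i.succ + (κ i).2 (Fin.last _) := by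
      intro i
      by_contra hne'
      refine hne (conv_eq_zero_of_top n _ _ i fun q e x hx => ?_)
      exact hsupp i _ _ x hx fun h => hne' h
    exact hb (BlockLabels.mem_range_toBlocks (R := fun i => (κ i).2)
      (fun i => by have := (hm i).1; omega) (fun i => by have := (hm i).2; omega))
  have hL : HasLSum G (rows C B y (conv C B n P (cons X w))) := by
    rw [← HasLSum.comp_injective BlockLabels.toBlocks_injective hG0]
    exact hR.congr fun a => (hG a).symm
  have hF : ∀ i, HasLSum (fun ν : Labels => conv C B ν.1 ν.2 (cons (W i ν.1) fun _ => y))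
      (rows C B y (restr C (P i.castSucc) (P i.succ) (w i))) :=
    fun i => (hT.hasLSum _).congr fun ν => (hWr i ν).symm
  have h5 := fun H : Fin (n + 1) → ℕ => conv_hasLSum (C := C) (B := B) n (fun i => P i + H i) X hF
  exact hL.prod_fiber h5

end Rows

section Conil

/-- Words of vectors act on functions of words of functionals. -/
def wordAction (k U : Type*) [Field k] [AddCommGroup U] [Module k U] :
    U →ₗ[k] Module.End k (List (U →ₗ[k] k) → k) where
  toFun x :=
    { toFun := fun f L => match L with
        | [] => 0
        | ψ :: L => ψ x * f L
      map_add' := fun f g => by funext L; cases L <;> simp [mul_add]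
      map_smul' := fun a f => by funext L; cases L <;> simp [mul_left_comm] }
  map_add' x y := by ext f L; cases L <;> simp [add_mul]
  map_smul' a x := by ext f L; cases L <;> simp [mul_assoc]

/-- Evaluation of words of vectors on words of functionals. -/
def evalWords (k U : Type*) [Field k] [AddCommGroup U] [Module k U] :
    TensorAlgebra k U →ₐ[k] Module.End k (List (U →ₗ[k] k) → k) :=
  TensorAlgebra.lift k (wordAction k U)

lemma evalWords_prod {n : ℕ} (z : Fin n → TensorAlgebra k U) (s : Fin n → k)
    (L : Fin n → List (U →ₗ[k] k))
    (h : ∀ i f L', evalWords k U (z i) f (L i ++ L') = s i * f L') (f : List (U →ₗ[k] k) → k)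
    (L' : List (U →ₗ[k] k)) :
    evalWords k U (List.ofFn z).prod f ((List.ofFn L).flatten ++ L') = (∏ i, s i) * f L' := by
  induction n generalizing f with
  | zero => simp
  | succ n ih =>
    rw [List.ofFn_succ, List.ofFn_succ, List.prod_cons, List.flatten_cons, map_mul,
      Module.End.mul_apply, List.append_assoc, h 0, ih (fun i => z i.succ) (fun i => s i.succ)
      (fun i => L i.succ) (fun i => h i.succ), prod_univ_succ, mul_assoc]

namespace DgBoxCooperad

variable (C : DgBoxCooperad k U)

/-- The functionals which evaluate the decomposition along a stacking on functionals. -/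
def words (π : U →ₗ[k] U) : Stack → Set (U →ₗ[k] k)
  | .leaf => {C.counit}
  | .box p r n a c => {φ | ∃ (ψ : U →ₗ[k] k) (χ : Fin n → U →ₗ[k] k),
      (∀ i, χ i ∈ words π (c i)) ∧
        φ = dualComp (C.decomp n (Stack.profile n a c)) (ψ ∘ₗ π ∘ₗ C.proj (p, n, r)) χ}

lemma exists_evalWords_eq (π : U →ₗ[k] U) (S : Stack) :
    ∀ φ ∈ C.words π S, ∃ L : List (U →ₗ[k] k), ∀ c f L',
      evalWords k U (C.iter π S c) f (L ++ L') = φ c * f L' := by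
  induction S with
  | leaf =>
    rintro φ rfl
    refine ⟨[], fun c f L' => ?_⟩
    simp [iter]
  | box p r n a cs ih =>
    rintro φ ⟨ψ, χ, hχ, rfl⟩
    choose L hL using fun i => ih i (χ i) (hχ i)
    refine ⟨ψ :: (List.ofFn L).flatten, fun c f L' => ?_⟩
    simp only [iter, dualComp, comp_apply]
    generalize C.decomp n (Stack.profile n a cs) c = t
    induction t using PiTensorProduct.induction_on with
    | smul_tprod b x =>
      rw [map_smul, map_smul, map_smul, PiTensorProduct.lift.tprod, PiTensorProduct.lift.tprod]
      rw [LinearMap.smul_apply, Pi.smul_apply, smul_eq_mul, smul_eq_mul, mul_assoc]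
      congr 1
      rw [compLinearMap_apply, compLinearMap_apply,
        MultilinearMap.mkPiAlgebraFin_apply, mkPiAlgebra_apply, List.ofFn_succ,
        prod_univ_succ, List.prod_cons, map_mul, Module.End.mul_apply, List.cons_append]
      simp only [cons_zero, cons_succ, comp_apply]
      have h1 : ∀ (y : U) (g : List (U →ₗ[k] k) → k) (l : List (U →ₗ[k] k)),
          evalWords k U (TensorAlgebra.ι k y) g (ψ :: l) = ψ y * g l := fun y g l => by
        rw [evalWords, TensorAlgebra.lift_ι_apply]; rfl
      rw [h1, mul_assoc]
      congr 1
      exact evalWords_prod _ _ L (fun i f L' => hL i _ f L') f L'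
    | add x y hx hy =>
      simp only [map_add, LinearMap.add_apply, Pi.add_apply, hx, hy, add_mul]

lemma words_eq_zero (π : U →ₗ[k] U) {S : Stack} {φ : U →ₗ[k] k} (hφ : φ ∈ C.words π S) {c : U}
    (h : C.iter π S c = 0) : φ c = 0 := by
  obtain ⟨L, hL⟩ := C.exists_evalWords_eq π S φ hφ
  have := hL c (fun _ => 1) []
  rw [h, map_zero, mul_one] at this
  exact this.symm

end DgBoxCooperad

namespace Stack

/-- All boxes have horizontal inputs and outputs. -/
def AllNonThin : Stack → Prop
  | leaf => True
  | box p r _ _ c => 0 < p ∧ 0 < r ∧ ∀ i, AllNonThin (c i)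

end Stack

namespace ConilpotentDgBoxCooperad

variable (C : ConilpotentDgBoxCooperad k U)

lemma reduce_comp_proj {α : Colour} (h : α ≠ (0, 1, 0)) :
    C.reduce C.one ∘ₗ C.proj α = C.proj α := C.linear_ext fun β e x hx => by
  rw [comp_apply, C.proj_apply α hx]
  split_ifs with hβ
  · subst hβ
    simp [DgBoxCooperad.reduce, C.counit_zero β e x hx (Or.inl h)]
  · rw [map_zero]

lemma words_reduce {S : Stack} (hS : S.AllNonThin) :
    C.words LinearMap.id S ⊆ C.words (C.reduce C.one) S := by
  induction S with
  | leaf => exact subset_rfl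
  | box p r n a c ih =>
    rintro φ ⟨ψ, χ, hχ, rfl⟩
    refine ⟨ψ, χ, fun i => ih i (hS.2.2 i) (hχ i), ?_⟩
    rw [C.reduce_comp_proj (fun h => by
      have := congrArg Prod.fst h; have := hS.1; simp_all), LinearMap.id_comp]

lemma dualComp_counit (p r : ℕ) (χ : Fin 1 → U →ₗ[k] k) {α : Colour} {e : ℤ} {c : U}
    (hc : c ∈ C.piece α e) (h : dualComp (C.decomp 1 ![p, r]) C.counit χ c ≠ 0) :
    χ 0 c ≠ 0 := by
  obtain ⟨P, Q, R⟩ := α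
  by_cases hPR : P = p ∧ R = r
  · obtain ⟨rfl, rfl⟩ := hPR
    have := C.counit_left P Q R e c hc (χ 0)
    rw [← this]
    convert h using 4
    rename_i i
    exact congrArg χ (Subsingleton.elim 0 i)
  · exfalso
    refine h ((Submodule.mem_bot k).1 (conv_induction (C := C) 1 ![p, r] hc ⊥
      (PiTensorProduct.lift ((mkPiAlgebra k (Fin 2) k).compLinearMap
        (cons (α := fun _ => U →ₗ[k] k) C.counit χ)))
      fun p' r' q ε x h1 h2 h3 h4 h5 h6 => ?_))
    rw [Submodule.mem_bot, PiTensorProduct.lift.tprod, compLinearMap_apply,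
      mkPiAlgebra_apply, prod_univ_succ, cons_zero]
    rw [C.counit_zero (p', 1, r') _ _ h5, zero_mul]
    refine Or.inl fun h' => hPR ?_
    simp only [Prod.mk.injEq] at h'
    simp [h'.1, h'.2.2] at h1 h3
    exact ⟨h1.symm, h3.symm⟩

/-- Only finitely many stackings of boxes of the third kind, and possibly a bottom box of arbitrary
kind, contribute to the decomposition of an element. -/
lemma finite_words {α : Colour} {e : ℤ} {c : U} (hc : c ∈ C.piece α e) :
    {S : Stack | S.Valid ∧ (∃ p r n a cs, S = .box p r n a cs ∧ ∀ i, (cs i).AllNonThin) ∧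
      ∃ φ ∈ C.words LinearMap.id S, φ c ≠ 0}.Finite := by
  refine ((C.conilpotent c).union ((C.conilpotent c).image
    fun T => Stack.box 0 0 1 0 fun _ => T)).subset ?_
  rintro _ ⟨hv, ⟨p, r, n, a, cs, rfl, hcs⟩, φ, ⟨ψ, χ, hχ, rfl⟩, hne⟩
  have hχ' := fun i => C.words_reduce (hcs i) (hχ i)
  by_cases h : dualComp (C.decomp n (Stack.profile n a cs))
      (ψ ∘ₗ C.reduce C.one ∘ₗ C.proj (p, n, r)) χ c = 0
  · right
    have hcol : (p, n, r) = (0, 1, 0) := by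
      by_contra hcol
      rw [C.reduce_comp_proj hcol] at h
      exact hne h
    simp only [Prod.mk.injEq] at hcol
    obtain ⟨rfl, rfl, rfl⟩ := hcol
    obtain rfl : a = 0 := hv.2.1 Nat.one_pos
    have hcs0 : cs = fun _ => cs 0 := funext fun i => congrArg cs (Subsingleton.elim i 0)
    refine ⟨cs 0, ⟨hv.1 0, fun h0 => ?_⟩, congrArg (Stack.box 0 0 1 0) hcs0.symm⟩
    have hprof : Stack.profile 1 0 cs = ![(cs 0).left, (cs 0).right] := by
      funext i
      refine Fin.cases rfl (fun i => ?_) i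
      obtain rfl := Subsingleton.elim i 0
      rfl
    have hψ : ψ ∘ₗ LinearMap.id ∘ₗ C.proj (0, 1, 0) =
        ψ ∘ₗ C.reduce C.one ∘ₗ C.proj (0, 1, 0) + ψ C.one • C.counit := by
      refine C.linear_ext fun β e x hx => ?_
      simp only [comp_apply, LinearMap.add_apply, LinearMap.smul_apply, C.proj_apply _ hx]
      by_cases hβ : β = (0, 1, 0)
      · simp [hβ, DgBoxCooperad.reduce, mul_comm]
      · simp [hβ, C.counit_zero β e x hx (Or.inl hβ)]
    have hlin : ∀ (φ₁ φ₂ : U →ₗ[k] k) (b : k),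
        dualComp (C.decomp 1 (Stack.profile 1 0 cs)) (φ₁ + b • φ₂) χ =
          dualComp (C.decomp 1 (Stack.profile 1 0 cs)) φ₁ χ +
            b • dualComp (C.decomp 1 (Stack.profile 1 0 cs)) φ₂ χ := by
      intro φ₁ φ₂ b
      unfold dualComp
      rw [← smul_comp, ← add_comp]
      congr 1
      refine PiTensorProduct.ext (MultilinearMap.ext fun x => ?_)
      simp [mkPiAlgebra_apply, prod_univ_succ]
      ring
    rw [hψ, hlin, LinearMap.add_apply, h, zero_add, LinearMap.smul_apply, hprof] at hne
    have := C.dualComp_counit _ _ χ hc (right_ne_zero_of_smul hne)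
    exact this (C.words_eq_zero _ (hχ' 0) h0)
  · left
    exact ⟨hv, fun h0 => h (C.words_eq_zero _ (S := .box p r n a cs)
      (show _ ∈ C.words _ (.box p r n a cs) from ⟨ψ, χ, hχ', rfl⟩) h0)⟩

end ConilpotentDgBoxCooperad
end Conil

section Approx

/-- On finite sets, `w` is a combination of maps of rank one made from functionals in `F`. -/
def Approx (F : Set (U →ₗ[k] k)) (w : U →ₗ[k] V) : Prop :=
  ∀ T : Finset U, ∃ w' ∈ Submodule.span k {z : U →ₗ[k] V | ∃ φ ∈ F, ∃ v, z = φ.smulRight v},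
    ∀ u ∈ T, w u = w' u

lemma Approx.exists_ne {F : Set (U →ₗ[k] k)} {w : U →ₗ[k] V} (h : Approx F w) {c : U}
    (hc : w c ≠ 0) : ∃ φ ∈ F, φ c ≠ 0 := by
  by_contra hF
  push Not at hF
  obtain ⟨w', hw', hT⟩ := h {c}
  rw [hT c (Finset.mem_singleton_self c)] at hc
  have hle : Submodule.span k {z : U →ₗ[k] V | ∃ φ ∈ F, ∃ v, z = φ.smulRight v} ≤
      LinearMap.ker (LinearMap.applyₗ c) := by
    rw [Submodule.span_le]
    rintro z ⟨φ, hφ, v, rfl⟩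
    simp [hF φ hφ]
  exact hc (hle hw')

lemma Approx.mono {F F' : Set (U →ₗ[k] k)} {w : U →ₗ[k] V} (h : Approx F w) (hF : F ⊆ F') :
    Approx F' w := fun T => by
  obtain ⟨w', hw', hT⟩ := h T
  refine ⟨w', Submodule.span_mono ?_ hw', hT⟩
  rintro z ⟨φ, hφ, v, rfl⟩
  exact ⟨φ, hF hφ, v, rfl⟩

/-- Every map is approximated by the coordinates of the basis vectors on which it does not vanish. -/
lemma approx_coord (M : DgModule k U) (w : U →ₗ[k] V) :
    Approx {φ | ∃ a : M.HIndex, w (M.hbasis a) ≠ 0 ∧ φ = M.hbasis.coord a} w := by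
  classical
  intro T
  let K : Finset M.HIndex := T.biUnion fun u => (M.hbasis.repr u).support
  refine ⟨∑ a ∈ K, (M.hbasis.coord a).smulRight (w (M.hbasis a)), ?_, fun u hu => ?_⟩
  · refine Submodule.sum_mem _ fun a _ => ?_
    by_cases ha : w (M.hbasis a) = 0
    · rw [ha]; simp
    · exact Submodule.subset_span ⟨_, ⟨a, ha, rfl⟩, _, rfl⟩
  · have h1 : (M.hbasis.repr u).support ⊆ K := subset_biUnion_of_mem
      (fun u => (M.hbasis.repr u).support) hu
    conv_lhs => rw [← M.hbasis.linearCombination_repr u, Finsupp.linearCombination_apply,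
      Finsupp.sum_of_support_subset _ h1 _ (by simp), map_sum]
    simp [LinearMap.sum_apply]

lemma multilinear_mem_span {n : ℕ} {W W' : Type*} [AddCommGroup W] [Module k W] [AddCommGroup W']
    [Module k W'] (μ : MultilinearMap k (fun _ : Fin n => W) W') (A : Fin n → Set W)
    (S : Submodule k W') (hμ : ∀ x : Fin n → W, (∀ i, x i ∈ A i) → μ x ∈ S) (x : Fin n → W)
    (hx : ∀ i, x i ∈ Submodule.span k (A i)) : μ x ∈ S := by
  classical
  choose m a g hg using fun i => (Submodule.mem_span_set'.1 (hx i))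
  have : x = fun i => ∑ j, a i j • (g i j : W) := funext fun i => (hg i).symm
  rw [this, MultilinearMap.map_sum]
  refine Submodule.sum_mem _ fun κ _ => ?_
  rw [map_smul_univ]
  exact Submodule.smul_mem _ _ (hμ _ fun i => (g i (κ i)).2)

variable {C : DgBoxCooperad k U} {B : DgBoxOperad k V}

lemma Approx.conv {n : ℕ} (P : Fin (n + 1) → ℕ) {F₀ : Set (U →ₗ[k] k)}
    {F : Fin n → Set (U →ₗ[k] k)} {w₀ : U →ₗ[k] V} {w : Fin n → U →ₗ[k] V} (h₀ : Approx F₀ w₀)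
    (h : ∀ i, Approx (F i) (w i)) :
    Approx {φ | ∃ φ₀ ∈ F₀, ∃ χ : Fin n → U →ₗ[k] k, (∀ i, χ i ∈ F i) ∧
      φ = dualComp (C.decomp n P) φ₀ χ} (conv C B n P (cons w₀ w)) := by
  classical
  intro T
  choose s hs using conv_local C B n P
  let T' := T.biUnion s
  obtain ⟨w₀', h₀', h₀T⟩ := h₀ T'
  choose w' hw' hT using fun i => h i T'
  refine ⟨BoxOperads.conv C B n P (cons w₀' w'), ?_, fun u hu => ?_⟩
  · refine multilinear_mem_span (BoxOperads.conv C B n P) (cons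
      {z : U →ₗ[k] V | ∃ φ ∈ F₀, ∃ v, z = φ.smulRight v}
      fun i => {z : U →ₗ[k] V | ∃ φ ∈ F i, ∃ v, z = φ.smulRight v}) _ ?_ _ ?_
    · intro x hx
      obtain ⟨φ₀, hφ₀, v₀, hx₀⟩ := hx 0
      choose φ hφ v hxv using fun i : Fin n => hx i.succ
      have : x = cons (φ₀.smulRight v₀) fun i => (φ i).smulRight (v i) := by
        funext i; exact Fin.cases hx₀ (fun i => hxv i) i
      rw [this, conv_rankOne]
      exact Submodule.subset_span ⟨_, ⟨φ₀, hφ₀, φ, hφ, rfl⟩, _, rfl⟩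
    · intro i
      exact Fin.cases h₀' (fun i => hw' i) i
  · refine hs u _ _ fun i v hv => ?_
    have hv' : v ∈ T' := mem_biUnion.2 ⟨u, hu, hv⟩
    exact Fin.cases (h₀T v hv') (fun i => hT i v hv') i

lemma approx_comp_proj (w : U →ₗ[k] V) (α : Colour) :
    Approx {φ | ∃ ψ : U →ₗ[k] k, φ = ψ ∘ₗ LinearMap.id ∘ₗ C.proj α} (w ∘ₗ C.proj α) := by
  refine (approx_coord C _).mono ?_
  rintro φ ⟨a, ha, rfl⟩
  refine ⟨C.hbasis.coord a, C.linear_ext fun β e x hx => ?_⟩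
  simp only [comp_apply, LinearMap.id_apply]
  rw [C.proj_apply α hx]
  split_ifs with h
  · rfl
  · rw [map_zero]
    refine C.hbasis_repr_of_ne a hx fun h' => ?_
    rw [comp_apply, C.proj_apply α (C.hbasis_mem a)] at ha
    refine h ?_
    rw [show β = a.1.1 from congrArg Prod.fst h']
    by_contra h''
    exact ha (by rw [if_neg h'', map_zero])

/-- To check that a family of operators is locally finite, homogeneous elements suffice. -/
lemma LFO.of_homogeneous (M : DgModule k U) {I : Type*} {V' : Type*} [AddCommGroup V']
    [Module k V'] {E : I → (U →ₗ[k] V) →ₗ[k] (U →ₗ[k] V')} (loc : ∀ i, Local (E i))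
    (fin : ∀ α e, ∀ c ∈ M.piece α e, {i | ∃ X, E i X c ≠ 0}.Finite) : LFO E where
  loc := loc
  fin c := by
    classical
    have hc : c ∈ ⨆ i : Colour × ℤ, M.piece i.1 i.2 := by
      rw [M.internal.submodule_iSup_eq_top]; trivial
    induction hc using Submodule.iSup_induction' with
    | mem i x hx =>
      refine ⟨(fin _ _ x hx).toFinset, fun j hj X => ?_⟩
      by_contra h
      exact hj ((fin _ _ x hx).mem_toFinset.2 ⟨X, h⟩)
    | zero => exact ⟨∅, by simp⟩
    | add x y _ _ hx hy =>
      obtain ⟨s, hs⟩ := hx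
      obtain ⟨t, ht⟩ := hy
      refine ⟨s ∪ t, fun i hi X => ?_⟩
      rw [Finset.mem_union, not_or] at hi
      rw [map_add, hs i hi.1, ht i hi.2, add_zero]

end Approx

section Columns

/-- The convolution along a stacking of one and the same map in all boxes. -/
def col (C : DgBoxCooperad k U) (B : DgBoxOperad k V) (g : U →ₗ[k] V) : Stack → (U →ₗ[k] V)
  | .leaf => unitH C B
  | .box p r n a c => conv C B n (Stack.profile n a c)
      (cons (g ∘ₗ C.proj (p, n, r)) fun i => col C B g (c i))

lemma convolve_const (C : DgBoxCooperad k U) (B : DgBoxOperad k V) (g : U →ₗ[k] V) (S : Stack)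
    (s : ℕ) : convolve C B (fun _ => g) S s = col C B g S := by
  induction S generalizing s with
  | leaf => rfl
  | box p r n a c ih =>
    simp only [convolve, col, conv_apply, ih]

lemma approx_col (C : DgBoxCooperad k U) (B : DgBoxOperad k V) (g : U →ₗ[k] V) (S : Stack) :
    Approx (C.words LinearMap.id S) (col C B g S) := by
  induction S with
  | leaf =>
    intro T
    exact ⟨_, Submodule.subset_span ⟨_, rfl, _, rfl⟩, fun _ _ => rfl⟩
  | box p r n a c ih =>
    refine (Approx.conv _ (approx_comp_proj g (p, n, r)) ih).mono ?_
    rintro φ ⟨_, ⟨ψ, rfl⟩, χ, hχ, rfl⟩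
    exact ⟨ψ, χ, hχ, rfl⟩

/-- The colours of a column. -/
lemma col_suppOn (C : DgBoxCooperad k U) (B : DgBoxOperad k V) (g : U →ₗ[k] V) {S : Stack} :
    SuppOn C (fun α => α.1 = S.left ∧ α.2.2 = S.right) (col C B g S) := by
  cases S with
  | leaf => exact unitH_suppOn.mono fun α h => by simp [h, Stack.left, Stack.right]
  | box p r n a c =>
    refine (conv_suppOn (C := C) (B := B) n _ (cons (g ∘ₗ C.proj (p, n, r)) fun i =>
      col C B g (c i)) (· = (p, n, r)) (fun _ _ => True) (SuppOn.proj g _)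
      (fun _ _ _ _ _ h => absurd trivial h)).mono ?_
    rintro α ⟨p', r', q, h1, -, rfl⟩
    simp only [Prod.mk.injEq, true_and] at h1
    obtain ⟨rfl, rfl⟩ := h1
    cases n <;> exact ⟨rfl, rfl⟩

lemma col_isEven {C : DgBoxCooperad k U} {B : DgBoxOperad k V} {g : U →ₗ[k] V}
    (hg : IsEven C B g) (S : Stack) : IsEven C B (col C B g S) := by
  induction S with
  | leaf => exact unitH_isEven
  | box p r n a c ih =>
    exact conv_isEven _ _ _ fun i => Fin.cases (fun α e _ hx => hg α e _ (C.proj_mem _ hx)) ih i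

end Columns

section Finiteness

lemma dualComp_counit_top (C : DgBoxCooperad k U) (n : ℕ) (φ : U →ₗ[k] k) :
    dualComp (C.decomp n fun _ => 0) φ (fun _ => C.counit) = φ ∘ₗ C.filter fun α => α.2.1 = n := by
  refine C.linear_ext fun α e c hc => ?_
  rw [comp_apply, C.filter_apply _ hc]
  obtain ⟨P, Q, R⟩ := α
  split_ifs with h
  · obtain rfl : Q = n := h
    exact C.counit_right P Q R e c hc φ
  · rw [map_zero]
    refine (Submodule.mem_bot k).1 (conv_induction (C := C) n (fun _ => 0) hc ⊥
      (PiTensorProduct.lift ((mkPiAlgebra k (Fin (n + 1)) k).compLinearMap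
        (cons (α := fun _ => U →ₗ[k] k) φ fun _ => C.counit)))
      fun p' r' q ε x h1 h2 h3 h4 h5 h6 => ?_)
    rw [Submodule.mem_bot, PiTensorProduct.lift.tprod, compLinearMap_apply,
      mkPiAlgebra_apply, prod_univ_succ]
    have : ∃ i, q i ≠ 1 := by
      by_contra hq
      push Not at hq
      apply h
      simp only
      rw [← h2]
      simp [hq]
    obtain ⟨i, hi⟩ := this
    rw [Finset.prod_eq_zero (mem_univ i), mul_zero]
    simp only [cons_succ]
    exact C.counit_zero _ _ _ (h6 i) (Or.inl fun h' => hi (congrArg (fun z => z.2.1) h'))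

namespace Stack

/-- A single box. -/
def corolla (α : Colour) : Stack := box α.1 α.2.2 α.2.1 0 fun _ => leaf

lemma left_corolla (α : Colour) : (corolla α).left = α.1 := by
  obtain ⟨p, q, r⟩ := α
  cases q <;> rfl

lemma right_corolla (α : Colour) : (corolla α).right = α.2.2 := by
  obtain ⟨p, q, r⟩ := α
  cases q <;> rfl

lemma profile_leaf (n : ℕ) : profile n 0 (fun _ => leaf) = fun _ => 0 := by
  cases n with
  | zero => rfl
  | succ n => funext i; exact Fin.cases rfl (fun _ => rfl) i

lemma valid_corolla (α : Colour) : (corolla α).Valid :=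
  ⟨fun _ => trivial, fun _ => rfl, fun _ _ _ => rfl⟩

end Stack

lemma coord_mem_words (C : DgBoxCooperad k U) (a : C.HIndex) :
    C.hbasis.coord a ∈ C.words LinearMap.id (Stack.corolla a.1.1) := by
  refine ⟨C.hbasis.coord a, fun _ => C.counit, fun _ => rfl, ?_⟩
  rw [Stack.profile_leaf, dualComp_counit_top]
  refine C.linear_ext fun α e x hx => ?_
  simp only [comp_apply, LinearMap.id_apply]
  rw [C.filter_apply _ hx]
  have h0 : α ≠ a.1.1 → C.hbasis.coord a x = 0 := fun h =>
    C.hbasis_repr_of_ne a hx fun h' => h (congrArg Prod.fst h')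
  split_ifs with h
  · rw [C.proj_apply _ hx]
    split_ifs with h'
    · rfl
    · rw [map_zero, h0 h']
  · rw [map_zero, map_zero]
    exact h0 fun h' => h (by rw [h'])

/-- The colours which are neither semi-thin nor `(0, 0, 0)`. -/
def TameColour (α : Colour) : Prop :=
  (α.1 = 0 ∧ α.2.2 = 0 ∧ 0 < α.2.1) ∨ (0 < α.1 ∧ 0 < α.2.2)

/-- Rows of boxes, given by the number of boxes, the number of strands if this is zero, and the
boxes with the stackings on top of them. -/
abbrev Row : Type := Σ n : ℕ, ℕ × (Fin n → Stack)

namespace Row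

/-- The row of the stackings on the bottom box. -/
def ofStack : Stack → Row
  | .leaf => ⟨0, 0, fun _ => .leaf⟩
  | .box _ _ n a c => ⟨n, a, c⟩

/-- The stacking with a given bottom box. -/
def onBox (ρ : Row) (p r : ℕ) : Stack := .box p r ρ.1 ρ.2.1 ρ.2.2

lemma ofStack_onBox (ρ : Row) (p r : ℕ) : ofStack (ρ.onBox p r) = ρ := rfl

/-- The horizontal labels. -/
def labels (ρ : Row) : Fin (ρ.1 + 1) → ℕ := Stack.profile ρ.1 ρ.2.1 ρ.2.2

/-- The labels match, and all boxes have horizontal inputs and outputs. -/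
def Good (ρ : Row) : Prop := (ρ.onBox 0 0).Valid ∧ ∀ i, (ρ.2.2 i).AllNonThin

end Row

/-- The convolution along a row, as an operator on maps in the bottom box. -/
def rowOp (C : DgBoxCooperad k U) (B : DgBoxOperad k V) (g : U →ₗ[k] V) (ρ : Row) :
    (U →ₗ[k] V) →ₗ[k] (U →ₗ[k] V) := convB C B ρ.1 ρ.labels fun i => col C B g (ρ.2.2 i)

variable (C : ConilpotentDgBoxCooperad k U) (B : DgBoxOperad k V)

lemma conv_bottom_proj {n : ℕ} (P : Fin (n + 1) → ℕ) {p q r : ℕ} {e : ℤ} {c : U}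
    (hc : c ∈ C.piece (p, q, r) e) (X : U →ₗ[k] V) (w : Fin n → U →ₗ[k] V) :
    conv C B n P (cons X w) c = conv C B n P
      (cons (X ∘ₗ C.proj (p - P 0, n, r - P (Fin.last n))) w) c := by
  refine conv_congr n P hc _ _ (fun p' r' e' h1 h2 x hx => ?_) fun i q e _ x _ => rfl
  simp only [cons_zero, comp_apply]
  rw [C.proj_apply _ hx, if_pos]
  rw [← h1, ← h2]; simp

lemma lfo_rowOp (g : U →ₗ[k] V) : LFO fun ρ : {ρ : Row // ρ.Good} => rowOp C B g ρ := by
  refine LFO.of_homogeneous C.toDgModule (fun ρ => local_convB _ _ _) ?_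
  rintro ⟨p, q, r⟩ e c hc
  refine Set.Finite.of_finite_image (f := fun ρ => (ρ : Row)) ?_ Subtype.val_injective.injOn
  refine ((C.finite_words hc).image Row.ofStack).subset ?_
  rintro _ ⟨⟨ρ, hρ⟩, ⟨X, hX⟩, rfl⟩
  obtain ⟨n, a, cs⟩ := ρ
  simp only [rowOp, convB_apply] at hX
  rw [conv_bottom_proj C B _ hc] at hX
  obtain ⟨φ, ⟨_, ⟨ψ, rfl⟩, χ, hχ, rfl⟩, hne⟩ := (Approx.conv _
    (approx_comp_proj X _) fun i => approx_col C.toDgBoxCooperad B g (cs i)).exists_ne hX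
  exact ⟨Row.onBox ⟨n, a, cs⟩ (p - Row.labels ⟨n, a, cs⟩ 0)
    (r - Row.labels ⟨n, a, cs⟩ (Fin.last n)), ⟨hρ.1, ⟨_, _, _, _, _, rfl, hρ.2⟩, _, ⟨ψ, χ, hχ, rfl⟩, hne⟩, rfl⟩

lemma rowFinite {y : U →ₗ[k] V} (hy : SuppOn C TameColour y) : RowFinite C B y := by
  refine LFO.of_homogeneous C.toDgModule (fun ρ => local_convB _ _ _) ?_
  rintro ⟨p, q, r⟩ e c hc
  have hfin : {ν : Labels | ν.1 ≤ q ∧ ν.2 = fun _ => 0}.Finite := by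
    refine ((Set.finite_Iic q).image fun n => (⟨n, fun _ => 0⟩ : Labels)).subset ?_
    rintro ⟨n, P⟩ ⟨h1, h2⟩
    exact ⟨n, h1, by simp only at h2; rw [h2]⟩
  refine (hfin.union ((C.finite_words hc).image fun S =>
    (⟨(Row.ofStack S).1, (Row.ofStack S).labels⟩ : Labels))).subset ?_
  rintro ⟨n, P⟩ ⟨X, hX⟩
  simp only [convB_apply] at hX
  have hne : conv C.toDgBoxCooperad B n P (cons X fun _ => y) ≠ 0 := fun h => hX (by rw [h]; rfl)
  have hends : ∀ i : Fin n, P i.castSucc = 0 ↔ P i.succ = 0 := by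
    intro i
    by_contra h
    refine hne (conv_eq_zero_of_top n P _ i fun q e x hx => hy _ _ x hx ?_)
    simp only [TameColour]
    omega
  have hall : ∀ i, P i = 0 ↔ P 0 = 0 := fun i => by
    induction i using Fin.induction with
    | zero => rfl
    | succ i ih => rw [← hends, ih]
  by_cases h0 : P 0 = 0
  · left
    refine ⟨?_, funext fun i => (hall i).2 h0⟩
    by_contra hlt
    refine hX (conv_suppOn (C := C.toDgBoxCooperad) (B := B) n P (cons X fun _ => y)
      (fun _ => True) (fun _ => TameColour) (fun _ _ _ _ h => absurd trivial h) (fun _ => hy)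
      _ _ c hc ?_)
    rintro ⟨p', r', q', -, hq', h⟩
    simp only [Prod.mk.injEq] at h
    refine hlt ?_
    have h1 : ∀ i ∈ univ, 1 ≤ q' i := fun i _ => by
      have := hq' i
      have h3 := (hall i.castSucc).2 h0
      simp only [TameColour] at this
      omega
    have : n ≤ ∑ i, q' i := by simpa using Finset.card_nsmul_le_sum univ q' 1 h1
    exact this.trans h.2.1.ge
  · right
    rw [← conv_restr, conv_bottom_proj C B _ hc] at hX
    obtain ⟨φ, ⟨_, ⟨ψ, rfl⟩, χ, hχ, rfl⟩, hne'⟩ := (Approx.conv _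
      (approx_comp_proj X _) fun i => approx_coord C.toDgModule
        (restr C (P i.castSucc) (P i.succ) y)).exists_ne hX
    choose a ha hχa using hχ
    have hcol : ∀ i, HasEnds (P i.castSucc) (P i.succ) (a i).1.1 := fun i => by
      by_contra h
      exact ha i (SuppOn.filter (M := C.toDgModule) y _ _ _ (C.hbasis_mem (a i)) h)
    have hprof : Stack.profile n (if n = 0 then P 0 else 0) (fun i => Stack.corolla (a i).1.1) = P := by
      cases n with
      | zero =>
        funext i
        exact Fin.cases rfl (fun i => i.elim0) i
      | succ n =>
        funext i
        refine Fin.cases ?_ (fun i => ?_) i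
        · exact (Stack.left_corolla _).trans (hcol 0).1
        · exact (Stack.right_corolla _).trans (hcol i).2
    refine ⟨.box (p - P 0) (r - P (Fin.last n)) n (if n = 0 then P 0 else 0)
      fun i => Stack.corolla (a i).1.1, ⟨⟨fun i => Stack.valid_corolla _, fun h => if_neg h.ne',
        fun i j hij => ?_⟩, ⟨_, _, _, _, _, rfl, fun i => ⟨?_, ?_, fun _ => trivial⟩⟩,
        dualComp (C.decomp n P) (ψ ∘ₗ LinearMap.id ∘ₗ C.proj (p - P 0, n, r - P (Fin.last n))) χ,
        ⟨ψ, χ, fun i => ?_, by rw [hprof]⟩, hne'⟩, ?_⟩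
    · rw [Stack.right_corolla, Stack.left_corolla, (hcol i).2, (hcol j).1]
      congr 1
      exact Fin.ext (by simpa using hij)
    · rw [(hcol i).1]
      exact Nat.pos_of_ne_zero fun h => h0 ((hall _).1 h)
    · rw [(hcol i).2]
      exact Nat.pos_of_ne_zero fun h => h0 ((hall _).1 h)
    · rw [hχa i]
      exact coord_mem_words _ (a i)
    · simp only [Row.ofStack, Row.labels, hprof]

/-- The columns of boxes with horizontal inputs and outputs. -/
abbrev Column : Type := {S : Stack // S.Valid ∧ S.AllNonThin}

/-- The sum over all columns. -/
def columns (g : U →ₗ[k] V) : U →ₗ[k] V :=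
  locallyFiniteSum fun S : Column => col C B g S

lemma hasLSum_columns (g : U →ₗ[k] V) :
    HasLSum (fun S : Column => col C B g S) (columns C B g) := by
  refine hasLSum_locallyFiniteSum fun c => ?_
  have hfin : {S : Column | col C B g S c ≠ 0}.Finite := by
    refine Set.Finite.of_finite_image (f := fun S => (S : Stack)) ?_ Subtype.val_injective.injOn
    refine (C.conilpotent c).subset ?_
    rintro _ ⟨⟨S, hS⟩, hne, rfl⟩
    obtain ⟨φ, hφ, hne'⟩ := (approx_col C.toDgBoxCooperad B g S).exists_ne hne
    exact ⟨hS.1, fun h0 => hne' (C.words_eq_zero _ (C.words_reduce hS.2 hφ) h0)⟩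
  refine ⟨hfin.toFinset, fun S hS => ?_⟩
  by_contra h
  exact hS (hfin.mem_toFinset.2 h)

end Finiteness

namespace Stack

/-- `F` is the lower part of a stacking `S`: some of the stackings on top of the inputs of boxes are
removed, and also some of the upper strands in degenerate spaces. -/
inductive Prefix : Stack → Stack → Prop
  | leaf (S : Stack) : Prefix leaf S
  | box {p r n a a' : ℕ} {c c' : Fin n → Stack} (h : ∀ i, Prefix (c i) (c' i))
      (ha : n = 0 → a ≤ a') : Prefix (box p r n a c) (box p r n a' c')

namespace Prefix

lemma refl (S : Stack) : Prefix S S := by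
  induction S with
  | leaf => exact .leaf _
  | box p r n a c ih => exact .box ih fun _ => le_rfl

lemma trans {F G S : Stack} (h : Prefix F G) (h' : Prefix G S) : Prefix F S := by
  induction h generalizing S with
  | leaf => exact .leaf _
  | box h ha ih =>
    cases h' with
    | box h' ha' => exact .box (fun i => ih i (h' i)) fun hn => (ha hn).trans (ha' hn)

lemma antisymm {F S : Stack} (h : Prefix F S) (h' : Prefix S F) (hF : F.Valid) (hS : S.Valid) :
    F = S := by
  induction h with
  | leaf => cases h'; rfl
  | @box p r n a a' c c' h ha ih =>
    cases h' with
    | box h' ha' =>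
      obtain rfl : c = c' := funext fun i => ih i (h' i) (hF.1 i) (hS.1 i)
      obtain rfl : a = a' := by
        rcases Nat.eq_zero_or_pos n with h0 | h0
        · exact le_antisymm (ha h0) (ha' h0)
        · rw [hF.2.1 h0, hS.2.1 h0]
      rfl

lemma left_right_le {F S : Stack} (h : Prefix F S) : F.left ≤ S.left ∧ F.right ≤ S.right := by
  induction h with
  | leaf => exact ⟨Nat.zero_le _, Nat.zero_le _⟩
  | @box p r n a a' c c' h ha ih =>
    cases n with
    | zero => exact ⟨Nat.add_le_add_left (ha rfl) _, Nat.add_le_add_left (ha rfl) _⟩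
    | succ n => exact ⟨Nat.add_le_add_left (ih 0).1 _, Nat.add_le_add_left (ih (Fin.last n)).2 _⟩

lemma left_le {F S : Stack} (h : Prefix F S) : F.left ≤ S.left := h.left_right_le.1

lemma right_le {F S : Stack} (h : Prefix F S) : F.right ≤ S.right := h.left_right_le.2

lemma profile_le {n a a' : ℕ} {c c' : Fin n → Stack} (h : ∀ i, Prefix (c i) (c' i))
    (ha : n = 0 → a ≤ a') (i : Fin (n + 1)) : profile n a c i ≤ profile n a' c' i := by
  cases n with
  | zero => exact ha rfl
  | succ n => exact Fin.cases (h 0).left_le (fun i => (h i).right_le) i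

lemma allNonThin {F S : Stack} (h : Prefix F S) (hS : S.AllNonThin) : F.AllNonThin := by
  induction h with
  | leaf => trivial
  | box h ha ih => exact ⟨hS.1, hS.2.1, fun i => ih i (hS.2.2 i)⟩

lemma box_of_left_le {p r n a a' : ℕ} {c c' s : Fin n → Stack}
    (hs : ∀ i F F', Prefix F (s i) → Prefix F' (s i) → F.Valid → F'.Valid → F.left ≤ F'.left →
      Prefix F F') (hc : ∀ i, Prefix (c i) (s i)) (hc' : ∀ i, Prefix (c' i) (s i))
    (hv : (Stack.box p r n a c).Valid) (hv' : (Stack.box p r n a' c').Valid)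
    (hl : (Stack.box p r n a c).left ≤ (Stack.box p r n a' c').left) :
    Prefix (.box p r n a c) (.box p r n a' c') := by
  have key : ∀ (i : ℕ) (hi : i < n), Prefix (c ⟨i, hi⟩) (c' ⟨i, hi⟩) := by
    intro i
    induction i with
    | zero =>
      intro hi
      obtain ⟨n, rfl⟩ := Nat.exists_eq_succ_of_ne_zero hi.ne'
      exact hs _ _ _ (hc _) (hc' _) (hv.1 _) (hv'.1 _) (Nat.le_of_add_le_add_left hl)
    | succ i ih =>
      intro hi
      refine hs _ _ _ (hc _) (hc' _) (hv.1 _) (hv'.1 _) ?_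
      rw [← hv.2.2 ⟨i, by omega⟩ ⟨i + 1, hi⟩ rfl, ← hv'.2.2 ⟨i, by omega⟩ ⟨i + 1, hi⟩ rfl]
      exact (ih _).right_le
  refine .box (fun i => key i i.2) fun h0 => ?_
  subst h0
  exact Nat.le_of_add_le_add_left hl

lemma of_left_le {S F F' : Stack} (hS : S.AllNonThin) (h : Prefix F S) (h' : Prefix F' S)
    (hF : F.Valid) (hF' : F'.Valid) (hl : F.left ≤ F'.left) : Prefix F F' := by
  induction S generalizing F F' with
  | leaf => cases h; exact .leaf _
  | box p r n a s ih =>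
    cases h with
    | leaf => exact .leaf _
    | @box _ _ _ a₁ _ c _ hc ha =>
      cases h' with
      | leaf =>
        exfalso
        have : p ≤ (Stack.box p r n a₁ c).left := by cases n <;> simp [left]
        have := hS.1
        simp only [left] at hl
        omega
      | box hc' ha' =>
        exact box_of_left_le (fun i F F' h h' hF hF' hl => ih i (hS.2.2 i) h h' hF hF' hl)
          hc hc' hF hF' hl

end Prefix

lemma left_pos {S : Stack} (hS : S.AllNonThin) (h : S ≠ leaf) : 0 < S.left := by
  cases S with
  | leaf => exact absurd rfl h
  | box p r n a c => have := hS.1; cases n <;> simp only [left] <;> omega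

lemma right_pos {S : Stack} (hS : S.AllNonThin) (h : S ≠ leaf) : 0 < S.right := by
  cases S with
  | leaf => exact absurd rfl h
  | box p r n a c => have := hS.2.1; cases n <;> simp only [right] <;> omega

lemma profile_castSucc {p r n a : ℕ} {c : Fin n → Stack} (h : (box p r n a c).Valid) (i : Fin n) :
    profile n a c i.castSucc = (c i).left := by
  cases n with
  | zero => exact i.elim0
  | succ n =>
    refine Fin.cases rfl (fun i => ?_) i
    exact h.2.2 i.castSucc i.succ (by simp)

lemma profile_succ {n a : ℕ} {c : Fin n → Stack} (i : Fin n) :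
    profile n a c i.succ = (c i).right := by
  cases n with
  | zero => exact i.elim0
  | succ n => rfl

end Stack

namespace Row

/-- The prefix order on rows. -/
def Prefix (ρ σ : Row) : Prop := Stack.Prefix (ρ.onBox 0 0) (σ.onBox 0 0)

/-- The left label of a row. -/
def left (ρ : Row) : ℕ := (ρ.onBox 0 0).left

lemma prefix_refl (ρ : Row) : ρ.Prefix ρ := Stack.Prefix.refl _

lemma Prefix.trans {ρ σ τ : Row} (h : ρ.Prefix σ) (h' : σ.Prefix τ) : ρ.Prefix τ :=
  Stack.Prefix.trans h h'

lemma Prefix.antisymm {ρ σ : Row} (h : ρ.Prefix σ) (h' : σ.Prefix ρ) (hρ : ρ.Good)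
    (hσ : σ.Good) : ρ = σ := by
  have := Stack.Prefix.antisymm h h' hρ.1 hσ.1
  rw [← ρ.ofStack_onBox 0 0, this, ofStack_onBox]

lemma Prefix.good {ρ σ : Row} (h : ρ.Prefix σ) (hv : (ρ.onBox 0 0).Valid) (hσ : σ.Good) :
    ρ.Good := by
  obtain ⟨n, a, c⟩ := ρ
  obtain ⟨m, b, d⟩ := σ
  refine ⟨hv, ?_⟩
  change Stack.Prefix (.box 0 0 n a c) (.box 0 0 m b d) at h
  cases h with
  | box h ha => exact fun i => (h i).allNonThin (hσ.2 i)

lemma Prefix.of_left_le {ρ ρ' σ : Row} (hσ : σ.Good) (h : ρ.Prefix σ) (h' : ρ'.Prefix σ)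
    (hρ : ρ.Good) (hρ' : ρ'.Good) (hl : ρ.left ≤ ρ'.left) : ρ.Prefix ρ' := by
  obtain ⟨n, a, c⟩ := ρ
  obtain ⟨n', a', c'⟩ := ρ'
  obtain ⟨m, b, d⟩ := σ
  change Stack.Prefix (.box 0 0 n a c) (.box 0 0 m b d) at h
  change Stack.Prefix (.box 0 0 n' a' c') (.box 0 0 m b d) at h'
  cases h with
  | box h ha =>
    cases h' with
    | box h' ha' =>
      exact Stack.Prefix.box_of_left_le (fun i F F' h h' hF hF' hl =>
        Stack.Prefix.of_left_le (hσ.2 i) h h' hF hF' hl) h h' hρ.1 hρ'.1 hl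

/-- A nonempty row without proper nonempty prefixes. -/
def Atomic (ρ : Row) : Prop :=
  0 < ρ.left ∧ ∀ ρ' : Row, ρ'.Good → ρ'.Prefix ρ → 0 < ρ'.left → ρ' = ρ

lemma exists_atomic {σ : Row} (hσ : σ.Good) (h : 0 < σ.left) :
    ∃ ρ : Row, ρ.Good ∧ ρ.Atomic ∧ ρ.Prefix σ := by
  classical
  have hex : ∃ l, ∃ ρ : Row, ρ.Good ∧ ρ.Prefix σ ∧ 0 < ρ.left ∧ ρ.left = l :=
    ⟨_, σ, hσ, σ.prefix_refl, h, rfl⟩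
  obtain ⟨ρ, h1, h2, h3, h4⟩ := Nat.find_spec hex
  refine ⟨ρ, h1, ⟨h3, fun ρ' g1 g2 g3 => ?_⟩, h2⟩
  have hmin := Nat.find_min' hex ⟨ρ', g1, g2.trans h2, g3, rfl⟩
  exact g2.antisymm (Prefix.of_left_le hσ h2 (g2.trans h2) h1 g1 (h4.trans_le hmin)) g1 h1

lemma atomic_unique {ρ ρ' σ : Row} (hσ : σ.Good) (h1 : ρ.Good) (h1' : ρ'.Good) (h2 : ρ.Atomic)
    (h2' : ρ'.Atomic) (h3 : ρ.Prefix σ) (h3' : ρ'.Prefix σ) : ρ = ρ' := by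
  rcases le_total ρ.left ρ'.left with h | h
  · exact h2'.2 ρ h1 (Prefix.of_left_le hσ h3 h3' h1 h1' h) h2.1
  · exact (h2.2 ρ' h1' (Prefix.of_left_le hσ h3' h3 h1' h1 h) h2'.1).symm

/-- The row of `n` inputs without boxes. -/
def trivial (n : ℕ) : Row := ⟨n, 0, fun _ => .leaf⟩

lemma trivial_good (n : ℕ) : (trivial n).Good :=
  ⟨⟨fun _ => True.intro, fun _ => rfl, fun _ _ _ => rfl⟩, fun _ => True.intro⟩

lemma left_trivial (n : ℕ) : (trivial n).left = 0 := by cases n <;> rfl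

lemma trivial_prefix_iff {n : ℕ} {σ : Row} : (trivial n).Prefix σ ↔ σ.1 = n := by
  obtain ⟨m, b, d⟩ := σ
  constructor
  · intro h
    change Stack.Prefix (.box 0 0 n 0 fun _ => .leaf) (.box 0 0 m b d) at h
    cases h with
    | box h ha => rfl
  · rintro rfl
    exact .box (fun i => .leaf _) fun _ => Nat.zero_le _

lemma eq_trivial {ρ : Row} (hρ : ρ.Good) (h : ρ.left = 0) : ρ = trivial ρ.1 := by
  obtain ⟨n, a, c⟩ := ρ
  have hprof : ∀ i, Stack.profile n a c i = 0 := by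
    intro i
    induction i using Fin.induction with
    | zero =>
      cases n with
      | zero => exact (Nat.zero_add _).symm.trans h
      | succ n => exact (Nat.zero_add _).symm.trans h
    | succ i ih =>
      rw [Stack.profile_castSucc hρ.1] at ih
      rw [Stack.profile_succ]
      by_contra hne
      have : c i = .leaf := by
        by_contra h'
        exact (Stack.left_pos (hρ.2 i) h').ne' ih
      rw [this] at hne
      exact hne rfl
  have hc : c = fun _ => .leaf := funext fun i => by
    by_contra h'
    have := hprof i.castSucc
    rw [Stack.profile_castSucc hρ.1] at this
    exact (Stack.left_pos (hρ.2 i) h').ne' this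
  have ha : a = 0 := by
    cases n with
    | zero => exact hprof 0
    | succ n => exact hρ.1.2.1 n.succ_pos
  rw [hc, ha]
  rfl

end Row

section Sums

lemma DgModule.filter_congr (M : DgModule k U) {P Q : Colour → Prop} [DecidablePred P]
    [DecidablePred Q] (h : ∀ α, P α ↔ Q α) : M.filter P = M.filter Q :=
  M.linear_ext fun α e x hx => by rw [M.filter_apply P hx, M.filter_apply Q hx]; simp only [h]

/-- Even maps concentrated in the non-thin colours. -/
structure IsNonThin (C : DgBoxCooperad k U) (B : DgBoxOperad k V) (φ : U →ₗ[k] V) : Prop where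
  even : IsEven C B φ
  supp : SuppOn C (fun α => 0 < α.1 ∧ 0 < α.2.2) φ

variable (C : ConilpotentDgBoxCooperad k U) (B : DgBoxOperad k V) {φ : U →ₗ[k] V}

lemma HasLSum.sum_of_lfo {I : Type*} {E : I → (U →ₗ[k] V) →ₗ[k] (U →ₗ[k] V)} (h : LFO E)
    (X : U →ₗ[k] V) : ∃ Z, HasLSum (fun i => E i X) Z := ⟨_, h.hasLSum X⟩

/-- The sum over a family which is the union of the families obtained by applying an operator to
the members of another one. -/
lemma HasLSum.of_fibers {I J : Type*} {β : J → Type*} {E : I → U →ₗ[k] V} {Z : U →ₗ[k] V}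
    (hZ : HasLSum E Z) {e : (Σ j, β j) → I} (he : Bijective e)
    {O : (U →ₗ[k] V) →ₗ[k] (U →ₗ[k] V)} (hO : Local O) {F : J → U →ₗ[k] V} {f : U →ₗ[k] V}
    (hF : HasLSum F f) (h : ∀ j, HasLSum (fun b => E (e ⟨j, b⟩)) (O (F j))) :
    HasLSum E (O f) := by
  have h1 := (HasLSum.comp_equiv (Equiv.ofBijective e he)).2 hZ
  have h2 := HasLSum.sigma (G := fun j => O (F j)) h1 h
  rwa [h2.unique (HasLSum.local_map hO hF)] at hZ

lemma columns_even (hφ : IsEven C B φ) : IsEven C B (columns C B φ) := by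
  rw [isEven_iff]
  exact HasDeg.hasLSum (hasLSum_columns C B φ) fun S => isEven_iff.1 (col_isEven hφ S)

lemma col_tame {S : Stack} (hS : S.AllNonThin) (g : U →ₗ[k] V) :
    SuppOn C TameColour (col C B g S) := by
  cases S with
  | leaf => exact unitH_suppOn.mono fun α h => by simp [h, TameColour]
  | box p r n a c =>
    refine (col_suppOn C B g).mono fun α h => Or.inr ?_
    rw [h.1, h.2]
    exact ⟨Stack.left_pos hS (by simp), Stack.right_pos hS (by simp)⟩

lemma columns_tame (g : U →ₗ[k] V) : SuppOn C TameColour (columns C B g) :=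
  SuppOn.hasLSum (hasLSum_columns C B g) fun S => col_tame C B S.2.2 g

lemma rowFinite_columns (g : U →ₗ[k] V) : RowFinite C B (columns C B g) :=
  rowFinite C B (columns_tame C B g)

lemma hasLSum_filter_ends (X : U →ₗ[k] V) : HasLSum (fun lr : ℕ × ℕ => restr C lr.1 lr.2 X) X := by
  refine (hasLSum_filter C (fun α => (α.1, α.2.2)) X).congr fun lr => ?_
  rw [restr, C.filter_congr (P := HasEnds lr.1 lr.2) (Q := fun α => (α.1, α.2.2) = lr)
    fun α => by rw [HasEnds, Prod.ext_iff]]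

lemma rows_unit {y : U →ₗ[k] V} (hy : IsEven C B y) (hT : RowFinite C B y) :
    rows C B y (unitH C B) = y := by
  let e : ℕ × ℕ → Labels := fun lr => ⟨1, ![lr.1, lr.2]⟩
  have he : Injective e := by
    rintro ⟨l, r⟩ ⟨l', r'⟩ h
    have h2 := eq_of_heq (Sigma.mk.inj h).2
    have h0 := congrFun h2 0
    have h1 := congrFun h2 1
    simp only [Matrix.cons_val_zero, Matrix.cons_val_one] at h0 h1
    rw [h0, h1]
  have h1 := hT.hasLSum (unitH C B)
  rw [← HasLSum.comp_injective he] at h1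
  · refine HasLSum.unique (h1.congr fun lr => ?_) (hasLSum_filter_ends C y)
    exact conv_unit_bottom lr.1 lr.2 y (isEven_iff.1 hy)
  · rintro ⟨n, P⟩ hn
    refine conv_eq_zero_of_bottom _ _ _ fun p r e x hx => ?_
    refine unitH_suppOn _ _ x hx fun h => hn ?_
    simp only [Prod.mk.injEq] at h
    obtain ⟨-, rfl, -⟩ := h
    have hP : (![P 0, P 1] : Fin 2 → ℕ) = P := by
      funext i
      fin_cases i <;> rfl
    exact ⟨(P 0, P 1), congrArg (fun z => (⟨1, z⟩ : Labels)) hP⟩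

lemma lfo_rowOp_of (g : U →ₗ[k] V) {p : Row → Prop} (hp : ∀ ρ, p ρ → ρ.Good) :
    LFO fun ρ : {ρ : Row // p ρ} => rowOp C B g ρ :=
  (lfo_rowOp C B g).subfamily (e := fun ρ : {ρ : Row // p ρ} => ⟨ρ, hp ρ ρ.2⟩) fun _ _ h =>
    Subtype.ext (congrArg (fun z : {ρ : Row // ρ.Good} => (z : Row)) h)

lemma Row.Prefix.fst_eq {ρ σ : Row} (h : ρ.Prefix σ) : σ.1 = ρ.1 := by
  obtain ⟨n, a, c⟩ := ρ
  obtain ⟨m, b, d⟩ := σ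
  change Stack.Prefix (.box 0 0 n a c) (.box 0 0 m b d) at h
  cases h
  rfl

lemma col_onBox (σ : Row) (p r : ℕ) : col C B φ (σ.onBox p r) =
    rowOp C B φ σ (φ ∘ₗ C.proj (p, σ.1, r)) := (convB_apply _ _ _ _).symm

/-- The columns on top of a column. -/
def ColumnExtends (F : Stack) : Prop :=
  HasLSum (fun S : {S : Column // Stack.Prefix F S} => col C B φ S)
    (rows C B (columns C B φ) (col C B φ F))

/-- The data of a row which extends the row with `n` boxes and stackings `c`. -/
abbrev RowExt (n : ℕ) (c : Fin n → Stack) : Type :=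
  (Fin (n + 1) → ℕ) × (∀ i : Fin n, {S : Column // Stack.Prefix (c i) S})

/-- The number of strands of an extension. -/
def RowExt.strands {n : ℕ} {c : Fin n → Stack} (a : ℕ) (b : RowExt n c) : ℕ :=
  if n = 0 then a + b.1 0 else 0

/-- The row of an extension. -/
def RowExt.row {n : ℕ} {c : Fin n → Stack} (a : ℕ) (b : RowExt n c) : Row :=
  ⟨n, b.strands a, fun i => (b.2 i).1.1⟩

/-- The labels of the row of an extension. -/
def RowExt.labels {n : ℕ} {c : Fin n → Stack} (a : ℕ) (b : RowExt n c) : Fin (n + 1) → ℕ :=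
  Stack.profile n (b.strands a) fun i => (b.2 i).1.1

/-- The extensions whose labels are shifted by the given numbers. -/
def RowExt.Fits {n : ℕ} {c : Fin n → Stack} (a : ℕ) (b : RowExt n c) : Prop :=
  (b.row a).Good ∧ ∀ i, b.labels a i = Stack.profile n a c i + b.1 i

lemma RowExt.prefix_row {n a : ℕ} {c : Fin n → Stack} (b : RowExt n c) :
    Row.Prefix ⟨n, a, c⟩ (b.row a) := by
  refine .box (fun i => (b.2 i).2) fun h => ?_
  show a ≤ RowExt.strands a b
  rw [RowExt.strands, if_pos h]
  omega

/-- The row of a fitting extension, as an extending row. -/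
def RowExt.toRow {n a : ℕ} {c : Fin n → Stack} (b : {b : RowExt n c // b.Fits a}) :
    {σ : Row // σ.Good ∧ Row.Prefix ⟨n, a, c⟩ σ} := ⟨b.1.row a, b.2.1, b.1.prefix_row⟩

lemma RowExt.toRow_bijective {n a : ℕ} {c : Fin n → Stack} :
    Bijective (RowExt.toRow (a := a) (c := c)) := by
  constructor
  · rintro ⟨⟨H, κ⟩, h1, h2⟩ ⟨⟨H', κ'⟩, h1', h2'⟩ h
    have h3 : RowExt.row a (H, κ) = RowExt.row a (H', κ') := congrArg (fun z => z.1) h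
    have h5 := eq_of_heq (Sigma.mk.inj h3).2
    have h4 := (Prod.mk.inj h5).2
    have hκ : κ = κ' := funext fun i => Subtype.ext (Subtype.ext (congrFun h4 i))
    subst hκ
    have hH : H = H' := funext fun i => by
      have e1 := h2 i
      have e2 := h2' i
      have e3 : RowExt.labels a (H, κ) = RowExt.labels a (H', κ) := by
        rw [RowExt.labels, RowExt.labels, (Prod.mk.inj h5).1]
      rw [e3] at e1
      exact Nat.add_left_cancel (e1.symm.trans e2)
    subst hH
    rfl
  · rintro ⟨⟨m, b, d⟩, hσ, hpre⟩
    have hpre' := hpre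
    change Stack.Prefix (.box 0 0 n a c) (.box 0 0 m b d) at hpre'
    cases hpre' with
    | @box _ _ _ _ _ _ d h ha =>
      have hle : ∀ i, Stack.profile n a c i ≤ Stack.profile n b d i := Stack.Prefix.profile_le h ha
      let b' : RowExt n c := (fun i => Stack.profile n b d i - Stack.profile n a c i,
        fun i => ⟨⟨d i, hσ.1.1 i, hσ.2 i⟩, h i⟩)
      have hs : RowExt.strands a b' = b := by
        unfold RowExt.strands
        split_ifs with h0
        · subst h0
          exact Nat.add_sub_of_le (ha rfl)
        · exact (hσ.1.2.1 (Nat.pos_of_ne_zero h0)).symm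
      have hrow : RowExt.row a b' = ⟨n, b, d⟩ := by
        rw [RowExt.row, hs]
      refine ⟨⟨b', by rw [hrow]; exact hσ, fun i => ?_⟩, Subtype.ext hrow⟩
      rw [RowExt.labels, hs]
      exact (Nat.add_sub_of_le (hle i)).symm

lemma rows_rowOp {n a : ℕ} {c : Fin n → Stack} (hφ : IsEven C B φ)
    (hρ : Row.Good ⟨n, a, c⟩) (hc : ∀ i, ColumnExtends C B (φ := φ) (c i)) (X : U →ₗ[k] V) :
    HasLSum (fun σ : {σ : Row // σ.Good ∧ Row.Prefix ⟨n, a, c⟩ σ} =>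
      rowOp C B φ σ X)
      (rows C B (columns C B φ) (rowOp C B φ ⟨n, a, c⟩ X)) := by
  obtain ⟨P, hP⟩ : ∃ P : Fin (n + 1) → ℕ, P = Stack.profile n a c := ⟨_, rfl⟩
  obtain ⟨Z, hZ⟩ := HasLSum.sum_of_lfo (lfo_rowOp_of C B φ
    (p := fun σ => σ.Good ∧ Row.Prefix ⟨n, a, c⟩ σ) fun ρ h => h.1) X
  have hZ' := (HasLSum.comp_equiv (Equiv.ofBijective _ (RowExt.toRow_bijective (a := a) (c := c)))).2 hZ
  let G : RowExt n c → U →ₗ[k] V := fun b => conv C B n (fun i => P i + b.1 i)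
    (cons X fun i => col C B φ (b.2 i).1.1)
  have hG : HasLSum G Z := by
    refine HasLSum.subtype (p := fun b => b.Fits a) (hZ'.congr fun b => ?_) fun b hb => ?_
    · have : b.1.labels a = fun i => P i + b.1.1 i := by
        rw [hP]; exact funext b.2.2
      change convB C B n (b.1.labels a) (fun i => col _ B φ (b.1.2 i).1.1) X = _
      rw [convB_apply, this]
    · by_contra hne
      have hm : ∀ i, (b.2 i).1.1.left = P i.castSucc + b.1 i.castSucc ∧
          (b.2 i).1.1.right = P i.succ + b.1 i.succ := by
        intro i
        by_contra h
        refine hne (conv_eq_zero_of_top n _ _ i fun q e x hx => ?_)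
        refine col_suppOn C B φ _ _ x hx fun h' => h ⟨h'.1.symm, h'.2.symm⟩
      refine hb ⟨⟨⟨fun i => (b.2 i).1.2.1, fun h => if_neg h.ne', fun i j hij => ?_⟩,
        fun i => (b.2 i).1.2.2⟩, fun i => ?_⟩
      · show (b.2 i).1.1.right = (b.2 j).1.1.left
        have h' : Fin.succ (n := n) i = Fin.castSucc (n := n) j := Fin.ext hij
        exact (hm i).2.trans ((congrArg (fun z => P z + b.1 z) h').trans (hm j).1.symm)
      · rw [← hP]
        clear hne hb hc hρ hZ hZ' G
        cases n with
        | zero =>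
          obtain rfl : i = 0 := Fin.ext (by omega)
          rw [hP]; rfl
        | succ n => exact Fin.cases (hm 0).1 (fun i => (hm i).2) i
  have h1 := fun H : Fin (n + 1) → ℕ => conv_hasLSum (C := C) (B := B) n (fun i => P i + H i) X hc
  have h2 := hG.prod_fiber h1
  have h3 := rows_conv (columns_even C B hφ) (rowFinite_columns C B φ) n P X
    (fun i => col C B φ (c i)) fun i => col_isEven hφ (c i)
  have h4 : ∀ i, restr C (P i.castSucc) (P i.succ)
      (col C B φ (c i)) = col C B φ (c i) := fun i => by
    have e1 : P i.castSucc = (c i).left := by rw [hP]; exact Stack.profile_castSucc hρ.1 i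
    have e2 : P i.succ = (c i).right := by rw [hP]; exact Stack.profile_succ i
    rw [e1, e2]
    exact (col_suppOn C B φ).comp_filter
  simp only [h4] at h3
  have h5 : rowOp C B φ ⟨n, a, c⟩ X = conv C B n P (cons X fun i => col C B φ (c i)) := by
    rw [hP]; exact convB_apply _ _ _ _
  rw [h5, h3.unique h2]
  exact hZ

lemma columnExtends (hφ : IsEven C B φ) {F : Stack} (hv : F.Valid)
    (hF : F.AllNonThin) : ColumnExtends C B (φ := φ) F := by
  induction F with
  | leaf =>
    unfold ColumnExtends
    simp only [col]
    rw [rows_unit C B (columns_even C B hφ) (rowFinite_columns C B φ)]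
    exact (HasLSum.comp_equiv (F := fun S : Column => col C.toDgBoxCooperad B φ S)
      (Equiv.subtypeUnivEquiv fun S : Column => Stack.Prefix.leaf S.1)).2 (hasLSum_columns C B φ)
  | box p r n a c ih =>
    have hρ : Row.Good ⟨n, a, c⟩ := ⟨hv, hF.2.2⟩
    have := rows_rowOp C B hφ hρ (fun i => ih i (hv.1 i) (hF.2.2 i)) (φ ∘ₗ C.proj (p, n, r))
    have h0 : rowOp C.toDgBoxCooperad B φ ⟨n, a, c⟩ (φ ∘ₗ C.proj (p, n, r)) =
      col C.toDgBoxCooperad B φ (.box p r n a c) := convB_apply _ _ _ _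
    rw [h0] at this
    let e : {σ : Row // σ.Good ∧ Row.Prefix ⟨n, a, c⟩ σ} →
        {S : Column // Stack.Prefix (.box p r n a c) S} := fun σ =>
      ⟨⟨σ.1.onBox p r, σ.2.1.1, hF.1, hF.2.1, σ.2.1.2⟩, by
        obtain ⟨⟨m, b, d⟩, h1, h2⟩ := σ
        change Stack.Prefix (.box 0 0 n a c) (.box 0 0 m b d) at h2
        cases h2 with
        | @box _ _ _ _ b _ d h ha => exact .box h ha⟩
    have he : Bijective e := by
      constructor
      · rintro ⟨σ, h⟩ ⟨σ', h'⟩ heq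
        have : σ.onBox p r = σ'.onBox p r := congrArg (fun z => z.1.1) heq
        refine Subtype.ext ?_
        simp only
        rw [← σ.ofStack_onBox p r, this, Row.ofStack_onBox]
      · rintro ⟨⟨S, h1, h2⟩, h3⟩
        simp only at h3
        cases h3 with
        | @box _ _ _ _ b _ d h ha =>
          exact ⟨⟨⟨n, b, d⟩, ⟨h1, h2.2.2⟩, .box h ha⟩, rfl⟩
    unfold ColumnExtends
    have key : ∀ σ : {σ : Row // σ.Good ∧ Row.Prefix ⟨n, a, c⟩ σ},
        rowOp C.toDgBoxCooperad B φ σ.1 (φ ∘ₗ C.proj (p, n, r)) =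
          col C.toDgBoxCooperad B φ (e σ).1.1 := fun σ => by
      have h' : n = σ.1.1 := σ.2.2.fst_eq.symm
      exact (congrArg (fun z => rowOp C.toDgBoxCooperad B φ σ.1 (φ ∘ₗ C.proj (p, z, r))) h').trans
        (col_onBox C B σ.1 p r).symm
    have h1 := this.congr key
    exact (HasLSum.comp_equiv (F := fun S : {S : Column // Stack.Prefix (.box p r n a c) S} =>
      col C.toDgBoxCooperad B φ S.1.1) (Equiv.ofBijective e he)).1 h1

lemma rows_rowOp' (hφ : IsEven C B φ) {ρ : Row} (hρ : ρ.Good) (X : U →ₗ[k] V) :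
    HasLSum (fun σ : {σ : Row // σ.Good ∧ ρ.Prefix σ} => rowOp C B φ σ X)
      (rows C B (columns C B φ) (rowOp C B φ ρ X)) :=
  rows_rowOp C B hφ hρ (fun i => columnExtends C B hφ (hρ.1.1 i) (hρ.2 i)) X

/-- The sum over the atomic rows. -/
def atoms (φ : U →ₗ[k] V) : (U →ₗ[k] V) →ₗ[k] (U →ₗ[k] V) :=
  opSum fun ρ : {ρ : Row // ρ.Good ∧ ρ.Atomic} => rowOp C B φ ρ

lemma lfo_atoms (φ : U →ₗ[k] V) : LFO fun ρ : {ρ : Row // ρ.Good ∧ ρ.Atomic} => rowOp C B φ ρ :=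
  lfo_rowOp_of C B φ fun _ h => h.1

lemma hasLSum_atoms (φ X : U →ₗ[k] V) :
    HasLSum (fun ρ : {ρ : Row // ρ.Good ∧ ρ.Atomic} => rowOp C B φ ρ X)
      (atoms C B φ X) := (lfo_atoms C B φ).hasLSum X

lemma rows_atoms (hφ : IsEven C B φ) (X : U →ₗ[k] V) :
    HasLSum (fun σ : {σ : Row // σ.Good ∧ 0 < σ.left} => rowOp C B φ σ X)
      (rows C B (columns C B φ) (atoms C B φ X)) := by
  obtain ⟨Z, hZ⟩ := HasLSum.sum_of_lfo (lfo_rowOp_of C B φ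
    (p := fun σ => σ.Good ∧ 0 < σ.left) fun ρ h => h.1) X
  let e : (Σ ρ : {ρ : Row // ρ.Good ∧ ρ.Atomic}, {σ : Row // σ.Good ∧ ρ.1.Prefix σ}) →
      {σ : Row // σ.Good ∧ 0 < σ.left} := fun a =>
    ⟨a.2.1, a.2.2.1, lt_of_lt_of_le a.1.2.2.1 a.2.2.2.left_le⟩
  have he : Bijective e := by
    constructor
    · rintro ⟨⟨ρ, h1, h2⟩, ⟨σ, h3, h4⟩⟩ ⟨⟨ρ', h1', h2'⟩, ⟨σ', h3', h4'⟩⟩ h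
      obtain rfl : σ = σ' := congrArg (fun z => z.1) h
      obtain rfl := Row.atomic_unique h3 h1 h1' h2 h2' h4 h4'
      rfl
    · rintro ⟨σ, h1, h2⟩
      obtain ⟨ρ, h3, h4, h5⟩ := Row.exists_atomic h1 h2
      exact ⟨⟨⟨ρ, h3, h4⟩, ⟨σ, h1, h5⟩⟩, rfl⟩
  exact hZ.of_fibers he (rowFinite_columns C B φ).local_opSum (hasLSum_atoms C B φ X)
    fun ρ => rows_rowOp' C B hφ ρ.2.1 X

lemma rows_trivial (X : U →ₗ[k] V) {d : ℤ} (hX : HasDeg C B d X) :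
    HasLSum (fun n : ℕ => rowOp C B φ (Row.trivial n) X) X := by
  refine (hasLSum_filter C (fun α => α.2.1) X).congr fun n => ?_
  rw [← conv_unit_top n X hX, rowOp, convB_apply]
  have : (Row.trivial n).labels = fun _ => 0 := Stack.profile_leaf n
  rw [this]
  rfl

/-- The sum of all rows. -/
lemma hasLSum_rows (hφ : IsEven C B φ) (X : U →ₗ[k] V) {d : ℤ} (hX : HasDeg C B d X) :
    HasLSum (fun σ : {σ : Row // σ.Good} => rowOp C B φ σ X) (rows C B (columns C B φ) X) := by
  obtain ⟨Z, hZ⟩ := HasLSum.sum_of_lfo (lfo_rowOp C B φ) X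
  let e : (Σ n : ℕ, {σ : Row // σ.Good ∧ (Row.trivial n).Prefix σ}) → {σ : Row // σ.Good} :=
    fun a => ⟨a.2.1, a.2.2.1⟩
  have he : Bijective e := by
    constructor
    · rintro ⟨n, σ, h1, h2⟩ ⟨n', σ', h1', h2'⟩ h
      obtain rfl : σ = σ' := congrArg (fun z => z.1) h
      obtain rfl : n = n' := (Row.trivial_prefix_iff.1 h2).symm.trans (Row.trivial_prefix_iff.1 h2')
      rfl
    · rintro ⟨σ, h⟩
      exact ⟨⟨σ.1, ⟨σ, h, Row.trivial_prefix_iff.2 rfl⟩⟩, rfl⟩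
  exact hZ.of_fibers he (rowFinite_columns C B φ).local_opSum (rows_trivial C B X hX)
    fun n => rows_rowOp' C B hφ (Row.trivial_good n) X

/-- Decomposition of rows into an atomic row and the rows on top of it. -/
lemma rows_eq (hφ : IsEven C B φ) (X : U →ₗ[k] V) {d : ℤ} (hX : HasDeg C B d X) :
    rows C B (columns C B φ) X = X + rows C B (columns C B φ) (atoms C B φ X) := by
  classical
  let F₁ : {σ : Row // σ.Good} → U →ₗ[k] V := fun σ =>
    if 0 < σ.1.left then 0 else rowOp C B φ σ X
  let F₂ : {σ : Row // σ.Good} → U →ₗ[k] V := fun σ =>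
    if 0 < σ.1.left then rowOp C B φ σ X else 0
  have h1 : HasLSum F₁ X := by
    have := rows_trivial C B (φ := φ) X hX
    refine (HasLSum.comp_injective (e := fun n : ℕ => (⟨Row.trivial n, Row.trivial_good n⟩ :
      {σ : Row // σ.Good})) ?_ ?_).1 (this.congr fun n => ?_)
    · intro n m h
      exact congrArg (fun z : {σ : Row // σ.Good} => z.1.1) h
    · rintro ⟨σ, hσ⟩ h
      simp only [F₁]
      split_ifs with h0
      · rfl
      · exact absurd ⟨σ.1, Subtype.ext (Row.eq_trivial hσ (by omega)).symm⟩ h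
    · simp [F₁, Row.left_trivial]
  have h2 : HasLSum F₂ (rows C B (columns C B φ) (atoms C B φ X)) := by
    refine (HasLSum.comp_injective (e := fun σ : {σ : Row // σ.Good ∧ 0 < σ.left} =>
      (⟨σ.1, σ.2.1⟩ : {σ : Row // σ.Good})) ?_ ?_).1 ((rows_atoms C B hφ X).congr fun σ => ?_)
    · intro σ σ' h
      exact Subtype.ext (congrArg (fun z : {σ : Row // σ.Good} => z.1) h)
    · rintro ⟨σ, hσ⟩ h
      simp only [F₂]
      split_ifs with h0
      · exact absurd ⟨⟨σ, hσ, h0⟩, rfl⟩ h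
      · rfl
    · simp [F₂, σ.2.2]
  refine (hasLSum_rows C B hφ X hX).unique ((h1.add h2).congr fun σ => ?_)
  simp only [F₁, F₂]
  split_ifs <;> simp

end Sums

section ThinRows

/-- The thin colours with at least one input. -/
def ThinTame (α : Colour) : Prop := α.1 = 0 ∧ α.2.2 = 0 ∧ 0 < α.2.1

lemma SuppOn.tame {M : DgModule k U} {u : U →ₗ[k] V} (h : SuppOn M ThinTame u) :
    SuppOn M TameColour u := h.mono fun _ => Or.inl

variable (C : ConilpotentDgBoxCooperad k U) (B : DgBoxOperad k V)

/-- The sum of all rows of the thin map `u` on top of a map. -/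
def thinRows (u : U →ₗ[k] V) : (U →ₗ[k] V) →ₗ[k] (U →ₗ[k] V) :=
  opSum fun n : ℕ => convB C B n (fun _ => 0) fun _ => u

lemma lfo_thinRows {u : U →ₗ[k] V} (hu : SuppOn C TameColour u) :
    LFO fun n : ℕ => convB C B n (fun _ => 0) fun _ => u :=
  (rowFinite C B hu).subfamily (e := fun n => (⟨n, fun _ => 0⟩ : Labels)) fun _ _ h =>
    congrArg Sigma.fst h

variable {C B}

lemma hasLSum_thinRows {u : U →ₗ[k] V} (hu : SuppOn C TameColour u)
    (X : U →ₗ[k] V) : HasLSum (fun n : ℕ => conv C B n (fun _ => 0)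
      (cons X fun _ => u)) (thinRows C B u X) :=
  ((lfo_thinRows C B hu).hasLSum X).congr fun _ => convB_apply _ _ _ _

lemma local_thinRows {u : U →ₗ[k] V} (hu : SuppOn C TameColour u) :
    Local (thinRows C B u) := (lfo_thinRows C B hu).local_opSum

lemma HasDeg.thinRows {u X : U →ₗ[k] V} (hu : SuppOn C TameColour u) (hue : HasDeg C B 0 u) {d : ℤ}
    (hX : HasDeg C B d X) :
    HasDeg C B d (thinRows C B u X) :=
  HasDeg.hasLSum (hasLSum_thinRows hu X) fun n => by
    have := conv_hasDeg (C := C) (B := B) n (fun _ => 0) (cons X fun _ => u)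
      (cons d fun _ => 0) (Fin.cases hX fun _ => hue)
    simpa [sum_univ_succ] using this

lemma SuppOn.thinRows_tame {u X : U →ₗ[k] V} (hu : SuppOn C TameColour u)
    (hX : SuppOn C TameColour X) :
    SuppOn C TameColour (BoxOperads.thinRows C B u X) :=
  SuppOn.hasLSum (hasLSum_thinRows hu X) fun n =>
    (conv_suppOn (C := C) (B := B) n (fun _ => 0) (cons X fun _ => u) _
      (fun _ => TameColour) hX fun _ => hu).mono fun α h => by
        obtain ⟨p, r, q, h, h', rfl⟩ := h
        simp only [TameColour, lt_self_iff_false, false_and, or_false, true_and, add_zero] at h h' ⊢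
        rcases h with h | h
        · exact Or.inl ⟨h.1, h.2.1, Finset.sum_pos (fun i _ => h' i) ⟨⟨0, h.2.2⟩, mem_univ _⟩⟩
        · exact Or.inr h

/-- Rows of tame maps on thin maps are tame. -/
lemma SuppOn.rows_tame {y X : U →ₗ[k] V} (hy : SuppOn C TameColour y)
    (hX : SuppOn C (fun α => 0 < α.2.1) X) (hX' : SuppOn C TameColour X) :
    SuppOn C TameColour (BoxOperads.rows C B y X) :=
  SuppOn.hasLSum ((rowFinite C B hy).hasLSum X) fun ν => by
    refine (conv_suppOn (C := C) (B := B) ν.1 ν.2 (cons X fun _ => y)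
      (fun α => 0 < α.2.1 ∧ TameColour α) (fun _ => TameColour) (fun α e x hx h => ?_)
      fun _ => hy).mono fun α h => ?_
    · rcases not_and_or.1 h with h | h
      · exact hX α e x hx h
      · exact hX' α e x hx h
    · obtain ⟨n, P⟩ := ν
      obtain ⟨p, r, q, ⟨h1, h2⟩, h', rfl⟩ := h
      change TameColour (p + P 0, ∑ i, q i, r + P (Fin.last n))
      change 0 < n at h1
      change TameColour (p, n, r) at h2
      have hends : ∀ i : Fin n, P i.castSucc = 0 ↔ P i.succ = 0 := by
        intro i
        have := h' i
        simp only [TameColour] at this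
        omega
      have hall : ∀ i, P i = 0 ↔ P 0 = 0 := fun i => by
        induction i using Fin.induction with
        | zero => rfl
        | succ i ih => rw [← hends, ih]
      by_cases h0 : P 0 = 0
      · have hl := (hall (Fin.last n)).2 h0
        have : 0 < ∑ i, q i := Finset.sum_pos (fun i _ => by
          have := h' i
          have h3 := (hall i.castSucc).2 h0
          simp only [TameColour] at this
          omega) ⟨⟨0, h1⟩, mem_univ _⟩
        unfold TameColour at h2 ⊢
        dsimp only at h2 ⊢
        rcases h2 with h2 | h2
        · exact Or.inl ⟨by omega, by omega, this⟩
        · exact Or.inr ⟨by omega, by omega⟩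
      · have hl := mt (hall (Fin.last n)).1 h0
        simp only [TameColour]
        omega

lemma thinRows_conv {u : U →ₗ[k] V} (hu : SuppOn C TameColour u)
    (hue : IsEven C B u) (n : ℕ) (P : Fin (n + 1) → ℕ) (X : U →ₗ[k] V)
    (w : Fin n → U →ₗ[k] V) (hw : ∀ i, IsEven C B (w i)) :
    thinRows C B u (conv C B n P (cons X w)) =
      conv C B n P (cons X fun i => thinRows C B u (w i)) := by
  classical
  obtain ⟨W, hWdef⟩ : ∃ W : Fin n → ℕ → U →ₗ[k] V, W = fun i m =>
    w i ∘ₗ C.filter fun α => α.2.1 = m := ⟨_, rfl⟩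
  have hWe : ∀ i m, IsEven C.toDgBoxCooperad B (W i m) := fun i m => by
    rw [hWdef]; exact (hw i).filter _
  have hWq : ∀ i m, SuppOn C.toDgModule (fun α => α.2.1 = m) (W i m) := fun i m => by
    rw [hWdef]; exact SuppOn.filter _
  have hWsum : ∀ i, HasLSum (W i) (w i) := fun i => by
    rw [hWdef]; exact hasLSum_filter C.toDgModule (fun α => α.2.1) _
  have hWr : ∀ i m, conv C B m (fun _ => 0) (cons (W i m) fun _ => u) =
      conv C B m (fun _ => 0) (cons (w i) fun _ => u) := by
    intro i m
    refine conv_congr' _ _ _ _ (fun p r e x hx => ?_) fun _ _ _ _ _ => rfl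
    simp only [cons_zero, hWdef, comp_apply]
    rw [C.filter_apply _ hx, if_pos rfl]
  clear hWdef
  have h1 := conv_hasLSum (C := C.toDgBoxCooperad) (B := B) n P X hWsum
  have h2 := (LFO.hasLSum_prod (lfo_thinRows C B hu) h1).congr fun a => convB_apply _ _ _ _
  have hinj : Injective fun m : Fin n → ℕ => (offset m n, m) := fun m m' h =>
    (Prod.mk.inj h).2
  rw [← HasLSum.comp_injective hinj] at h2
  swap
  · rintro ⟨N, m⟩ hm
    refine conv_eq_zero_of_bottom _ _ _ fun p r e x hx => ?_
    have hs := conv_suppOn (C := C.toDgBoxCooperad) (B := B) n P (cons X fun i => W i (m i))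
      (fun _ => True) (fun i α => α.2.1 = m i) (fun _ _ _ _ h => absurd trivial h)
      (fun i => hWq i (m i))
    refine hs _ _ x hx ?_
    rintro ⟨p', r', q, -, hq, h⟩
    simp only [Prod.mk.injEq] at h hq
    exact hm ⟨m, Prod.ext (by rw [h.2.1]; simp [hq, offset_self]) rfl⟩
  have hF : ∀ i, HasLSum (fun m : ℕ => conv C B m (fun _ => 0)
      (cons (W i m) fun _ => u)) (thinRows C B u (w i)) :=
    fun i => (hasLSum_thinRows hu (w i)).congr fun m => (hWr i m).symm
  have h3 := conv_hasLSum (C := C.toDgBoxCooperad) (B := B) n P X hF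
  refine h2.unique (h3.congr fun m => ?_)
  have := conv_assoc_fin (C := C.toDgBoxCooperad) (B := B) hue P X m (fun _ => 0)
    (fun i => W i (m i)) (fun i => hWe i _) fun i α e x hx => hWq i _ α e x hx
  have hs : ∀ j, stream (fun _ : Fin (offset m n + 1) => 0) j = 0 := fun j => by simp [stream]
  simp only [hs, add_zero] at this
  exact this

end ThinRows

section Filtered

/-- A bounded multiplicative filtration of a dg box operad. -/
structure Filtration (B : DgBoxOperad k V) where
  fil : ℕ → Submodule k V
  zero : fil 0 = ⊤
  anti : Antitone fil
  comp_mem : ∀ (n : ℕ) (P : Fin (n + 1) → ℕ) (x : Fin (n + 1) → V) (a : Fin (n + 1) → ℕ),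
    (∀ i, x i ∈ fil (a i)) → B.comp n P x ∈ fil (∑ i, a i)
  koszul_mem : ∀ (a : ℕ) (m : ℤ) (x : V), x ∈ fil a → B.koszul m x ∈ fil a
  d_mem : ∀ (a : ℕ) (x : V), x ∈ fil a → B.d x ∈ fil a
  bound : ℕ
  bot : fil bound = ⊥

/-- The filtration of `B ⊕ ε B` with `ε` in filtration degree `s`. -/
def Filtration.ext {B : DgBoxOperad k V} (F : Filtration B) (d : ℤ) (s : ℕ) :
    Filtration (B.ext d) where
  fil a := (F.fil a).prod (F.fil (a - s))
  zero := by rw [Nat.zero_sub, F.zero, Submodule.prod_top]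
  anti a b h := Submodule.prod_mono (F.anti h) (F.anti (Nat.sub_le_sub_right h s))
  comp_mem n P x a h := by
    refine ⟨F.comp_mem n P _ a fun i => (h i).1, ?_⟩
    change (B.extComp d n P x).2 ∈ _
    rw [B.extComp_snd]
    refine sum_mem fun i _ => ?_
    refine F.anti ?_ (F.comp_mem n P _ (fun j => a j - if j = i then s else 0) fun j => ?_)
    · have h1 : ∑ j, a j ≤ ∑ j, ((a j - if j = i then s else 0) + if j = i then s else 0) :=
        Finset.sum_le_sum fun j _ => by omega
      rw [sum_add_distrib, sum_ite_eq' univ i, if_pos (mem_univ i)] at h1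
      omega
    · rcases lt_trichotomy j i with hj | rfl | hj
      · rw [B.slot_lt hj, if_neg hj.ne]; exact F.koszul_mem _ _ _ (h j).1
      · rw [B.slot_self, if_pos rfl]; exact (h j).2
      · rw [B.slot_gt hj, if_neg hj.ne']; exact (h j).1
  koszul_mem a m x h := by
    change (B.toDgModule.ext d).koszul m x ∈ _
    rw [DgModule.ext_koszul]
    exact ⟨F.koszul_mem a m _ h.1, Submodule.smul_mem _ _ (F.koszul_mem _ m _ h.2)⟩
  d_mem a x h := ⟨F.d_mem a _ h.1, Submodule.smul_mem _ _ (F.d_mem _ _ h.2)⟩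
  bound := F.bound + s
  bot := by
    have h := F.anti (Nat.le_add_right F.bound s)
    rw [F.bot, le_bot_iff] at h
    rw [Nat.add_sub_cancel, F.bot, h, Submodule.prod_bot]

variable {B : DgBoxOperad k V}

/-- Maps with values in a step of the filtration. -/
def Filtration.Holds (F : Filtration B) (a : ℕ) (w : U →ₗ[k] V) : Prop := ∀ c, w c ∈ F.fil a

namespace Filtration.Holds

variable {F : Filtration B} {a : ℕ} {w w' : U →ₗ[k] V}

lemma add (h : F.Holds a w) (h' : F.Holds a w') : F.Holds a (w + w') :=
  fun c => add_mem (h c) (h' c)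

lemma zero_left : F.Holds 0 w := fun c => by rw [F.zero]; trivial

lemma zero : F.Holds a (0 : U →ₗ[k] V) := fun _ => zero_mem _

lemma comp (h : F.Holds a w) {U' : Type*} [AddCommGroup U'] [Module k U'] (l : U' →ₗ[k] U) :
    F.Holds a (w ∘ₗ l) := fun c => h (l c)

lemma hasLSum {I : Type*} {f : I → U →ₗ[k] V} (h : HasLSum f w) (hf : ∀ i, F.Holds a (f i)) :
    F.Holds a w := fun c => by
  obtain ⟨s, -, hs⟩ := h c
  rw [← hs]
  exact sum_mem fun i _ => hf i c

lemma eq_zero (h : F.Holds a w) (ha : F.bound ≤ a) : w = 0 := LinearMap.ext fun c => by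
  have := F.anti ha (h c)
  rwa [F.bot, Submodule.mem_bot] at this

lemma conv {C : DgBoxCooperad k U} (n : ℕ) (P : Fin (n + 1) → ℕ) (f : Fin (n + 1) → U →ₗ[k] V)
    (a : Fin (n + 1) → ℕ) (h : ∀ i, F.Holds (a i) (f i)) :
    F.Holds (∑ i, a i) (conv C B n P f) := fun c => by
  rw [conv_apply, comp_apply]
  induction C.decomp n P c using PiTensorProduct.induction_on with
  | smul_tprod r x =>
    rw [map_smul, PiTensorProduct.lift.tprod]
    exact Submodule.smul_mem _ _ (F.comp_mem n P _ a fun i => h i (x i))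
  | add x y hx hy => rw [map_add]; exact add_mem hx hy

lemma conv_sub {C : DgBoxCooperad k U} (n : ℕ) (P : Fin (n + 1) → ℕ) (X : U →ₗ[k] V)
    {y y' : U →ₗ[k] V} {b : ℕ} (h : F.Holds a X) (h' : F.Holds b (y - y')) :
    F.Holds (a + b) (BoxOperads.conv C B n P (cons X fun _ => y) -
      BoxOperads.conv C B n P (cons X fun _ => y')) := by
  classical
  have key : ∀ s : Finset (Fin n), F.Holds (a + b)
      (BoxOperads.conv C B n P (cons X fun i => if i ∈ s then y else y') -
        BoxOperads.conv C B n P (cons X fun _ => y')) := by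
    intro s
    induction s using Finset.induction_on with
    | empty => simp only [notMem_empty, if_false, sub_self]; exact zero
    | insert i s hi ih =>
      have e : ∀ z, BoxOperads.conv C B n P (cons X (update
          (fun j => if j ∈ s then y else y') i z)) = (BoxOperads.conv C B n P).toLinearMap
            (cons X fun j => if j ∈ s then y else y') i.succ z := fun z => by
        rw [toLinearMap_apply, cons_update]
      have e1 : (fun j => if j ∈ insert i s then y else y') =
          update (fun j => if j ∈ s then y else y') i y := by
        funext j
        rcases eq_or_ne j i with rfl | hne
        · simp
        · simp [hne]
      have e2 : (fun j => if j ∈ s then y else y') =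
          update (fun j => if j ∈ s then y else y') i y' := by
        funext j
        rcases eq_or_ne j i with rfl | hne
        · simp [hi]
        · simp [hne]
      have h1 : F.Holds (a + b) (BoxOperads.conv C B n P (cons X (update
          (fun j => if j ∈ s then y else y') i (y - y')))) := by
        have h2 : ∀ j, F.Holds ((cons a fun j => if j = i then b else 0 : Fin (n + 1) → ℕ) j)
            ((cons X (update (fun j => if j ∈ s then y else y') i (y - y')) :
              Fin (n + 1) → U →ₗ[k] V) j) := by
          refine Fin.cases h fun j => ?_
          rcases eq_or_ne j i with rfl | hne
          · simpa using h'
          · simp only [cons_succ, if_neg hne]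
            exact zero_left
        have := conv (C := C) (F := F) n P _ _ h2
        rw [sum_univ_succ] at this
        simpa only [cons_zero, cons_succ, sum_ite_eq', mem_univ, if_true] using this
      rw [e, map_sub, ← e, ← e, ← e1, ← e2] at h1
      simpa using h1.add ih
  simpa using key univ

end Filtration.Holds

end Filtered

section Main

variable {C : ConilpotentDgBoxCooperad k U} {B : DgBoxOperad k V}

lemma rows_fixed_unique (F : Filtration B) {φ u y y' : U →ₗ[k] V} (hφ : F.Holds 1 φ)
    (hy : RowFinite C B y) (hy' : RowFinite C B y')
    (h : y = u + rows C B y φ) (h' : y' = u + rows C B y' φ) :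
    y = y' := by
  have key : ∀ m, F.Holds m (y - y') := by
    intro m
    induction m with
    | zero => exact Filtration.Holds.zero_left
    | succ m ih =>
      have e : y - y' = rows C B y φ - rows C B y' φ := by
        conv_lhs => rw [h, h']
        abel
      rw [e]
      have hs := (hy.hasLSum φ).add (hy'.hasLSum φ).neg
      rw [← sub_eq_add_neg] at hs
      refine Filtration.Holds.hasLSum hs fun ν => ?_
      rw [← sub_eq_add_neg, add_comm m 1]
      exact Filtration.Holds.conv_sub ν.1 ν.2 φ hφ ih
  exact sub_eq_zero.1 ((key F.bound).eq_zero le_rfl)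

lemma thinRows_rows {u y X : U →ₗ[k] V} (hu : SuppOn C TameColour u)
    (hue : IsEven C B u) (hy : SuppOn C TameColour y)
    (hye : IsEven C B y) :
    thinRows C B u (rows C B y X) = rows C B (thinRows C B u y) X := by
  have h1 := HasLSum.local_map (local_thinRows (B := B) hu) ((rowFinite C B hy).hasLSum X)
  have h2 := (rowFinite C B (hu.thinRows_tame (B := B) hy)).hasLSum X
  exact h1.unique (h2.congr fun ν => (thinRows_conv hu hue ν.1 ν.2 X _ fun _ => hye).symm)

lemma rows_thinRows {u y X : U →ₗ[k] V} (hu : SuppOn C ThinTame u)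
    (hue : IsEven C B u) (hy : SuppOn C TameColour y)
    (hye : IsEven C B y) :
    rows C B y (thinRows C B u X) = rows C B (rows C B y u) X := by
  have h1 := HasLSum.local_map (rowFinite C B hy).local_opSum (hasLSum_thinRows (B := B) hu.tame X)
  have h2 := (rowFinite C B (hy.rows_tame (B := B) (hu.mono fun _ h => h.2.2) hu.tame)).hasLSum X
  have h3 := HasLSum.sigma (G := fun n => rows C B y
    (conv C B n (fun _ => 0) (cons X fun _ => u))) h2 fun n => by
      have := rows_conv hye (rowFinite C B hy) n (fun _ => 0) X (fun _ => u) fun _ => hue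
      have hr : restr C 0 0 u = u :=
        (hu.mono fun _ h => (⟨h.1, h.2.1⟩ : HasEnds 0 0 _)).comp_filter
      simpa only [hr, zero_add] using this
  exact h1.unique h3

variable {φ Ψ u X : U →ₗ[k] V}

lemma rowOp_hasDeg (hφ : IsEven C B φ) (ρ : Row) {d : ℤ} (hX : HasDeg C B d X) :
    HasDeg C B d (rowOp C B φ ρ X) := by
  rw [rowOp, convB_apply]
  have := conv_hasDeg (C := C) (B := B) ρ.1 ρ.labels (cons X fun i => col C B φ (ρ.2.2 i))
    (cons d fun _ => 0) (Fin.cases hX fun _ => isEven_iff.1 (col_isEven hφ _))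
  simpa [sum_univ_succ] using this

lemma HasDeg.atoms (hφ : IsEven C B φ) {d : ℤ} (hX : HasDeg C B d X) :
    HasDeg C B d (atoms C B φ X) :=
  HasDeg.hasLSum (hasLSum_atoms C B φ X) fun ρ => rowOp_hasDeg hφ ρ.1 hX

/-- The numbers of horizontal inputs grow by the left label of a row. -/
lemma rowOp_suppOn {m : ℕ} (hX : SuppOn C (fun α => m ≤ α.1) X) (ρ : Row) :
    SuppOn C (fun α => m + ρ.labels 0 ≤ α.1) (rowOp C B φ ρ X) := by
  rw [rowOp, convB_apply]
  refine (conv_suppOn (C := C.toDgBoxCooperad) (B := B) ρ.1 ρ.labels _ _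
    (fun _ _ => True) hX fun _ _ _ _ _ h => absurd trivial h).mono fun α h => ?_
  obtain ⟨p, r, q, h, -, rfl⟩ := h
  exact Nat.add_le_add_right h _

lemma Row.left_eq (ρ : Row) : ρ.left = ρ.labels 0 := by
  obtain ⟨n, a, c⟩ := ρ
  cases n <;> exact Nat.zero_add _

lemma rows_columns_injective (hφ : IsEven C B φ) {d : ℤ} (hX : HasDeg C B d X)
    (h : rows C B (columns C B φ) X = 0) : X = 0 := by
  have key : ∀ m, SuppOn C (fun α => m ≤ α.1) X := by
    intro m
    induction m with
    | zero => exact fun _ _ _ _ h => absurd (Nat.zero_le _) h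
    | succ m ih =>
      have e := rows_eq C B hφ X hX
      rw [h] at e
      rw [eq_neg_of_add_eq_zero_left e.symm, ← neg_one_smul k]
      have h1 := HasLSum.smul ((rowFinite_columns C B φ).hasLSum (atoms C B φ X)) (-1 : k)
      refine SuppOn.hasLSum h1 fun ν => ?_
      have h2 : SuppOn C (fun α => m + 1 ≤ α.1) (atoms C B φ X) :=
        SuppOn.hasLSum (hasLSum_atoms C B φ X) fun ρ => (rowOp_suppOn ih ρ.1).mono fun α h => by
          have := ρ.2.2.1
          rw [Row.left_eq] at this
          omega
      have h3 : SuppOn C (fun α => m + 1 ≤ α.1) (conv C B ν.1 ν.2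
          (cons (atoms C B φ X) fun _ => columns C B φ)) :=
        (conv_suppOn (C := C.toDgBoxCooperad) (B := B) ν.1 ν.2 _ _
          (fun _ _ => True) h2 fun _ _ _ _ _ h => absurd trivial h).mono fun α h => by
            obtain ⟨p, r, q, h, -, rfl⟩ := h
            exact le_add_right h
      intro α e x hx hα
      rw [LinearMap.smul_apply, h3 α e x hx hα, smul_zero]
  exact C.linear_ext fun α e x hx => key (α.1 + 1) α e x hx (by simp)

lemma columns_eq (hφ : IsNonThin C B φ) :
    columns C B φ = unitH C B + rows C B (columns C B φ) φ := by
  classical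
  let F₁ : Column → U →ₗ[k] V := fun S =>
    if S.1 = .leaf then col C B φ S else 0
  let F₂ : Column → U →ₗ[k] V := fun S =>
    if S.1 = .leaf then 0 else col C B φ S
  have h1 : HasLSum F₁ (unitH C B) := by
    have := HasLSum.single (F := F₁) ⟨.leaf, trivial, trivial⟩ fun S hS =>
      if_neg fun h => hS (Subtype.ext h)
    have e : F₁ ⟨.leaf, trivial, trivial⟩ = unitH C B := if_pos rfl
    rwa [e] at this
  have h2 : HasLSum F₂ (rows C B (columns C B φ) φ) := by
    have h3 := LFO.hasLSum_prod (lfo_rowOp C B φ) (hasLSum_filter_ends C φ)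
    have h4 := (hasLSum_rows C B hφ.even φ (isEven_iff.1 hφ.even)).unique
      ((lfo_rowOp C B φ).hasLSum φ)
    rw [← h4] at h3
    have h5 : ∀ ρ : Row, ∀ p r : ℕ, rowOp C B φ ρ (restr C p r φ) =
        col C B φ (ρ.onBox p r) := fun ρ p r => by
      rw [col_onBox, rowOp, convB_apply, convB_apply]
      refine conv_congr' _ _ _ _ (fun p' r' e x hx => ?_) fun _ _ _ _ _ => rfl
      simp only [cons_zero, restr, comp_apply]
      rw [C.filter_apply _ hx, C.proj_apply _ hx]
      simp [HasEnds]
    let e : {a : {ρ : Row // ρ.Good} × (ℕ × ℕ) // 0 < a.2.1 ∧ 0 < a.2.2} → Column := fun a =>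
      ⟨a.1.1.1.onBox a.1.2.1 a.1.2.2, a.1.1.2.1, a.2.1, a.2.2, a.1.1.2.2⟩
    have he : Injective e := by
      rintro ⟨⟨⟨ρ, hρ⟩, p, r⟩, h⟩ ⟨⟨⟨ρ', hρ'⟩, p', r'⟩, h'⟩ heq
      have h1 : ρ.onBox p r = ρ'.onBox p' r' := congrArg (fun z : Column => z.1) heq
      have h2 : ρ = ρ' := by rw [← ρ.ofStack_onBox p r, h1, Row.ofStack_onBox]
      subst h2
      have h3 := (Stack.box.inj h1).1
      have h4 := (Stack.box.inj h1).2.1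
      subst h3 h4
      rfl
    refine (HasLSum.comp_injective he ?_).1 ?_
    · rintro ⟨S, h1, h2⟩ hS
      cases S with
      | leaf => exact if_pos rfl
      | box p r n a c =>
        exact absurd ⟨⟨⟨⟨⟨n, a, c⟩, h1, h2.2.2⟩, p, r⟩, h2.1, h2.2.1⟩, rfl⟩ hS
    · refine ((HasLSum.comp_injective (e := fun a : {a : {ρ : Row // ρ.Good} × (ℕ × ℕ) //
        0 < a.2.1 ∧ 0 < a.2.2} => a.1) Subtype.val_injective ?_).2 h3).congr fun a => ?_
      · rintro ⟨ρ, p, r⟩ ha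
        have : restr C p r φ = 0 := C.linear_ext fun α e x hx => by
          rw [restr, comp_apply, C.filter_apply _ hx]
          split_ifs with h
          · refine hφ.supp α e x hx fun h' => ha ⟨⟨(ρ, p, r), ?_⟩, rfl⟩
            dsimp only at h' ⊢
            rwa [h.1, h.2] at h'
          · rw [map_zero]; rfl
        simp only [this, map_zero]
      · rw [h5]
        exact (if_neg (by simp [e, Row.onBox])).symm
  refine (hasLSum_columns C B φ).unique ((h1.add h2).congr fun S => ?_)
  simp only [F₁, F₂]
  split_ifs <;> simp

lemma thinRows_unit (hu : SuppOn C ThinTame u) (hue : IsEven C B u) :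
    thinRows C B u (unitH C B) = u := by
  have h1 := hasLSum_thinRows (B := B) hu.tame (unitH C B)
  refine h1.unique ?_
  have h2 : conv C B 1 (fun _ => 0) (cons (unitH C B) fun _ => u) = u := by
    have := conv_unit_bottom (C := C) (B := B) 0 0 u (isEven_iff.1 hue)
    have e : (![0, 0] : Fin 2 → ℕ) = fun _ => 0 := by funext i; fin_cases i <;> rfl
    rw [e] at this
    rw [this]
    exact (hu.mono fun _ h => ⟨h.1, h.2.1⟩).comp_filter
  have h3 := HasLSum.single (F := fun n => conv C B n (fun _ => 0)
      (cons (unitH C B) fun _ => u)) 1 fun n hn =>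
    conv_eq_zero_of_bottom _ _ _ fun p r e x hx => unitH_suppOn _ _ x hx fun h => hn (by
      simp only [Prod.mk.injEq] at h; exact h.2.1)
  rwa [h2] at h3

/-- Atomic rows and thin rows commute if they do so on the unit. -/
lemma atoms_thinRows (F : Filtration B) (hφ : IsNonThin C B φ)
    (hΨ : IsNonThin C B Ψ) (hφF : F.Holds 1 φ)
    (hu : SuppOn C ThinTame u) (hue : IsEven C B u)
    (h : atoms C B Ψ u = thinRows C B u φ) {d : ℤ} (hX : HasDeg C B d X) :
    atoms C B Ψ (thinRows C B u X) = thinRows C B u (atoms C B φ X) := by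
  have hyt := columns_tame C B Ψ
  have hye := columns_even C B hΨ.even
  have hA : rows C B (columns C B Ψ) u = u + rows C B (rows C B (columns C B Ψ) u) φ := by
    rw [← rows_thinRows hu hue hyt hye, ← h]
    exact rows_eq C B hΨ.even u (isEven_iff.1 hue)
  have hB : thinRows C B u (columns C B φ) = u + rows C B (thinRows C B u (columns C B φ)) φ := by
    conv_lhs => rw [columns_eq hφ, map_add, thinRows_unit hu hue,
      thinRows_rows hu.tame hue (columns_tame C B φ) (columns_even C B hφ.even)]
  have hAB := rows_fixed_unique F hφF
    (rowFinite C B (hyt.rows_tame (hu.mono fun _ h => h.2.2) hu.tame))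
    (rowFinite C B (hu.tame.thinRows_tame (columns_tame C B φ))) hA hB
  have h5 : ∀ X : U →ₗ[k] V, rows C B (columns C B Ψ) (thinRows C B u X) =
      thinRows C B u (rows C B (columns C B φ) X) := fun X => by
    rw [rows_thinRows hu hue hyt hye, thinRows_rows hu.tame hue (columns_tame C B φ)
      (columns_even C B hφ.even), hAB]
  have hRX := HasDeg.thinRows hu.tame (isEven_iff.1 hue) hX
  refine sub_eq_zero.1 (rows_columns_injective hΨ.even ((hRX.atoms hΨ.even).sub
    (HasDeg.thinRows hu.tame (isEven_iff.1 hue) (hX.atoms hφ.even))) ?_)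
  rw [map_sub, h5 (atoms C B φ X), sub_eq_zero]
  have e1 := rows_eq C B hΨ.even _ hRX
  rw [h5, rows_eq C B hφ.even X hX, map_add] at e1
  exact (add_left_cancel e1).symm

end Main

section Naturality

variable {V' : Type*} [AddCommGroup V'] [Module k V']

/-- Linear maps compatible with compositions and units. -/
structure IsMorphism (B : DgBoxOperad k V) (B' : DgBoxOperad k V') (ι : V →ₗ[k] V') : Prop where
  map_comp : ∀ n P (x : Fin (n + 1) → V), B'.comp n P (fun i => ι (x i)) = ι (B.comp n P x)
  map_one : ι B.one = B'.one

lemma cons_comp_apply {n : ℕ} (X : U →ₗ[k] V) (w : Fin n → U →ₗ[k] V) (x : Fin (n + 1) → U) :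
    (fun i => (cons X w : Fin (n + 1) → U →ₗ[k] V) i (x i)) =
      cons (X (x 0)) fun j => w j (x j.succ) :=
  funext fun i => Fin.cases rfl (fun _ => rfl) i

variable {B : DgBoxOperad k V} {B' : DgBoxOperad k V'}

lemma inl_isMorphism (d : ℤ) : IsMorphism B (B.ext d) (inl k V V) where
  map_comp n P x := by
    refine Prod.ext rfl ?_
    change (B.extComp d n P _).2 = 0
    rw [B.extComp_snd]
    refine sum_eq_zero fun i _ => (B.comp n P).map_coord_zero i ?_
    rw [B.slot_self]; rfl
  map_one := rfl

lemma fst_isMorphism (d : ℤ) : IsMorphism (B.ext d) B (LinearMap.fst k V V) where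
  map_comp _ _ _ := rfl
  map_one := rfl

lemma conv_map_of {C : DgBoxCooperad k U} {n : ℕ} (P : Fin (n + 1) → ℕ) (ι : V →ₗ[k] V')
    (f' : Fin (n + 1) → U →ₗ[k] V') (f : Fin (n + 1) → U →ₗ[k] V)
    (h : ∀ x : Fin (n + 1) → U, B'.comp n P (fun i => f' i (x i)) =
      ι (B.comp n P fun i => f i (x i))) : conv C B' n P f' = ι ∘ₗ conv C B n P f := by
  rw [conv_apply, conv_apply, ← comp_assoc]
  congr 1
  refine PiTensorProduct.ext (MultilinearMap.ext fun x => ?_)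
  simp only [compMultilinearMap_apply, comp_apply, PiTensorProduct.lift.tprod, compLinearMap_apply]
  exact h x

namespace IsMorphism

variable {ι : V →ₗ[k] V'} (hι : IsMorphism B B' ι)

include hι

lemma conv {C : DgBoxCooperad k U} {n : ℕ} (P : Fin (n + 1) → ℕ) (X : U →ₗ[k] V)
    (w : Fin n → U →ₗ[k] V) : conv C B' n P (cons (ι ∘ₗ X) fun i => ι ∘ₗ w i) =
      ι ∘ₗ conv C B n P (cons X w) := by
  refine conv_map_of P ι _ _ fun x => ?_
  rw [← hι.map_comp]
  congr 1
  exact funext fun i => Fin.cases rfl (fun _ => rfl) i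

lemma unitH {C : DgBoxCooperad k U} : unitH C B' = ι ∘ₗ unitH C B := LinearMap.ext fun c => by
  simp [BoxOperads.unitH, hι.map_one]

lemma col {C : DgBoxCooperad k U} (φ : U →ₗ[k] V) (S : Stack) :
    col C B' (ι ∘ₗ φ) S = ι ∘ₗ col C B φ S := by
  induction S with
  | leaf => exact hι.unitH
  | box p r n a c ih =>
    simp only [BoxOperads.col, ih, comp_assoc]
    exact hι.conv _ _ _

lemma rowOp {C : DgBoxCooperad k U} (φ X : U →ₗ[k] V) (ρ : Row) :
    rowOp C B' (ι ∘ₗ φ) ρ (ι ∘ₗ X) = ι ∘ₗ rowOp C B φ ρ X := by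
  simp only [BoxOperads.rowOp, convB_apply, hι.col]
  exact hι.conv _ _ _

lemma atoms {C : ConilpotentDgBoxCooperad k U} (φ X : U →ₗ[k] V) :
    atoms C B' (ι ∘ₗ φ) (ι ∘ₗ X) = ι ∘ₗ atoms C B φ X :=
  (hasLSum_atoms C B' (ι ∘ₗ φ) (ι ∘ₗ X)).unique
    (((hasLSum_atoms C B φ X).map_left ι).congr fun ρ => (hι.rowOp φ X ρ.1).symm)

end IsMorphism

lemma conv_inr {C : DgBoxCooperad k U} (d : ℤ) {n : ℕ} (P : Fin (n + 1) → ℕ) (Y : U →ₗ[k] V)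
    (w : Fin n → U →ₗ[k] V × V) :
    conv C (B.ext d) n P (cons (inr k V V ∘ₗ Y) w) =
      inr k V V ∘ₗ conv C B n P (cons Y fun i => LinearMap.fst k V V ∘ₗ w i) := by
  refine conv_map_of P (inr k V V) _ _ fun x => ?_
  rw [cons_comp_apply, cons_comp_apply]
  refine Prod.ext ?_ ?_
  · rw [B.ext_comp_cons_fst]
    exact (B.comp n P).map_coord_zero 0 rfl
  · rw [B.ext_comp_cons_snd]
    refine (add_eq_left.2 (sum_eq_zero fun i _ => ?_)).trans rfl
    refine (B.comp n P).map_coord_zero 0 ?_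
    simp

lemma atoms_inr {C : ConilpotentDgBoxCooperad k U} (d : ℤ) (φ : U →ₗ[k] V × V) (Y : U →ₗ[k] V) :
    atoms C (B.ext d) φ (inr k V V ∘ₗ Y) = inr k V V ∘ₗ atoms C B (LinearMap.fst k V V ∘ₗ φ) Y := by
  refine (hasLSum_atoms C (B.ext d) φ _).unique
    (((hasLSum_atoms C B (LinearMap.fst k V V ∘ₗ φ) Y).map_left (inr k V V)).congr fun ρ => ?_)
  simp only [rowOp, convB_apply]
  rw [conv_inr]
  simp only [(fst_isMorphism (B := B) d).col]

/-- Convolution in `B ⊕ ε B`. -/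
lemma conv_ext {C : DgBoxCooperad k U} (d : ℤ) {n : ℕ} (P : Fin (n + 1) → ℕ) (X Y : U →ₗ[k] V)
    (a b : Fin n → U →ₗ[k] V) :
    conv C (B.ext d) n P (cons (X.prod Y) fun j => (a j).prod (b j)) =
      (conv C B n P (cons X a)).prod (conv C B n P (cons Y a) +
        ∑ i : Fin n, conv C B n P (cons (B.koszul d ∘ₗ X) fun j =>
          if j < i then B.koszul d ∘ₗ a j else if j = i then b j else a j)) := by
  have h : PiTensorProduct.lift (((B.ext d).comp n P).compLinearMap
      (cons (X.prod Y) fun j => (a j).prod (b j) : Fin (n + 1) → U →ₗ[k] V × V)) =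
      (PiTensorProduct.lift ((B.comp n P).compLinearMap (cons X a))).prod
        (PiTensorProduct.lift ((B.comp n P).compLinearMap (cons Y a)) +
        ∑ i : Fin n, PiTensorProduct.lift ((B.comp n P).compLinearMap
          (cons (B.koszul d ∘ₗ X) fun j =>
          if j < i then B.koszul d ∘ₗ a j else if j = i then b j else a j))) := by
    refine PiTensorProduct.ext (MultilinearMap.ext fun x => ?_)
    simp only [compMultilinearMap_apply, PiTensorProduct.lift.tprod,
      compLinearMap_apply, prod_apply, LinearMap.add_apply,
      LinearMap.sum_apply, Function.prod, cons_comp_apply]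
    refine Prod.ext ?_ ?_
    · rw [B.ext_comp_cons_fst]
    · rw [B.ext_comp_cons_snd, sum_range]
      congr 1
      refine sum_congr rfl fun i _ => ?_
      congr 2
      funext j
      rcases lt_trichotomy j i with hj | rfl | hj
      · rw [B.topSlot_lt hj, if_pos hj]; rfl
      · rw [B.topSlot_self, if_neg (lt_irrefl _), if_pos rfl]
      · rw [B.topSlot_gt hj, if_neg hj.not_gt, if_neg hj.ne']
  rw [conv_apply, h]
  refine LinearMap.ext fun c => ?_
  simp only [comp_apply, prod_apply, Function.prod, LinearMap.add_apply,
    LinearMap.sum_apply, conv_apply]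

lemma unitH_ext {C : DgBoxCooperad k U} (d : ℤ) : unitH C (B.ext d) = (unitH C B).prod 0 :=
  (inl_isMorphism d).unitH

lemma koszul_comp_unitH {C : DgBoxCooperad k U} (m : ℤ) :
    B.koszul m ∘ₗ unitH C B = unitH C B := LinearMap.ext fun c => by
  simp [unitH, B.koszul_one]

end Naturality

section Differential

variable {C : DgBoxCooperad k U} {B : DgBoxOperad k V}

lemma d_comp_conv (n : ℕ) (P : Fin (n + 1) → ℕ) (f : Fin (n + 1) → U →ₗ[k] V) :
    B.d ∘ₗ conv C B n P f = ∑ i, conv C B n P fun j =>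
      if j < i then B.koszul 1 ∘ₗ f j else if j = i then B.d ∘ₗ f j else f j := by
  have h : B.d ∘ₗ PiTensorProduct.lift ((B.comp n P).compLinearMap f) =
      ∑ i, PiTensorProduct.lift ((B.comp n P).compLinearMap fun j =>
        if j < i then B.koszul 1 ∘ₗ f j else if j = i then B.d ∘ₗ f j else f j) := by
    refine PiTensorProduct.ext (MultilinearMap.ext fun x => ?_)
    simp only [compMultilinearMap_apply, comp_apply, PiTensorProduct.lift.tprod,
      compLinearMap_apply, LinearMap.sum_apply]
    rw [B.d_comp]
    refine sum_congr rfl fun i _ => congrArg _ (funext fun j => ?_)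
    split_ifs <;> rfl
  rw [conv_apply, ← comp_assoc, h]
  exact LinearMap.ext fun c => by
    simp only [comp_apply, LinearMap.sum_apply, conv_apply]

lemma conv_comp_d (n : ℕ) (P : Fin (n + 1) → ℕ) (f : Fin (n + 1) → U →ₗ[k] V) :
    conv C B n P f ∘ₗ C.d = ∑ i, conv C B n P fun j =>
      if j < i then f j ∘ₗ C.koszul 1 else if j = i then f j ∘ₗ C.d else f j := by
  refine LinearMap.ext fun c => ?_
  simp only [comp_apply, LinearMap.sum_apply, conv_apply]
  rw [C.decomp_d, map_sum]
  refine sum_congr rfl fun i _ => ?_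
  rw [← comp_apply]
  congr 1
  refine PiTensorProduct.ext (MultilinearMap.ext fun x => ?_)
  simp only [compMultilinearMap_apply, comp_apply, PiTensorProduct.map_tprod,
    PiTensorProduct.lift.tprod, compLinearMap_apply]
  refine congrArg _ (funext fun j => ?_)
  split_ifs <;> rfl

/-- Maps of degree `m` commute with the Koszul operators up to sign. -/
lemma HasDeg.koszul_comp {m : ℤ} {X : U →ₗ[k] V} (h : HasDeg C B m X)
    (l : ℤ) : X ∘ₗ C.koszul l = sgn k (l * m) • (B.koszul l ∘ₗ X) := C.linear_ext fun α e x hx => by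
  simp only [comp_apply, LinearMap.smul_apply]
  rw [C.koszul_apply l hx, map_smul, B.koszul_apply l (h α e x hx), smul_smul, ← sgn_add]
  congr 1
  refine sgn_eq_of_even_sub ⟨-(l * m), by ring⟩

variable (C B) in
/-- A map of degree `m` together with its differential. -/
def hat (m : ℤ) (X : U →ₗ[k] V) : U →ₗ[k] V × V := X.prod (C.homD B m X)

/-- Convolution is compatible with differentials. -/
lemma conv_hat {m : ℤ} {n : ℕ} (P : Fin (n + 1) → ℕ) {X : U →ₗ[k] V}
    (hX : HasDeg C B m X) {w : Fin n → U →ₗ[k] V}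
    (hw : ∀ i, HasDeg C B 0 (w i)) :
    conv C (B.ext (-1)) n P (cons (hat C B m X) fun i => hat C B 0 (w i)) =
      hat C B m (conv C B n P (cons X w)) := by
  have hk : B.koszul (-1) = B.koszul 1 := B.linear_ext fun α e x hx => by
    rw [B.koszul_apply _ hx, B.koszul_apply _ hx]
    congr 1
    exact sgn_eq_of_even_sub ⟨-e, by ring⟩
  unfold hat
  rw [conv_ext, hk]
  congr 1
  conv_rhs => rw [DgModule.homD, d_comp_conv, conv_comp_d]
  rw [sum_univ_succ, sum_univ_succ, smul_add, smul_sum]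
  have e0 : ∀ z : U →ₗ[k] V, (fun j : Fin (n + 1) => if j < 0 then z else if j = 0 then z else z) =
      fun _ => z := fun z => funext fun j => by split_ifs <;> rfl
  let v : Fin (n + 1) → U →ₗ[k] V := cons X w
  have h1 : (fun j : Fin (n + 1) => if j < 0 then
      B.koszul 1 ∘ₗ v j else if j = 0 then
      B.d ∘ₗ v j else
        v j) = cons (B.d ∘ₗ X) w :=
    funext fun j => Fin.cases (by simp [v]) (fun j => by simp [v]) j
  have h2 : (fun j : Fin (n + 1) => if j < 0 then
      v j ∘ₗ C.koszul 1 else if j = 0 then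
      v j ∘ₗ C.d else
        v j) = cons (X ∘ₗ C.d) w :=
    funext fun j => Fin.cases (by simp [v]) (fun j => by simp [v]) j
  have hcons : ∀ (Z : U →ₗ[k] V), conv C B n P (cons Z w) =
      (conv C B n P).toLinearMap (cons 0 w) 0 Z := fun Z => by
    rw [toLinearMap_apply, update_cons_zero]
  rw [h1, h2, hcons (C.homD B m X), DgModule.homD, map_sub, map_smul, ← hcons, ← hcons, add_sub_add_comm,
    ← Finset.sum_sub_distrib]
  congr 1
  refine sum_congr rfl fun i _ => ?_
  have hup : ∀ (Y : U →ₗ[k] V) (Z : U →ₗ[k] V), conv C B n P (cons Y fun j => if j < i then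
      B.koszul 1 ∘ₗ w j else if j = i then Z else w j) =
      (conv C B n P).toLinearMap (cons Y fun j => if j < i then
      B.koszul 1 ∘ₗ w j else w j) i.succ Z := fun Y Z => by
    rw [toLinearMap_apply, ← cons_update]
    congr 2
    funext j
    rcases lt_trichotomy j i with hj | rfl | hj
    · simp [hj, hj.ne]
    · simp
    · simp [hj.not_gt, hj.ne']
  have h3 : (fun j : Fin (n + 1) => if j < i.succ then
      B.koszul 1 ∘ₗ v j else if j = i.succ then
      B.d ∘ₗ v j else
        v j) = cons (B.koszul 1 ∘ₗ X) fun j =>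
      if j < i then B.koszul 1 ∘ₗ w j else if j = i then B.d ∘ₗ w i else w j :=
    funext fun j => Fin.cases (by simp [v]) (fun j => by
      simp only [v, cons_succ, Fin.succ_lt_succ_iff, Fin.succ_inj]
      split_ifs with h h' <;> [rfl; rw [h']; rfl]) j
  have h4 : (fun j : Fin (n + 1) => if j < i.succ then
      v j ∘ₗ C.koszul 1 else if j = i.succ then
      v j ∘ₗ C.d else
        v j) = cons (sgn k m • (B.koszul 1 ∘ₗ X)) fun j =>
      if j < i then B.koszul 1 ∘ₗ w j else if j = i then w i ∘ₗ C.d else w j :=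
    funext fun j => Fin.cases (by simp [v, hX.koszul_comp]) (fun j => by
      simp only [v, cons_succ, Fin.succ_lt_succ_iff, Fin.succ_inj]
      split_ifs with h h'
      · rw [(hw j).koszul_comp]; simp
      · rw [h']
      · rfl) j
  have hsm : ∀ (a : k) (Z : U →ₗ[k] V) (w' : Fin n → U →ₗ[k] V),
      conv C B n P (cons (a • Z) w') = a • conv C B n P (cons Z w') := fun a Z w' => by
    have := (conv C B n P).map_update_smul (cons Z w') 0 a Z
    rwa [update_cons_zero, update_cons_zero] at this
  rw [h3, h4, hsm, smul_smul, sgn_mul_self, one_smul, hup, hup]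
  have h5 : (fun j => if j < i then B.koszul 1 ∘ₗ w j else if j = i then
      C.homD B 0 (w j) else w j) = fun j => if j < i then B.koszul 1 ∘ₗ w j else
        if j = i then C.homD B 0 (w i) else w j := funext fun j => by
    split_ifs with h h' <;> [rfl; rw [h']; rfl]
  rw [h5, hup, ← map_sub]
  congr 1
  rw [DgModule.homD, sgn_zero, one_smul]

lemma hat_unitH : hat C B 0 (unitH C B) = unitH C (B.ext (-1)) := by
  rw [unitH_ext, hat]
  congr 1
  refine LinearMap.ext fun c => ?_
  simp [DgModule.homD, unitH, C.counit_d, B.d_one]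

lemma hat_comp {m : ℤ} (X : U →ₗ[k] V) {l : U →ₗ[k] U} (hl : l ∘ₗ C.d = C.d ∘ₗ l) :
    hat C B m X ∘ₗ l = hat C B m (X ∘ₗ l) := by
  refine LinearMap.ext fun c => Prod.ext rfl ?_
  have := LinearMap.congr_fun hl c
  simp only [comp_apply] at this
  simp [hat, DgModule.homD, this]

lemma DgModule.proj_comp_d (M : DgModule k U) (β : Colour) : M.proj β ∘ₗ M.d = M.d ∘ₗ M.proj β :=
  M.linear_ext fun α e x hx => by
    simp only [comp_apply]
    rw [M.proj_apply β hx, M.proj_apply β (M.d_mem hx)]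
    split_ifs <;> simp

lemma col_hat {φ : U →ₗ[k] V} (hφ : IsEven C B φ) (S : Stack) :
    col C (B.ext (-1)) (hat C B 0 φ) S = hat C B 0 (col C B φ S) := by
  induction S with
  | leaf => exact hat_unitH.symm
  | box p r n a c ih =>
    simp only [col, ih]
    rw [hat_comp _ (C.proj_comp_d _)]
    exact conv_hat _ ((isEven_iff.1 hφ).proj _) fun i => isEven_iff.1 (col_isEven hφ _)

lemma HasLSum.hat {I : Type*} {E : I → U →ₗ[k] V} {f : U →ₗ[k] V} (h : HasLSum E f) (m : ℤ) :
    HasLSum (fun i => hat C B m (E i)) (hat C B m f) := by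
  have h1 := h.map_left (inl k V V)
  have h2 := ((h.map_left B.d).add ((h.map_right C.d).smul (-sgn k m))).map_left (inr k V V)
  have e : ∀ X : U →ₗ[k] V, inl k V V ∘ₗ X + inr k V V ∘ₗ
      (B.d ∘ₗ X + -sgn k m • X ∘ₗ C.d) = BoxOperads.hat C B m X := fun X =>
    LinearMap.ext fun c => by
      simp [BoxOperads.hat, DgModule.homD, sub_eq_add_neg]
  rw [← e]
  exact (h1.add h2).congr fun i => e _

lemma atoms_hat {C : ConilpotentDgBoxCooperad k U} {φ X : U →ₗ[k] V}
    (hφ : IsEven C B φ) {m : ℤ} (hX : HasDeg C B m X) :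
    atoms C (B.ext (-1)) (hat C B 0 φ) (hat C B m X) = hat C B m (atoms C B φ X) := by
  refine (hasLSum_atoms C (B.ext (-1)) _ _).unique
    (((hasLSum_atoms C B φ X).hat m).congr fun ρ => ?_)
  simp only [rowOp, convB_apply, col_hat hφ]
  exact (conv_hat _ hX fun i => isEven_iff.1 (col_isEven hφ _)).symm

lemma thinRows_hat {C : ConilpotentDgBoxCooperad k U} {u X : U →ₗ[k] V}
    (hu : SuppOn C TameColour u) (hue : HasDeg C B 0 u) {m : ℤ}
    (hX : HasDeg C B m X) :
    thinRows C (B.ext (-1)) (hat C B 0 u) (hat C B m X) = hat C B m (thinRows C B u X) := by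
  refine (hasLSum_thinRows (B := B.ext (-1)) (fun α e x hx h => ?_) _).unique
    (((hasLSum_thinRows hu X).hat m).congr fun n => (conv_hat _ hX fun i => hue).symm)
  have h1 := hu α e x hx h
  have h2 := hu α _ _ (C.d_mem hx) h
  simp [hat, DgModule.homD, h1, h2]

end Differential

section Insertion

lemma HasLSum.prod {V' I : Type*} [AddCommGroup V'] [Module k V'] {E : I → U →ₗ[k] V}
    {E' : I → U →ₗ[k] V'} {f : U →ₗ[k] V} {f' : U →ₗ[k] V'} (h : HasLSum E f)
    (h' : HasLSum E' f') : HasLSum (fun i => (E i).prod (E' i)) (f.prod f') := by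
  have h1 := (h.map_left (inl k V V')).add (h'.map_left (inr k V V'))
  have e : ∀ (X : U →ₗ[k] V) (Y : U →ₗ[k] V'), inl k V V' ∘ₗ X +
      inr k V V' ∘ₗ Y = X.prod Y := fun X Y => LinearMap.ext fun c => by simp
  rw [← e]
  exact h1.congr fun i => e _ _

lemma sum_prod {V' I : Type*} [AddCommGroup V'] [Module k V'] (s : Finset I) (f : I → U →ₗ[k] V)
    (g : I → U →ₗ[k] V') : ∑ i ∈ s, (f i).prod (g i) = (∑ i ∈ s, f i).prod (∑ i ∈ s, g i) :=
  LinearMap.ext fun c => Prod.ext (by simp [Prod.fst_sum]) (by simp [Prod.snd_sum])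

lemma conv_cons_smul {C : DgBoxCooperad k U} {B : DgBoxOperad k V} {n : ℕ} (P : Fin (n + 1) → ℕ)
    (X : U →ₗ[k] V) (a : Fin n → k) (w : Fin n → U →ₗ[k] V) :
    conv C B n P (cons X fun j => a j • w j) = (∏ j, a j) • conv C B n P (cons X w) := by
  have := (conv C B n P).map_smul_univ (cons 1 a) (cons X w)
  rw [prod_univ_succ] at this
  simp only [cons_zero, one_mul, cons_succ] at this
  rw [← this]
  congr 1
  exact funext fun i => Fin.cases (by simp) (fun j => by simp) i

lemma conv_cons_zero {C : DgBoxCooperad k U} {B : DgBoxOperad k V} {n : ℕ} (P : Fin (n + 1) → ℕ)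
    (w : Fin n → U →ₗ[k] V) : conv C B n P (cons 0 w) = 0 :=
  (conv C B n P).map_coord_zero 0 rfl

lemma DgModule.koszul_neg (M : DgModule k V) (m : ℤ) : M.koszul (-m) = M.koszul m :=
  M.linear_ext fun α e x hx => by
    rw [M.koszul_apply _ hx, M.koszul_apply _ hx]
    congr 1
    exact sgn_eq_of_even_sub ⟨-(m * e), by ring⟩

lemma DgModule.ext_koszul_one (M : DgModule k V) (X Y : U →ₗ[k] V) :
    (M.ext (-1)).koszul 1 ∘ₗ X.prod Y = (M.koszul 1 ∘ₗ X).prod (-(M.koszul 1 ∘ₗ Y)) :=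
  LinearMap.ext fun c => by
    rw [comp_apply, M.ext_koszul]
    simp

lemma DgModule.koszul_koszul_comp (M : DgModule k V) (m : ℤ) (X : U →ₗ[k] V) :
    M.koszul m ∘ₗ M.koszul m ∘ₗ X = X :=
  LinearMap.ext fun _ => M.koszul_self m _

lemma HasDeg.prod {M : DgModule k U} {N : DgModule k V} {d m : ℤ} {X Y : U →ₗ[k] V}
    (hX : HasDeg M N m X) (hY : HasDeg M N (m + d) Y) : HasDeg M (N.ext d) m (X.prod Y) :=
  fun α e x hx => ⟨hX α e x hx, by rw [add_assoc]; exact hY α e x hx⟩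

lemma HasDeg.koszul {M : DgModule k U} {N : DgModule k V} {m : ℤ} {X : U →ₗ[k] V}
    (hX : HasDeg M N m X) (l : ℤ) : HasDeg M N m (N.koszul l ∘ₗ X) :=
  fun α e x hx => N.koszul_mem l (hX α e x hx)

lemma HasDeg.homD {M : DgModule k U} {N : DgModule k V} {m : ℤ} {X : U →ₗ[k] V}
    (hX : HasDeg M N m X) (l : ℤ) : HasDeg M N (m - 1) (M.homD N l X) := fun α e x hx => by
  have h1 := N.d_mem (hX α e x hx)
  have h2 := hX α _ _ (M.d_mem hx)
  rw [show e + (m - 1) = e + m - 1 by ring]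
  refine sub_mem h1 (Submodule.smul_mem _ _ ?_)
  rwa [show e - 1 + m = e + m - 1 by ring] at h2

lemma SuppOn.prod {M : DgModule k U} {P : Colour → Prop} {X Y : U →ₗ[k] V}
    (hX : SuppOn M P X) (hY : SuppOn M P Y) : SuppOn M P (X.prod Y) := fun α e x hx h =>
  Prod.ext (hX α e x hx h) (hY α e x hx h)

lemma SuppOn.comp_left {V' : Type*} [AddCommGroup V'] [Module k V'] {M : DgModule k U}
    {P : Colour → Prop} {X : U →ₗ[k] V}
    (hX : SuppOn M P X) (l : V →ₗ[k] V') : SuppOn M P (l ∘ₗ X) := fun α e x hx h => by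
  rw [comp_apply, hX α e x hx h, map_zero]

lemma SuppOn.smul {M : DgModule k U} {P : Colour → Prop} {X : U →ₗ[k] V}
    (hX : SuppOn M P X) (t : k) : SuppOn M P (t • X) := fun α e x hx h => by
  rw [LinearMap.smul_apply, hX α e x hx h, smul_zero]

lemma SuppOn.neg {M : DgModule k U} {P : Colour → Prop} {X : U →ₗ[k] V}
    (hX : SuppOn M P X) : SuppOn M P (-X) := fun α e x hx h => by
  rw [LinearMap.neg_apply, hX α e x hx h, neg_zero]

lemma SuppOn.zero {M : DgModule k U} {P : Colour → Prop} : SuppOn M P (0 : U →ₗ[k] V) :=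
  fun _ _ _ _ _ => rfl

lemma SuppOn.homD {M : DgModule k U} {N : DgModule k V} {P : Colour → Prop} {X : U →ₗ[k] V}
    (hX : SuppOn M P X) (l : ℤ) : SuppOn M P (M.homD N l X) := fun α e x hx h => by
  simp [DgModule.homD, hX α e x hx h, hX α _ _ (M.d_mem hx) h]

variable (C : ConilpotentDgBoxCooperad k U) (B : DgBoxOperad k V)

/-- The unit on all inputs but the `i`-th, and `θ` on that one. -/
def slotted (θ : U →ₗ[k] V) {n : ℕ} (i j : Fin n) : U →ₗ[k] V :=
  if j = i then θ else unitH C B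

/-- The sum of all insertions of `θ` into one of the inputs. -/
def ins (θ : U →ₗ[k] V) : (U →ₗ[k] V) →ₗ[k] (U →ₗ[k] V) :=
  opSum fun a : Σ n : ℕ, Fin n => convB C B a.1 (fun _ => 0) (slotted C B θ a.2)

/-- The pre-Lie product with a map of degree `-1`. -/
def star (θ X : U →ₗ[k] V) : U →ₗ[k] V := ins C B θ (B.koszul 1 ∘ₗ X)

variable {C B} {θ τ X Y : U →ₗ[k] V}

lemma slotted_suppOn (hθ : SuppOn C ThinTame θ) {n : ℕ} (i j : Fin n) :
    SuppOn C ThinTame (slotted C B θ i j) := by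
  unfold slotted
  split_ifs
  · exact hθ
  · exact unitH_suppOn.mono fun α h => by rw [h]; exact ⟨rfl, rfl, one_pos⟩

lemma lfo_ins (hθ : SuppOn C ThinTame θ) : LFO fun a : Σ n : ℕ, Fin n =>
    convB C B a.1 (fun _ => 0) (slotted C B θ a.2) := by
  refine LFO.of_homogeneous C.toDgModule (fun ρ => local_convB _ _ _) ?_
  rintro ⟨p, q, r⟩ e c hc
  refine ((range (q + 1)).sigma fun _ => univ).finite_toSet.subset ?_
  rintro ⟨n, i⟩ ⟨X, hX⟩
  simp only [Finset.coe_sigma, Set.mem_sigma_iff, Finset.coe_range, Set.mem_Iio, Finset.coe_univ,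
    Set.mem_univ, and_true]
  by_contra hn
  rw [convB_apply] at hX
  refine hX (conv_suppOn (C := C.toDgBoxCooperad) (B := B) n (fun _ => 0) _ (fun _ => True)
    (fun _ => ThinTame) (fun _ _ _ _ h => absurd trivial h) (slotted_suppOn hθ i) _ _ c hc ?_)
  rintro ⟨p', r', q', -, hq', h⟩
  simp only [Prod.mk.injEq] at h
  have : n ≤ ∑ i, q' i := by
    simpa using Finset.card_nsmul_le_sum univ q' 1 fun i _ => (hq' i).2.2
  omega

lemma hasLSum_ins (hθ : SuppOn C ThinTame θ) (X : U →ₗ[k] V) :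
    HasLSum (fun a : Σ n : ℕ, Fin n => conv C B a.1 (fun _ => 0)
      (cons X (slotted C B θ a.2))) (ins C B θ X) :=
  ((lfo_ins hθ).hasLSum X).congr fun _ => convB_apply _ _ _ _

lemma hasLSum_ins_sum (hθ : SuppOn C ThinTame θ) (X : U →ₗ[k] V) :
    HasLSum (fun n : ℕ => ∑ i : Fin n, conv C B n (fun _ => 0)
      (cons X (slotted C B θ i))) (ins C B θ X) :=
  (hasLSum_ins hθ X).sigma fun _ => HasLSum.fintype

lemma conv_slotted {n : ℕ} (P : Fin (n + 1) → ℕ) (X : U →ₗ[k] V) (i : Fin n) (θ : U →ₗ[k] V) :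
    conv C B n P (cons X (slotted C B θ i)) = (conv C B n P).toLinearMap
        (cons X fun _ => unitH C B) i.succ θ := by
  rw [toLinearMap_apply, ← cons_update]
  congr 2
  funext j
  rcases eq_or_ne j i with rfl | h
  · simp [slotted]
  · simp [slotted, h]

lemma ins_smul_left (hθ : SuppOn C ThinTame θ) (t : k)
    (X : U →ₗ[k] V) : ins C B (t • θ) X = t • ins C B θ X :=
  (hasLSum_ins (hθ.smul t) X).unique (((hasLSum_ins hθ X).smul t).congr fun a => by
    simp only [conv_slotted, map_smul])

lemma ins_neg_left (hθ : SuppOn C ThinTame θ) (X : U →ₗ[k] V) : ins C B (-θ) X = -ins C B θ X := by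
  rw [← neg_one_smul k, ins_smul_left hθ, neg_one_smul]

lemma ins_zero_left (X : U →ₗ[k] V) : ins C B 0 X = 0 := by
  have := ins_smul_left (C := C) (B := B) (θ := 0) SuppOn.zero 0 X
  rwa [zero_smul, zero_smul] at this

lemma HasDeg.ins (hθ : SuppOn C ThinTame θ) {d m : ℤ} (hθd : HasDeg C B d θ) (hX : HasDeg C B m X) :
    HasDeg C B (m + d) (ins C B θ X) :=
  HasDeg.hasLSum (hasLSum_ins hθ X) fun a => by
    have := conv_hasDeg (C := C) (B := B) a.1 (fun _ => 0)
      (cons X (slotted C B θ a.2)) (cons m fun j => if j = a.2 then d else 0)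
      (Fin.cases hX fun j => by
        simp only [cons_succ, slotted]
        split_ifs
        · exact hθd
        · exact isEven_iff.1 unitH_isEven)
    simpa [sum_univ_succ] using this

lemma SuppOn.ins (hθ : SuppOn C ThinTame θ)
    {P : ℕ → ℕ → Prop} (hX : SuppOn C (fun α => P α.1 α.2.2) X) :
    SuppOn C (fun α => P α.1 α.2.2) (ins C B θ X) :=
  SuppOn.hasLSum (hasLSum_ins hθ X) fun a =>
    (conv_suppOn (C := C.toDgBoxCooperad) (B := B) a.1 (fun _ => 0) _ _
      (fun _ _ => True) hX fun _ _ _ _ _ h => absurd trivial h).mono fun α h => by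
        obtain ⟨p, r, q, h, -, rfl⟩ := h
        simpa using h

lemma SuppOn.ins_thin (hθ : SuppOn C ThinTame θ) (hX : SuppOn C ThinTame X) :
    SuppOn C ThinTame (BoxOperads.ins C B θ X) := by
  refine SuppOn.hasLSum (hasLSum_ins hθ X) fun a => ?_
  obtain ⟨n, i⟩ := a
  have h1 := conv_suppOn (C := C) (B := B) n (fun _ => 0)
    (cons X (slotted C B θ i)) ThinTame (fun _ => ThinTame) hX fun j => slotted_suppOn hθ i j
  refine h1.mono fun α h => ?_
  obtain ⟨p, r, q, h, h', rfl⟩ := h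
  exact ⟨h.1, h.2.1, Finset.sum_pos (fun i _ => (h' i).2.2) ⟨⟨0, h.2.2⟩, mem_univ _⟩⟩

lemma conv_unit_one {m : ℤ} (hθ : SuppOn C ThinTame θ)
    (hθd : HasDeg C B m θ) : conv C B 1 (fun _ => 0) (cons (unitH C B) fun _ => θ) = θ := by
  have := conv_unit_bottom (C := C) (B := B) 0 0 θ hθd
  have e : (![0, 0] : Fin 2 → ℕ) = fun _ => 0 := by funext i; fin_cases i <;> rfl
  rw [e] at this
  rw [this]
  exact (hθ.mono fun _ h => ⟨h.1, h.2.1⟩).comp_filter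

lemma conv_unit_of_ne {n : ℕ} (hn : n ≠ 1) (P : Fin (n + 1) → ℕ) (w : Fin n → U →ₗ[k] V) :
    conv C B n P (cons (unitH C B) w) = 0 :=
  conv_eq_zero_of_bottom _ _ _ fun p r e x hx => unitH_suppOn _ _ x hx fun h => hn (by
    simp only [Prod.mk.injEq] at h; exact h.2.1)

lemma ins_unit (hθ : SuppOn C ThinTame θ) {d : ℤ}
    (hθd : HasDeg C B d θ) : ins C B θ (unitH C B) = θ := by
  have h1 := HasLSum.single (F := fun a : Σ n : ℕ, Fin n => conv C B a.1
    (fun _ => 0) (cons (unitH C B) (slotted C B θ a.2))) ⟨1, 0⟩ fun a ha => by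
      obtain ⟨n, i⟩ := a
      refine conv_unit_of_ne (fun hn => ha ?_) _ _
      subst hn
      rw [Subsingleton.elim i 0]
  have e : slotted C B θ (0 : Fin 1) = fun _ => θ := funext fun j => by
    rw [slotted, if_pos (Subsingleton.elim _ _)]
  have h2 := (hasLSum_ins hθ _).unique h1
  rw [h2]
  simp only [e]
  exact conv_unit_one hθ hθd

lemma conv_ext_one {n : ℕ} (P : Fin (n + 1) → ℕ) (X Y : U →ₗ[k] V) (a b : Fin n → U →ₗ[k] V) :
    conv C (B.ext (-1)) n P (cons (X.prod Y) fun j => (a j).prod (b j)) =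
      (conv C B n P (cons X a)).prod (conv C B n P (cons Y a) +
        ∑ i : Fin n, conv C B n P (cons (B.koszul 1 ∘ₗ X) fun j =>
          if j < i then B.koszul 1 ∘ₗ a j else if j = i then b j else a j)) := by
  rw [conv_ext, B.koszul_neg]

lemma hasLSum_unit_top {m : ℤ} (hX : HasDeg C B m X) : HasLSum (fun n : ℕ => conv C B n (fun _ => 0)
      (cons X fun _ => unitH C B)) X :=
  (hasLSum_filter C.toDgModule (fun α => α.2.1) X).congr fun n => (conv_unit_top n X hX).symm

lemma thinTame_unitH : SuppOn C.toDgModule ThinTame (unitH C.toDgBoxCooperad B) :=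
  unitH_suppOn.mono fun α h => by rw [h]; exact ⟨rfl, rfl, one_pos⟩

/-- Rows of `1 + ε θ`. -/
lemma thinRows_unit_prod (hθ : SuppOn C ThinTame θ) {m m' : ℤ}
    (hX : HasDeg C B m X) (hY : HasDeg C B m' Y) :
    thinRows C (B.ext (-1)) ((unitH C B).prod θ) (X.prod Y) = X.prod (Y + star C B θ X) := by
  refine (hasLSum_thinRows (thinTame_unitH.prod hθ).tame _).unique
    (((hasLSum_unit_top hX).prod ((hasLSum_unit_top hY).add (hasLSum_ins_sum hθ _))).congr
      fun n => ?_)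
  rw [conv_ext_one]
  simp only [koszul_comp_unitH]
  congr 2
  refine sum_congr rfl fun i _ => ?_
  congr 2
  funext j
  unfold slotted
  rcases lt_trichotomy j i with hj | rfl | hj
  · rw [if_pos hj, if_neg hj.ne]
  · simp
  · rw [if_neg hj.not_gt]

/-- Insertions in `B ⊕ ε B`. -/
lemma ins_ext (hθ : SuppOn C ThinTame θ) (hτ : SuppOn C ThinTame τ) (X Y : U →ₗ[k] V) :
    ins C (B.ext (-1)) (θ.prod τ) (X.prod Y) =
      (ins C B θ X).prod (ins C B θ Y + ins C B τ (B.koszul 1 ∘ₗ X)) := by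
  refine (hasLSum_ins (hθ.prod hτ) _).unique
    (((hasLSum_ins hθ X).prod ((hasLSum_ins hθ Y).add (hasLSum_ins hτ _))).congr fun a => ?_)
  obtain ⟨n, i⟩ := a
  have e : slotted C (B.ext (-1)) (θ.prod τ) i = fun j => (slotted C B θ i j).prod
      (if j = i then τ else 0) := funext fun j => by
    simp only [slotted, unitH_ext]
    split_ifs <;> rfl
  simp only
  rw [e, conv_ext_one]
  congr 2
  rw [sum_eq_single i]
  · congr 2
    funext j
    unfold slotted
    rcases lt_trichotomy j i with hj | rfl | hj
    · rw [if_pos hj, if_neg hj.ne, if_neg hj.ne, koszul_comp_unitH]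
    · simp
    · rw [if_neg hj.not_gt, if_neg hj.ne', if_neg hj.ne', if_neg hj.ne']
  · intro l _ hl
    exact (conv C.toDgBoxCooperad B n (fun _ => 0)).map_coord_zero l.succ (by simp [hl])
  · intro h; exact absurd (mem_univ i) h

lemma star_ext (hθ : SuppOn C ThinTame θ) (hτ : SuppOn C ThinTame τ) (X Y : U →ₗ[k] V) :
    star C (B.ext (-1)) (θ.prod τ) (X.prod Y) =
      (star C B θ X).prod (-star C B θ Y + ins C B τ X) := by
  have : (B.ext (-1)).koszul 1 ∘ₗ X.prod Y = (B.koszul 1 ∘ₗ X).prod (-(B.koszul 1 ∘ₗ Y)) :=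
    B.toDgModule.ext_koszul_one X Y
  rw [star, this, ins_ext hθ hτ, map_neg, B.koszul_koszul_comp]
  rfl

end Insertion

section DoubleExtension

variable {C : ConilpotentDgBoxCooperad k U} {B : DgBoxOperad k V} {θ τ X Y : U →ₗ[k] V}

variable (C B) in
/-- The units, with `κ θ` in the position `l` and `θ` in the position `i`. -/
def pairSlots (θ : U →ₗ[k] V) {n : ℕ} (l i j : Fin n) : U →ₗ[k] V :=
  if j = l then B.koszul 1 ∘ₗ θ else if j = i then θ else unitH C B

lemma conv_double (t : k) (n : ℕ) : ∑ i : Fin n, conv C (B.ext (-1)) n (fun _ => 0)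
      (cons ((B.ext (-1)).koszul 1 ∘ₗ X.prod 0) fun j =>
        if j < i then (B.ext (-1)).koszul 1 ∘ₗ (unitH C B).prod θ
        else if j = i then (t • θ).prod τ else (unitH C B).prod θ) =
      (t • ∑ i : Fin n, conv C B n (fun _ => 0) (cons (B.koszul 1 ∘ₗ X) (slotted C B θ i))).prod
      (∑ i : Fin n, conv C B n (fun _ => 0) (cons X (slotted C B τ i))) := by
  have hk : ∀ X Y : U →ₗ[k] V, (B.ext (-1)).koszul 1 ∘ₗ X.prod Y =
      (B.koszul 1 ∘ₗ X).prod (-(B.koszul 1 ∘ₗ Y)) := B.toDgModule.ext_koszul_one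
  let slots : Fin n → Fin n → U →ₗ[k] V × V := fun i j =>
    if j < i then (B.ext (-1)).koszul 1 ∘ₗ (unitH C B).prod θ
    else if j = i then (t • θ).prod τ else (unitH C B).prod θ
  change ∑ i, conv _ _ _ _ (cons _ (slots i)) = _
  have key : ∀ i : Fin n, conv C (B.ext (-1)) n (fun _ => 0)
      (cons ((B.ext (-1)).koszul 1 ∘ₗ X.prod 0) (slots i)) =
      (t • conv C B n (fun _ => 0) (cons (B.koszul 1 ∘ₗ X) (slotted C B θ i))).prod
      (conv C B n (fun _ => 0) (cons X (slotted C B τ i)) +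
        ∑ l : Fin n, ((if l < i then (-t) • conv C B n (fun _ => 0)
            (cons X (pairSlots C B θ l i)) else 0) +
          if i < l then t • conv C B n (fun _ => 0) (cons X (pairSlots C B θ i l)) else 0)) := by
    intro i
    have e : slots i = fun j => (slotted C B (t • θ) i j).prod
        (if j < i then -(B.koszul 1 ∘ₗ θ) else if j = i then τ else θ) := funext fun j => by
      simp only [slots]
      rw [hk, koszul_comp_unitH]
      unfold slotted
      rcases lt_trichotomy j i with hj | rfl | hj
      · rw [if_pos hj, if_pos hj, if_neg hj.ne]
      · simp
      · rw [if_neg hj.not_gt, if_neg hj.ne', if_neg hj.not_gt, if_neg hj.ne', if_neg hj.ne']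
    rw [e, hk, conv_ext_one, LinearMap.comp_zero, neg_zero, conv_cons_zero, zero_add,
      B.koszul_koszul_comp]
    congr 1
    · rw [conv_slotted, map_smul, ← conv_slotted]
    · rw [← add_sum_erase _ _ (mem_univ i),
        ← add_sum_erase _ (fun l => _ + _) (mem_univ i)]
      simp only [lt_irrefl, if_false, add_zero, zero_add]
      congr 1
      · congr 2
        funext j
        unfold slotted
        rcases lt_trichotomy j i with hj | rfl | hj
        · rw [if_pos hj, if_neg hj.ne, if_neg hj.ne, koszul_comp_unitH]
        · simp
        · rw [if_neg hj.not_gt, if_neg hj.ne', if_neg hj.ne', if_neg hj.ne']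
      · refine sum_congr rfl fun l hl => ?_
        have hl' := (mem_erase.1 hl).1
        rcases lt_or_gt_of_ne hl' with h | h
        · rw [if_pos h, if_neg h.not_gt, add_zero]
          have e : (fun j => if j < l then B.koszul 1 ∘ₗ slotted C B (t • θ) i j else if j = l then
              (if j < i then -(B.koszul 1 ∘ₗ θ) else if j = i then τ else θ) else
                slotted C B (t • θ) i j) = fun j =>
              ((if j = l then (-1 : k) else 1) * if j = i then t else 1) •
                pairSlots C B θ l i j := funext fun j => by
            unfold slotted pairSlots
            rcases lt_trichotomy j l with hj | rfl | hj
            · simp [hj, hj.ne, (hj.trans h).ne, koszul_comp_unitH]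
            · simp [h, h.ne]
            · by_cases hji : j = i
              · subst hji
                simp [hj.not_gt, hj.ne']
              · simp [hj.not_gt, hj.ne', hji]
          rw [e, conv_cons_smul, prod_mul_distrib]
          simp
        · rw [if_neg h.not_gt, if_pos h, zero_add]
          have e : (fun j => if j < l then B.koszul 1 ∘ₗ slotted C B (t • θ) i j else if j = l then
              (if j < i then -(B.koszul 1 ∘ₗ θ) else if j = i then τ else θ) else
                slotted C B (t • θ) i j) = fun j =>
              (if j = i then t else 1) • pairSlots C B θ i l j := funext fun j => by
            unfold slotted pairSlots
            rcases lt_trichotomy j l with hj | rfl | hj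
            · by_cases hji : j = i
              · subst hji
                simp [hj, LinearMap.comp_smul]
              · simp [hj, hj.ne, hji, koszul_comp_unitH]
            · simp [h.not_gt, h.ne']
            · simp [hj.not_gt, hj.ne', (h.trans hj).ne']
          rw [e, conv_cons_smul]
          simp
  simp only [key]
  rw [sum_prod, smul_sum, sum_add_distrib, sum_congr rfl fun i _ =>
    sum_add_distrib, sum_add_distrib]
  congr 1
  rw [add_eq_left]
  rw [sum_comm, ← sum_add_distrib]
  refine sum_eq_zero fun i _ => ?_
  rw [← sum_add_distrib]
  refine sum_eq_zero fun l _ => ?_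
  split_ifs <;> simp

end DoubleExtension

section Quadratic

variable {C : ConilpotentDgBoxCooperad k U} {B : DgBoxOperad k V} {θ τ φ ψ X Y : U →ₗ[k] V}

lemma hasDeg_unitH : HasDeg C.toDgModule B.toDgModule 0 (unitH C.toDgBoxCooperad B) :=
  isEven_iff.1 unitH_isEven

/-- Rows of `1 + ε θ + ε' (t θ + ε τ)`. -/
lemma thinRows_double (hθ : SuppOn C ThinTame θ) (hτ : SuppOn C ThinTame τ)
    (t : k) {m m' : ℤ} (hX : HasDeg C B m X)
    (hY : HasDeg C B m' Y) :
    thinRows C ((B.ext (-1)).ext (-1)) (((unitH C B).prod θ).prod ((t • θ).prod τ))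
      ((X.prod 0).prod (Y.prod 0)) =
      (X.prod (star C B θ X)).prod ((Y + t • star C B θ X).prod (star C B θ Y + ins C B τ X)) := by
  have hu : SuppOn C ThinTame ((unitH C B).prod θ) :=
    thinTame_unitH.prod hθ
  have h1 := hasLSum_thinRows (B := B.ext (-1)) hu.tame (X.prod 0)
  have h2 := hasLSum_thinRows (B := B.ext (-1)) hu.tame (Y.prod 0)
  have h3 : HasLSum (fun n : ℕ => ∑ i : Fin n, conv C (B.ext (-1)) n (fun _ => 0)
      (cons ((B.ext (-1)).koszul 1 ∘ₗ X.prod 0) fun j =>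
        if j < i then (B.ext (-1)).koszul 1 ∘ₗ (unitH C B).prod θ
        else if j = i then (t • θ).prod τ else (unitH C B).prod θ))
      ((t • star C B θ X).prod (ins C B τ X)) :=
    (((hasLSum_ins_sum hθ _).smul t).prod (hasLSum_ins_sum hτ X)).congr fun n =>
      (conv_double t n).symm
  have h4 := h1.prod (h2.add h3)
  have e1 := thinRows_unit_prod (C := C) (B := B) hθ hX (HasDeg.zero (d := 0))
  have e2 := thinRows_unit_prod (C := C) (B := B) hθ hY (HasDeg.zero (d := 0))
  rw [e1, e2, zero_add, zero_add] at h4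
  have e3 : Y.prod (star C B θ Y) + (t • star C B θ X).prod (ins C B τ X) =
      (Y + t • star C B θ X).prod (star C B θ Y + ins C B τ X) := rfl
  rw [e3] at h4
  exact (hasLSum_thinRows (hu.prod ((hθ.smul t).prod hτ)).tame _).unique
    (h4.congr fun n => (conv_ext_one _ _ _ _ _).symm)

lemma thinRows_thinRows {u u' X : U →ₗ[k] V} (hu : SuppOn C TameColour u)
    (hue : IsEven C B u) (hu' : SuppOn C TameColour u')
    (hue' : IsEven C B u') :
    thinRows C B u (thinRows C B u' X) = thinRows C B (thinRows C B u u') X :=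
  (HasLSum.local_map (local_thinRows hu) (hasLSum_thinRows hu' X)).unique
    ((hasLSum_thinRows (hu.thinRows_tame hu') X).congr fun n =>
      (thinRows_conv hu hue n _ X _ fun _ => hue').symm)

lemma HasDeg.zero_left {M : DgModule k U} {N : DgModule k V} (d : ℤ) :
    HasDeg M N d (0 : U →ₗ[k] V) := HasDeg.zero

lemma HasDeg.star (hθ : SuppOn C ThinTame θ) (hθd : HasDeg C B (-1) θ) {m : ℤ}
    (hX : HasDeg C B m X) :
    HasDeg C B (m - 1) (star C B θ X) :=
  HasDeg.ins hθ hθd (hX.koszul 1)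

lemma SuppOn.star_thin (hθ : SuppOn C ThinTame θ)
    (hX : SuppOn C ThinTame X) : SuppOn C ThinTame (star C B θ X) :=
  hθ.ins_thin (hX.comp_left _)

/-- The pre-Lie relation for a square. -/
lemma ins_star (hθ : SuppOn C ThinTame θ) (hθd : HasDeg C B (-1) θ) {m : ℤ} (hX : HasDeg C B m X) :
    ins C B (star C B θ θ) X = star C B θ (star C B θ X) := by
  have hunit := thinTame_unitH (C := C) (B := B)
  have h0 : SuppOn C.toDgModule ThinTame (0 : U →ₗ[k] V) := SuppOn.zero
  have hd0 := fun d => HasDeg.zero_left (M := C.toDgModule) (N := B.toDgModule) d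
  have hu0 := hasDeg_unitH (C := C) (B := B)
  have hθ0 : SuppOn C.toDgModule ThinTame (θ.prod (0 : U →ₗ[k] V)) := hθ.prod h0
  have hu : SuppOn C.toDgModule ThinTame ((unitH C.toDgBoxCooperad B).prod θ) := hunit.prod hθ
  have hud : HasDeg C.toDgModule (B.ext (-1)).toDgModule 0 ((unitH C.toDgBoxCooperad B).prod θ) :=
    hu0.prod (d := -1) (by simpa using hθd)
  have h1 : SuppOn C.toDgModule ThinTame
      (((unitH C.toDgBoxCooperad B).prod θ).prod ((0 : U →ₗ[k] V).prod (0 : U →ₗ[k] V))) :=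
    hu.prod (h0.prod h0)
  have h1e : IsEven C.toDgBoxCooperad ((B.ext (-1)).ext (-1))
      (((unitH C.toDgBoxCooperad B).prod θ).prod ((0 : U →ₗ[k] V).prod (0 : U →ₗ[k] V))) :=
    isEven_iff.2 (hud.prod (d := -1) (HasDeg.zero_left _))
  have h2 : SuppOn C.toDgModule ThinTame
      ((unitH C.toDgBoxCooperad (B.ext (-1))).prod (θ.prod (0 : U →ₗ[k] V))) :=
    thinTame_unitH.prod hθ0
  have h2e : IsEven C.toDgBoxCooperad ((B.ext (-1)).ext (-1))
      ((unitH C.toDgBoxCooperad (B.ext (-1))).prod (θ.prod (0 : U →ₗ[k] V))) :=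
    isEven_iff.2 (hasDeg_unitH.prod (d := -1) (HasDeg.prod (d := -1) (by simpa using hθd)
      (HasDeg.zero_left _)))
  have key := thinRows_thinRows (X := (X.prod (0 : U →ₗ[k] V)).prod ((0 : U →ₗ[k] V).prod 0))
    h2.tame h2e h1.tame h1e
  have e1 := thinRows_double (C := C) (B := B) hθ h0 0 hX (hd0 0)
  have es0 : star C B θ 0 = 0 := by simp [star]
  simp only [zero_smul, es0, ins_zero_left, add_zero] at e1
  rw [e1] at key
  have e2 : ∀ {Z W : U →ₗ[k] V} {m m' : ℤ}, HasDeg C.toDgModule B.toDgModule m Z →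
      HasDeg C.toDgModule B.toDgModule (m - 1) W →
      thinRows C ((B.ext (-1)).ext (-1))
        ((unitH C.toDgBoxCooperad (B.ext (-1))).prod (θ.prod (0 : U →ₗ[k] V)))
        ((Z.prod W).prod ((0 : U →ₗ[k] V).prod 0)) =
      (Z.prod W).prod ((star C B θ Z).prod (-star C B θ W)) := fun {Z W m _} hZ hW => by
    have := thinRows_unit_prod (C := C) (B := B.ext (-1)) hθ0 (hZ.prod (d := -1) hW)
      (HasDeg.zero_left (N := (B.ext (-1)).toDgModule) 0)
    rw [zero_add, star_ext hθ h0, ins_zero_left, add_zero] at this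
    exact this
  rw [e2 (m' := 0) hX (HasDeg.star hθ hθd hX), e2 (m' := 0) hu0 (by simpa using hθd)] at key
  have e3 : star C B θ (unitH C.toDgBoxCooperad B) = θ := by
    rw [star, koszul_comp_unitH, ins_unit hθ hθd]
  rw [e3] at key
  have e4 := thinRows_double (C := C) (B := B) hθ (τ := -star C B θ θ) (hθ.star_thin hθ).neg 1 hX
    (hd0 0)
  rw [one_smul] at e4
  rw [e4, es0, zero_add, ins_neg_left (hθ.star_thin hθ)] at key
  have h5 := congrArg (fun z => LinearMap.snd k V V ∘ₗ LinearMap.snd k (V × V) (V × V) ∘ₗ z) key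
  have h6 : -star C B θ (star C B θ X) = 0 + -ins C B (star C B θ θ) X := h5
  rw [zero_add] at h6
  exact (neg_injective h6).symm

/-- The insertions of `θ` form a chain map. -/
lemma homD_star (hθ : SuppOn C ThinTame θ) (hθd : HasDeg C B (-1) θ) {m : ℤ} (hX : HasDeg C B m X) :
    C.homD B (m - 1) (star C B θ X) = -star C B θ (C.homD B m X) + ins C B (C.homD B (-1) θ) X := by
  have h0 : SuppOn C ThinTame (0 : U →ₗ[k] V) := SuppOn.zero
  have hu : SuppOn C ThinTame ((unitH C B).prod θ) :=
    thinTame_unitH.prod hθ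
  have hud : HasDeg C (B.ext (-1)) 0 ((unitH C B).prod θ) :=
    hasDeg_unitH.prod (d := -1) (by simpa using hθd)
  have hXd : HasDeg C (B.ext (-1)) m (X.prod (0 : U →ₗ[k] V)) :=
    hX.prod (d := -1) (HasDeg.zero_left _)
  have key := thinRows_hat (B := B.ext (-1)) hu.tame hud hXd
  have hD : ∀ (l : ℤ) (Z W : U →ₗ[k] V), C.homD (B.ext (-1)).toDgModule l (Z.prod W) =
      (C.homD B.toDgModule l Z).prod (-C.homD B.toDgModule (l - 1) W) := fun l Z W => by
    refine LinearMap.ext fun c => Prod.ext rfl ?_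
    change sgn k (-1) • B.d (W c) - sgn k l • W (C.d c) = -(B.d (W c) - sgn k (l - 1) • W (C.d c))
    rw [sub_eq_add_neg l, sgn_add]
    simp
    abel
  have hDu : C.homD B.toDgModule 0 (unitH C.toDgBoxCooperad B) = 0 := by
    have := congrArg (fun z => LinearMap.snd k V V ∘ₗ z) (hat_unitH (C := C.toDgBoxCooperad) (B := B))
    exact this.trans (by rw [unitH_ext]; rfl)
  have hD0 : ∀ l, C.homD B.toDgModule l (0 : U →ₗ[k] V) = 0 := fun l => by simp [DgModule.homD]
  rw [hat, hat, hD, hD, hDu, zero_sub, hD0, neg_zero] at key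
  have e := thinRows_double (C := C) (B := B) hθ (τ := -C.homD B.toDgModule (-1) θ)
    (hθ.homD _).neg 0 hX (hX.homD m)
  rw [zero_smul] at e
  rw [e, thinRows_unit_prod hθ hX (HasDeg.zero_left 0), hat, hD, zero_add,
    ins_neg_left (hθ.homD _)] at key
  have h5 := congrArg (fun z => LinearMap.snd k V V ∘ₗ LinearMap.snd k (V × V) (V × V) ∘ₗ z) key
  have h6 : star C B θ (C.homD B.toDgModule m X) + -ins C B (C.homD B.toDgModule (-1) θ) X =
      -C.homD B.toDgModule (m - 1) (star C B θ X) := h5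
  rw [← neg_inj, ← h6, neg_add, neg_neg]

lemma star_hat (hθ : SuppOn C ThinTame θ) (hθd : HasDeg C B (-1) θ) {m : ℤ} (hX : HasDeg C B m X) :
    star C (B.ext (-1)) (hat C B (-1) θ) (hat C B m X) = hat C B (m - 1) (star C B θ X) := by
  rw [hat, hat, star_ext hθ (hθ.homD _), hat, homD_star hθ hθd hX]

lemma Row.labels_pos {ρ : Row} (hρ : ρ.Good) (h : 0 < ρ.left) (i : Fin (ρ.1 + 1)) :
    0 < ρ.labels i := by
  obtain ⟨n, a, c⟩ := ρ
  change Fin (n + 1) at i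
  rw [Row.left_eq] at h
  change 0 < Stack.profile n a c 0 at h
  change 0 < Stack.profile n a c i
  induction i using Fin.induction with
  | zero => exact h
  | succ i ih =>
    rw [Stack.profile_castSucc hρ.1] at ih
    rw [Stack.profile_succ]
    refine Stack.right_pos (hρ.2 i) fun h' => ?_
    change c i = .leaf at h'
    change 0 < (c i).left at ih
    rw [h'] at ih
    exact lt_irrefl 0 ih

/-- Atomic rows are not thin. -/
lemma atoms_suppOn (φ X : U →ₗ[k] V) : SuppOn C (fun α => 0 < α.1 ∧ 0 < α.2.2) (atoms C B φ X) := by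
  refine SuppOn.hasLSum (hasLSum_atoms C B φ X) fun ρ => ?_
  rw [rowOp, convB_apply]
  have h1 := conv_suppOn (C := C) (B := B) ρ.1.1 ρ.1.labels
    (cons X fun i => col C B φ (ρ.1.2.2 i)) (fun _ => True) (fun _ _ => True)
    (fun _ _ _ _ h => absurd trivial h) (fun _ _ _ _ _ h => absurd trivial h)
  refine h1.mono fun α h => ?_
  obtain ⟨p, r, q, -, -, rfl⟩ := h
  exact ⟨Nat.add_pos_right _ (Row.labels_pos ρ.2.1 ρ.2.2.1 _),
    Nat.add_pos_right _ (Row.labels_pos ρ.2.1 ρ.2.2.1 _)⟩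

lemma atoms_unit (hφ : IsNonThin C B φ) : atoms C B φ (unitH C B) = φ := by
  have hu := hasDeg_unitH (C := C) (B := B)
  have h1 := rows_eq C B hφ.even _ hu
  rw [rows_unit C B (columns_even C B hφ.even) (rowFinite_columns C B φ)] at h1
  have h2 := columns_eq hφ
  rw [h1, add_right_inj, ← h1] at h2
  refine sub_eq_zero.1 (rows_columns_injective hφ.even
    ((hu.atoms hφ.even).sub (isEven_iff.1 hφ.even)) ?_)
  rw [map_sub, h2, sub_self]

lemma IsNonThin.prod (hφ : IsNonThin C B φ) (hψ : HasDeg C B (-1) ψ)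
    (hψs : SuppOn C (fun α => 0 < α.1 ∧ 0 < α.2.2) ψ) :
    IsNonThin C (B.ext (-1)) (φ.prod ψ) where
  even := isEven_iff.2 ((isEven_iff.1 hφ.even).prod (d := -1) (by simpa using hψ))
  supp := hφ.supp.prod hψs

variable (C B) in
/-- The non-thin part of the quadratic operation. -/
def quadNonThin (θ φ : U →ₗ[k] V) : U →ₗ[k] V := star C B θ φ - atoms C B φ θ

lemma quadNonThin_hasDeg (hφ : IsNonThin C B φ)
    (hθ : SuppOn C ThinTame θ) (hθd : HasDeg C B (-1) θ) :
    HasDeg C B (-1) (quadNonThin C B θ φ) := by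
  have := HasDeg.star (B := B) hθ hθd (isEven_iff.1 hφ.even)
  rw [zero_sub] at this
  exact this.sub (hθd.atoms hφ.even)

lemma quadNonThin_suppOn (hφ : IsNonThin C B φ) (hθ : SuppOn C ThinTame θ) :
    SuppOn C (fun α => 0 < α.1 ∧ 0 < α.2.2) (quadNonThin C B θ φ) :=
  SuppOn.sub (SuppOn.ins (P := fun p r => 0 < p ∧ 0 < r) hθ (hφ.supp.comp_left _))
    (atoms_suppOn _ _)

lemma atoms_prod_unit (hφ : IsNonThin C B φ) (hθ : SuppOn C ThinTame θ) (hθd : HasDeg C B (-1) θ) :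
    atoms C (B.ext (-1)) (φ.prod (quadNonThin C B θ φ)) ((unitH C B).prod θ) =
      φ.prod (star C B θ φ) := by
  have hΨ := hφ.prod (quadNonThin_hasDeg hφ hθ hθd) (quadNonThin_suppOn hφ hθ)
  have e : (unitH C B).prod θ = unitH C (B.ext (-1)) + inr k V V ∘ₗ θ := by
    rw [unitH_ext]
    exact LinearMap.ext fun c => by simp
  rw [e, map_add, atoms_unit hΨ, atoms_inr, LinearMap.fst_prod, quadNonThin]
  exact LinearMap.ext fun c => by simp

/-- The quadratic operation squares to zero, in the non-thin colours. -/
lemma atoms_prod_star (F : Filtration B) (hφ : IsNonThin C B φ)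
    (hφF : F.Holds 1 φ) (hθ : SuppOn C ThinTame θ)
    (hθd : HasDeg C B (-1) θ) :
    atoms C (B.ext (-1)) (φ.prod (quadNonThin C B θ φ)) (θ.prod (star C B θ θ)) =
      (atoms C B φ θ).prod (star C B θ (atoms C B φ θ)) := by
  have hΨ := hφ.prod (quadNonThin_hasDeg hφ hθ hθd) (quadNonThin_suppOn hφ hθ)
  have hφ' : IsNonThin C (B.ext (-1)) (φ.prod (0 : U →ₗ[k] V)) :=
    hφ.prod (HasDeg.zero_left _) SuppOn.zero
  have hu : SuppOn C ThinTame ((unitH C B).prod θ) :=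
    thinTame_unitH.prod hθ
  have hud : HasDeg C (B.ext (-1)) 0 ((unitH C B).prod θ) :=
    hasDeg_unitH.prod (d := -1) (by simpa using hθd)
  have h1 := atoms_thinRows (F.ext (-1) 0) hφ' hΨ (fun c => ⟨hφF c, zero_mem _⟩) hu
    (isEven_iff.2 hud) (by
      rw [atoms_prod_unit hφ hθ hθd, thinRows_unit_prod hθ (isEven_iff.1 hφ.even)
        (HasDeg.zero_left 0), zero_add])
    (hθd.prod (d := -1) (HasDeg.zero_left _))
  have h2 : atoms C (B.ext (-1)) (φ.prod 0) (θ.prod 0) = (atoms C B φ θ).prod 0 :=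
    (inl_isMorphism (B := B) (-1)).atoms φ θ
  rw [thinRows_unit_prod hθ hθd (HasDeg.zero_left 0), h2, thinRows_unit_prod hθ
    (hθd.atoms hφ.even) (HasDeg.zero_left 0), zero_add, zero_add] at h1
  exact h1

variable (C B) in
/-- The quadratic operation: the sum of all operations of arity at least two. -/
def quad (θ φ : U →ₗ[k] V) : U →ₗ[k] V := star C B θ θ + quadNonThin C B θ φ

/-- The quadratic operation squares to zero. -/
lemma quad_quad (F : Filtration B) (hφ : IsNonThin C B φ)
    (hφF : F.Holds 1 φ) (hθ : SuppOn C ThinTame θ)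
    (hθd : HasDeg C B (-1) θ) :
    quad C (B.ext (-1)) (θ.prod (star C B θ θ)) (φ.prod (quadNonThin C B θ φ)) =
      (quad C B θ φ).prod 0 := by
  rw [quad, quadNonThin, atoms_prod_star F hφ hφF hθ hθd, star_ext hθ (hθ.star_thin hθ),
    star_ext hθ (hθ.star_thin hθ), ins_star hθ hθd hθd, ins_star hθ hθd (isEven_iff.1 hφ.even)]
  refine LinearMap.ext fun c => Prod.ext (by simp [quad, quadNonThin]) ?_
  have : star C B θ (quadNonThin C B θ φ) = star C B θ (star C B θ φ) -
      star C B θ (atoms C B φ θ) := by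
    rw [quadNonThin, star, LinearMap.comp_sub, map_sub]; rfl
  rw [this]
  simp

/-- The quadratic operation is compatible with differentials. -/
lemma quad_hat (hφ : IsNonThin C B φ) (hθ : SuppOn C ThinTame θ) (hθd : HasDeg C B (-1) θ) :
    quad C (B.ext (-1)) (hat C B (-1) θ) (hat C B 0 φ) = hat C B (-2) (star C B θ θ) +
        hat C B (-1) (quadNonThin C B θ φ) := by
  rw [quad, quadNonThin, star_hat hθ hθd hθd, star_hat hθ hθd (isEven_iff.1 hφ.even),
    atoms_hat hφ.even hθd]
  congr 1
  refine LinearMap.ext fun c => Prod.ext (by simp [hat, quadNonThin]) ?_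
  simp [hat, quadNonThin, DgModule.homD]
  abel

end Quadratic

namespace Stack

/-- A Boolean function on the nodes is constant on connected components. -/
def Invariant (S : Stack) (f : Node S → Bool) : Prop := ∀ v w, Adj S v w → f v = f w

lemma Invariant.eq_of_mk_eq {S : Stack} {f : Node S → Bool} (hf : S.Invariant f) {v w : Node S}
    (h : Quot.mk (Adj S) v = Quot.mk (Adj S) w) : f v = f w :=
  congrArg (Quot.lift f hf) h

lemma Invariant.up {p r n a : ℕ} {c : Fin n → Stack} {f : Node (box p r n a c) → Bool}
    (hf : Invariant _ f) (i : Fin n) : (c i).Invariant fun v => f (.up i v) :=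
  fun _ _ h => hf _ _ (.up i _ _ h)

lemma length_leftWires (S : Stack) : S.leftWires.length = S.left := by
  induction S with
  | leaf => rfl
  | box p r n a c ih => cases n <;> simp [leftWires, left, ih]

lemma length_rightWires (S : Stack) : S.rightWires.length = S.right := by
  induction S with
  | leaf => rfl
  | box p r n a c ih => cases n <;> simp [rightWires, right, ih]

lemma map_eq_of_zip {α β γ : Type*} {l : List α} {l' : List β} (f : α → γ) (g : β → γ)
    (hl : l.length = l'.length) (h : ∀ v w, (v, w) ∈ l.zip l' → f v = g w) :
    l.map f = l'.map g := by
  induction l generalizing l' with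
  | nil => cases l' with
    | nil => rfl
    | cons b l' => simp at hl
  | cons a l ih => cases l' with
    | nil => simp at hl
    | cons b l' =>
      rw [List.map_cons, List.map_cons, h a b (by simp), ih (by simpa using hl)
        fun v w hvw => h v w (by simp [hvw])]

lemma eq_of_map_eq_of_zip {α β γ : Type*} {l : List α} {l' : List β} {f : α → γ} {g : β → γ}
    (h : l.map f = l'.map g) {v : α} {w : β} (hvw : (v, w) ∈ l.zip l') : f v = g w := by
  induction l generalizing l' with
  | nil => simp at hvw
  | cons a l ih => cases l' with
    | nil => simp at hvw
    | cons b l' =>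
      simp only [List.map_cons, List.cons.injEq] at h
      simp only [List.zip_cons_cons, List.mem_cons, Prod.mk.injEq] at hvw
      rcases hvw with ⟨rfl, rfl⟩ | hvw
      · exact h.1
      · exact ih h.2 hvw

lemma Invariant.map_wires {p r n a : ℕ} {c : Fin n → Stack} {f : Node (box p r n a c) → Bool}
    (hf : Invariant _ f) (hv : (box p r n a c).Valid) {i j : Fin n} (h : i.val + 1 = j.val) :
    (c i).rightWires.map (fun v => f (.up i v)) = (c j).leftWires.map fun v => f (.up j v) :=
  map_eq_of_zip _ _ (by rw [length_rightWires, length_leftWires, hv.2.2 i j h])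
    fun v w hvw => hf _ _ (.row i j h v w hvw)

/-- The number of lower strands on which `f` holds. -/
def cutStrands : ∀ {p r n a : ℕ} {c : Fin n → Stack} (_ : Node (box p r n a c) → Bool), ℕ
  | _, _, 0, a, _, f => (((List.finRange a).map fun t => f (.strand t)).takeWhile id).length
  | _, _, _ + 1, a, _, _ => a

lemma cutStrands_le {p r n a : ℕ} {c : Fin n → Stack} (f : Node (box p r n a c) → Bool) :
    cutStrands f ≤ a := by
  cases n with
  | zero => exact (List.takeWhile_prefix _).length_le.trans (by simp)
  | succ n => exact le_rfl

/-- The lower part of a stacking on which `f` holds. -/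
def cut : ∀ S : Stack, (Node S → Bool) → Stack
  | leaf, _ => leaf
  | box p r n _ c, f => bif f .root then box p r n (cutStrands f) fun i => cut (c i) fun v => f (.up i v)
    else leaf

lemma cut_prefix (S : Stack) (f : Node S → Bool) : Prefix (S.cut f) S := by
  induction S with
  | leaf => exact .leaf _
  | box p r n a c ih =>
    rw [cut]
    cases f .root with
    | false => exact .leaf _
    | true =>
      exact .box (fun i => ih i _) fun _ => cutStrands_le f

lemma takeWhile_replicate_append (n : ℕ) (b : Bool) (l : List Bool) (hn : 0 < n) :
    ((List.replicate n b ++ l).takeWhile id).length =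
      bif b then n + (l.takeWhile id).length else 0 := by
  cases b with
  | true =>
    rw [List.takeWhile_append_of_pos (by simp [List.mem_replicate])]
    simp
  | false =>
    obtain ⟨n, rfl⟩ := Nat.exists_eq_succ_of_ne_zero hn.ne'
    simp [List.replicate_succ]

lemma left_cut {S : Stack} (hS : S.AllNonThin) (f : Node S → Bool) :
    (S.cut f).left = ((S.leftWires.map f).takeWhile id).length := by
  induction S with
  | leaf => rfl
  | box p r n a c ih =>
    cases n with
    | zero =>
      rw [leftWires, List.map_append, List.map_replicate, takeWhile_replicate_append _ _ _ hS.1, cut]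
      cases f .root with
      | false => rfl
      | true => simp [left, cutStrands, Function.comp_def]
    | succ n =>
      rw [leftWires, List.map_append, List.map_replicate, takeWhile_replicate_append _ _ _ hS.1, cut]
      cases f .root with
      | false => rfl
      | true => simp [left, ih 0 (hS.2.2 0), Function.comp_def]

lemma right_cut {S : Stack} (hS : S.AllNonThin) (f : Node S → Bool) :
    (S.cut f).right = ((S.rightWires.map f).takeWhile id).length := by
  induction S with
  | leaf => rfl
  | box p r n a c ih =>
    cases n with
    | zero =>
      rw [rightWires, List.map_append, List.map_replicate, takeWhile_replicate_append _ _ _ hS.2.1,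
        cut]
      cases f .root with
      | false => rfl
      | true => simp [right, cutStrands, Function.comp_def]
    | succ n =>
      rw [rightWires, List.map_append, List.map_replicate, takeWhile_replicate_append _ _ _ hS.2.1,
        cut]
      cases f .root with
      | false => rfl
      | true => simp [right, ih (Fin.last n) (hS.2.2 _), Function.comp_def]

lemma cut_row_valid {p r n a a' : ℕ} {c : Fin n → Stack} {f : Node (box p r n a c) → Bool}
    (hf : Invariant _ f) (hv : (box p r n a c).Valid) (hS : ∀ i, (c i).AllNonThin)
    (ih : ∀ i, ((c i).cut fun v => f (.up i v)).Valid) (ha : 0 < n → a' = 0) :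
    (box p r n a' fun i => (c i).cut fun v => f (.up i v)).Valid :=
  ⟨ih, ha, fun i j h => by rw [right_cut (hS i), left_cut (hS j), hf.map_wires hv h]⟩

lemma cut_valid {S : Stack} (hS : S.AllNonThin) (hv : S.Valid) {f : Node S → Bool}
    (hf : S.Invariant f) : (S.cut f).Valid := by
  induction S with
  | leaf => trivial
  | box p r n a c ih =>
    rw [cut]
    cases f .root with
    | false => trivial
    | true =>
      refine cut_row_valid hf hv hS.2.2 (fun i => ih i (hS.2.2 i) (hv.1 i) (hf.up i)) fun h => ?_
      exact Nat.eq_zero_of_le_zero ((cutStrands_le f).trans (hv.2.1 h).le)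

lemma of_cutStrands {p r a : ℕ} {c : Fin 0 → Stack} {f : Node (box p r 0 a c) → Bool}
    (h : cutStrands f = a) (t : Fin a) : f (.strand t) = true := by
  have h1 : ((List.finRange a).map fun t => f (.strand t)).takeWhile id =
      (List.finRange a).map fun t => f (.strand t) :=
    (List.takeWhile_prefix _).eq_of_length ((show _ = a from h).trans (by simp))
  rw [List.takeWhile_eq_self_iff] at h1
  exact h1 _ (List.mem_map.2 ⟨t, List.mem_finRange t, rfl⟩)

lemma of_cut_eq {S : Stack} {f : Node S → Bool} (h : S.cut f = S) (v : Node S) : f v = true := by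
  induction S with
  | leaf => cases v
  | box p r n a c ih =>
    rw [cut] at h
    cases hr : f .root with
    | false => rw [hr] at h; cases h
    | true =>
      rw [hr] at h
      simp only [cond_true, box.injEq, heq_eq_eq, true_and] at h
      cases v with
      | root => exact hr
      | strand t => exact of_cutStrands h.1 t
      | up i v => exact ih i (congrFun h.2 i) v

/-- The node is the bottom box. -/
def Node.IsRoot : ∀ {S : Stack}, Node S → Prop
  | _, .root => True
  | _, .strand _ => False
  | _, .up _ _ => False

/-- The function which is `true` on the bottom box and the lower `a` strands, and given by `fi` on
the other boxes. -/
def boxFun (p r a a' : ℕ) {n : ℕ} {c : Fin n → Stack} (fi : ∀ i, Node (c i) → Bool) :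
    Node (box p r n a' c) → Bool
  | .root => true
  | .strand t => decide (t.val < a)
  | .up i v => fi i v

/-- A lower part of a stacking is described by a Boolean function on the nodes. -/
lemma Prefix.exists_invariant {F S : Stack} (h : Prefix F S) (hF : F.Valid) (hv : S.Valid) :
    ∃ f : Node S → Bool, S.Invariant f ∧
      S.leftWires.map f = List.replicate F.left true ++ List.replicate (S.left - F.left) false ∧
      S.rightWires.map f = List.replicate F.right true ++ List.replicate (S.right - F.right) false ∧
      ((∀ v, f v = true) → F = S) ∧ (F ≠ .leaf → ∀ v : Node S, v.IsRoot → f v = true) := by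
  induction h with
  | leaf S =>
    refine ⟨fun _ => false, fun _ _ _ => rfl, ?_, ?_, fun h => ?_, fun h => absurd rfl h⟩
    · simp [left, List.map_const', length_leftWires]
    · simp [right, List.map_const', length_rightWires]
    · cases S with
      | leaf => rfl
      | box p r n a c => exact absurd (h .root) (by simp)
  | @box p r n a a' c c' h ha ih =>
    choose fi h1 h2 h3 h4 _ using fun i => ih i (hF.1 i) (hv.1 i)
    let f := boxFun p r a a' fi
    have hst : a ≤ a' → (List.finRange a').map (fun t => decide (t.val < a)) =
        List.replicate a true ++ List.replicate (a' - a) false := fun h => by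
      refine List.ext_getElem (by simp; omega) fun i h1 h2 => ?_
      simp only [List.getElem_map, List.getElem_finRange, List.getElem_append, List.getElem_replicate,
        List.length_replicate]
      split_ifs with h <;> simpa using h
    refine ⟨f, ?_, ?_, ?_, ?_, ?_⟩
    · intro v w hvw
      cases hvw with
      | row i j hij v w hvw =>
        exact eq_of_map_eq_of_zip (f := fi i) (g := fi j)
          (by rw [h2, h3, hF.2.2 i j hij, hv.2.2 i j hij]) hvw
      | up i v w hvw => exact h1 i v w hvw
    · cases n with
      | zero =>
        simp only [leftWires, List.map_append, List.map_replicate, List.map_map, left]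
        rw [show (f ∘ Node.strand) = fun t : Fin a' => decide (t.val < a) from rfl, hst (ha rfl),
          List.replicate_add, List.append_assoc, Nat.add_sub_add_left]
        rfl
      | succ n =>
        simp only [leftWires, List.map_append, List.map_replicate, List.map_map, left]
        rw [show (f ∘ Node.up 0) = fi 0 from rfl, h2, List.replicate_add, List.append_assoc,
          Nat.add_sub_add_left]
        rfl
    · cases n with
      | zero =>
        simp only [rightWires, List.map_append, List.map_replicate, List.map_map, right]
        rw [show (f ∘ Node.strand) = fun t : Fin a' => decide (t.val < a) from rfl, hst (ha rfl),
          List.replicate_add, List.append_assoc, Nat.add_sub_add_left]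
        rfl
      | succ n =>
        simp only [rightWires, List.map_append, List.map_replicate, List.map_map, right]
        rw [show (f ∘ Node.up (Fin.last n)) = fi (Fin.last n) from rfl, h3, List.replicate_add,
          List.append_assoc, Nat.add_sub_add_left]
        rfl
    · intro hall
      obtain rfl : c = c' := funext fun i => h4 i fun v => hall (.up i v)
      congr 1
      cases n with
      | zero =>
        refine le_antisymm (ha rfl) ?_
        by_contra hlt
        have := hall (.strand ⟨a, by omega⟩)
        simp [f, boxFun] at this
      | succ n => rw [hF.2.1 n.succ_pos, hv.2.1 n.succ_pos]
    · intro _ v hr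
      cases v with
      | root => rfl
      | strand t => exact hr.elim
      | up i v => exact hr.elim

/-- The bottom box is isolated. -/
lemma mk_root_ne {p r n a : ℕ} {c : Fin n → Stack} {v : Node (box p r n a c)} (hv : v ≠ .root) :
    Quot.mk (Adj _) v ≠ Quot.mk (Adj _) .root := fun h => by
  classical
  have hf : Invariant (box p r n a c) fun v => decide (v = .root) := by
    intro v w hvw
    cases hvw <;> simp
  have := hf.eq_of_mk_eq h
  simp [hv] at this

lemma components_eq_two_iff {p r n a : ℕ} {c : Fin n → Stack} {v₀ : Node (box p r n a c)}
    (hv₀ : v₀ ≠ .root) : horizontalComponents (box p r n a c) = 2 ↔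
      ∀ v, v ≠ .root → Quot.mk (Adj _) v = Quot.mk (Adj _) v₀ := by
  rw [horizontalComponents, Nat.card_eq_two_iff]
  constructor
  · rintro ⟨x, y, hxy, h⟩ v hv
    have h' : ∀ z, z = x ∨ z = y := fun z => by
      have : z ∈ ({x, y} : Set _) := h ▸ Set.mem_univ z
      simpa using this
    have h1 := mk_root_ne hv
    have h2 := mk_root_ne hv₀
    rcases h' (Quot.mk _ v) with e | e <;> rcases h' (Quot.mk _ v₀) with e' | e' <;>
      rcases h' (Quot.mk _ .root) with e'' | e'' <;> simp_all
  · intro h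
    refine ⟨_, _, mk_root_ne hv₀, Set.eq_univ_of_forall fun z => ?_⟩
    induction z using Quot.ind with
    | mk v =>
      by_cases hv : v = .root
      · exact Or.inr (by rw [hv]; rfl)
      · exact Or.inl (h v hv)

end Stack

open Stack in
/-- Atomic rows are the connected ones. -/
lemma Row.atomic_iff {ρ : Row} (hρ : ρ.Good) (h : 0 < ρ.left) :
    ρ.Atomic ↔ (ρ.onBox 0 0).horizontalComponents = 2 := by
  classical
  obtain ⟨n, a, c⟩ := ρ
  obtain ⟨v₀, l, hv₀, hl⟩ : ∃ (v₀ : Node (Stack.box 0 0 n a c)) (l : List _), v₀ ≠ .root ∧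
      (Stack.box 0 0 n a c).leftWires = v₀ :: l := by
    cases n with
    | zero =>
      change 0 < 0 + a at h
      obtain ⟨a, rfl⟩ := Nat.exists_eq_succ_of_ne_zero (by omega : a ≠ 0)
      exact ⟨.strand 0, _, nofun, by rw [leftWires, List.finRange_succ]; rfl⟩
    | succ n =>
      change 0 < 0 + (c 0).left at h
      rw [zero_add, ← length_leftWires] at h
      obtain ⟨v, l, hvl⟩ := List.exists_cons_of_length_pos h
      exact ⟨.up 0 v, _, nofun, by rw [leftWires, hvl]; rfl⟩
  refine Iff.trans ?_ (components_eq_two_iff hv₀).symm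
  constructor
  · intro hat v hv
    let f : Node (Stack.box 0 0 n a c) → Bool := fun v =>
      decide (Quot.mk (Adj (Stack.box 0 0 n a c)) v = Quot.mk _ v₀)
    have hf : Invariant _ f := fun v w hvw => by simp only [f, Quot.sound hvw]
    have hf₀ : f v₀ = true := decide_eq_true rfl
    have hpre : Row.Prefix ⟨n, cutStrands f, fun i => (c i).cut fun v => f (.up i v)⟩ ⟨n, a, c⟩ :=
      .box (fun i => cut_prefix _ _) fun _ => cutStrands_le f
    have hval := cut_row_valid hf hρ.1 hρ.2
      (fun i => cut_valid (hρ.2 i) (hρ.1.1 i) (hf.up i)) (a' := cutStrands f)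
      fun h => Nat.eq_zero_of_le_zero ((cutStrands_le f).trans (hρ.1.2.1 h).le)
    have hpos : 0 < (((Stack.box 0 0 n a c).leftWires.map f).takeWhile id).length := by
      rw [hl, List.map_cons, hf₀]
      simp
    have key := hat.2 _ (hpre.good hval hρ) hpre (by
      cases n with
      | zero => simpa [Row.left, Row.onBox, Stack.left, leftWires, cutStrands, Function.comp_def]
          using hpos
      | succ n => simpa [Row.left, Row.onBox, Stack.left, leftWires, left_cut (hρ.2 0),
          Function.comp_def] using hpos)
    simp only [Sigma.mk.injEq, heq_eq_eq, Prod.mk.injEq, true_and] at key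
    refine of_decide_eq_true (p := Quot.mk (Adj (Stack.box 0 0 n a c)) v = Quot.mk _ v₀) ?_
    change f v = true
    cases v with
    | root => exact absurd rfl hv
    | strand t => exact of_cutStrands key.1 t
    | up i v => exact of_cut_eq (congrFun key.2 i) v
  · intro hconn
    refine ⟨h, fun ρ' hρ' hpre hpos => hpre.antisymm ?_ hρ' hρ⟩
    obtain ⟨f, h1, h2, -, h4, h5⟩ := Stack.Prefix.exists_invariant hpre hρ'.1 hρ.1
    have hf₀ : f v₀ = true := by
      have e : (Row.onBox ⟨n, a, c⟩ 0 0).leftWires = v₀ :: l := hl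
      obtain ⟨m, hm⟩ := Nat.exists_eq_succ_of_ne_zero (n := (ρ'.onBox 0 0).left) hpos.ne'
      rw [e, hm, List.replicate_succ] at h2
      exact (List.cons.inj h2).1
    have := h4 fun v => by
      by_cases hv : v = .root
      · exact h5 (fun h => by cases h) v (hv ▸ True.intro)
      · exact (h1.eq_of_mk_eq (hconn v hv)).trans hf₀
    exact (congrArg (Stack.Prefix _) this).mpr (Stack.Prefix.refl _)

namespace Stack

/-- The node is a thin box. -/
def Node.IsThin : ∀ {S : Stack}, Node S → Prop
  | box p r n _ _, .root => Thin (p, n, r)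
  | _, .strand _ => False
  | _, .up _ v => v.IsThin

lemma Node.IsThin.not_mem_wires {S : Stack} {v : Node S} (hv : v.IsThin) :
    v ∉ S.leftWires ∧ v ∉ S.rightWires := by
  induction v with
  | @root p r n a c =>
    have h1 : p = 0 := hv.1
    have h2 : r = 0 := hv.2
    subst h1 h2
    cases n <;> simp [leftWires, rightWires]
  | strand t => exact hv.elim
  | @up p r n a c i v ih =>
    have h := ih hv
    cases n with
    | zero => exact i.elim0
    | succ n =>
      constructor
      · simp only [leftWires, List.mem_append, List.mem_replicate, List.mem_map, Node.up.injEq, not_or]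
        refine ⟨fun h' => by simp at h', ?_⟩
        rintro ⟨w, hw, rfl, hwv⟩
        exact h.1 (eq_of_heq hwv ▸ hw)
      · simp only [rightWires, List.mem_append, List.mem_replicate, List.mem_map, Node.up.injEq, not_or]
        refine ⟨fun h' => by simp at h', ?_⟩
        rintro ⟨w, hw, rfl, hwv⟩
        exact h.2 (eq_of_heq hwv ▸ hw)

lemma Adj.not_isThin {S : Stack} {v w : Node S} (h : Adj S v w) : ¬ v.IsThin ∧ ¬ w.IsThin := by
  induction h with
  | row i j hij v w hvw =>
    exact ⟨fun h => Node.IsThin.not_mem_wires (v := v) h |>.2 (List.of_mem_zip hvw).1,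
      fun h => Node.IsThin.not_mem_wires (v := w) h |>.1 (List.of_mem_zip hvw).2⟩
  | up i v w h ih => exact ih

/-- Thin boxes are isolated. -/
lemma Node.IsThin.eq_of_mk_eq {S : Stack} {v w : Node S} (hv : v.IsThin)
    (h : Quot.mk (Adj S) w = Quot.mk (Adj S) v) : w = v := by
  classical
  have hf : S.Invariant fun x => decide (x = v) := fun x y hxy => by
    have h1 : x ≠ v := fun e => hxy.not_isThin.1 (e ▸ hv)
    have h2 : y ≠ v := fun e => hxy.not_isThin.2 (e ▸ hv)
    simp [h1, h2]
  simpa using hf.eq_of_mk_eq h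

lemma exists_isThin {S : Stack} (h : 0 < S.thinCount) : ∃ v : Node S, v.IsThin := by
  induction S with
  | leaf => exact absurd h (lt_irrefl 0)
  | box p r n a c ih =>
    by_cases hb : Thin (p, n, r)
    · exact ⟨.root, hb⟩
    · rw [thinCount, if_neg hb, zero_add] at h
      obtain ⟨i, -, hi⟩ := exists_ne_zero_of_sum_ne_zero h.ne'
      obtain ⟨v, hv⟩ := ih i (Nat.pos_of_ne_zero hi)
      exact ⟨.up i v, hv⟩

lemma AllNonThin.thinCount {S : Stack} (h : S.AllNonThin) : S.thinCount = 0 := by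
  induction S with
  | leaf => rfl
  | box p r n a c ih =>
    rw [Stack.thinCount, if_neg fun h' => h.1.ne' h'.1, zero_add]
    exact sum_eq_zero fun i _ => ih i (h.2.2 i)

lemma AllNonThin.noSemiThin {S : Stack} (h : S.AllNonThin) : S.NoSemiThin := by
  induction S with
  | leaf => trivial
  | box p r n a c ih =>
    have h1 := h.1
    have h2 := h.2.1
    exact ⟨by simp only [SemiThin]; omega, fun i => ih i (h.2.2 i)⟩

lemma NoSemiThin.allNonThin {S : Stack} (h : S.NoSemiThin) (h0 : S.thinCount = 0) :
    S.AllNonThin := by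
  induction S with
  | leaf => trivial
  | box p r n a c ih =>
    rw [Stack.thinCount] at h0
    have h1 : ¬ Thin (p, n, r) := fun h' => by rw [if_pos h'] at h0; omega
    rw [if_neg h1, zero_add, sum_eq_zero_iff] at h0
    have h2 := h.1
    simp only [Thin, SemiThin] at h1 h2
    exact ⟨by omega, by omega, fun i => ih i (h.2 i) (h0 i (mem_univ i))⟩

lemma eq_leaf_of_size {S : Stack} (h : S.size = 0) : S = leaf := by
  cases S with
  | leaf => rfl
  | box p r n a c => simp [size] at h

lemma eq_leaf_of_node {S : Stack} (h : Node S → False) : S = leaf := by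
  cases S with
  | leaf => rfl
  | box p r n a c => exact (h .root).elim

lemma size_pos {S : Stack} (h : S ≠ leaf) : 0 < S.size :=
  Nat.pos_of_ne_zero fun h' => h (eq_leaf_of_size h')

@[simp] lemma size_corolla (α : Colour) : (corolla α).size = 1 := by simp [corolla, size]

lemma thinCount_corolla {α : Colour} (h : Thin α) : (corolla α).thinCount = 1 := by
  simp [corolla, thinCount, h]

/-- A thin box on top of the `i`-th input of a box. -/
def twoBox (p r : ℕ) {n : ℕ} (i : Fin n) (q : ℕ) : Stack :=
  box p r n 0 (update (fun _ => leaf) i (corolla (0, q, 0)))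

lemma update_corolla_cases {n : ℕ} (i : Fin n) (q : ℕ) (P : Stack → Prop) (h0 : P leaf)
    (h1 : P (corolla (0, q, 0))) (j : Fin n) :
    P (update (fun _ => leaf) i (corolla (0, q, 0)) j) := by
  by_cases h : j = i
  · rw [h, update_self]; exact h1
  · rw [update_of_ne h]; exact h0

lemma sum_update_corolla {n : ℕ} (i : Fin n) (q : ℕ) (f : Stack → ℕ) (h : f leaf = 0) :
    ∑ j, f (update (fun _ => leaf) i (corolla (0, q, 0)) j) = f (corolla (0, q, 0)) := by
  rw [sum_eq_single i]
  · rw [update_self]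
  · intro j _ hj
    rw [update_of_ne hj, h]
  · simp

@[simp] lemma size_twoBox (p r : ℕ) {n : ℕ} (i : Fin n) (q : ℕ) : (twoBox p r i q).size = 2 := by
  rw [twoBox, size, sum_update_corolla i q size rfl]; simp

lemma profile_update_corolla {n : ℕ} (i : Fin n) (q : ℕ) :
    profile n 0 (update (fun _ => leaf) i (corolla (0, q, 0))) = fun _ => 0 := by
  cases n with
  | zero => exact i.elim0
  | succ n =>
    funext j
    refine Fin.cases ?_ (fun j => ?_) j
    · exact update_corolla_cases i q (fun S => S.left = 0) rfl (left_corolla _) 0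
    · exact update_corolla_cases i q (fun S => S.right = 0) rfl (right_corolla _) j

lemma left_twoBox (p r : ℕ) {n : ℕ} (i : Fin n) (q : ℕ) : (twoBox p r i q).left = p := by
  cases n with
  | zero => exact i.elim0
  | succ n =>
    rw [twoBox, left, update_corolla_cases i q (fun S => S.left = 0) rfl (left_corolla _) 0]; rfl

lemma right_twoBox (p r : ℕ) {n : ℕ} (i : Fin n) (q : ℕ) : (twoBox p r i q).right = r := by
  cases n with
  | zero => exact i.elim0
  | succ n =>
    rw [twoBox, right, update_corolla_cases i q (fun S => S.right = 0) rfl (right_corolla _)]; rfl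

lemma thinCount_twoBox (p r : ℕ) {n : ℕ} (i : Fin n) (q : ℕ) :
    (twoBox p r i q).thinCount = (if Thin (p, n, r) then 1 else 0) + 1 := by
  rw [twoBox, thinCount, sum_update_corolla i q thinCount rfl, thinCount_corolla ⟨rfl, rfl⟩]

lemma corolla_node {α : Colour} (v : Node (corolla α)) : v = .root := by
  obtain ⟨p, q, r⟩ := α
  cases v with
  | root => rfl
  | strand t => exact t.elim0
  | up i v => cases v

lemma thinQuadratic_twoBox {p r n : ℕ} (i : Fin n) (q : ℕ) (h : ¬ SemiThin (p, n, r)) :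
    (twoBox p r i q).ThinQuadratic := by
  refine ⟨⟨?_, fun _ => rfl, fun j l _ => ?_⟩, ⟨h, ?_⟩, ?_, ?_⟩
  · exact update_corolla_cases i q Valid trivial (valid_corolla _)
  · rw [update_corolla_cases i q (fun S => S.right = 0) rfl (right_corolla _) j,
      update_corolla_cases i q (fun S => S.left = 0) rfl (left_corolla _) l]
  · exact update_corolla_cases i q NoSemiThin trivial
      ⟨by simp [SemiThin], fun _ => trivial⟩
  · rw [thinDegree, left_twoBox, right_twoBox, thinCount_twoBox, size_twoBox]
    simp only [Thin]
    split_ifs with h1 <;> simp [h1]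
  · have hi : update (fun _ => leaf) i (corolla (0, q, 0)) i = corolla (0, q, 0) :=
      update_self _ _ _
    obtain ⟨v₀, hv₀⟩ : ∃ v₀ : Node (update (fun _ => leaf) i (corolla (0, q, 0)) i),
        ∀ v, v = v₀ := by
      rw [hi]; exact ⟨.root, corolla_node⟩
    refine (components_eq_two_iff (v₀ := .up i v₀) nofun).2 fun v hv => ?_
    cases v with
    | root => exact absurd rfl hv
    | strand t => exact i.elim0
    | up j v =>
      by_cases hj : j = i
      · subst hj
        rw [hv₀ v]
      · exfalso
        rw [update_of_ne hj] at v
        cases v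

lemma two_le_size_onBox {ρ : Row} (hρ : ρ.Good) (h : 0 < ρ.left) (hn : 0 < ρ.1) (p r : ℕ) :
    2 ≤ (ρ.onBox p r).size := by
  obtain ⟨n, a, c⟩ := ρ
  have h1 := Row.labels_pos hρ h (Fin.castSucc ⟨0, hn⟩)
  rw [Row.labels, profile_castSucc hρ.1] at h1
  have h2 : 0 < (c ⟨0, hn⟩).size := size_pos fun h' => by
    change 0 < (c ⟨0, hn⟩).left at h1
    rw [h'] at h1
    exact lt_irrefl 0 h1
  have h3 : (c ⟨0, hn⟩).size ≤ ∑ i, (c i).size :=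
    Finset.single_le_sum (f := fun i => (c i).size) (fun _ _ => Nat.zero_le _) (mem_univ _)
  change 2 ≤ 1 + ∑ i, (c i).size
  omega

lemma thinQuadratic_onBox {ρ : Row} (hρ : ρ.Good) (h : ρ.Atomic) : (ρ.onBox 0 0).ThinQuadratic := by
  have hc := (Row.atomic_iff hρ h.1).1 h
  have hl := h.1
  obtain ⟨n, a, c⟩ := ρ
  refine ⟨hρ.1, ⟨by simp [SemiThin], fun i => (hρ.2 i).noSemiThin⟩, ?_, hc⟩
  have h0 : (Row.onBox ⟨n, a, c⟩ 0 0).thinCount = 1 := by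
    rw [Row.onBox, thinCount, if_pos ⟨rfl, rfl⟩]
    rw [sum_eq_zero fun i _ => (hρ.2 i).thinCount, add_zero]
  rw [thinDegree, if_neg fun h' => hl.ne' h'.1, h0]
  push_cast
  ring

lemma eq_corolla_of_size {S : Stack} (hv : S.Valid) (h : S.size = 1) (hl : S.left = 0)
    (hr : S.right = 0) : ∃ q, S = corolla (0, q, 0) := by
  cases S with
  | leaf => simp [size] at h
  | box p r n a c =>
    have h1 : ∀ i, c i = leaf := fun i => eq_leaf_of_size <| by
      have : ∑ i, (c i).size = 0 := by simp only [size] at h; omega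
      exact sum_eq_zero_iff.1 this i (mem_univ i)
    obtain rfl : c = fun _ => leaf := funext h1
    refine ⟨n, ?_⟩
    cases n with
    | zero =>
      simp only [left, right] at hl hr
      obtain ⟨rfl, rfl⟩ : p = 0 ∧ a = 0 := by omega
      obtain rfl : r = 0 := by omega
      rfl
    | succ n =>
      simp only [left, right] at hl hr
      obtain rfl : p = 0 := hl
      obtain rfl : r = 0 := hr
      rw [hv.2.1 n.succ_pos]
      rfl

lemma eq_twoBox {p r n a : ℕ} {c : Fin n → Stack} (hv : (box p r n a c).Valid) {i : Fin n}
    {q : ℕ} (hi : c i = corolla (0, q, 0)) (h : ∀ j, j ≠ i → c j = leaf) :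
    box p r n a c = twoBox p r i q := by
  rw [twoBox, hv.2.1 (Fin.pos i)]
  congr 1
  funext j
  by_cases hj : j = i
  · rw [hj, hi, update_self]
  · rw [h j hj, update_of_ne hj]

lemma ThinQuadratic.cases {S : Stack} (h : S.ThinQuadratic) (h2 : 2 ≤ S.size) :
    (∃ (p r n : ℕ) (i : Fin n) (q : ℕ), ¬ SemiThin (p, n, r) ∧ S = twoBox p r i q) ∨
      ∃ ρ : Row, ρ.Good ∧ ρ.Atomic ∧ 0 < ρ.1 ∧ S = ρ.onBox 0 0 := by
  obtain ⟨hv, hs, hd, hc⟩ := h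
  cases S with
  | leaf => simp [size] at h2
  | box p r n a c =>
    rw [thinDegree] at hd
    split_ifs at hd with h0
    · left
      have hsum : ∑ i, (c i).size = 1 := by
        have : (box p r n a c).size = 2 := by omega
        simp only [size] at this
        omega
      obtain ⟨i, -, hi⟩ := exists_ne_zero_of_sum_ne_zero (hsum.trans_ne one_ne_zero)
      have hother := sum_erase_add univ (fun i => (c i).size) (mem_univ i)
      have hi1 : (c i).size = 1 := by omega
      have hj : ∀ j, j ≠ i → c j = leaf := fun j hj => eq_leaf_of_size <| by
        have : ∑ j ∈ univ.erase i, (c j).size = 0 := by omega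
        exact sum_eq_zero_iff.1 this j (mem_erase.2 ⟨hj, mem_univ j⟩)
      cases n with
      | zero => exact i.elim0
      | succ n =>
        have hl : (c i).left = 0 := by
          rcases Fin.eq_zero_or_eq_succ i with e | ⟨l, e⟩
          · have := h0.1
            simp only [left] at this
            rw [e]; omega
          · rw [e, ← hv.2.2 l.castSucc l.succ (by simp), hj l.castSucc (by
              rw [e]; exact (Fin.castSucc_lt_succ).ne)]
            rfl
        have hr : (c i).right = 0 := by
          rcases Fin.eq_castSucc_or_eq_last i with ⟨l, e⟩ | e
          · rw [e, hv.2.2 l.castSucc l.succ (by simp), hj l.succ (by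
              rw [e]; exact (Fin.castSucc_lt_succ).ne')]
            rfl
          · have := h0.2
            simp only [right] at this
            rw [e]; omega
        obtain ⟨q, hq⟩ := eq_corolla_of_size (hv.1 i) hi1 hl hr
        exact ⟨p, r, n + 1, i, q, hs.1, eq_twoBox hv hq hj⟩
    · have hone : (box p r n a c).thinCount = 1 := by omega
      by_cases hb : Thin (p, n, r)
      · right
        obtain ⟨h1, h2'⟩ := hb
        simp only at h1 h2'
        subst h1 h2'
        rw [thinCount, if_pos ⟨rfl, rfl⟩, Nat.add_eq_left, sum_eq_zero_iff] at hone
        have hgood : Row.Good ⟨n, a, c⟩ :=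
          ⟨hv, fun i => (hs.2 i).allNonThin (hone i (mem_univ i))⟩
        have hpos : 0 < Row.left ⟨n, a, c⟩ := by
          by_contra hneg
          have := Row.eq_trivial hgood (by omega)
          simp only [Row.trivial, Sigma.mk.injEq, heq_eq_eq, Prod.mk.injEq, true_and] at this
          rw [this.2] at h2
          simp [size] at h2
        refine ⟨⟨n, a, c⟩, hgood, (Row.atomic_iff hgood hpos).2 hc, Nat.pos_of_ne_zero fun hn => ?_, rfl⟩
        change n = 0 at hn
        subst hn
        simp [size] at h2
      · left
        obtain ⟨v, hvt⟩ := exists_isThin (S := box p r n a c) (by omega)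
        have hroot : v ≠ .root := fun h' => hb (by rw [h'] at hvt; exact hvt)
        have hall : ∀ w, w ≠ .root → w = v := fun w hw =>
          hvt.eq_of_mk_eq ((components_eq_two_iff hroot).1 hc w hw)
        cases v with
        | root => exact absurd rfl hroot
        | strand t => exact hvt.elim
        | up i v =>
          have hj : ∀ j, j ≠ i → c j = leaf := fun j hj => eq_leaf_of_node fun w => by
            have := hall (.up j w) nofun
            simp only [Node.up.injEq] at this
            exact hj this.1
          have hi : ∀ w : Node (c i), w = v := fun w => by
            have := hall (.up i w) nofun
            simpa using this
          obtain ⟨q, hq⟩ : ∃ q, c i = corolla (0, q, 0) := by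
            have hvi := hv.1 i
            have hvt' : v.IsThin := hvt
            clear hall hvt hroot
            generalize c i = T at v hi hvi hvt'
            cases T with
            | leaf => cases v
            | box p' r' n' a' c' =>
              obtain rfl : v = .root := (hi .root).symm
              obtain ⟨h1, h2'⟩ := hvt'
              simp only at h1 h2'
              subst h1 h2'
              obtain rfl : c' = fun _ => leaf := funext fun j => eq_leaf_of_node fun w => by
                have := hi (.up j w)
                simp at this
              refine ⟨n', ?_⟩
              have : a' = 0 := by
                rcases Nat.eq_zero_or_pos n' with h' | h'
                · subst h'
                  by_contra ha
                  have := hi (.strand ⟨0, Nat.pos_of_ne_zero ha⟩)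
                  simp at this
                · exact hvi.2.1 h'
              rw [this]
              rfl
          exact ⟨p, r, n, i, q, hs.1, eq_twoBox hv hq hj⟩

end Stack

section Convolve

namespace Stack

/-- The position of the first box over the `i`-th input. -/
def start {n : ℕ} (c : Fin n → Stack) (i : Fin n) : ℕ := ∑ j with j < i, (c j).size

lemma start_eq_offset {n : ℕ} (c : Fin n → Stack) (i : Fin n) :
    start c i = offset (fun j => (c j).size) i := by
  refine (sum_bij (fun t ht => ⟨t, (mem_range.1 ht).trans i.2⟩) (fun t ht => ?_)
    (fun t _ t' _ h => congrArg Fin.val h) (fun j hj => ?_) fun t ht => ?_).symm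
  · exact mem_filter.2 ⟨mem_univ _, mem_range.1 ht⟩
  · exact ⟨j, mem_range.2 (mem_filter.1 hj).2, rfl⟩
  · exact stream_lt _ _

lemma start_add_size {n : ℕ} (c : Fin n → Stack) (i : Fin n) :
    start c i + (c i).size = offset (fun j => (c j).size) (i + 1) := by
  rw [start_eq_offset, offset_castSucc_add]

lemma start_add_size_le {n : ℕ} (c : Fin n → Stack) {i j : Fin n} (h : i < j) :
    start c i + (c i).size ≤ start c j := by
  rw [start_add_size, start_eq_offset]
  exact offset_le _ h

lemma start_add_size_le_sum {n : ℕ} (c : Fin n → Stack) (i : Fin n) :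
    start c i + (c i).size ≤ ∑ j, (c j).size := by
  rw [start_add_size, ← offset_self]
  exact offset_le _ i.2

lemma sum_range_size {M : Type*} [AddCommMonoid M] {p r n a : ℕ} {c : Fin n → Stack} (f : ℕ → M) :
    ∑ v ∈ range (box p r n a c).size, f v =
      f 0 + ∑ i, ∑ t ∈ range (c i).size, f (1 + start c i + t) := by
  rw [size, Finset.sum_range_add, sum_range_one, ← offset_self,
    sum_range_blocks (stream fun j => (c j).size) (offset fun j => (c j).size) (fun _ => rfl),
    sum_range]
  refine congrArg _ (sum_congr rfl fun i _ => ?_)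
  rw [stream_coe, start_eq_offset]
  exact sum_congr rfl fun t _ => by rw [add_assoc]

end Stack

open Stack

variable {C : DgBoxCooperad k U} {B : DgBoxOperad k V}

lemma convolve_box (g : ℕ → U →ₗ[k] V) (p r n a : ℕ) (c : Fin n → Stack) (s : ℕ) :
    convolve C B g (box p r n a c) s = conv C B n (profile n a c)
      (cons (g s ∘ₗ C.proj (p, n, r)) fun i => convolve C B g (c i) (s + 1 + start c i)) := rfl

lemma convolve_congr {g g' : ℕ → U →ₗ[k] V} (S : Stack) (s : ℕ)
    (h : ∀ v, s ≤ v → v < s + S.size → g v = g' v) :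
    convolve C B g S s = convolve C B g' S s := by
  induction S generalizing s with
  | leaf => rfl
  | box p r n a c ih =>
    rw [convolve_box, convolve_box]
    have h0 := h s le_rfl (by simp only [size]; omega)
    have hi : ∀ i, convolve C B g (c i) (s + 1 + start c i) =
        convolve C B g' (c i) (s + 1 + start c i) := fun i => ih i _ fun v h1 h2 => by
      have := start_add_size_le_sum c i
      exact h v (by omega) (by simp only [size]; omega)
    simp only [h0, hi]

lemma IsMorphism.convolve {V' : Type*} [AddCommGroup V'] [Module k V'] {B' : DgBoxOperad k V'}
    {ι : V →ₗ[k] V'} (hι : IsMorphism B B' ι) (g : ℕ → U →ₗ[k] V) (S : Stack) (s : ℕ) :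
    convolve C B' (fun v => ι ∘ₗ g v) S s = ι ∘ₗ convolve C B g S s := by
  induction S generalizing s with
  | leaf => exact hι.unitH
  | box p r n a c ih =>
    simp only [convolve_box, ih, comp_assoc]
    exact hι.conv _ _ _

lemma koszul_isMorphism (m : ℤ) : IsMorphism B B (B.koszul m) where
  map_comp n P x := (B.koszul_comp m n P x).symm
  map_one := B.koszul_one m

/-- The convolution along a stacking is linear in each box. -/
lemma convolve_update_linear {g g₁ g₂ : ℕ → U →ₗ[k] V} {S : Stack} {s w : ℕ} (h1 : s ≤ w)
    (h2 : w < s + S.size) (a b : k) (hw : g w = a • g₁ w + b • g₂ w)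
    (h : ∀ v, v ≠ w → g v = g₁ v ∧ g v = g₂ v) : convolve C B g S s =
      a • convolve C B g₁ S s + b • convolve C B g₂ S s := by
  classical
  induction S generalizing s with
  | leaf => simp only [size] at h2; omega
  | box p r n t c ih =>
    have hch : ∀ i, (w < s + 1 + start c i ∨ s + 1 + start c i + (c i).size ≤ w) →
        convolve C B g₁ (c i) (s + 1 + start c i) = convolve C B g (c i) (s + 1 + start c i) ∧
        convolve C B g₂ (c i) (s + 1 + start c i) = convolve C B g (c i) (s + 1 + start c i) :=
      fun i hi => ⟨convolve_congr _ _ fun v h3 h4 => ((h v (by omega)).1).symm,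
        convolve_congr _ _ fun v h3 h4 => ((h v (by omega)).2).symm⟩
    simp only [convolve_box]
    rcases h1.eq_or_lt with rfl | h1
    · have e : ∀ i, s < s + 1 + start c i := fun i => by omega
      simp only [(hch _ (Or.inl (e _))).1, (hch _ (Or.inl (e _))).2, hw, add_comp, smul_comp]
      simp only [← convB_apply, map_add, map_smul]
    · obtain ⟨i, hi, t', ht, hv⟩ := exists_block (m := stream fun j => (c j).size)
        (off := offset fun j => (c j).size) (fun _ => rfl) (n := n) (j := w - (s + 1)) (by
          rw [offset_self]
          simp only [size] at h2
          omega)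
      have hst := start_eq_offset c ⟨i, hi⟩
      rw [stream_lt _ hi] at ht
      simp only at hst
      have hj : ∀ j, j ≠ ⟨i, hi⟩ → (w < s + 1 + start c j ∨ s + 1 + start c j + (c j).size ≤ w) := by
        intro j hj
        rcases lt_or_gt_of_ne hj with h' | h'
        · have := start_add_size_le c h'
          omega
        · have := start_add_size_le c h'
          omega
      have e0 : g₁ s = g s ∧ g₂ s = g s := ⟨(h s (by omega)).1.symm, (h s (by omega)).2.symm⟩
      rw [e0.1, e0.2]
      have key : ∀ g' : ℕ → U →ₗ[k] V, (∀ j, j ≠ ⟨i, hi⟩ →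
          convolve C B g' (c j) (s + 1 + start c j) = convolve C B g (c j) (s + 1 + start c j)) →
          (cons (g s ∘ₗ C.proj (p, n, r)) fun j => convolve C B g' (c j) (s + 1 + start c j) :
            Fin (n + 1) → U →ₗ[k] V) = update (cons (g s ∘ₗ C.proj (p, n, r))
              fun j => convolve C B g (c j) (s + 1 + start c j)) (Fin.succ ⟨i, hi⟩)
              (convolve C B g' (c ⟨i, hi⟩) (s + 1 + start c ⟨i, hi⟩)) := by
        intro g' hg'
        rw [← cons_update]
        congr 1
        funext j
        rcases eq_or_ne j ⟨i, hi⟩ with rfl | hne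
        · rw [update_self]
        · rw [update_of_ne hne, hg' j hne]
      rw [key g fun _ _ => rfl, key g₁ fun j hj' => (hch j (hj j hj')).1,
        key g₂ fun j hj' => (hch j (hj j hj')).2,
        ih ⟨i, hi⟩ (s := s + 1 + start c ⟨i, hi⟩) (by omega) (by omega),
        MultilinearMap.map_update_add, MultilinearMap.map_update_smul, MultilinearMap.map_update_smul]

lemma convolve_sgn_smul (e : ℕ → ℤ) (g : ℕ → U →ₗ[k] V) (S : Stack) (s : ℕ) :
    convolve C B (fun v => sgn k (e v) • g v) S s =
      sgn k (∑ v ∈ range S.size, e (s + v)) • convolve C B g S s := by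
  induction S generalizing s with
  | leaf => simp [convolve, size]
  | box p r n a c ih =>
    simp only [convolve_box, ih, smul_comp]
    have : (cons (sgn k (e s) • g s ∘ₗ C.proj (p, n, r)) fun i =>
        sgn k (∑ v ∈ range (c i).size, e (s + 1 + start c i + v)) •
          convolve C B g (c i) (s + 1 + start c i) : Fin (n + 1) → U →ₗ[k] V) =
        fun i => (cons (sgn k (e s)) fun i =>
          sgn k (∑ v ∈ range (c i).size, e (s + 1 + start c i + v)) : Fin (n + 1) → k) i •
          (cons (g s ∘ₗ C.proj (p, n, r)) fun i => convolve C B g (c i) (s + 1 + start c i) :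
            Fin (n + 1) → U →ₗ[k] V) i := funext fun i => Fin.cases rfl (fun _ => rfl) i
    rw [this, map_smul_univ, prod_univ_succ, cons_zero, sum_range_size, sgn_add, sgn_sum, add_zero]
    simp only [cons_succ, add_assoc]

/-- The maps entering the component of `ε` in the box `w`. -/
def epsSlot (B : DgBoxOperad k V) (d : ℤ) (f g : ℕ → U →ₗ[k] V) (w v : ℕ) : U →ₗ[k] V :=
  if v < w then B.koszul d ∘ₗ f v else if v = w then g v else f v

lemma convolve_ext (d : ℤ) (f g : ℕ → U →ₗ[k] V) (S : Stack) (s : ℕ) :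
    convolve C (B.ext d) (fun v => (f v).prod (g v)) S s = (convolve C B f S s).prod
      (∑ v ∈ range S.size, convolve C B (epsSlot B d f g (s + v)) S s) := by
  induction S generalizing s with
  | leaf => exact unitH_ext d
  | box p r n a c ih =>
    have hp : ∀ X Y : U →ₗ[k] V, (X.prod Y) ∘ₗ C.proj (p, n, r) =
        (X ∘ₗ C.proj (p, n, r)).prod (Y ∘ₗ C.proj (p, n, r)) := fun _ _ => rfl
    simp only [convolve_box, ih, hp]
    rw [conv_ext, sum_range_size]
    congr 2
    · congr 1
      have h0 : epsSlot B d f g (s + 0) s = g s := by simp [epsSlot]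
      rw [h0]
      congr 1
      funext i
      exact convolve_congr _ _ fun v h1 h2 => by
        rw [epsSlot, if_neg (by omega), if_neg (by omega)]
    · let T := fun j => convolve C B f (c j) (s + 1 + start c j)
      refine sum_congr rfl fun i _ => ?_
      have key : ∀ Z : U →ₗ[k] V, (cons (B.koszul d ∘ₗ f s ∘ₗ C.proj (p, n, r)) fun j =>
          if j < i then B.koszul d ∘ₗ T j else
          if j = i then Z else T j : Fin (n + 1) → U →ₗ[k] V) =
          update (cons (B.koszul d ∘ₗ f s ∘ₗ C.proj (p, n, r)) fun j =>
            if j < i then B.koszul d ∘ₗ T j else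
            T j) i.succ Z := fun Z => by
        rw [← cons_update]
        congr 1
        funext j
        rcases eq_or_ne j i with rfl | hne
        · simp
        · rw [update_of_ne hne, if_neg hne]
      have hsum : (fun j => if j < i then B.koszul d ∘ₗ T j else
          if j = i then ∑ v ∈ range (c j).size,
            convolve C B (epsSlot B d f g (s + 1 + start c j + v)) (c j) (s + 1 + start c j)
          else T j) =
          fun j => if j < i then B.koszul d ∘ₗ T j else
          if j = i then ∑ v ∈ range (c i).size,
            convolve C B (epsSlot B d f g (s + 1 + start c i + v)) (c i) (s + 1 + start c i)
          else T j := by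
        funext j
        rcases eq_or_ne j i with rfl | hne
        · rfl
        · simp only [if_neg hne]
      rw [hsum, key, MultilinearMap.map_update_sum]
      refine sum_congr rfl fun t ht => ?_
      rw [← key]
      have ht' := mem_range.1 ht
      congr 1
      have hs : epsSlot B d f g (s + (1 + start c i + t)) s = B.koszul d ∘ₗ f s := by
        rw [epsSlot, if_pos (by omega)]
      rw [hs]
      congr 1
      funext j
      rcases lt_trichotomy j i with hj | rfl | hj
      · have hle := start_add_size_le c hj
        rw [if_pos hj, ← (koszul_isMorphism d).convolve]
        exact convolve_congr _ _ fun v h1 h2 => by rw [epsSlot, if_pos (by omega)]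
      · rw [if_neg (lt_irrefl _), if_pos rfl]
        congr 2
        omega
      · have hle := start_add_size_le c hj
        rw [if_neg hj.not_gt, if_neg hj.ne']
        exact convolve_congr _ _ fun v h1 h2 => by
          rw [epsSlot, if_neg (by omega), if_neg (by omega)]

/-- The number of vertical inputs of a stacking. -/
def Stack.leaves : Stack → ℕ
  | leaf => 1
  | box _ _ _ _ c => ∑ i, leaves (c i)

lemma convolve_suppOn (g : ℕ → U →ₗ[k] V) (S : Stack) (s : ℕ) :
    SuppOn C (· = (S.left, S.leaves, S.right)) (convolve C B g S s) := by
  induction S generalizing s with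
  | leaf => exact unitH_suppOn
  | box p r n a c ih =>
    rw [convolve_box]
    refine (conv_suppOn (C := C) (B := B) n _ (cons (g s ∘ₗ C.proj (p, n, r)) fun i =>
      convolve C B g (c i) (s + 1 + start c i)) (· = (p, n, r))
      (fun i α => α = ((c i).left, (c i).leaves, (c i).right)) (SuppOn.proj _ _)
      fun i => ih i _).mono ?_
    rintro α ⟨p', r', q, h1, h2, rfl⟩
    simp only [Prod.mk.injEq, true_and] at h1
    obtain ⟨rfl, rfl⟩ := h1
    have hq : q = fun i => (c i).leaves := funext fun i => congrArg (fun z => z.2.1) (h2 i)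
    rw [hq]
    cases n <;> rfl

lemma convolve_hasDeg (g : ℕ → U →ₗ[k] V) (δ : ℕ → ℤ) (S : Stack) (s : ℕ)
    (h : ∀ v, s ≤ v → v < s + S.size → ∀ α, HasDeg C B
      (δ v - if Thin α then 1 else 0) (g v ∘ₗ C.proj α)) :
    HasDeg C B (∑ v ∈ range S.size, δ (s + v) - S.thinCount) (convolve C B g S s) := by
  induction S generalizing s with
  | leaf =>
    have := isEven_iff.1 (unitH_isEven (C := C) (B := B))
    simpa [size, thinCount, convolve, unitH] using this
  | box p r n a c ih =>
    have hb := h s le_rfl (by simp only [size]; omega) (p, n, r)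
    have hc : ∀ i, _ := fun i => ih i (s + 1 + start c i) fun v h1 h2 => by
      have := start_add_size_le_sum c i
      exact h v (by omega) (by simp only [size]; omega)
    have := conv_hasDeg (C := C) (B := B) n (profile n a c) (cons (g s ∘ₗ C.proj (p, n, r))
      fun i => convolve C B g (c i) (s + 1 + start c i)) (cons _ fun i =>
        ∑ v ∈ range (c i).size, δ (s + 1 + start c i + v) - (c i).thinCount)
      (Fin.cases hb fun i => hc i)
    rw [convolve_box]
    convert this using 1
    rw [sum_range_size, sum_univ_succ, cons_zero, thinCount]
    simp only [cons_succ, Finset.sum_sub_distrib, add_assoc, add_zero]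
    push_cast
    ring

lemma Filtration.Holds.convolve {F : Filtration B} {g : ℕ → U →ₗ[k] V} (S : Stack) (s : ℕ)
    (h : ∀ v, F.Holds 1 (g v)) : F.Holds S.size (convolve C B g S s) := by
  induction S generalizing s with
  | leaf => exact Filtration.Holds.zero_left
  | box p r n a c ih =>
    rw [convolve_box, size]
    have := Filtration.Holds.conv (C := C) (F := F) n (profile n a c) (cons (g s ∘ₗ C.proj (p, n, r))
      fun i => BoxOperads.convolve C B g (c i) (s + 1 + start c i)) (cons 1 fun i => (c i).size)
      (Fin.cases ((h s).comp _) fun i => ih i _)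
    simpa [sum_univ_succ] using this

lemma approx_convolve (g : ℕ → U →ₗ[k] V) (S : Stack) (s : ℕ) :
    Approx (C.words LinearMap.id S) (convolve C B g S s) := by
  induction S generalizing s with
  | leaf =>
    intro T
    exact ⟨_, Submodule.subset_span ⟨_, rfl, _, rfl⟩, fun _ _ => rfl⟩
  | box p r n a c ih =>
    rw [convolve_box]
    refine (Approx.conv _ (approx_comp_proj (g s) (p, n, r)) fun i => ih i _).mono ?_
    rintro φ ⟨_, ⟨ψ, rfl⟩, χ, hχ, rfl⟩
    exact ⟨ψ, χ, hχ, rfl⟩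

end Convolve

namespace Stack

lemma leaves_corolla (α : Colour) : (corolla α).leaves = α.2.1 := by simp [corolla, leaves]

lemma leaves_twoBox (p r : ℕ) {n : ℕ} (i : Fin n) (q : ℕ) :
    (twoBox p r i q).leaves + 1 = n + q := by
  have h : (fun j => (update (fun _ => leaf) i (corolla (0, q, 0)) j).leaves) =
      update (fun _ => 1) i q := by
    funext j
    rcases eq_or_ne j i with rfl | h
    · rw [update_self, update_self, leaves_corolla]
    · rw [update_of_ne h, update_of_ne h]; rfl
  have hn := Fin.pos i
  rw [twoBox, leaves, h, Finset.sum_update_of_mem (mem_univ i), Finset.sum_const,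
    smul_eq_mul, mul_one, Finset.card_sdiff_of_subset (by simp)]
  simp
  omega

end Stack

section Quadratic

open Stack

/-- Only finitely many thin-quadratic stackings contribute to the decomposition of an element. -/
lemma finite_thinQuadratic (C : ConilpotentDgBoxCooperad k U) (B : DgBoxOperad k V) (c : U) :
    {S : Stack | S.ThinQuadratic ∧ 2 ≤ S.size ∧
      ∃ g : ℕ → U →ₗ[k] V, convolve C B g S 0 c ≠ 0}.Finite := by
  have hc : c ∈ ⨆ i : Colour × ℤ, C.piece i.1 i.2 := by
    rw [C.internal.submodule_iSup_eq_top]; trivial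
  induction hc using Submodule.iSup_induction' with
  | mem i c hc =>
    obtain ⟨⟨P, Q, R⟩, e⟩ := i
    refine ((C.finite_words hc).union (((range (Q + 2) ×ˢ range (Q + 2) ×ˢ
      range (Q + 2)).finite_toSet.image fun x : ℕ × ℕ × ℕ =>
        if h : x.2.1 < x.1 then twoBox P R ⟨x.2.1, h⟩ x.2.2 else leaf))).subset ?_
    rintro S ⟨hS, h2, g, hne⟩
    rcases hS.cases h2 with ⟨p, r, n, i, q, -, rfl⟩ | ⟨ρ, h1, -, -, rfl⟩
    · right
      have hcol : (P, Q, R) = ((twoBox p r i q).left, (twoBox p r i q).leaves,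
          (twoBox p r i q).right) := by
        by_contra h
        exact hne (convolve_suppOn g _ 0 _ _ _ hc h)
      rw [left_twoBox, right_twoBox] at hcol
      simp only [Prod.mk.injEq] at hcol
      obtain ⟨rfl, hq, rfl⟩ := hcol
      have := leaves_twoBox P R i q
      have hi := i.2
      refine ⟨(n, i, q), ?_, by simp⟩
      simp only [Finset.coe_product, Finset.coe_range, Set.mem_prod, Set.mem_Iio]
      omega
    · left
      obtain ⟨φ, hφ, hne'⟩ := (approx_convolve g _ 0).exists_ne hne
      exact ⟨hS.1, ⟨_, _, _, _, _, rfl, h1.2⟩, φ, hφ, hne'⟩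
  | zero => simp
  | add x y _ _ hx hy =>
    refine (hx.union hy).subset ?_
    rintro S ⟨h1, h2, g, hne⟩
    rw [map_add] at hne
    by_cases h : convolve C B g S 0 x = 0
    · exact Or.inr ⟨h1, h2, g, fun h' => hne (by rw [h, h', add_zero])⟩
    · exact Or.inl ⟨h1, h2, g, h⟩

lemma HasDeg.comp_koszul {M : DgModule k U} {N : DgModule k V} {m : ℤ} {X : U →ₗ[k] V}
    (h : HasDeg M N m X) (l : ℤ) : N.koszul l ∘ₗ X = sgn k (l * m) • X ∘ₗ M.koszul l :=
  M.linear_ext fun α e x hx => by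
    simp only [comp_apply, LinearMap.smul_apply]
    rw [M.koszul_apply l hx, map_smul, N.koszul_apply l (h α e x hx), smul_smul, ← sgn_add]
    congr 2
    ring

lemma DgModule.koszul_comp_koszul (M : DgModule k U) (m n : ℤ) :
    M.koszul m ∘ₗ M.koszul n = M.koszul (m + n) := LinearMap.ext fun x => M.koszul_koszul m n x

variable (C : DgBoxCooperad k U) (π : U →ₗ[k] U)

/-- The maps in the boxes of a stacking which define the operations `P_n`. -/
def pSlot {n : ℕ} (δ : Fin n → ℤ) (f : Fin n → U →ₗ[k] V) (S : Stack) (v : ℕ) : U →ₗ[k] V :=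
  if h : v < n then f ⟨v, h⟩ ∘ₗ C.thinDesuspension.koszul (∑ j with (⟨v, h⟩ : Fin n) < j, δ j) ∘ₗ
    π ∘ₗ (if v = 0 then infinitesimalSign C S else LinearMap.id) else 0

variable {C π}

lemma pSummand_eq {B : DgBoxOperad k V} {n : ℕ} (δ : Fin n → ℤ) (f : Fin n → U →ₗ[k] V)
    (S : Stack) : pSummand C B π δ f S = convolve C B (pSlot C π δ f S) S 0 := rfl

lemma pSummand_linear {B : DgBoxOperad k V} {n : ℕ} {δ : Fin n → ℤ}
    {f f₁ f₂ : Fin n → U →ₗ[k] V} (w : Fin n) (a b : k) (hw : f w = a • f₁ w + b • f₂ w)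
    (h : ∀ v, v ≠ w → f v = f₁ v ∧ f v = f₂ v) {S : Stack} (hS : S.size = n) :
    pSummand C B π δ f S = a • pSummand C B π δ f₁ S + b • pSummand C B π δ f₂ S := by
  refine convolve_update_linear (w := w) (Nat.zero_le _) (by rw [hS, zero_add]; exact w.2) a b ?_
    fun v hv => ?_
  · simp only [dif_pos w.2, Fin.eta, hw, add_comp, smul_comp]
  · by_cases hvn : v < n
    · have h' := h ⟨v, hvn⟩ fun e => hv (congrArg Fin.val e)
      simp only [dif_pos hvn, ← h'.1, ← h'.2, and_self]
    · simp only [dif_neg hvn, and_self]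

lemma pSummand_ext {B : DgBoxOperad k V} (d : ℤ) {n : ℕ} {δ : Fin n → ℤ}
    {f g : Fin n → U →ₗ[k] V} (hf : ∀ v, HasDeg C.thinDesuspension B (δ v) (f v))
    {S : Stack} (hS : S.size = n) :
    pSummand C (B.ext d) π δ (fun v => (f v).prod (g v)) S = (pSummand C B π δ f S).prod
      (∑ v, sgn k (d * ∑ u with u < v, δ u) •
        pSummand C B π (update δ v (δ v + d)) (update f v (g v)) S) := by
  have h1 : pSlot C π δ (fun v => (f v).prod (g v)) S = fun v =>
      (pSlot C π δ f S v).prod (pSlot C π δ g S v) := funext fun v => by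
    by_cases hv : v < n <;> simp only [pSlot, dif_pos, dif_neg, hv, not_false_iff] <;> rfl
  rw [pSummand_eq, h1, convolve_ext, hS, sum_range]
  congr 1
  refine sum_congr rfl fun v _ => ?_
  let e : ℕ → ℤ := fun u => if h : u < n then (if (⟨u, h⟩ : Fin n) < v then d * δ ⟨u, h⟩ else 0) else 0
  have h2 : ∀ u, 0 ≤ u → u < 0 + S.size → epsSlot B d (pSlot C π δ f S) (pSlot C π δ g S) (0 + v) u =
      sgn k (e u) • pSlot C π (update δ v (δ v + d)) (update f v (g v)) S u := by
    intro u _ hu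
    rw [zero_add, hS] at hu
    have hsum : ∀ s : Finset (Fin n), ∑ j ∈ s, update δ v (δ v + d) j =
        ∑ j ∈ s, δ j + if v ∈ s then d else 0 := fun s => by
      rw [← sum_ite_eq' s v (fun _ => d), ← sum_add_distrib]
      refine sum_congr rfl fun j _ => ?_
      rcases eq_or_ne j v with rfl | hj
      · simp
      · simp [hj]
    simp only [epsSlot, pSlot, dif_pos hu, zero_add, hsum, mem_filter, mem_univ, true_and, e]
    rcases lt_trichotomy u (v : ℕ) with h | h | h
    · have h' : (⟨u, hu⟩ : Fin n) < v := h
      rw [if_pos h, if_pos h', if_pos h', update_of_ne h'.ne, add_comm _ d,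
        ← DgModule.koszul_comp_koszul, ← comp_assoc, (hf _).comp_koszul,
        smul_comp]
      rfl
    · have h' : (⟨u, hu⟩ : Fin n) = v := Fin.ext h
      subst h'
      simp
    · have h' : v < (⟨u, hu⟩ : Fin n) := h
      rw [if_neg h.not_gt, if_neg h.ne', if_neg h'.not_gt, if_neg h'.not_gt,
        update_of_ne h'.ne', add_zero, sgn_zero, one_smul]
  rw [convolve_congr S 0 h2, convolve_sgn_smul, pSummand_eq, hS]
  congr 2
  rw [mul_sum, Finset.sum_filter, sum_range]
  refine sum_congr rfl fun u _ => ?_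
  simp [e]

lemma mem_thinDesuspension {M : DgModule k U} {α : Colour} {e : ℤ} {x : U} (hx : x ∈ M.piece α e) :
    x ∈ M.thinDesuspension.piece α (e - if Thin α then 1 else 0) := by
  change x ∈ M.piece α (if Thin α then _ else _)
  split_ifs with h <;> simpa using hx

lemma infinitesimalSign_mem (S : Stack) {α : Colour} {e : ℤ} {x : U} (hx : x ∈ C.piece α e) :
    infinitesimalSign C S x ∈ C.piece α e := by
  unfold infinitesimalSign
  split_ifs
  · exact neg_mem (C.koszul_mem 1 hx)
  · exact neg_mem hx
  · exact C.koszul_mem 1 hx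

lemma pSummand_hasDeg {B : DgBoxOperad k V} {n : ℕ} {δ : Fin n → ℤ} {f : Fin n → U →ₗ[k] V}
    (hπ : ∀ α e, ∀ x ∈ C.piece α e, π x ∈ C.piece α e)
    (hf : ∀ v, HasDeg C.thinDesuspension B (δ v) (f v)) {S : Stack} (hS : S.size = n) :
    HasDeg C B (∑ v, δ v - S.thinCount) (pSummand C B π δ f S) := by
  have := convolve_hasDeg (C := C) (B := B) (pSlot C π δ f S)
    (fun v => if h : v < n then δ ⟨v, h⟩ else 0) S 0 fun v _ hv α β e x hx => by
      rw [zero_add, hS] at hv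
      simp only [pSlot, dif_pos hv, comp_apply, C.proj_apply α hx]
      by_cases hβ : β = α
      · subst hβ
        have key : (if v = 0 then infinitesimalSign C S else LinearMap.id) x ∈ C.piece β e := by
          split_ifs
          · exact infinitesimalSign_mem S hx
          · exact hx
        have := hf ⟨v, hv⟩ _ _ _ (C.thinDesuspension.koszul_mem
          (∑ j with (⟨v, hv⟩ : Fin n) < j, δ j) (mem_thinDesuspension (hπ _ _ _ key)))
        rw [if_pos rfl]
        convert this using 2
        ring
      · rw [if_neg hβ, map_zero, map_zero, map_zero, map_zero]
        exact zero_mem _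
  rw [hS, sum_range] at this
  simpa [pSummand_eq] using this

end Quadratic

section Operations

open Stack

variable (C : ConilpotentDgBoxCooperad k U) (B : DgBoxOperad k V) {π : U →ₗ[k] U}

lemma finite_pSummand {n : ℕ} (hn : 2 ≤ n) (δ : Fin n → ℤ) (f : Fin n → U →ₗ[k] V) (c : U) :
    {S : Stack | S.ThinQuadratic ∧ S.size = n ∧
      pSummand C B π δ f S c ≠ 0}.Finite :=
  (finite_thinQuadratic C B c).subset fun _ h => ⟨h.1, h.2.1 ▸ hn, _, h.2.2⟩

variable {C B}

lemma hasLSum_opP {n : ℕ} (hn : 2 ≤ n) (δ : Fin n → ℤ) (f : Fin n → U →ₗ[k] V) :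
    HasLSum (fun S : {S : Stack // S.ThinQuadratic ∧ S.size = n} =>
      sgn k (∑ i, δ i) • pSummand C B π δ f S) (opP C B π n δ f) := by
  refine (hasLSum_locallyFiniteSum fun c => ?_).smul _
  have hfin := (finite_pSummand C B (π := π) hn δ f c).preimage
    (f := fun S : {S : Stack // S.ThinQuadratic ∧ S.size = n} => (S : Stack))
    Subtype.val_injective.injOn
  refine ⟨hfin.toFinset, fun S hS => ?_⟩
  by_contra h
  exact hS (hfin.mem_toFinset.2 ⟨S.2.1, S.2.2, h⟩)

lemma opP_linear {n : ℕ} (hn : 2 ≤ n) {δ : Fin n → ℤ} {f f₁ f₂ : Fin n → U →ₗ[k] V} (w : Fin n)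
    (a b : k) (hw : f w = a • f₁ w + b • f₂ w) (h : ∀ v, v ≠ w → f v = f₁ v ∧ f v = f₂ v) :
    opP C B π n δ f = a • opP C B π n δ f₁ + b • opP C B π n δ f₂ := by
  refine (hasLSum_opP hn δ f).unique ((((hasLSum_opP hn δ f₁).smul a).add
    ((hasLSum_opP hn δ f₂).smul b)).congr fun S => ?_)
  rw [pSummand_linear w a b hw h S.2.2, smul_add, smul_comm a, smul_comm b]

lemma HasLSum.sum {ι I : Type*} (s : Finset ι) {F : ι → I → U →ₗ[k] V} {f : ι → U →ₗ[k] V}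
    (h : ∀ j ∈ s, HasLSum (F j) (f j)) : HasLSum (fun i => ∑ j ∈ s, F j i) (∑ j ∈ s, f j) := by
  classical
  induction s using Finset.induction_on with
  | empty => simpa using HasLSum.zero
  | insert a s ha ih =>
    simp only [Finset.sum_insert ha]
    exact (h a (Finset.mem_insert_self a s)).add (ih fun j hj => h j (Finset.mem_insert_of_mem hj))

lemma opP_ext (d : ℤ) {n : ℕ} (hn : 2 ≤ n) {δ : Fin n → ℤ} {f g : Fin n → U →ₗ[k] V}
    (hf : ∀ v, HasDeg C.thinDesuspension B (δ v) (f v)) :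
    opP C (B.ext d) π n δ (fun v => (f v).prod (g v)) =
      (opP C B π n δ f).prod (sgn k d • ∑ v, sgn k (d * ∑ u with u < v, δ u) •
        opP C B π n (update δ v (δ v + d)) (update f v (g v))) := by
  refine (hasLSum_opP hn δ _).unique (((hasLSum_opP hn δ f).prod ((HasLSum.sum univ fun v _ =>
    ((hasLSum_opP hn (update δ v (δ v + d)) (update f v (g v))).smul
      (sgn k (d * ∑ u with u < v, δ u)))).smul (sgn k d))).congr fun S => ?_)
  rw [pSummand_ext d hf S.2.2]
  refine LinearMap.ext fun c => Prod.ext rfl ?_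
  simp only [prod_apply, Function.prod, LinearMap.smul_apply, LinearMap.sum_apply,
    Prod.smul_snd, smul_sum, smul_smul]
  refine sum_congr rfl fun v _ => ?_
  have h1 : ∑ j, update δ v (δ v + d) j = ∑ j, δ j + d := by
    have : ∀ j, update δ v (δ v + d) j = δ j + if j = v then d else 0 := fun j => by
      rcases eq_or_ne j v with rfl | hj
      · simp
      · simp [hj]
    simp only [this, sum_add_distrib, sum_ite_eq', mem_univ, if_true]
  rw [h1, sgn_add]
  congr 1
  linear_combination (sgn k (d * ∑ u with u < v, δ u) * sgn k (∑ j, δ j)) * sgn_mul_self (k := k) d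

lemma ThinQuadratic.thinCount {S : Stack} (h : S.ThinQuadratic) (h2 : 2 ≤ S.size) :
    (S.thinCount : ℤ) = if S.left = 0 ∧ S.right = 0 then 2 else 1 := by
  split_ifs with h0
  · rcases h.cases h2 with ⟨p, r, n, i, q, -, rfl⟩ | ⟨ρ, -, h1, -, rfl⟩
    · rw [left_twoBox, right_twoBox] at h0
      rw [thinCount_twoBox, if_pos (show Thin (p, n, r) from h0)]
      rfl
    · exact absurd h0.1 h1.1.ne'
  · have := h.2.2.1
    rw [thinDegree, if_neg h0] at this
    omega

lemma opP_hasDeg (hπ : ∀ α e, ∀ x ∈ C.piece α e, π x ∈ C.piece α e) {n : ℕ} (hn : 2 ≤ n)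
    {δ : Fin n → ℤ} {f : Fin n → U →ₗ[k] V}
    (hf : ∀ v, HasDeg C.thinDesuspension B (δ v) (f v)) :
    HasDeg C.thinDesuspension B (∑ v, δ v - 1) (opP C B π n δ f) := by
  refine HasDeg.hasLSum (hasLSum_opP hn δ f) fun S => HasDeg.smul (fun α e x hx => ?_) _
  obtain ⟨S, hS, hn'⟩ := S
  have h1 := pSummand_hasDeg hπ hf hn' α _ x hx
  have h2 := ThinQuadratic.thinCount hS (hn'.symm ▸ hn)
  by_cases hα : α = (S.left, S.leaves, S.right)
  · convert h1 using 2
    rw [h2, hα]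
    by_cases h : S.left = 0 ∧ S.right = 0
    · rw [if_pos h, if_pos (show Thin (S.left, S.leaves, S.right) from h)]
      ring
    · rw [if_neg h, if_neg (show ¬ Thin (S.left, S.leaves, S.right) from h)]
  · rw [pSummand_eq, convolve_suppOn (C := C.toDgBoxCooperad) _ S 0 α _ x hx hα]
    exact zero_mem _

end Operations

section Exponential

variable {C : ConilpotentDgBoxCooperad k U} {B : DgBoxOperad k V}

open Stack

instance : DecidablePred fun α : Colour => 0 < α.1 ∧ 0 < α.2.2 :=
  fun _ => inferInstanceAs (Decidable (_ ∧ _))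

variable (C) in
/-- The thin part of a map. -/
def thinPart (G : U →ₗ[k] V) : U →ₗ[k] V := G ∘ₗ C.filter Thin

variable (C) in
/-- The part of a map in the colours with horizontal inputs and outputs. -/
def nonThinPart (G : U →ₗ[k] V) : U →ₗ[k] V := G ∘ₗ C.filter fun α => 0 < α.1 ∧ 0 < α.2.2

variable {G : U →ₗ[k] V}

lemma thinPart_apply {α : Colour} {e : ℤ} {x : U} (hx : x ∈ C.piece α e) :
    thinPart C G x = if Thin α then G x else 0 := by
  rw [thinPart, comp_apply, C.filter_apply _ hx]
  split_ifs <;> simp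

lemma nonThinPart_apply {α : Colour} {e : ℤ} {x : U} (hx : x ∈ C.piece α e) :
    nonThinPart C G x = if 0 < α.1 ∧ 0 < α.2.2 then G x else 0 := by
  rw [nonThinPart, comp_apply, C.filter_apply _ hx]
  split_ifs <;> simp

lemma thinPart_hasDeg {d : ℤ} (hG : HasDeg C.thinDesuspension B d G) :
    HasDeg C B (d - 1) (thinPart C G) := fun α e x hx => by
  rw [thinPart_apply hx]
  split_ifs with h
  · have := hG _ _ x (mem_thinDesuspension hx)
    rw [if_pos h] at this
    convert this using 2
    ring
  · exact zero_mem _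

lemma nonThinPart_hasDeg {d : ℤ} (hG : HasDeg C.thinDesuspension B d G) :
    HasDeg C B d (nonThinPart C G) := fun α e x hx => by
  rw [nonThinPart_apply hx]
  split_ifs with h
  · have := hG _ _ x (mem_thinDesuspension hx)
    rw [if_neg (fun h' => h.1.ne' h'.1)] at this
    simpa using this
  · exact zero_mem _

lemma nonThinPart_suppOn :
    SuppOn C (fun α => 0 < α.1 ∧ 0 < α.2.2) (nonThinPart C G) := SuppOn.filter _

lemma nonThinPart_isNonThin (hG : HasDeg C.thinDesuspension B 0 G) :
    IsNonThin C B (nonThinPart C G) :=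
  ⟨isEven_iff.2 (nonThinPart_hasDeg hG), nonThinPart_suppOn⟩

lemma thinPart_suppOn (h₀ : (∀ m, C.piece (0, 0, 0) m = ⊥) ∨ (∀ m, B.piece (0, 0, 0) m = ⊥))
    {d : ℤ} (hG : HasDeg C.thinDesuspension B d G) :
    SuppOn C ThinTame (thinPart C G) := fun α e x hx hα => by
  rw [thinPart_apply hx]
  split_ifs with h
  · obtain ⟨p, q, r⟩ := α
    obtain ⟨h1, h2⟩ := h
    simp only at h1 h2
    subst h1 h2
    obtain rfl : q = 0 := by
      by_contra hq
      exact hα ⟨rfl, rfl, Nat.pos_of_ne_zero hq⟩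
    rcases h₀ with h₀ | h₀
    · rw [h₀, Submodule.mem_bot] at hx
      rw [hx, map_zero]
    · have := hG _ _ x (mem_thinDesuspension hx)
      rwa [h₀, Submodule.mem_bot] at this
  · rfl

/-- The summand along `S` for one map of degree `0`. -/
def powSummand (C : DgBoxCooperad k U) (B : DgBoxOperad k V) (G : U →ₗ[k] V) (S : Stack) :
    U →ₗ[k] V := convolve C B (fun v => if v = 0 then G ∘ₗ infinitesimalSign C S else G) S 0

lemma pSummand_const {n : ℕ} (π : U →ₗ[k] U) (F : U →ₗ[k] V) {S : Stack} (hS : S.size = n) :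
    pSummand C B π (fun _ : Fin n => 0) (fun _ => F) S = powSummand C B (F ∘ₗ π) S := by
  refine convolve_congr _ _ fun v _ hv => ?_
  rw [zero_add, hS] at hv
  rw [dif_pos hv]
  simp only [sum_const_zero, DgModule.koszul_zero, LinearMap.id_comp]
  split_ifs <;> simp [comp_assoc]

lemma convolve_allNonThin {S : Stack} (hS : S.AllNonThin) (G : U →ₗ[k] V) :
    col C B G S = col C B (nonThinPart C G) S := by
  induction S with
  | leaf => rfl
  | box p r n a c ih =>
    rw [col, col]
    congr 2
    · refine C.linear_ext fun β e x hx => ?_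
      simp only [comp_apply, C.proj_apply _ hx]
      split_ifs with h
      · rw [nonThinPart_apply hx, h, if_pos ⟨hS.1, hS.2.1⟩]
      · simp
    · exact funext fun i => ih i (hS.2.2 i)

lemma powSummand_onBox {ρ : Row} (hρ : ρ.Good) (h : ρ.Atomic) (hn : 0 < ρ.1) :
    powSummand C B G (ρ.onBox 0 0) = -rowOp C B (nonThinPart C G) ρ (thinPart C G) := by
  have h2 := two_le_size_onBox hρ h.1 hn 0 0
  have hcount : (ρ.onBox 0 0).thinCount = 1 := by
    have := ThinQuadratic.thinCount (thinQuadratic_onBox hρ h) h2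
    rw [if_neg fun h' => h.1.ne' h'.1] at this
    exact_mod_cast this
  have hsign : infinitesimalSign C.toDgBoxCooperad (ρ.onBox 0 0) = -LinearMap.id := by
    rw [infinitesimalSign, if_neg (not_not.2 ⟨rfl, rfl⟩), if_neg (by omega)]
  obtain ⟨n, a, c⟩ := ρ
  have hc : ∀ i, convolve C B (fun v => if v = 0 then
      G ∘ₗ infinitesimalSign C.toDgBoxCooperad (Row.onBox ⟨n, a, c⟩ 0 0) else G) (c i)
        (0 + 1 + start c i) = col C.toDgBoxCooperad B (nonThinPart C G) (c i) := fun i => by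
    rw [convolve_congr (g' := fun _ => G) _ _ fun v h1 _ => if_neg (by omega), convolve_const,
      convolve_allNonThin (hρ.2 i)]
  rw [rowOp, convB_apply, powSummand, Row.onBox, convolve_box]
  simp only [Row.onBox] at hc
  simp only [hc, if_true]
  simp only [Row.onBox] at hsign
  rw [hsign, ← convB_apply, ← convB_apply, ← map_neg, convB_apply, convB_apply]
  refine conv_congr' _ _ _ _ (fun p r e x hx => ?_) fun i q e x _ => rfl
  simp only [cons_zero, comp_apply, C.proj_apply _ hx, LinearMap.neg_apply,
    thinPart_apply hx, Thin, Prod.mk.injEq, true_and]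
  split_ifs with h <;> simp [h]

lemma powSummand_twoBox (hG : HasDeg C.thinDesuspension B 0 G) {p r n : ℕ} (i : Fin n)
    (q : ℕ) (hp : ¬ SemiThin (p, n, r)) :
    powSummand C B G (twoBox p r i q) = conv C B n (fun _ => 0) (cons
        ((B.koszul 1 ∘ₗ (thinPart C G + nonThinPart C G)) ∘ₗ C.proj (p, n, r))
        (slotted C B (thinPart C G ∘ₗ C.proj (0, q, 0)) i)) := by
  have hbot : (G ∘ₗ infinitesimalSign C (twoBox p r i q)) ∘ₗ C.proj (p, n, r) =
      (B.koszul 1 ∘ₗ (thinPart C G + nonThinPart C G)) ∘ₗ C.proj (p, n, r) := by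
    refine C.linear_ext fun β e x hx => ?_
    simp only [comp_apply, C.proj_apply _ hx]
    split_ifs with h
    · subst h
      have hmem := hG _ _ x (mem_thinDesuspension hx)
      rw [LinearMap.add_apply, thinPart_apply hx, nonThinPart_apply hx, infinitesimalSign]
      by_cases ht : Thin (p, n, r)
      · have hcount : (twoBox p r i q).thinCount = (twoBox p r i q).size := by
          rw [thinCount_twoBox, if_pos ht, size_twoBox]
        rw [if_neg (not_not.2 (show (twoBox p r i q).BottomThin from ht)), if_pos hcount, if_pos ht, if_neg fun h' => h'.1.ne' ht.1, add_zero,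
          B.koszul_apply 1 hmem, LinearMap.neg_apply, C.koszul_apply 1 hx, if_pos ht, map_neg,
          map_smul, ← neg_smul]
        congr 1
        rw [one_mul, one_mul, add_zero, sub_eq_add_neg, sgn_add]
        simp
      · have hNT : 0 < (p, n, r).1 ∧ 0 < (p, n, r).2.2 := by
          simp only [SemiThin, Thin] at hp ht ⊢
          omega
        rw [if_pos (show ¬ (twoBox p r i q).BottomThin from ht), if_neg ht, if_pos hNT, zero_add,
          B.koszul_apply 1 hmem, C.koszul_apply 1 hx, if_neg ht, map_smul]
        simp
    · simp
  have htop : ∀ j, convolve C B (fun v => if v = 0 then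
      G ∘ₗ infinitesimalSign C (twoBox p r i q) else G)
        (update (fun _ => leaf) i (corolla (0, q, 0)) j)
        (0 + 1 + start (update (fun _ => leaf) i (corolla (0, q, 0))) j) =
      slotted C B (thinPart C G ∘ₗ C.proj (0, q, 0)) i j := fun j => by
    rw [convolve_congr (g' := fun _ => G) _ _ fun v h1 _ => if_neg (by omega), convolve_const, slotted]
    rcases eq_or_ne j i with rfl | hj
    · have hdeg : HasDeg C B (0 - 1) (thinPart C G ∘ₗ C.proj (0, q, 0)) :=
        (thinPart_hasDeg hG).proj _
      have e : G ∘ₗ C.proj (0, q, 0) = thinPart C G ∘ₗ C.proj (0, q, 0) :=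
        C.linear_ext fun β e x hx => by
          simp only [comp_apply, C.proj_apply _ hx]
          split_ifs with h
          · rw [thinPart_apply hx, h, if_pos ⟨rfl, rfl⟩]
          · simp
      rw [update_self, if_pos rfl, corolla, col, profile_leaf]
      simp only [col]
      rw [e, conv_unit_top _ _ hdeg]
      refine C.linear_ext fun β e x hx => ?_
      rw [comp_apply, C.filter_apply _ hx]
      split_ifs with h
      · rfl
      · rw [map_zero, comp_apply, C.proj_apply _ hx, if_neg fun h' => h (by rw [h']),
          map_zero]
    · rw [update_of_ne hj, if_neg hj]
      rfl
  rw [powSummand, twoBox, convolve_box, profile_update_corolla, if_pos rfl]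
  change conv C B n _ (cons ((G ∘ₗ infinitesimalSign C
    (twoBox p r i q)) ∘ₗ C.proj (p, n, r)) fun j => convolve C B (fun v => if v = 0
    then G ∘ₗ infinitesimalSign C (twoBox p r i q) else G) _ _) = _
  rw [hbot]
  simp only [htop]

end Exponential

section Exponential

variable {C : ConilpotentDgBoxCooperad k U} {B : DgBoxOperad k V} {G : U →ₗ[k] V}

open Stack

/-- The stackings of two boxes, the upper one being thin. -/
def twoBoxOf (a : Σ _ : (Σ n : ℕ, Fin n), (ℕ × ℕ) × ℕ) : Stack :=
  twoBox a.2.1.1 a.2.1.2 a.1.2 a.2.2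

lemma twoBoxOf_injective : Injective twoBoxOf := by
  rintro ⟨⟨n, i⟩, ⟨p, r⟩, q⟩ ⟨⟨n', i'⟩, ⟨p', r'⟩, q'⟩ h
  simp only [twoBoxOf, twoBox] at h
  injection h with h1 h2 h3 _ h4
  subst h1 h2 h3
  have h5 := congrFun (eq_of_heq h4) i
  rcases eq_or_ne i i' with rfl | hi
  · simp only [update_self, corolla] at h5
    injection h5 with _ _ h6
    rw [h6]
  · rw [update_self, update_of_ne hi] at h5
    exact Stack.noConfusion h5

open Classical in
/-- The summand along a thin-quadratic stacking with at least two boxes. -/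
def quadSummand (C : DgBoxCooperad k U) (B : DgBoxOperad k V) (G : U →ₗ[k] V) (S : Stack) :
    U →ₗ[k] V := if S.ThinQuadratic ∧ 2 ≤ S.size then powSummand C B G S else 0

lemma quadSummand_twoBoxOf (hG : HasDeg C.thinDesuspension B 0 G)
    (a : Σ _ : (Σ n : ℕ, Fin n), (ℕ × ℕ) × ℕ) :
    quadSummand C B G (twoBoxOf a) = conv C B a.1.1 (fun _ => 0) (cons
        ((B.koszul 1 ∘ₗ (thinPart C G + nonThinPart C G)) ∘ₗ C.proj (a.2.1.1, a.1.1, a.2.1.2))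
        (slotted C B (thinPart C G ∘ₗ C.proj (0, a.2.2, 0)) a.1.2)) := by
  obtain ⟨⟨n, i⟩, ⟨p, r⟩, q⟩ := a
  by_cases h : SemiThin (p, n, r)
  · rw [quadSummand, if_neg, eq_comm]
    · refine conv_eq_zero_of_bottom _ _ _ fun p' r' e x hx => ?_
      simp only [cons_zero, comp_apply, C.proj_apply _ hx]
      split_ifs with h'
      · simp only [SemiThin] at h
        rw [LinearMap.add_apply, thinPart_apply hx, nonThinPart_apply hx, h', if_neg, if_neg]
        · simp
        · simp only
          omega
        · simp only [Thin]
          omega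
      · simp
    · exact fun h' => (show ¬ SemiThin (p, n, r) from h'.1.2.1.1) h
  · rw [quadSummand, twoBoxOf, if_pos ⟨thinQuadratic_twoBox i q h, (size_twoBox ..).ge⟩,
      powSummand_twoBox hG i q h]

lemma hasLSum_proj (w : ℕ) (X : U →ₗ[k] V) : HasLSum (fun a : ℕ × ℕ => X ∘ₗ C.proj (a.1, w, a.2))
    (X ∘ₗ C.filter fun α => α.2.1 = w) := by
  refine ((hasLSum_filter C (fun α => (α.1, α.2.2)) _).congr fun a => ?_)
  refine C.linear_ext fun α e x hx => ?_
  rw [comp_apply, comp_apply, comp_apply, C.filter_apply _ hx, C.proj_apply _ hx]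
  obtain ⟨p, q, r⟩ := α
  obtain ⟨p', r'⟩ := a
  simp only [Prod.mk.injEq]
  by_cases h : p = p' ∧ r = r'
  · rw [if_pos h, C.filter_apply _ hx]
    split_ifs <;> simp_all
  · rw [if_neg h, if_neg fun h' => h ⟨h'.1, h'.2.2⟩]
    simp

lemma hasLSum_quadSummand_twoBoxOf
    (h₀ : (∀ m, C.piece (0, 0, 0) m = ⊥) ∨ (∀ m, B.piece (0, 0, 0) m = ⊥))
    (hG : HasDeg C.thinDesuspension B 0 G) :
    HasLSum (fun a => quadSummand C B G (twoBoxOf a))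
      (ins C B (thinPart C G) (B.koszul 1 ∘ₗ (thinPart C G + nonThinPart C G))) := by
  have hθ := thinPart_suppOn h₀ hG
  set θ := thinPart C G
  set X := B.koszul 1 ∘ₗ (θ + nonThinPart C G)
  have hs := hasLSum_locallyFiniteSum
    (F := fun a => quadSummand C.toDgBoxCooperad B G (twoBoxOf a)) fun c => by
    have hfin := (finite_thinQuadratic C B c).preimage (f := twoBoxOf) twoBoxOf_injective.injOn
    refine ⟨hfin.toFinset, fun a ha => ?_⟩
    by_contra h
    rw [quadSummand] at h
    split_ifs at h with h'
    · exact ha (hfin.mem_toFinset.2 ⟨h'.1, h'.2, _, h⟩)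
    · exact h rfl
  have hq : HasLSum (fun q : ℕ => θ ∘ₗ C.proj (0, q, 0)) θ := by
    refine (hasLSum_filter C.toDgModule (fun α => α.2.1) θ).congr fun q => ?_
    refine C.linear_ext fun α e x hx => ?_
    rw [comp_apply, comp_apply, C.filter_apply _ hx, C.proj_apply _ hx]
    obtain ⟨p, q', r⟩ := α
    by_cases h : p = 0 ∧ r = 0
    · simp [h]
    · have h0 : θ x = 0 := hθ _ _ x hx fun h' => h ⟨h'.1, h'.2.1⟩
      rw [if_neg (c := (p, q', r) = (0, q, 0)) fun h' => h (by simp_all), map_zero]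
      split_ifs
      · exact h0
      · exact map_zero _
  have hs' := hs.sigma (G := fun a : Σ n : ℕ, Fin n => conv C.toDgBoxCooperad B a.1
    (fun _ => 0) (cons X (slotted C B θ a.2))) fun ⟨n, i⟩ => by
    have hs2 := hasLSum_locallyFiniteSum
      (F := fun b => quadSummand C.toDgBoxCooperad B G (twoBoxOf ⟨⟨n, i⟩, b⟩)) fun c => by
      obtain ⟨s, hs, -⟩ := hs c
      exact ⟨s.image Sigma.snd,
        fun b hb => hs ⟨⟨n, i⟩, b⟩ fun h => hb (Finset.mem_image_of_mem Sigma.snd h)⟩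
    have h1 := (hs2.prod_fiber (G := fun a => conv C.toDgBoxCooperad B n (fun _ => 0)
      (cons (X ∘ₗ C.proj (a.1, n, a.2)) (slotted C B θ i))) fun a => by
        simp only [quadSummand_twoBoxOf hG, conv_slotted]
        exact hq.local_map (local_conv C.toDgBoxCooperad B n _ _ i.succ))
    have h2 := (hasLSum_proj (C := C) n X).local_map
      (local_convB (C := C.toDgBoxCooperad) (B := B) n (fun _ => 0) (slotted C B θ i))
    simp only [convB_apply] at h2
    have h3 : conv C B n (fun _ => 0) (cons (X ∘ₗ C.filter fun α => α.2.1 = n)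
        (slotted C B θ i)) = conv C B n (fun _ => 0) (cons X (slotted C B θ i)) :=
      conv_congr' _ _ _ _ (fun p r e x hx => by simp [C.filter_apply _ hx]) fun i q e x _ => rfl
    rw [← h3, ← h1.unique h2]
    exact hs2
  rw [← hs'.unique (hasLSum_ins hθ X)]
  exact hs

lemma hasLSum_quadSummand_onBox
    (h₀ : (∀ m, C.piece (0, 0, 0) m = ⊥) ∨ (∀ m, B.piece (0, 0, 0) m = ⊥))
    (hG : HasDeg C.thinDesuspension B 0 G) :
    HasLSum (fun ρ : {ρ : Row // ρ.Good ∧ ρ.Atomic} =>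
      quadSummand C B G (Row.onBox ρ 0 0))
      (-atoms C B (nonThinPart C G) (thinPart C G)) := by
  have hθ := thinPart_suppOn h₀ hG
  refine (hasLSum_atoms C B _ _).neg.congr fun ρ => ?_
  obtain ⟨⟨n, a, c⟩, hρ⟩ := ρ
  rcases n with _ | n
  · rw [quadSummand, if_neg, rowOp, convB_apply, conv_eq_zero_of_bottom, neg_zero]
    · exact fun p r e x hx => hθ _ _ x hx fun h => h.2.2.ne' rfl
    · simp [Row.onBox, size]
  · rw [quadSummand, if_pos ⟨thinQuadratic_onBox hρ.1 hρ.2,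
      two_le_size_onBox hρ.1 hρ.2.1 n.succ_pos 0 0⟩, powSummand_onBox hρ.1 hρ.2 n.succ_pos]

lemma twoBoxOf_ne_onBox (a : Σ _ : (Σ n : ℕ, Fin n), (ℕ × ℕ) × ℕ) {ρ : Row} (hρ : ρ.Good) :
    twoBoxOf a ≠ ρ.onBox 0 0 := fun h => by
  obtain ⟨⟨n, i⟩, ⟨p, r⟩, q⟩ := a
  obtain ⟨n', b, c⟩ := ρ
  simp only [twoBoxOf, twoBox, Row.onBox] at h
  injection h with h1 h2 h3 _ h4
  subst h3
  have h5 : (c i).AllNonThin := hρ.2 i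
  rw [← eq_of_heq h4, update_self] at h5
  exact absurd h5.1 (lt_irrefl 0)

lemma hasLSum_quadSummand (h₀ : (∀ m, C.piece (0, 0, 0) m = ⊥) ∨ (∀ m, B.piece (0, 0, 0) m = ⊥))
    (hG : HasDeg C.thinDesuspension B 0 G) :
    HasLSum (quadSummand C B G) (quad C B (thinPart C G) (nonThinPart C G)) := by
  classical
  have hinj : Injective fun ρ : {ρ : Row // ρ.Good ∧ ρ.Atomic} => ρ.1.onBox 0 0 := by
    rintro ⟨⟨n, a, c⟩, h⟩ ⟨⟨n', a', c'⟩, h'⟩ e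
    simp only [Row.onBox] at e
    injection e with _ _ h1 h2 h3
    subst h1 h2
    simp only [eq_of_heq h3]
  have hA := (HasLSum.comp_injective twoBoxOf_injective (F := fun S => if S ∈ Set.range twoBoxOf then
    quadSummand C.toDgBoxCooperad B G S else 0) fun S hS => if_neg hS).1
    ((hasLSum_quadSummand_twoBoxOf h₀ hG).congr fun a => (if_pos ⟨a, rfl⟩).symm)
  have hB := (HasLSum.comp_injective hinj (F := fun S => if S ∈ Set.range
    (fun ρ : {ρ : Row // ρ.Good ∧ ρ.Atomic} => ρ.1.onBox 0 0) then
    quadSummand C.toDgBoxCooperad B G S else 0) fun S hS => if_neg hS).1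
    ((hasLSum_quadSummand_onBox h₀ hG).congr fun a => (if_pos ⟨a, rfl⟩).symm)
  have hquad : quad C B (thinPart C G) (nonThinPart C G) =
      ins C B (thinPart C G) (B.koszul 1 ∘ₗ (thinPart C G + nonThinPart C G)) +
        -atoms C B (nonThinPart C G) (thinPart C G) := by
    rw [LinearMap.comp_add, map_add, quad, quadNonThin, star, star]
    abel
  rw [hquad]
  refine (hA.add hB).congr fun S => ?_
  by_cases h : S.ThinQuadratic ∧ 2 ≤ S.size
  · rcases h.1.cases h.2 with ⟨p, r, n, i, q, -, rfl⟩ | ⟨ρ, h1, h2, -, rfl⟩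
    · rw [if_pos ⟨⟨⟨n, i⟩, (p, r), q⟩, rfl⟩, if_neg, add_zero]
      rintro ⟨ρ, hρ⟩
      exact twoBoxOf_ne_onBox ⟨⟨n, i⟩, (p, r), q⟩ ρ.2.1 hρ.symm
    · rw [if_pos (show Row.onBox ρ 0 0 ∈ Set.range
        (fun ρ : {ρ : Row // ρ.Good ∧ ρ.Atomic} => ρ.1.onBox 0 0) from ⟨⟨ρ, h1, h2⟩, rfl⟩), if_neg,
        zero_add]
      rintro ⟨a, ha⟩
      exact twoBoxOf_ne_onBox a h1 ha
  · rw [quadSummand, if_neg h]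
    simp

lemma powSummand_one {F : U →ₗ[k] V} (hF : F C.one = 0) {S : Stack} (hS : 0 < S.size) :
    powSummand C B F S C.one = 0 := by
  have hsign : F (infinitesimalSign C.toDgBoxCooperad S C.one) = 0 := by
    unfold infinitesimalSign
    split_ifs <;> simp [C.koszul_apply 1 C.one_mem, hF]
  cases S with
  | leaf => exact absurd hS (lt_irrefl 0)
  | box p r n a c =>
    rw [powSummand, convolve_box, conv_apply, comp_apply]
    by_cases h : n = 1 ∧ ∀ i, profile n a c i = 0
    · obtain ⟨rfl, h⟩ := h
      rw [show profile 1 a c = fun _ => 0 from funext h, C.decomp_one, PiTensorProduct.lift.tprod]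
      refine (B.comp 1 _).map_coord_zero 0 ?_
      simp only [cons_zero, comp_apply, C.proj_apply _ C.one_mem, if_true]
      split_ifs
      · exact hsign
      · rw [map_zero, map_zero]
    · rw [C.decomp_one_zero, map_zero]
      by_cases hn : n = 1
      · exact Or.inr (by simpa [hn] using h)
      · exact Or.inl hn

lemma quad_one (h₀ : (∀ m, C.piece (0, 0, 0) m = ⊥) ∨ (∀ m, B.piece (0, 0, 0) m = ⊥))
    (hG : HasDeg C.thinDesuspension B 0 G) (h1 : G C.one = 0) :
    quad C B (thinPart C G) (nonThinPart C G) C.one = 0 := by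
  obtain ⟨s, -, hs⟩ := hasLSum_quadSummand h₀ hG C.one
  rw [← hs]
  refine sum_eq_zero fun S _ => ?_
  rw [quadSummand]
  split_ifs with h
  · exact powSummand_one h1 (by omega)
  · rfl

lemma sum_opP_eq_quad (h₀ : (∀ m, C.piece (0, 0, 0) m = ⊥) ∨ (∀ m, B.piece (0, 0, 0) m = ⊥))
    {π : U →ₗ[k] U} {F : U →ₗ[k] V} (hF : HasDeg C.thinDesuspension B 0 (F ∘ₗ π))
    (fil : Filtration B) (hfil : fil.Holds 1 F) {K : ℕ} (hK : fil.bound ≤ K) :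
    ∑ n ∈ Ico 2 K, opP C B π n (fun _ => 0) (fun _ => F) =
      quad C B (thinPart C (F ∘ₗ π)) (nonThinPart C (F ∘ₗ π)) := by
  classical
  have h1 : ∀ n ∈ Ico 2 K, HasLSum (fun S => if S.ThinQuadratic ∧ S.size = n then
      powSummand C B (F ∘ₗ π) S else 0)
      (opP C B π n (fun _ => 0) (fun _ => F)) := fun n hn => by
    refine HasLSum.subtype (p := fun S : Stack => S.ThinQuadratic ∧ S.size = n)
      ((hasLSum_opP (mem_Ico.1 hn).1 _ _).congr fun S => ?_) fun S hS => if_neg hS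
    rw [if_pos S.2, pSummand_const _ _ S.2.2, sum_const_zero, sgn_zero, one_smul]
  refine (HasLSum.sum _ h1).unique ((hasLSum_quadSummand h₀ hF).congr fun S => ?_)
  rw [quadSummand]
  by_cases h : S.ThinQuadratic ∧ 2 ≤ S.size
  · rw [if_pos h]
    by_cases hK' : S.size < K
    · rw [Finset.sum_eq_single_of_mem S.size (mem_Ico.2 ⟨h.2, hK'⟩)
        fun n _ hn => if_neg fun h' => hn h'.2.symm, if_pos ⟨h.1, rfl⟩]
    · rw [sum_eq_zero fun n hn => if_neg fun h' : _ ∧ S.size = n =>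
        hK' (h'.2.trans_lt (mem_Ico.1 hn).2)]
      refine Filtration.Holds.eq_zero (F := fil) (a := S.size)
        (Filtration.Holds.convolve S 0 fun v => ?_) (by omega)
      split_ifs
      · exact (hfil.comp π).comp _
      · exact hfil.comp π
  · rw [if_neg h, sum_eq_zero fun n hn => if_neg fun h' : _ ∧ S.size = n =>
      h ⟨h'.1, h'.2 ▸ (mem_Ico.1 hn).1⟩]

end Exponential

section MaurerCartan

variable {C : ConilpotentDgBoxCooperad k U} {B : DgBoxOperad k V}

/-- An endomorphism of the cooperad compatible with the gradings and the differential, along which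
the operations take values in maps that factor through it. -/
structure IsTwist (C : ConilpotentDgBoxCooperad k U) (π : U →ₗ[k] U) : Prop where
  mem : ∀ α e, ∀ x ∈ C.piece α e, π x ∈ C.piece α e
  comp_d : π ∘ₗ C.d = C.d ∘ₗ π
  eq_id_or : π = LinearMap.id ∨ (π C.one = 0 ∧ ∀ x, ∃ a : k, π x = x - a • C.one)

lemma isTwist {π : U →ₗ[k] U} (hπ : π = LinearMap.id ∨ π = C.reduce C.one) : IsTwist C π := by
  rcases hπ with rfl | rfl
  · exact ⟨fun _ _ _ hx => hx, rfl, Or.inl rfl⟩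
  · refine ⟨fun α e x hx => ?_, LinearMap.ext fun x => ?_, Or.inr ⟨?_, fun x => ⟨C.counit x, rfl⟩⟩⟩
    · change x - C.counit x • C.one ∈ _
      by_cases h : α ≠ (0, 1, 0) ∨ e ≠ 0
      · rwa [C.counit_zero α e x hx h, zero_smul, sub_zero]
      · rw [not_or, not_not, not_not] at h
        obtain ⟨rfl, rfl⟩ := h
        exact sub_mem hx (Submodule.smul_mem _ _ C.one_mem)
    · change C.d x - C.counit (C.d x) • C.one = C.d (x - C.counit x • C.one)
      rw [C.counit_d, map_sub, map_smul, C.d_one, zero_smul, smul_zero]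
    · change C.one - C.counit C.one • C.one = 0
      rw [C.counit_one, one_smul, sub_self]

lemma IsTwist.comp_eq {π : U →ₗ[k] U} (hπ : IsTwist C π) {N : U →ₗ[k] V}
    (h : π C.one = 0 → N C.one = 0) : N ∘ₗ π = N := by
  rcases hπ.eq_id_or with rfl | ⟨h1, h2⟩
  · rfl
  · refine LinearMap.ext fun x => ?_
    obtain ⟨a, ha⟩ := h2 x
    rw [comp_apply, ha, map_sub, map_smul, h h1, smul_zero, sub_zero]

lemma thinDesuspension_d {α : Colour} {e : ℤ} {x : U} (hx : x ∈ C.piece α e) :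
    C.thinDesuspension.d x = (if Thin α then (-1 : k) else 1) • C.d x :=
  C.toDgModule.scale_apply (fun α _ => if Thin α then (-1 : k) else 1) (C.d_mem hx)

lemma HasDeg.comp_twist {π : U →ₗ[k] U} (hπ : IsTwist C π) {F : U →ₗ[k] V} {m : ℤ}
    (hF : HasDeg C.thinDesuspension B m F) :
    HasDeg C.thinDesuspension B m (F ∘ₗ π) := fun α e x hx => hF α e _ (hπ.mem _ _ x hx)

lemma homD_comp_twist {π : U →ₗ[k] U} (hπ : IsTwist C π) (F : U →ₗ[k] V) (m : ℤ) :
    C.thinDesuspension.homD B m F ∘ₗ π = C.thinDesuspension.homD B m (F ∘ₗ π) :=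
  C.linear_ext fun α e x hx => by
    simp only [DgModule.homD, comp_apply, LinearMap.sub_apply, LinearMap.smul_apply,
      thinDesuspension_d hx, thinDesuspension_d (hπ.mem _ _ x hx), map_smul]
    rw [← comp_apply, ← comp_apply π, hπ.comp_d]
    rfl

lemma homD_thin {w : U →ₗ[k] V} (hw : SuppOn C ThinTame w) (m : ℤ) :
    C.thinDesuspension.homD B m w = C.homD B (m - 1) w :=
  C.linear_ext fun α e x hx => by
    simp only [DgModule.homD, comp_apply, LinearMap.sub_apply, LinearMap.smul_apply,
      thinDesuspension_d hx, map_smul]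
    by_cases h : Thin α
    · rw [if_pos h, sub_eq_add_neg m, sgn_add]
      simp
    · rw [hw _ _ _ (C.d_mem hx) fun h' => h ⟨h'.1, h'.2.1⟩, smul_zero, smul_zero, smul_zero]

lemma homD_nonThin {w : U →ₗ[k] V} (hw : SuppOn C (fun α => 0 < α.1 ∧ 0 < α.2.2) w) (m : ℤ) :
    C.thinDesuspension.homD B m w = C.homD B m w :=
  C.linear_ext fun α e x hx => by
    simp only [DgModule.homD, comp_apply, LinearMap.sub_apply, LinearMap.smul_apply,
      thinDesuspension_d hx, map_smul]
    by_cases h : Thin α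
    · rw [hw _ _ _ (C.d_mem hx) fun h' => h'.1.ne' h.1, smul_zero, smul_zero]
    · rw [if_neg h, one_smul]

lemma homD_homD (M : DgModule k U) (N : DgModule k V) (m : ℤ) (X : U →ₗ[k] V) :
    M.homD N (m - 1) (M.homD N m X) = 0 := LinearMap.ext fun x => by
  simp only [DgModule.homD, comp_apply, LinearMap.sub_apply, LinearMap.smul_apply, map_sub,
    N.d_d, M.d_d, map_zero, map_smul, sub_eq_add_neg m, sgn_add]
  simp

lemma homD_add (M : DgModule k U) (N : DgModule k V) (m : ℤ) (X Y : U →ₗ[k] V) :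
    M.homD N m (X + Y) = M.homD N m X + M.homD N m Y := by
  simp only [DgModule.homD, LinearMap.comp_add, add_comp, smul_add]
  abel

lemma thinPart_prod_homD {G : U →ₗ[k] V} : thinPart C (G.prod (C.thinDesuspension.homD B 0 G)) =
      hat C B (-1) (thinPart C G) :=
  C.linear_ext fun α e x hx => by
    rw [thinPart_apply hx]
    simp only [hat, DgModule.homD, prod_apply, Function.prod, comp_apply,
      LinearMap.sub_apply, LinearMap.smul_apply, thinPart_apply hx, thinPart_apply (C.d_mem hx),
      thinDesuspension_d hx, map_smul]
    split_ifs <;> simp [← Prod.mk_zero_zero]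

lemma nonThinPart_prod_homD {G : U →ₗ[k] V} :
    nonThinPart C (G.prod (C.thinDesuspension.homD B 0 G)) = hat C B 0 (nonThinPart C G) :=
  C.linear_ext fun α e x hx => by
    rw [nonThinPart_apply hx]
    simp only [hat, DgModule.homD, prod_apply, Function.prod, comp_apply,
      LinearMap.sub_apply, LinearMap.smul_apply, nonThinPart_apply hx,
      nonThinPart_apply (C.d_mem hx), thinDesuspension_d hx, map_smul]
    by_cases h : 0 < α.1 ∧ 0 < α.2.2
    · simp only [if_pos h, if_neg (show ¬ Thin α from fun h' => h.1.ne' h'.1), one_smul]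
    · simp [if_neg h, ← Prod.mk_zero_zero]

variable {π : U →ₗ[k] U} {F : U →ₗ[k] V}

/-- The Maurer–Cartan series. -/
def curvature (C : ConilpotentDgBoxCooperad k U) (B : DgBoxOperad k V) (π : U →ₗ[k] U) (K : ℕ)
    (F : U →ₗ[k] V) : U →ₗ[k] V :=
  C.thinDesuspension.homD B 0 F + ∑ n ∈ Ico 2 K, opP C B π n (fun _ => 0) (fun _ => F)

/-- The derivative of the higher terms of the Maurer–Cartan series. -/
def curvatureDeriv (C : ConilpotentDgBoxCooperad k U) (B : DgBoxOperad k V) (π : U →ₗ[k] U) (K : ℕ)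
    (F z : U →ₗ[k] V) : U →ₗ[k] V :=
  ∑ n ∈ Ico 2 K, ∑ v : Fin n, opP C B π n (update (fun _ => 0) v (-1)) (update (fun _ => F) v z)

lemma sum_opP_prod (hF : HasDeg C.thinDesuspension B 0 F) (K : ℕ) (z : U →ₗ[k] V) :
    ∑ n ∈ Ico 2 K, opP C (B.ext (-1)) π n (fun _ => 0) (fun _ => F.prod z) =
      (∑ n ∈ Ico 2 K, opP C B π n (fun _ => 0) (fun _ => F)).prod
        (-curvatureDeriv C B π K F z) := by
  rw [sum_congr rfl fun n hn => opP_ext (-1) (mem_Ico.1 hn).1 (g := fun _ => z) fun _ => hF]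
  refine LinearMap.ext fun c => Prod.ext ?_ ?_
  · simp [LinearMap.sum_apply, Prod.fst_sum]
  · simp [LinearMap.sum_apply, Prod.snd_sum, curvatureDeriv, Finset.sum_neg_distrib]

lemma curvatureDeriv_add (K : ℕ) (z z' : U →ₗ[k] V) :
    curvatureDeriv C B π K F (z + z') = curvatureDeriv C B π K F z + curvatureDeriv C B π K F z' := by
  simp only [curvatureDeriv, ← sum_add_distrib]
  refine sum_congr rfl fun n hn => sum_congr rfl fun v _ => ?_
  rw [opP_linear (mem_Ico.1 hn).1 (f₁ := update (fun _ => F) v z)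
    (f₂ := update (fun _ => F) v z') v 1 1 (by simp) fun u hu => by simp [hu], one_smul,
    one_smul]

lemma ext_piece_zero {W : Type*} [AddCommGroup W] [Module k W] {C : DgModule k W}
    (h₀ : (∀ m, C.piece (0, 0, 0) m = ⊥) ∨ (∀ m, B.piece (0, 0, 0) m = ⊥)) (d : ℤ) :
    (∀ m, C.piece (0, 0, 0) m = ⊥) ∨ (∀ m, (B.ext d).piece (0, 0, 0) m = ⊥) :=
  h₀.imp_right fun h m => by
    change (B.piece _ _).prod (B.piece _ _) = ⊥
    rw [h, h, Submodule.prod_bot]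

/-- The Bianchi identity. -/
lemma bianchi (h₀ : (∀ m, C.piece (0, 0, 0) m = ⊥) ∨ (∀ m, B.piece (0, 0, 0) m = ⊥))
    (hπ : IsTwist C π) (hF : HasDeg C.thinDesuspension B 0 F) (fil : Filtration B)
    (hfil : fil.Holds 1 F) {K : ℕ} (hK : fil.bound < K) :
    C.thinDesuspension.homD B (-1) (curvature C B π K F) +
      curvatureDeriv C B π K F (curvature C B π K F) = 0 := by
  have hG := hF.comp_twist hπ
  have hDdeg := hF.homD 0
  have hθ := thinPart_suppOn h₀ hG
  have hθd := thinPart_hasDeg hG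
  have hφ := nonThinPart_isNonThin hG
  have hφF : fil.Holds 1 (nonThinPart C (F ∘ₗ π)) := (hfil.comp π).comp _
  rw [zero_sub] at hθd hDdeg
  have hN := sum_opP_eq_quad h₀ hG fil hfil hK.le
  have hderiv : ∀ z : U →ₗ[k] V, HasDeg C.thinDesuspension B (-1) z →
      -curvatureDeriv C B π K F z = LinearMap.snd k V V ∘ₗ quad C (B.ext (-1))
        (thinPart C ((F ∘ₗ π).prod (z ∘ₗ π))) (nonThinPart C ((F ∘ₗ π).prod (z ∘ₗ π))) := by
    intro z hz
    have hFz : HasDeg C.thinDesuspension (B.ext (-1)) 0 (F.prod z) := hF.prod (by simpa)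
    have h1 := sum_opP_eq_quad (K := K) (ext_piece_zero h₀ _) (hFz.comp_twist hπ) (fil.ext (-1) 1)
      (fun c => ⟨hfil c, by rw [fil.zero]; trivial⟩) hK
    rw [sum_opP_prod hF] at h1
    exact congrArg (fun X => LinearMap.snd k V V ∘ₗ X) h1
  set N := ∑ n ∈ Ico 2 K, opP C B π n (fun _ => 0) (fun _ => F)
  set D := C.thinDesuspension.homD B.toDgModule 0 F
  have hNdeg : HasDeg C.thinDesuspension B (-1) N := by
    refine Submodule.sum_mem (C.thinDesuspension.Hom B.toDgModule (-1)) fun n hn => ?_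
    have := opP_hasDeg (B := B) hπ.mem (mem_Ico.1 hn).1 (fun _ => hF)
    rwa [sum_const_zero, zero_sub] at this
  have hNπ : N ∘ₗ π = N := hπ.comp_eq fun h => by
    rw [hN]
    exact quad_one h₀ hG (by rw [comp_apply, h, map_zero])
  have hstar : SuppOn C ThinTame (star C B (thinPart C (F ∘ₗ π)) (thinPart C (F ∘ₗ π))) :=
    hθ.star_thin hθ
  have hqN := quadNonThin_suppOn hφ hθ
  have hsplit : ∀ {α e x}, x ∈ C.piece α e → N x =
      star C B (thinPart C (F ∘ₗ π)) (thinPart C (F ∘ₗ π)) x +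
        quadNonThin C B (thinPart C (F ∘ₗ π)) (nonThinPart C (F ∘ₗ π)) x := fun _ => by
    rw [hN]; rfl
  have e1 : -curvatureDeriv C B π K F D = C.thinDesuspension.homD B.toDgModule (-1) N := by
    rw [hderiv D hDdeg, homD_comp_twist hπ, thinPart_prod_homD, nonThinPart_prod_homD,
      quad_hat hφ hθ hθd, hN, quad, homD_add, homD_thin hstar, homD_nonThin hqN]
    rfl
  have e2 : curvatureDeriv C B π K F N = 0 := by
    have hA : thinPart C ((F ∘ₗ π).prod N) = (thinPart C (F ∘ₗ π)).prod
        (star C B (thinPart C (F ∘ₗ π)) (thinPart C (F ∘ₗ π))) :=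
      C.linear_ext fun α e x hx => by
        rw [thinPart_apply hx]
        simp only [prod_apply, Function.prod, thinPart_apply hx, hsplit hx]
        split_ifs with h
        · rw [hqN α e x hx fun h' => h'.1.ne' h.1, add_zero]
        · rw [hstar α e x hx fun h' => h ⟨h'.1, h'.2.1⟩]
          rfl
    have hB : nonThinPart C ((F ∘ₗ π).prod N) = (nonThinPart C (F ∘ₗ π)).prod
        (quadNonThin C B (thinPart C (F ∘ₗ π)) (nonThinPart C (F ∘ₗ π))) :=
      C.linear_ext fun α e x hx => by
        rw [nonThinPart_apply hx]
        simp only [prod_apply, Function.prod, nonThinPart_apply hx, hsplit hx]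
        split_ifs with h
        · rw [hstar α e x hx fun h' => h.1.ne' h'.1, zero_add]
        · rw [hqN α e x hx h]
          rfl
    rw [← neg_eq_zero, hderiv N hNdeg, hNπ, hA, hB, quad_quad fil hφ hφF hθ hθd]
    rfl
  rw [curvature, homD_add, curvatureDeriv_add, ← e1, e2]
  have := homD_homD C.thinDesuspension B.toDgModule 0 F
  rw [zero_sub] at this
  rw [this]
  abel

end MaurerCartan

section Polarization

/-- The operations `P_n`, including the differential, on maps with a degree. -/
def opQ (C : ConilpotentDgBoxCooperad k U) (B : DgBoxOperad k V) (π : U →ₗ[k] U) :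
    ∀ n : ℕ, (Fin n → ℤ × (U →ₗ[k] V)) → U →ₗ[k] V
  | 0, _ => 0
  | 1, x => C.thinDesuspension.homD B (x 0).1 (x 0).2
  | n + 2, x => opP C B π (n + 2) (fun i => (x i).1) fun i => (x i).2

/-- The sum over the insertions of the elements of a list into the slots in `A`. -/
def plug (C : ConilpotentDgBoxCooperad k U) (B : DgBoxOperad k V) (π : U →ₗ[k] U) {n : ℕ} :
    List (ℤ × (U →ₗ[k] V)) → (Fin n → ℤ × (U →ₗ[k] V)) → Finset (Fin n) → U →ₗ[k] V
  | [], x, _ => opQ C B π n x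
  | z :: Z, x, A => ∑ v ∈ A, sgn k (z.1 * ∑ u with v < u, (x u).1) •
      plug C B π Z (update x v z) (A.erase v)

/-- The polarized Maurer–Cartan series. -/
def pol (C : ConilpotentDgBoxCooperad k U) (B : DgBoxOperad k V) (π : U →ₗ[k] U) (K : ℕ)
    (F : U →ₗ[k] V) (Z : List (ℤ × (U →ₗ[k] V))) : U →ₗ[k] V :=
  ∑ n ∈ range K, plug C B π Z (fun _ : Fin n => (0, F)) univ

variable {C : ConilpotentDgBoxCooperad k U} {B : DgBoxOperad k V} {π : U →ₗ[k] U}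

lemma sum_update_fst {n : ℕ} (x : Fin n → ℤ × (U →ₗ[k] V)) (w : Fin n) (z : ℤ × (U →ₗ[k] V))
    (s : Finset (Fin n)) : ∑ u ∈ s, (update x w z u).1 =
      ∑ u ∈ s, (x u).1 + if w ∈ s then z.1 - (x w).1 else 0 := by
  rw [← sum_ite_eq' s w fun _ => z.1 - (x w).1, ← sum_add_distrib]
  refine sum_congr rfl fun u _ => ?_
  rcases eq_or_ne u w with rfl | hu
  · simp
  · simp [hu]

lemma opQ_linear {n : ℕ} (x : Fin n → ℤ × (U →ₗ[k] V)) (v : Fin n) (e : ℤ) (a b : k)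
    (X Y : U →ₗ[k] V) : opQ C B π n (update x v (e, a • X + b • Y)) =
      a • opQ C B π n (update x v (e, X)) + b • opQ C B π n (update x v (e, Y)) := by
  match n with
  | 0 => exact v.elim0
  | 1 =>
    obtain rfl := Subsingleton.elim v 0
    simp only [opQ, update_self, DgModule.homD, LinearMap.comp_add, LinearMap.comp_smul,
      add_comp, smul_comp]
    module
  | n + 2 =>
    simp only [opQ]
    have h : ∀ X : U →ₗ[k] V, (fun i => (update x v (e, X) i).1) =
        update (fun i => (x i).1) v e := fun X => Function.comp_update Prod.fst x v _
    rw [h, h, h]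
    exact opP_linear (by omega) v a b (by simp) fun u hu => by simp [hu]

lemma plug_linear {n : ℕ} (Z : List (ℤ × (U →ₗ[k] V))) (x : Fin n → ℤ × (U →ₗ[k] V))
    {A : Finset (Fin n)} {v : Fin n} (hv : v ∉ A) (e : ℤ) (a b : k) (X Y : U →ₗ[k] V) :
    plug C B π Z (update x v (e, a • X + b • Y)) A = a • plug C B π Z (update x v (e, X)) A +
        b • plug C B π Z (update x v (e, Y)) A := by
  induction Z generalizing x A with
  | nil => exact opQ_linear x v e a b X Y
  | cons z Z ih =>
    simp only [plug, smul_sum, ← sum_add_distrib]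
    refine sum_congr rfl fun w hw => ?_
    have hwv : v ≠ w := fun h => hv (h ▸ hw)
    simp only [Function.update_comm hwv, sum_update_fst]
    rw [ih _ fun h => hv (mem_of_mem_erase h)]
    module

lemma plug_zero {n : ℕ} (Z : List (ℤ × (U →ₗ[k] V))) {x : Fin n → ℤ × (U →ₗ[k] V)}
    {A : Finset (Fin n)} {v : Fin n} (hv : v ∉ A) (h : (x v).2 = 0) : plug C B π Z x A = 0 := by
  have := plug_linear (C := C) (B := B) (π := π) Z x hv (x v).1 0 0 0 0
  rwa [zero_smul, zero_smul, add_zero, show ((x v).1, 0) = x v from Prod.ext rfl h.symm,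
    Function.update_eq_self] at this

lemma plug_cons_linear {n : ℕ} (Z : List (ℤ × (U →ₗ[k] V))) (x : Fin n → ℤ × (U →ₗ[k] V))
    (A : Finset (Fin n)) (e : ℤ) (a b : k) (X Y : U →ₗ[k] V) :
    plug C B π ((e, a • X + b • Y) :: Z) x A =
      a • plug C B π ((e, X) :: Z) x A + b • plug C B π ((e, Y) :: Z) x A := by
  simp only [plug, smul_sum, ← sum_add_distrib]
  refine sum_congr rfl fun w _ => ?_
  rw [plug_linear Z x (Finset.notMem_erase w A)]
  module

lemma plug_swap {n : ℕ} (z y : ℤ × (U →ₗ[k] V)) (Z : List (ℤ × (U →ₗ[k] V)))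
    {x : Fin n → ℤ × (U →ₗ[k] V)} {A : Finset (Fin n)} (hA : ∀ v ∈ A, (x v).1 = 0) :
    plug C B π (z :: y :: Z) x A = sgn k (z.1 * y.1) • plug C B π (y :: z :: Z) x A := by
  simp only [plug, smul_sum, smul_smul]
  rw [Finset.sum_comm' (s' := fun w => A.erase w) (t' := A) fun v w => by
    simp only [mem_erase]; tauto]
  refine sum_congr rfl fun w hw => sum_congr rfl fun v hv => ?_
  obtain ⟨hvw, hv⟩ := mem_erase.1 hv
  rw [Function.update_comm hvw, Finset.erase_right_comm, sum_update_fst, sum_update_fst, hA v hv, hA w hw]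
  congr 1
  simp only [mem_filter, mem_univ, true_and, sub_zero, mul_add, sgn_add]
  rcases lt_or_gt_of_ne hvw with h | h
  · rw [if_neg h.not_gt, if_pos h, mul_zero, sgn_zero]
    linear_combination (-(sgn k (z.1 * ∑ u with v < u, (x u).1) *
      sgn k (y.1 * ∑ u with w < u, (x u).1))) * sgn_mul_self (k := k) (z.1 * y.1)
  · rw [if_pos h, if_neg h.not_gt, mul_zero, sgn_zero, mul_comm y.1 z.1]
    ring

/-- A list of maps, as maps into `B ⊕ ε B`. -/
abbrev liftZero (z : ℤ × (U →ₗ[k] V)) : ℤ × (U →ₗ[k] V × V) := (z.1, z.2.prod 0)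

/-- A family of maps into `B ⊕ ε B`. -/
abbrev withEps {n : ℕ} (x : Fin n → ℤ × (U →ₗ[k] V)) (g : Fin n → U →ₗ[k] V) (v : Fin n) :
    ℤ × (U →ₗ[k] V × V) := ((x v).1, (x v).2.prod (g v))

lemma update_withEps {n : ℕ} (x : Fin n → ℤ × (U →ₗ[k] V)) (g : Fin n → U →ₗ[k] V) (v : Fin n)
    (e : ℤ) (X Y : U →ₗ[k] V) : update (withEps x g) v (e, X.prod Y) =
      withEps (update x v (e, X)) (update g v Y) := funext fun u => by
  rcases eq_or_ne u v with rfl | hu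
  · simp [withEps]
  · simp [withEps, hu]

lemma sum_smul_prod {I : Type*} (s : Finset I) (a : I → k) (X Y : I → U →ₗ[k] V) :
    ∑ i ∈ s, a i • (X i).prod (Y i) = (∑ i ∈ s, a i • X i).prod (∑ i ∈ s, a i • Y i) :=
  LinearMap.ext fun c => Prod.ext (by simp [LinearMap.sum_apply, Prod.fst_sum])
    (by simp [LinearMap.sum_apply, Prod.snd_sum])

lemma opQ_ext (d : ℤ) {n : ℕ} {x : Fin n → ℤ × (U →ₗ[k] V)} (g : Fin n → U →ₗ[k] V)
    (hx : ∀ v, HasDeg C.thinDesuspension B (x v).1 (x v).2) :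
    opQ C (B.ext d) π n (withEps x g) = (opQ C B π n x).prod (sgn k d • ∑ v,
      sgn k (d * ∑ u with u < v, (x u).1) • opQ C B π n (update x v ((x v).1 + d, g v))) := by
  match n with
  | 0 => simp [opQ]; rfl
  | 1 =>
    refine LinearMap.ext fun c => Prod.ext rfl ?_
    simp only [opQ, Fin.sum_univ_one, update_self]
    change sgn k d • B.d (g 0 c) - sgn k (x 0).1 • g 0 _ = _
    have : (univ.filter fun u : Fin 1 => u < 0) = ∅ := by simp
    simp only [prod_apply, Function.prod, this, Finset.sum_empty, mul_zero, sgn_zero,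
      one_smul, DgModule.homD, LinearMap.smul_apply, LinearMap.sub_apply, comp_apply,
      smul_sub, smul_smul, sgn_add]
    rw [show sgn k d * (1 * (sgn k (x 0).1 * sgn k d)) = sgn k (x 0).1 by
      linear_combination sgn k (x 0).1 * sgn_mul_self (k := k) d]
  | n + 2 =>
    have := opP_ext (C := C) (B := B) (π := π) d (by omega : 2 ≤ n + 2) (δ := fun v => (x v).1)
      (f := fun v => (x v).2) (g := g) hx
    refine this.trans ?_
    congr 2
    refine sum_congr rfl fun v _ => ?_
    rw [opQ]
    congr 2
    · exact (Function.comp_update Prod.fst x v ((x v).1 + d, g v)).symm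
    · exact (Function.comp_update Prod.snd x v ((x v).1 + d, g v)).symm

lemma plug_ext (d : ℤ) {n : ℕ} (Z : List (ℤ × (U →ₗ[k] V))) {x : Fin n → ℤ × (U →ₗ[k] V)}
    (g : Fin n → U →ₗ[k] V) {A : Finset (Fin n)} (hA : ∀ v ∈ A, (x v).1 = 0)
    (hx : ∀ v, HasDeg C.thinDesuspension B (x v).1 (x v).2)
    (hZ : ∀ z ∈ Z, HasDeg C.thinDesuspension B z.1 z.2) :
    plug C (B.ext d) π (Z.map liftZero) (withEps x g) A = (plug C B π Z x A).prod
      (sgn k d • ∑ v, sgn k (d * ∑ u with u < v, (x u).1) •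
        plug C B π Z (update x v ((x v).1 + d, g v)) (A.erase v)) := by
  induction Z generalizing x g A with
  | nil => exact opQ_ext d g hx
  | cons z Z ih =>
    have h1 := fun (w : Fin n) (hw : w ∈ A) => ih (x := update x w z) (update g w 0)
      (A := A.erase w) (fun v hv => by
        rw [update_of_ne (ne_of_mem_erase hv)]
        exact hA v (mem_of_mem_erase hv)) (fun v => by
        rcases eq_or_ne v w with rfl | hv
        · simpa using hZ z List.mem_cons_self
        · simpa [hv] using hx v) fun y hy => hZ y (List.mem_cons_of_mem _ hy)
    rw [List.map_cons, plug]
    simp only [update_withEps]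
    rw [sum_congr rfl fun w hw => congrArg _ (h1 w hw), sum_smul_prod, plug]
    refine congrArg₂ LinearMap.prod rfl ?_
    simp only [plug, smul_sum]
    rw [sum_congr rfl fun w _ => (Finset.sum_erase univ (a := w) (by
      rw [plug_zero Z (v := w)] <;> simp)).symm]
    rw [Finset.sum_comm' (s' := fun v => A.erase v) (t' := univ) fun v w => by
      simp only [mem_erase, mem_univ]; tauto]
    refine sum_congr rfl fun v _ => sum_congr rfl fun w hw => ?_
    obtain ⟨hwv, hw⟩ := mem_erase.1 hw
    have hpar : sgn k (d * ∑ u with u < v, (update x w z u).1) *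
        sgn k (z.1 * ∑ u with w < u, (x u).1) =
        sgn k (d * ∑ u with u < v, (x u).1) *
          sgn k (z.1 * ∑ u with w < u, (update x v ((x v).1 + d, g v) u).1) := by
      rw [sum_update_fst, sum_update_fst, hA w hw, ← sgn_add, ← sgn_add]
      congr 1
      simp only [mem_filter, mem_univ, true_and]
      split_ifs <;> ring
    rw [update_of_ne hwv.symm, update_of_ne hwv.symm, Function.update_comm hwv,
      Finset.erase_right_comm]
    simp only [smul_smul]
    congr 1
    linear_combination sgn k d * hpar

lemma opQ_hasDeg (hπ : IsTwist C π) {n : ℕ} {x : Fin n → ℤ × (U →ₗ[k] V)}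
    (hx : ∀ v, HasDeg C.thinDesuspension B (x v).1 (x v).2) :
    HasDeg C.thinDesuspension B (∑ v, (x v).1 - 1) (opQ C B π n x) := by
  match n with
  | 0 => exact Submodule.zero_mem (C.thinDesuspension.Hom B.toDgModule _)
  | 1 =>
    rw [Fin.sum_univ_one]
    exact (hx 0).homD _
  | n + 2 => exact opP_hasDeg hπ.mem (by omega) hx

/-- The total degree of a list. -/
def totalDeg (Z : List (ℤ × (U →ₗ[k] V))) : ℤ := (Z.map Prod.fst).sum

lemma plug_hasDeg (hπ : IsTwist C π) {n : ℕ} (Z : List (ℤ × (U →ₗ[k] V)))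
    {x : Fin n → ℤ × (U →ₗ[k] V)} {A : Finset (Fin n)} (hA : ∀ v ∈ A, (x v).1 = 0)
    (hx : ∀ v, HasDeg C.thinDesuspension B (x v).1 (x v).2)
    (hZ : ∀ z ∈ Z, HasDeg C.thinDesuspension B z.1 z.2) :
    HasDeg C.thinDesuspension B (∑ v, (x v).1 + totalDeg Z - 1) (plug C B π Z x A) := by
  induction Z generalizing x A with
  | nil =>
    have := opQ_hasDeg (B := B) hπ hx
    rwa [totalDeg, List.map_nil, List.sum_nil, add_zero]
  | cons z Z ih =>
    refine Submodule.sum_mem (C.thinDesuspension.Hom B.toDgModule _) fun w hw =>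
      Submodule.smul_mem _ _ ?_
    have := ih (x := update x w z) (A := A.erase w) (fun v hv => ?_) (fun v => ?_)
        fun y hy => hZ y (List.mem_cons_of_mem _ hy)
    · rw [sum_update_fst, hA w hw, if_pos (mem_univ w)] at this
      rw [show totalDeg (z :: Z) = z.1 + totalDeg Z from List.sum_cons, ← add_assoc]
      rwa [sub_zero] at this
    · rw [update_of_ne (ne_of_mem_erase hv)]
      exact hA v (mem_of_mem_erase hv)
    · rcases eq_or_ne v w with rfl | hv
      · simpa using hZ z List.mem_cons_self
      · simpa [hv] using hx v

end Polarization

section SplitSum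

variable {H E : Type*} [AddCommGroup E] [Module k E]

/-- The sum over all splittings of a list into two parts, with Koszul signs. -/
def splitSum (k : Type*) {H E : Type*} [Field k] [AddCommGroup E] [Module k E] :
    List (ℤ × H) → (List (ℤ × H) → List (ℤ × H) → E) → E
  | [], G => G [] []
  | z :: Z, G => splitSum k Z fun A A' =>
      G (z :: A) A' + sgn k (z.1 * (A.map Prod.fst).sum) • G A (z :: A')

lemma splitSum_congr {Z : List (ℤ × H)} {P : ℤ × H → Prop} (hZ : ∀ z ∈ Z, P z)
    {G G' : List (ℤ × H) → List (ℤ × H) → E}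
    (h : ∀ A A', (∀ z ∈ A, P z) → (∀ z ∈ A', P z) → G A A' = G' A A') :
    splitSum k Z G = splitSum k Z G' := by
  induction Z generalizing G G' with
  | nil => exact h _ _ (by simp) (by simp)
  | cons z Z ih =>
    have h' : ∀ A, (∀ y ∈ A, P y) → ∀ y ∈ z :: A, P y := fun A hA =>
      List.forall_mem_cons.2 ⟨hZ z List.mem_cons_self, hA⟩
    exact ih (fun y hy => hZ y (List.mem_cons_of_mem _ hy)) fun A A' hA hA' => by
      rw [h _ _ (h' A hA) hA', h _ _ hA (h' A' hA')]

lemma splitSum_map {H' : Type*} (φ : ℤ × H → ℤ × H') (hφ : ∀ z, (φ z).1 = z.1) (Z : List (ℤ × H))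
    (G : List (ℤ × H') → List (ℤ × H') → E) :
    splitSum k (Z.map φ) G = splitSum k Z fun A A' => G (A.map φ) (A'.map φ) := by
  induction Z generalizing G with
  | nil => rfl
  | cons z Z ih =>
    rw [List.map_cons, splitSum, splitSum, ih]
    simp only [List.map_map, hφ, List.map_cons, show Prod.fst ∘ φ = Prod.fst from funext hφ]

lemma map_splitSum {E' : Type*} [AddCommGroup E'] [Module k E'] (l : E →ₗ[k] E') (Z : List (ℤ × H))
    (G : List (ℤ × H) → List (ℤ × H) → E) :
    l (splitSum k Z G) = splitSum k Z fun A A' => l (G A A') := by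
  induction Z generalizing G with
  | nil => rfl
  | cons z Z ih =>
    rw [splitSum, splitSum, ih]
    simp only [map_add, map_smul]

end SplitSum

section Polarization

variable {C : ConilpotentDgBoxCooperad k U} {B : DgBoxOperad k V} {π : U →ₗ[k] U}
variable {F : U →ₗ[k] V} {K : ℕ}

lemma pol_cons_linear (Z : List (ℤ × (U →ₗ[k] V))) (e : ℤ) (a b : k) (X Y : U →ₗ[k] V) :
    pol C B π K F ((e, a • X + b • Y) :: Z) =
      a • pol C B π K F ((e, X) :: Z) + b • pol C B π K F ((e, Y) :: Z) := by
  simp only [pol, smul_sum, ← sum_add_distrib]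
  exact sum_congr rfl fun n _ => plug_cons_linear Z _ _ e a b X Y

lemma pol_swap (z y : ℤ × (U →ₗ[k] V)) (Z : List (ℤ × (U →ₗ[k] V))) :
    pol C B π K F (z :: y :: Z) = sgn k (z.1 * y.1) • pol C B π K F (y :: z :: Z) := by
  simp only [pol, smul_sum]
  exact sum_congr rfl fun n _ => plug_swap z y Z fun _ _ => rfl

lemma pol_hasDeg (hπ : IsTwist C π) (hF : HasDeg C.thinDesuspension B 0 F)
    {Z : List (ℤ × (U →ₗ[k] V))} (hZ : ∀ z ∈ Z, HasDeg C.thinDesuspension B z.1 z.2) :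
    HasDeg C.thinDesuspension B (totalDeg Z - 1) (pol C B π K F Z) := by
  refine Submodule.sum_mem (C.thinDesuspension.Hom B.toDgModule _) fun n _ => ?_
  have := plug_hasDeg (B := B) hπ Z (x := fun _ : Fin n => (0, F)) (A := univ)
    (fun _ _ => rfl) (fun _ => hF) hZ
  rwa [sum_const_zero, zero_add] at this

lemma sum_prod_zero_left {I : Type*} (s : Finset I) (X : I → U →ₗ[k] V) :
    ∑ i ∈ s, (0 : U →ₗ[k] V).prod (X i) = (0 : U →ₗ[k] V).prod (∑ i ∈ s, X i) := by
  simpa using sum_smul_prod s (fun _ => (1 : k)) (fun _ => (0 : U →ₗ[k] V)) X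

lemma pol_ext (d : ℤ) (z : U →ₗ[k] V) (hF : HasDeg C.thinDesuspension B 0 F)
    {Z : List (ℤ × (U →ₗ[k] V))} (hZ : ∀ z ∈ Z, HasDeg C.thinDesuspension B z.1 z.2) :
    pol C (B.ext d) π K (F.prod z) (Z.map liftZero) =
      (pol C B π K F Z).prod (sgn k d • pol C B π K F ((d, z) :: Z)) := by
  have h := fun n : ℕ => plug_ext (B := B) (π := π) d Z (x := fun _ : Fin n => (0, F)) (fun _ => z)
    (A := univ) (fun _ _ => rfl) (fun _ => hF) hZ
  rw [pol, sum_congr rfl fun n _ => h n]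
  have := sum_smul_prod (range K) (fun _ => (1 : k)) (fun n => plug C B π Z
    (fun _ : Fin n => (0, F)) univ) fun n => sgn k d • plug C B π ((d, z) :: Z)
      (fun _ : Fin n => (0, F)) univ
  simp only [one_smul, ← smul_sum] at this
  refine (sum_congr rfl fun n _ => ?_).trans this
  simp only [plug, sum_const_zero, zero_add]

lemma pol_ext_inr (d e : ℤ) (z Y : U →ₗ[k] V) (hF : HasDeg C.thinDesuspension B 0 F)
    {Z : List (ℤ × (U →ₗ[k] V))} (hZ : ∀ z ∈ Z, HasDeg C.thinDesuspension B z.1 z.2) :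
    pol C (B.ext d) π K (F.prod z) ((e, (0 : U →ₗ[k] V).prod Y) :: Z.map liftZero) =
      (0 : U →ₗ[k] V).prod (sgn k d • pol C B π K F ((e + d, Y) :: Z)) := by
  rw [pol, pol, smul_sum, ← sum_prod_zero_left]
  refine sum_congr rfl fun n _ => ?_
  rw [plug, plug, smul_sum, ← sum_prod_zero_left]
  refine sum_congr rfl fun w _ => ?_
  have h := plug_ext (B := B) (π := π) d Z (x := update (fun _ : Fin n => (0, F)) w (e, 0))
    (update (fun _ => z) w Y) (A := univ.erase w)
    (fun v hv => by rw [update_of_ne (ne_of_mem_erase hv)]) (fun v => by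
      rcases eq_or_ne v w with rfl | hv
      · rw [update_self]
        exact Submodule.zero_mem (C.thinDesuspension.Hom B.toDgModule e)
      · simpa [hv] using hF) hZ
  rw [← update_withEps, plug_zero Z (Finset.notMem_erase w _) (by rw [update_self]),
    sum_eq_single w] at h
  · simp only [sum_const_zero, mul_zero, sgn_zero, one_smul]
    refine h.trans ?_
    rw [sum_update_fst, if_neg (by simp)]
    simp
  · intro v _ hv
    rw [plug_zero Z (v := w) (by simp) (by rw [update_of_ne hv.symm, update_self]), smul_zero]
  · simp

/-- The polarized Bianchi identity. -/
lemma splitSum_pol (hπ : IsTwist C π) (m : ℕ)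
    (h₀ : (∀ m, C.piece (0, 0, 0) m = ⊥) ∨ (∀ m, B.piece (0, 0, 0) m = ⊥))
    (hF : HasDeg C.thinDesuspension B 0 F) (fil : Filtration B) (hfil : fil.Holds 1 F)
    (hK : fil.bound + m + 2 ≤ K) {Z : List (ℤ × (U →ₗ[k] V))} (hm : Z.length = m)
    (hZ : ∀ z ∈ Z, HasDeg C.thinDesuspension B z.1 z.2) :
    splitSum k Z (fun A A' => pol C B π K F ((totalDeg A - 1, pol C B π K F A) :: A')) = 0 := by
  induction m generalizing V with
  | zero =>
    obtain rfl := List.length_eq_zero_iff.1 hm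
    have h1 : pol C B π K F [] = curvature C B π K F := by
      rw [pol, range_eq_Ico, ← Finset.sum_Ico_consecutive _ (Nat.zero_le 2) (by omega),
        ← range_eq_Ico, sum_range_succ, sum_range_one, curvature]
      congr 1
      · simp [plug, opQ]
      · refine sum_congr rfl fun n hn => ?_
        obtain ⟨n, rfl⟩ := Nat.exists_eq_add_of_le' (mem_Ico.1 hn).1
        rfl
    have h2 : ∀ z, pol C B π K F [(-1, z)] =
        C.thinDesuspension.homD B.toDgModule (-1) z + curvatureDeriv C B π K F z := fun z => by
      rw [pol, range_eq_Ico, ← Finset.sum_Ico_consecutive _ (Nat.zero_le 2) (by omega),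
        ← range_eq_Ico, sum_range_succ, sum_range_one, curvatureDeriv]
      congr 1
      · simp [plug, opQ]
      · refine sum_congr rfl fun n hn => ?_
        obtain ⟨n, rfl⟩ := Nat.exists_eq_add_of_le' (mem_Ico.1 hn).1
        refine sum_congr rfl fun v _ => ?_
        rw [sum_const_zero, mul_zero, sgn_zero, one_smul, plug, opQ]
        congr 1
        · exact Function.comp_update Prod.fst (fun _ => (0, F)) v (-1, z)
        · exact Function.comp_update Prod.snd (fun _ => (0, F)) v (-1, z)
    simp only [splitSum, totalDeg, List.map_nil, List.sum_nil, zero_sub, h1, h2]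
    exact bianchi h₀ hπ hF fil hfil (by omega)
  | succ m ih =>
    obtain ⟨⟨d, z⟩, Z, rfl⟩ := List.exists_cons_of_length_eq_add_one hm
    have hz : HasDeg C.thinDesuspension B d z := hZ _ List.mem_cons_self
    have hZ' := fun y hy => hZ y (List.mem_cons_of_mem _ hy)
    have key := ih (V := V × V) (B := B.ext d) (F := F.prod z) (Z := Z.map liftZero)
      (ext_piece_zero h₀ d) (hF.prod (by simpa)) (fil.ext d 1)
      (fun c => ⟨hfil c, by rw [Nat.sub_self, fil.zero]; trivial⟩) (by
        change fil.bound + 1 + m + 2 ≤ K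
        omega) (by simpa using hm) fun y hy => by
          obtain ⟨x, hx, rfl⟩ := List.mem_map.1 hy
          exact (hZ' x hx).prod (Submodule.zero_mem (C.thinDesuspension.Hom B.toDgModule _))
    rw [splitSum_map liftZero fun _ => rfl] at key
    have key2 := congrArg (LinearMap.compRight k (M := U) (LinearMap.snd k V V)) key
    rw [map_zero, map_splitSum] at key2
    rw [splitSum, ← key2]
    refine splitSum_congr hZ' fun A A' hA hA' => ?_
    have hdeg : totalDeg (A.map liftZero) = totalDeg A := by
      simp [totalDeg, Function.comp_def]
    have hdeg' : totalDeg ((d, z) :: A) = d + totalDeg A := List.sum_cons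
    have hX := pol_hasDeg (K := K) hπ hF hA
    have hA2 : ∀ y ∈ (totalDeg A - 1, pol C B π K F A) :: A',
        HasDeg C.thinDesuspension B y.1 y.2 := List.forall_mem_cons.2 ⟨hX, hA'⟩
    have hsplit : (pol C B π K F A).prod (sgn k d • pol C B π K F ((d, z) :: A)) =
        (1 : k) • (pol C B π K F A).prod 0 +
          (1 : k) • (0 : U →ₗ[k] V).prod (sgn k d • pol C B π K F ((d, z) :: A)) :=
      LinearMap.ext fun c => Prod.ext (by simp) (by simp)
    have h1 := pol_ext (π := π) (K := K) d z hF hA2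
    have h2 := pol_ext_inr (π := π) (K := K) d (totalDeg A - 1) z
      (sgn k d • pol C B π K F ((d, z) :: A)) hF hA'
    have h3 := pol_cons_linear (C := C) (B := B) (π := π) (K := K) (F := F) A'
      (totalDeg A - 1 + d) (sgn k d) 0 (pol C B π K F ((d, z) :: A)) 0
    rw [zero_smul, zero_smul, add_zero, add_zero] at h3
    rw [h3, smul_smul, sgn_mul_self, one_smul] at h2
    rw [List.map_cons] at h1
    rw [hdeg, pol_ext d z hF hA, hsplit, pol_cons_linear, h1, h2, pol_swap, hdeg']
    refine LinearMap.ext fun c => ?_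
    simp only [LinearMap.compRight_apply, comp_apply, LinearMap.add_apply,
      LinearMap.smul_apply, prod_apply, Function.prod, LinearMap.snd_apply, Prod.snd_add,
      one_smul, smul_smul, ← sgn_add]
    have hs : sgn k (d * (A.map Prod.fst).sum + (totalDeg A - 1) * d) = sgn k d := by
      rw [show (totalDeg A - 1) * d = d * (A.map Prod.fst).sum + -d by rw [totalDeg]; ring, sgn_add,
        sgn_add, ← mul_assoc, sgn_mul_self, one_mul, sgn_neg]
    rw [hs, show d + totalDeg A - 1 = totalDeg A - 1 + d by ring, add_comm]

end Polarization

section Shuffles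

variable {H E : Type*} [AddCommGroup E] [Module k E]

/-- The elements of a family at the places where `b` has the value `t`. -/
def part {n : ℕ} (b : Fin n → Bool) (t : Bool) (z : Fin n → ℤ × H) : List (ℤ × H) :=
  ((List.finRange n).filter fun i => b i = t).map z

lemma part_succ {n : ℕ} (b : Fin (n + 1) → Bool) (t : Bool) (z : Fin (n + 1) → ℤ × H) :
    part b t z = if b 0 = t then z 0 :: part (fun i => b i.succ) t (fun i => z i.succ)
      else part (fun i => b i.succ) t (fun i => z i.succ) := by
  rw [part, List.finRange_succ, List.filter_cons]
  simp only [List.filter_map, decide_eq_true_eq]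
  split_ifs <;> simp [part, Function.comp_def]

lemma sgn_mul_part {n : ℕ} (d : ℤ) (b : Fin n → Bool) (z : Fin n → ℤ × H) :
    sgn k (d * ((part b true z).map Prod.fst).sum) =
      ∏ j, if b j = true then sgn k (d * (z j).1) else 1 := by
  induction n with
  | zero => simp [part]
  | succ n ih =>
    rw [prod_univ_succ, ← ih, part_succ]
    split_ifs
    · rw [List.map_cons, List.sum_cons, mul_add, sgn_add]
    · rw [one_mul]

/-- The Koszul sign of a splitting. -/
def partSign (k : Type*) [Field k] {n : ℕ} (δ : Fin n → ℤ) (b : Fin n → Bool) : k :=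
  ∏ i, ∏ j, if i < j ∧ b i = false ∧ b j = true then sgn k (δ i * δ j) else 1

lemma splitSum_ofFn {n : ℕ} (z : Fin n → ℤ × H) (G : List (ℤ × H) → List (ℤ × H) → E) :
    splitSum k (List.ofFn z) G = ∑ b : Fin n → Bool,
      partSign k (fun i => (z i).1) b • G (part b true z) (part b false z) := by
  induction n generalizing G with
  | zero => simp [splitSum, partSign, part]
  | succ n ih =>
    rw [List.ofFn_succ, splitSum, ih, ← (Fin.consEquiv fun _ => Bool).sum_comp, Fintype.sum_prod_type,
      Fintype.sum_bool, ← sum_add_distrib]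
    refine sum_congr rfl fun b _ => ?_
    have hs : ∀ t : Bool, partSign k (fun i => (z i).1) ((Fin.consEquiv fun _ => Bool) (t, b)) =
        (∏ j, if t = false ∧ b j = true then sgn k ((z 0).1 * (z j.succ).1) else 1) *
          partSign k (fun i => (z i.succ).1) b := fun t => by
      change partSign k _ (cons t b : Fin (n + 1) → Bool) = _
      simp only [partSign, prod_univ_succ, cons_zero, cons_succ, Fin.succ_lt_succ_iff,
        Fin.not_lt_zero, Fin.succ_pos, false_and, if_false, one_mul, true_and]
    simp only [hs, Fin.consEquiv_apply, part_succ, cons_zero, cons_succ, if_true, if_false,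
      Bool.true_eq_false, Bool.false_eq_true, false_and, true_and, prod_const_one, one_mul,
      sgn_mul_part, smul_add, smul_smul]
    rw [mul_comm]

lemma IsShuffle.part_eq {n m : ℕ} {σ : Equiv.Perm (Fin n)} (h : IsShuffle m σ) {b : Fin n → Bool}
    (hb : ∀ i, b (σ i) = true ↔ i.val < m) (z : Fin n → ℤ × H) {l l' : ℕ} (hm : l = m) (hl : l + l' = n) :
    part b true z = List.ofFn (fun i : Fin l => z (σ ⟨i.val, by omega⟩)) ∧
      part b false z = List.ofFn fun i : Fin l' => z (σ ⟨l + i.val, by omega⟩) := by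
  subst hm
  have key : ∀ (t : Bool) {c : ℕ} (f : Fin c → Fin n), StrictMono f → (∀ a, b a = t ↔ ∃ i, f i = a) →
      part b t z = List.ofFn fun i => z (f i) := fun t c f hf hf' => by
    have : (List.finRange n).filter (fun i => b i = t) = List.ofFn f :=
      List.Pairwise.eq_of_mem_iff (r := (· < ·)) ((List.pairwise_lt_finRange n).filter _)
        (List.pairwise_ofFn.2 fun i j hij => hf hij) fun a => by
          simp [List.mem_ofFn, hf']
    rw [part, this, List.map_ofFn]
    rfl
  refine ⟨key true (fun i => σ ⟨i.val, by omega⟩) (fun i j hij => h _ _ hij (Or.inl j.2)) fun a => ?_,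
    key false (fun i => σ ⟨l + i.val, by omega⟩)
      (fun i j hij => h _ _ (Nat.add_lt_add_left hij l) (Or.inr (Nat.le_add_right _ _))) fun a => ?_⟩
  · obtain ⟨a, rfl⟩ := σ.surjective a
    rw [hb]
    exact ⟨fun h => ⟨⟨a, h⟩, rfl⟩, fun ⟨i, hi⟩ => by rw [← σ.injective hi]; exact i.2⟩
  · obtain ⟨a, rfl⟩ := σ.surjective a
    rw [← Bool.not_eq_true, hb, not_lt]
    refine ⟨fun h => ⟨⟨a - l, by omega⟩, congrArg σ (Fin.ext ?_)⟩, fun ⟨i, hi⟩ => ?_⟩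
    · show l + (a.val - l) = a.val
      omega
    · rw [← σ.injective hi]
      exact Nat.le_add_right _ _

lemma prod_prod_comp {n : ℕ} {M : Type*} [CommMonoid M] (σ : Equiv.Perm (Fin n))
    (f : Fin n → Fin n → M) : ∏ i, ∏ j, f (σ i) (σ j) = ∏ i, ∏ j, f i j :=
  (prod_congr rfl fun i _ => Equiv.prod_comp σ (f (σ i))).trans
    (Equiv.prod_comp σ fun i => ∏ j, f i j)

lemma IsShuffle.koszulSign_eq {n m : ℕ} {σ : Equiv.Perm (Fin n)} (h : IsShuffle m σ)
    {b : Fin n → Bool} (hb : ∀ i, b (σ i) = true ↔ i.val < m) (δ : Fin n → ℤ) :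
    ((koszulSign δ σ : ℤ) : k) = partSign k δ b := by
  rw [partSign, ← prod_prod_comp σ, prod_comm, koszulSign]
  push_cast
  refine prod_congr rfl fun i _ => prod_congr rfl fun j _ => ?_
  have : (i < j ∧ σ j < σ i) ↔ (σ j < σ i ∧ b (σ j) = false ∧ b (σ i) = true) := by
    rw [← Bool.not_eq_true, hb, hb]
    constructor
    · rintro ⟨h1, h2⟩
      have h3 : ¬(j.val < m ∨ m ≤ i.val) := fun hc => (h i j h1 hc).not_gt h2
      omega
    · rintro ⟨h1, h2, h3⟩
      exact ⟨Fin.lt_def.2 (by omega), h1⟩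
  simp only [this]
  split_ifs
  · rw [sgn, mul_comm]
  · simp

/-- The permutation which lists first the places where `b` is true. -/
def splitPerm {n : ℕ} (b : Fin n → Bool) : Equiv.Perm (Fin n) := Tuple.sort fun i => !b i

lemma splitPerm_apply {n : ℕ} (b : Fin n → Bool) (i : Fin n) :
    b (splitPerm b i) = true ↔ i.val < (univ.filter fun i => b i = true).card := by
  have h := Tuple.lt_card_le_iff_apply_le_of_monotone (j := i) (a := false)
    (Tuple.monotone_sort fun i => !b i)
  have hle : ∀ x : Bool, (!x) ≤ false ↔ x = true := by decide
  have hc : (univ.filter fun i => b i = true).card =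
      (univ.filter fun i => ((fun i => !b i) ∘ splitPerm b) i ≤ false).card := by
    refine (Finset.card_equiv (splitPerm b) fun i => ?_).symm
    simp [hle]
  rw [hc]
  exact (hle _).symm.trans h.symm

lemma isShuffle_iff {n m : ℕ} {σ : Equiv.Perm (Fin n)} {b : Fin n → Bool}
    (hb : ∀ i, b (σ i) = true ↔ i.val < m) : IsShuffle m σ ↔ σ = splitPerm b := by
  rw [splitPerm, Tuple.eq_sort_iff]
  have hb' : ∀ i, b (σ i) = decide (i.val < m) := fun i => by
    rw [Bool.eq_iff_iff, hb, decide_eq_true_iff]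
  constructor
  · refine fun h => ⟨fun i j hij => ?_, fun i j hij h' => h i j hij ?_⟩
    · have := Fin.le_def.1 hij
      simp only [Function.comp_apply, hb']
      by_cases h1 : j.val < m
      · simp [h1, lt_of_le_of_lt this h1]
      · simp [h1]
    · simp only [hb', Bool.not_inj_iff, decide_eq_decide] at h'
      have := Fin.lt_def.1 hij
      omega
  · rintro ⟨-, h⟩ i j hij hc
    refine h i j hij ?_
    have := Fin.lt_def.1 hij
    simp only [hb', Bool.not_inj_iff, decide_eq_decide]
    omega

lemma sum_shuffles {n : ℕ} (T : Fin n → Equiv.Perm (Fin n) → E) (S : (Fin n → Bool) → E)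
    (h0 : S (fun _ => false) = 0) (h : ∀ (l : Fin n) σ b, IsShuffle (l.val + 1) σ →
      (∀ i, b (σ i) = true ↔ i.val < l.val + 1) → T l σ = S b) :
    ∑ l : Fin n, ∑ σ : Equiv.Perm (Fin n) with IsShuffle (l.val + 1) σ, T l σ = ∑ b, S b := by
  rw [← Finset.sum_erase univ h0, Finset.sum_sigma']
  have hB : ∀ a : (_ : Fin n) × Equiv.Perm (Fin n), ∀ i,
      (fun i => decide ((a.2.symm i).val < a.1.val + 1)) (a.2 i) = true ↔ i.val < a.1.val + 1 :=
    fun a i => by simp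
  have hcard : ∀ (l : Fin n) (σ : Equiv.Perm (Fin n)),
      (univ.filter fun i => decide ((σ.symm i).val < l.val + 1) = true).card = l.val + 1 :=
    fun l σ => by
      rw [← Finset.card_equiv (s := univ.filter fun i : Fin n => i.val < l.val + 1) σ
        fun i => by simp]
      rw [show (univ.filter fun i : Fin n => i.val < l.val + 1) = Finset.Iic l from
        Finset.ext fun i => by simp, Fin.card_Iic]
  refine sum_bij (fun a _ i => decide ((a.2.symm i).val < a.1.val + 1)) (fun a _ => ?_) ?_ ?_ ?_
  · refine mem_erase.2 ⟨fun h => ?_, mem_univ _⟩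
    have := congrFun h (a.2 ⟨0, a.1.pos⟩)
    simp at this
  · rintro ⟨l, σ⟩ h1 ⟨l', σ'⟩ h2 he
    simp only [mem_sigma, mem_filter, mem_univ, true_and] at h1 h2
    have e1 := (isShuffle_iff (b := fun i => decide ((σ.symm i).val < l.val + 1)) (hB ⟨l, σ⟩)).1 h1
    have e2 := (isShuffle_iff (b := fun i => decide ((σ'.symm i).val < l'.val + 1)) (hB ⟨l', σ'⟩)).1 h2
    simp only at he e1 e2
    obtain rfl : σ = σ' := by rw [e1, e2, he]
    have e3 := hcard l σ
    have e4 := hcard l' σ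
    simp only [fun i => congrFun he i] at e3
    obtain rfl : l = l' := Fin.ext (by omega)
    rfl
  · intro b hb
    have hpos : 0 < (univ.filter fun i => b i = true).card := by
      by_contra h
      refine ne_of_mem_erase hb (funext fun i => ?_)
      have := Finset.card_eq_zero.1 (Nat.eq_zero_of_not_pos h)
      simpa using Finset.eq_empty_iff_forall_notMem.1 this i
    have hle : (univ.filter fun i => b i = true).card ≤ n := (Finset.card_le_univ _).trans (by simp)
    have e : (univ.filter fun i => b i = true).card - 1 + 1 =
      (univ.filter fun i => b i = true).card := Nat.sub_add_cancel hpos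
    refine ⟨⟨⟨(univ.filter fun i => b i = true).card - 1, by omega⟩, splitPerm b⟩, ?_, ?_⟩
    · simp only [mem_sigma, mem_filter, mem_univ, true_and, e]
      exact (isShuffle_iff (splitPerm_apply b)).2 rfl
    · funext i
      obtain ⟨i, rfl⟩ := (splitPerm b).surjective i
      simp only [e, Equiv.symm_apply_apply]
      rw [Bool.eq_iff_iff, splitPerm_apply, decide_eq_true_iff]
  · rintro ⟨l, σ⟩ h1
    simp only [mem_sigma, mem_filter, mem_univ, true_and] at h1
    exact h l σ _ h1 (hB ⟨l, σ⟩)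

lemma prod_prod_eq_prod_lt {n : ℕ} {M : Type*} [CommMonoid M] (f : Fin n → Fin n → M)
    (h : ∀ i, f i i = 1) : ∏ i, ∏ j, f i j = ∏ i, ∏ j, if i < j then f i j * f j i else 1 := by
  have h1 : ∀ i j, f i j = (if i < j then f i j else 1) * if j < i then f i j else 1 := fun i j => by
    rcases lt_trichotomy i j with h' | rfl | h'
    · simp [h', h'.not_gt]
    · simp [h]
    · simp [h', h'.not_gt]
  have h2 : ∏ i, ∏ j, (if j < i then f i j else 1) = ∏ i, ∏ j, if i < j then f j i else 1 :=
    prod_comm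
  rw [prod_congr rfl fun i _ => prod_congr rfl fun j _ => h1 i j]
  simp only [prod_mul_distrib]
  rw [h2]
  simp only [← prod_mul_distrib]
  refine prod_congr rfl fun i _ => prod_congr rfl fun j _ => ?_
  split_ifs <;> simp

lemma koszulSign_mul {n : ℕ} (δ : Fin n → ℤ) (τ σ : Equiv.Perm (Fin n)) :
    koszulSign (fun i => δ (τ i)) σ * koszulSign δ τ = koszulSign δ (τ * σ) := by
  have e : ∀ i j, ((δ i * δ j).negOnePow : ℤ) = ((δ j * δ i).negOnePow : ℤ) := fun i j => by
    rw [mul_comm]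
  have e2 : ∀ i j, ((δ i * δ j).negOnePow : ℤ) * ((δ i * δ j).negOnePow : ℤ) = 1 := fun i j => by
    rw [← Units.val_mul, Int.units_mul_self, Units.val_one]
  have h1 : koszulSign δ τ = ∏ i, ∏ j, if σ i < σ j ∧ τ (σ j) < τ (σ i) then
      ((δ (τ (σ i)) * δ (τ (σ j))).negOnePow : ℤ) else 1 :=
    (prod_prod_comp σ fun i j => if i < j ∧ τ j < τ i then
      ((δ (τ i) * δ (τ j)).negOnePow : ℤ) else 1).symm
  rw [h1, prod_prod_eq_prod_lt _ fun i => by simp, koszulSign, koszulSign]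
  simp only [← prod_mul_distrib, Equiv.Perm.mul_apply]
  refine prod_congr rfl fun i _ => prod_congr rfl fun j _ => ?_
  by_cases hij : i < j
  · have hσ : σ i ≠ σ j := fun h => hij.ne (σ.injective h)
    have hτ : τ (σ i) ≠ τ (σ j) := fun h => hσ (τ.injective h)
    rw [e (τ (σ j))]
    rcases lt_or_gt_of_ne hσ with h | h <;> rcases lt_or_gt_of_ne hτ with h' | h' <;>
      simp [hij, h, h', h.not_gt, h'.not_gt, e2]
  · simp [hij]

lemma koszulSign_mul_self {n : ℕ} (δ : Fin n → ℤ) (σ : Equiv.Perm (Fin n)) :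
    koszulSign δ σ * koszulSign δ σ = 1 := by
  simp only [koszulSign, ← prod_mul_distrib]
  refine Finset.prod_eq_one fun i _ => Finset.prod_eq_one fun j _ => ?_
  split_ifs
  · rw [← Units.val_mul, Int.units_mul_self, Units.val_one]
  · rfl

end Shuffles

section LInfty

variable {C : ConilpotentDgBoxCooperad k U} {B : DgBoxOperad k V} {π : U →ₗ[k] U}

lemma opL_eq {n : ℕ} (hn : 1 ≤ n) (δ : Fin n → ℤ) (f : Fin n → U →ₗ[k] V) :
    opL C B π n δ f = ∑ σ : Equiv.Perm (Fin n),
      koszulSign δ σ • opQ C B π n fun i => (δ (σ i), f (σ i)) := by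
  match n with
  | 1 =>
    rw [Fintype.sum_unique]
    simp [koszulSign, opL, opQ]
  | n + 2 => rfl

lemma extend_cons {α : Type*} {m n : ℕ} {v : Fin n} {ι : Fin m → Fin n} (hv : v ∉ Set.range ι)
    (hι : Injective ι) (z : Fin (m + 1) → α) (x : Fin n → α) :
    extend (cons v ι : Fin (m + 1) → Fin n) z x =
      extend ι (fun i => z i.succ) (update x v (z 0)) := by
  have hinj : Injective (cons v ι : Fin (m + 1) → Fin n) :=
    Fin.cons_injective_iff.2 ⟨hv, hι⟩
  funext u
  by_cases hu : u ∈ Set.range ι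
  · obtain ⟨a, rfl⟩ := hu
    rw [hι.extend_apply]
    exact hinj.extend_apply z x a.succ
  · rw [Function.extend_apply' _ _ _ hu]
    rcases eq_or_ne u v with rfl | huv
    · rw [update_self]
      exact hinj.extend_apply z x 0
    · rw [update_of_ne huv, Function.extend_apply']
      rintro ⟨a, ha⟩
      induction a using Fin.cases with
      | zero => exact huv ha.symm
      | succ a => exact hu ⟨a, ha⟩

lemma plug_ofFn {m n : ℕ} (z : Fin m → ℤ × (U →ₗ[k] V)) (x : Fin n → ℤ × (U →ₗ[k] V))
    {A : Finset (Fin n)} (hA : ∀ v ∈ A, (x v).1 = 0) :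
    plug C B π (List.ofFn z) x A = ∑ ι : Fin m → Fin n, if Injective ι ∧ ∀ a, ι a ∈ A then
        ((∏ a, sgn k ((z a).1 * ∑ u with ι a < u, (x u).1)) *
          ∏ a, ∏ b, if a < b ∧ ι b < ι a then sgn k ((z a).1 * (z b).1) else 1) •
          opQ C B π n (extend ι z x) else 0 := by
  induction m generalizing x A with
  | zero =>
    rw [Fintype.sum_unique, if_pos ⟨Function.injective_of_subsingleton _, fun a => a.elim0⟩]
    have : extend default z x = x := funext fun u =>
      Function.extend_apply' _ _ _ fun ⟨a, _⟩ => a.elim0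
    simp [plug, this]
  | succ m ih =>
    rw [List.ofFn_succ, plug, ← (Fin.consEquiv fun _ => Fin n).sum_comp, Fintype.sum_prod_type,
      ← sum_subset (Finset.subset_univ A)]
    · refine sum_congr rfl fun v hv => ?_
      rw [ih _ _ fun w hw => by
        rw [update_of_ne (ne_of_mem_erase hw)]
        exact hA w (mem_of_mem_erase hw), smul_sum]
      refine sum_congr rfl fun ι _ => ?_
      change _ = if Injective (cons v ι : Fin (m + 1) → Fin n) ∧
        ∀ a, (cons v ι : Fin (m + 1) → Fin n) a ∈ A then
          ((∏ a, sgn k ((z a).1 * ∑ u with (cons v ι : Fin (m + 1) → Fin n) a < u, (x u).1)) *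
          ∏ a, ∏ b, if a < b ∧ (cons v ι : Fin (m + 1) → Fin n) b <
            (cons v ι : Fin (m + 1) → Fin n) a then sgn k ((z a).1 * (z b).1) else 1) •
          opQ C B π n (extend (cons v ι : Fin (m + 1) → Fin n) z x) else 0
      have hiff : (Injective ι ∧ ∀ a, ι a ∈ A.erase v) ↔
          (Injective (cons v ι : Fin (m + 1) → Fin n) ∧
            ∀ a, (cons v ι : Fin (m + 1) → Fin n) a ∈ A) := by
        rw [Fin.cons_injective_iff, Fin.forall_fin_succ]
        simp only [mem_erase, cons_zero, cons_succ, Set.mem_range, not_exists, hv,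
          true_and, forall_and]
        tauto
      rw [smul_ite, smul_zero]
      refine if_ctx_congr hiff (fun h => ?_) fun _ => rfl
      obtain ⟨hv', hι⟩ := Fin.cons_injective_iff.1 h.1
      rw [extend_cons hv' hι, smul_smul]
      congr 1
      simp only [prod_univ_succ, cons_zero, cons_succ, Fin.succ_lt_succ_iff,
        Fin.not_lt_zero, Fin.succ_pos, false_and, if_false, one_mul, true_and, sum_update_fst, hA v hv,
        mem_filter, mem_univ, sub_zero]
      have hsplit : ∀ a, sgn k ((z a.succ).1 * (∑ u with ι a < u, (x u).1 + if ι a < v then (z 0).1 else 0))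
          = sgn k ((z a.succ).1 * ∑ u with ι a < u, (x u).1) *
            if ι a < v then sgn k ((z 0).1 * (z a.succ).1) else 1 := fun a => by
        rw [mul_add, sgn_add]
        split_ifs
        · rw [mul_comm (z 0).1]
        · rw [mul_zero, sgn_zero]
      simp only [hsplit, prod_mul_distrib]
      ring
    · intro v _ hv
      refine sum_eq_zero fun ι _ => if_neg fun h => hv (h.2 0)

lemma pol_zero_ofFn {n K : ℕ} (hn : 1 ≤ n) (hK : n < K) (z : Fin n → ℤ × (U →ₗ[k] V)) :
    pol C B π K 0 (List.ofFn z) = opL C B π n (fun i => (z i).1) fun i => (z i).2 := by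
  rw [pol, Finset.sum_eq_single_of_mem n (mem_range.2 hK), opL_eq hn,
    plug_ofFn z _ fun _ _ => rfl, ← Finset.sum_filter]
  · refine (sum_bij (fun (σ : Equiv.Perm (Fin n)) _ => (σ.symm : Fin n → Fin n)) (fun σ _ => ?_) (fun σ _ τ _ h => ?_)
      (fun ι hι => ?_) fun σ _ => ?_).symm
    · exact mem_filter.2 ⟨mem_univ _, σ.symm.injective, fun _ => mem_univ _⟩
    · exact Equiv.symm_bijective.injective (DFunLike.coe_injective h)
    · have h := (mem_filter.1 hι).2.1
      exact ⟨(Equiv.ofBijective ι (Finite.injective_iff_bijective.1 h)).symm, mem_univ _, rfl⟩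
    · have h1 : extend σ.symm z (fun _ => (0, 0)) = fun i => z (σ i) := funext fun i => by
        conv_lhs => rw [← σ.symm_apply_apply i]
        exact σ.symm.injective.extend_apply z _ (σ i)
      rw [h1, ← Int.cast_smul_eq_zsmul k]
      congr 1
      simp only [sum_const_zero, mul_zero, sgn_zero, prod_const_one, one_mul]
      rw [← prod_prod_comp σ, prod_comm, koszulSign]
      push_cast
      refine prod_congr rfl fun i _ => prod_congr rfl fun j _ => ?_
      simp only [Equiv.symm_apply_apply, and_comm (a := σ j < σ i)]
      split_ifs
      · rw [sgn, mul_comm]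
      · simp
  · intro m _ hm
    rw [plug_ofFn z _ fun _ _ => rfl]
    refine sum_eq_zero fun ι _ => ?_
    split_ifs with h
    · obtain ⟨u, hu⟩ : ∃ u, u ∉ Set.range ι := by
        by_contra! hs
        have := Fintype.card_of_bijective (f := ι) ⟨h.1, hs⟩
        simp only [Fintype.card_fin] at this
        exact hm this.symm
      have := plug_zero (C := C) (B := B) (π := π) [] (A := ∅) (x := extend ι z fun _ => (0, 0))
        (v := u) (notMem_empty u) (by rw [Function.extend_apply' _ _ _ hu])
      rw [plug] at this
      rw [this, smul_zero]
    · rfl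

/-- The filtration whose positive part vanishes. -/
def Filtration.trivial (B : DgBoxOperad k V) : Filtration B where
  fil a := if a = 0 then ⊤ else ⊥
  zero := if_pos rfl
  anti a b h := by
    dsimp only
    split_ifs <;> first | omega | simp
  comp_mem n P x a h := by
    split_ifs with h0
    · exact Submodule.mem_top
    · obtain ⟨i, -, hi⟩ := exists_ne_zero_of_sum_ne_zero h0
      have := h i
      rw [if_neg hi, Submodule.mem_bot] at this
      exact (Submodule.mem_bot k).2 ((B.comp n P).map_coord_zero i this)
  koszul_mem a m x h := by
    split_ifs at h ⊢
    · exact Submodule.mem_top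
    · rw [(Submodule.mem_bot k).1 h, map_zero]
      exact zero_mem _
  d_mem a x h := by
    split_ifs at h ⊢
    · exact Submodule.mem_top
    · rw [(Submodule.mem_bot k).1 h, map_zero]
      exact zero_mem _
  bound := 1
  bot := if_neg one_ne_zero

lemma opL_linear {n : ℕ} (hn : 1 ≤ n) (δ : Fin n → ℤ) (f : Fin n → U →ₗ[k] V) (i : Fin n) (a b : k)
    (y z : U →ₗ[k] V) : opL C B π n δ (update f i (a • y + b • z)) =
      a • opL C B π n δ (update f i y) + b • opL C B π n δ (update f i z) := by
  have h : ∀ (σ : Equiv.Perm (Fin n)) (y : U →ₗ[k] V), (fun j => (δ (σ j), update f i y (σ j))) =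
        update (fun j => (δ (σ j), f (σ j))) (σ.symm i) (δ i, y) := fun σ y => funext fun j => by
    rcases eq_or_ne j (σ.symm i) with rfl | hj
    · simp
    · rw [update_of_ne hj, update_of_ne fun h' => hj (by simp [← h'])]
  simp only [opL_eq hn, h, opQ_linear, smul_add, sum_add_distrib, smul_sum]
  simp only [smul_comm a, smul_comm b]

lemma opL_relation (h₀ : (∀ m, C.piece (0, 0, 0) m = ⊥) ∨ (∀ m, B.piece (0, 0, 0) m = ⊥))
    (hπ : IsTwist C π) {n : ℕ} (δ : Fin n → ℤ) (f : Fin n → U →ₗ[k] V)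
    (hf : ∀ i, f i ∈ C.thinDesuspension.Hom B (δ i)) :
    ∑ l : Fin n, ∑ σ : Equiv.Perm (Fin n) with IsShuffle (l.val + 1) σ, koszulSign δ σ •
        opL C B π (n - (l.val + 1) + 1) (cons (∑ i : Fin (l.val + 1), δ (σ ⟨i.val, by omega⟩) - 1)
            fun j : Fin (n - (l.val + 1)) => δ (σ ⟨l.val + 1 + j.val, by omega⟩))
          (cons (opL C B π (l.val + 1) (fun i => δ (σ ⟨i.val, by omega⟩))
              fun i => f (σ ⟨i.val, by omega⟩))
            fun j : Fin (n - (l.val + 1)) => f (σ ⟨l.val + 1 + j.val, by omega⟩)) = 0 := by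
  have key := splitSum_pol (C := C) (B := B) (F := 0) (K := 1 + n + 2) hπ n h₀
    (Submodule.zero_mem (C.thinDesuspension.Hom B.toDgModule 0)) (Filtration.trivial B)
    Filtration.Holds.zero le_rfl (Z := List.ofFn fun i => (δ i, f i)) List.length_ofFn fun y hy => by
      obtain ⟨i, rfl⟩ := List.mem_ofFn.1 hy
      exact hf i
  rw [splitSum_ofFn] at key
  refine (sum_shuffles _ _ ?_ fun l σ b hσ hb => ?_).trans key
  · have h1 : part (fun _ : Fin n => false) true (fun i => (δ i, f i)) = [] := by simp [part]
    have h2 : pol C B π (1 + n + 2) 0 [] = 0 := by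
      refine sum_eq_zero fun m _ => ?_
      rcases m with _ | m
      · rfl
      · exact plug_zero (C := C) (B := B) (π := π) [] (A := ∅) (v := 0) (notMem_empty _) rfl
    have h3 := pol_cons_linear (C := C) (B := B) (π := π) (K := 1 + n + 2) (F := 0)
      (part (fun _ : Fin n => false) false fun i => (δ i, f i)) (totalDeg ([] : List (ℤ × (U →ₗ[k] V))) - 1) 0 0 0 0
    simp only [zero_smul, add_zero] at h3
    rw [h1, h2, h3, smul_zero]
  · obtain ⟨h1, h2⟩ := hσ.part_eq hb (fun i => (δ i, f i)) (l := l.val + 1) (l' := n - (l.val + 1)) rfl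
      (by omega)
    rw [h1, h2, pol_zero_ofFn (by omega) (by omega), totalDeg, List.map_ofFn, List.sum_ofFn,
      ← hσ.koszulSign_eq hb, Int.cast_smul_eq_zsmul]
    have h4 := pol_zero_ofFn (C := C) (B := B) (π := π) (K := 1 + n + 2) (n := n - (l.val + 1) + 1)
      (by omega) (by omega) (cons (∑ i : Fin (l.val + 1), δ (σ ⟨i.val, by omega⟩) - 1,
        opL C.toDgBoxCooperad B π (l.val + 1) (fun i => δ (σ ⟨i.val, by omega⟩))
          fun i => f (σ ⟨i.val, by omega⟩)) fun j : Fin (n - (l.val + 1)) =>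
            (δ (σ ⟨l.val + 1 + j.val, by omega⟩), f (σ ⟨l.val + 1 + j.val, by omega⟩)))
    rw [List.ofFn_succ] at h4
    simp only [cons_zero, cons_succ] at h4
    refine congrArg (koszulSign δ σ • ·) (Eq.trans ?_ h4.symm)
    congr 1
    · exact funext fun i => Fin.cases rfl (fun _ => rfl) i
    · exact funext fun i => Fin.cases rfl (fun _ => rfl) i

lemma isSuspendedLInfty (h₀ : (∀ m, C.piece (0, 0, 0) m = ⊥) ∨ (∀ m, B.piece (0, 0, 0) m = ⊥))
    (hπ : IsTwist C π) :
    IsSuspendedLInfty (C.thinDesuspension.Hom B) (opL C B π) where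
  map_add n hn δ f _ i y _ z _ := by
    simpa only [one_smul] using opL_linear hn δ f i 1 1 y z
  map_smul n hn δ f _ i a y _ := by
    simpa only [zero_smul, add_zero] using opL_linear hn δ f i a 0 y 0
  mem n hn δ f hf := by
    rw [opL_eq hn]
    refine Submodule.sum_mem _ fun σ _ => zsmul_mem ?_ _
    have := opQ_hasDeg (B := B) hπ (x := fun i => (δ (σ i), f (σ i))) fun i => hf (σ i)
    rwa [Equiv.sum_comp σ δ] at this
  symm n hn δ f _ σ := by
    rw [opL_eq hn, opL_eq hn, smul_sum]
    refine (sum_congr rfl fun τ _ => ?_).trans (Equiv.sum_comp (Equiv.mulLeft σ) fun τ =>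
      koszulSign δ σ • koszulSign δ τ • opQ C B π n fun i => (δ (τ i), f (τ i)))
    rw [smul_smul, Equiv.coe_mulLeft, ← koszulSign_mul δ σ τ, mul_left_comm, koszulSign_mul_self,
      mul_one]
    rfl
  relation n _ δ f hf := opL_relation h₀ hπ δ f hf

end LInfty

end BoxOperads

theorem mainTheorem4 {k U V : Type*} [Field k] [AddCommGroup U] [Module k U] [AddCommGroup V]
    [Module k V] (C : BoxOperads.ConilpotentDgBoxCooperad k U) (B : BoxOperads.DgBoxOperad k V)
    (h₀ : (∀ m, C.piece (0, 0, 0) m = ⊥) ∨ (∀ m, B.piece (0, 0, 0) m = ⊥))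
    (π : U →ₗ[k] U) (hπ : π = LinearMap.id ∨ π = C.reduce C.one) :
    (∀ (n : ℕ), 2 ≤ n → ∀ (δ : Fin n → ℤ) (f : Fin n → U →ₗ[k] V),
      (∀ i, f i ∈ C.thinDesuspension.Hom B.toDgModule (δ i)) → ∀ c : U,
      {S : BoxOperads.Stack | S.ThinQuadratic ∧ S.size = n ∧
        BoxOperads.pSummand C.toDgBoxCooperad B π δ f S c ≠ 0}.Finite) ∧
    BoxOperads.IsSuspendedLInfty (C.thinDesuspension.Hom B.toDgModule)
      (BoxOperads.opL C.toDgBoxCooperad B π) :=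
  ⟨fun _ hn δ f _ c => BoxOperads.finite_pSummand C B hn δ f c,
    BoxOperads.isSuspendedLInfty h₀ (BoxOperads.isTwist hπ)⟩
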